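/- **Setting.** Let $\mathbf k$ be a field of characteristic $0$, $\Gamma$ a group, and $\mathfrak g$ a finite-dimensional $\Gamma$ Lie bialgebra over $\mathbf k$: a Lie bialgebra $(\mathfrak g,[\,,],\delta)$ with a group morphism $\theta:\Gamma\to\mathrm{Aut}(\mathfrak g,[\,,])$ and a map $f:\Gamma\to\wedge^2(\mathfrak g)\subset\mathfrak g^{\otimes 2}$ such that $\wedge^2(\theta_\gamma)\circ\delta\circ\theta_\gamma^{-1}(x)=\delta(x)+[f_\gamma,x\otimes1+1\otimes x]$, $f_{\gamma\gamma'}=f_\gamma+\wedge^2(\theta_\gamma)(f_{\gamma'})$, and $(\delta\otimes\mathrm{id})(f_\gamma)+[f_\gamma^{1,3},f_\gamma^{2,3}]+\text{cyclic permutations}=0$. Put $\delta_\gamma=\wedge^2(\theta_\gamma)\circ\delta\circ\theta_\gamma^{-1}$. Fix $c\in\mathbf k$ (the normalization of the duality). Let $\mathfrak g^*_\gamma$ be the dual Lie bialgebra of $(\mathfrak g,\delta_\gamma)$, with bracket $\langle[\xi,\eta],x\rangle=c\,\langle\xi\otimes\eta,\delta_\gamma(x)\rangle$ and with cobracket the transpose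 of the bracket of $\mathfrak g$. Let $\mathcal O_{G^*}=U(\mathfrak g^*_\gamma)^*$, and more generally $\mathcal O_{(G^*)^n}=(U(\mathfrak g^*_\gamma)^{\otimes n})^*$, be the algebras of functions on the powers of the corresponding formal Poisson-Lie group $G^*$, with coproduct $\Delta_\gamma$ dual to the product of $U(\mathfrak g_\gamma^*)$ and Poisson brackets dual to the co-Poisson structures. Let $\mathfrak m_{G^*}$ be the maximal ideal of $\mathcal O_{G^*}$; by restriction of functions to $\mathfrak g^*_\gamma\subset U(\mathfrak g^*_\gamma)$ one has $\mathfrak m_{G^*}/\mathfrak m_{G^*}^2=\mathfrak g$, and $\Delta_\gamma-\Delta_\gamma^{2,1}$ induces $c\,\delta_\gamma$ on $\mathfrak g$. Thus $c=1$ is the standard duality, while for $c=2$ the cobracket $\delta_\gamma$ is induced by $\frac12(\Delta_\gamma-\Delta_\gamma^{2,1})$. Write $u\star_\gamma v=u+v+\frac12\{u,v\}+\cdots$ for the sum of the Baker-Campbell-Hausdorff series of the Poisson bracket, whenever it converges. A *twist* is an $\tilde f\in\mathfrak m_{G^*}^{\hat\otimes 2}$ such that both sides of the following equation converge and $$(\tilde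 f\otimes1)\star_\gamma(\Delta_\gamma\otimes\mathrm{id})(\tilde f)=(1\otimes\tilde f)\star_\gamma(\mathrm{id}\otimes\Delta_\gamma)(\tilde f).$$ **Proposition.** Let $\gamma,\gamma'\in\Gamma$. 1. There exists a twist $\tilde f_{\gamma,\gamma\gamma'}$ whose image in $(\mathfrak m_{G^*}/\mathfrak m_{G^*}^2)^{\otimes2}=\mathfrak g^{\otimes 2}$ is $\frac c2\wedge^2(\theta_\gamma)(f_{\gamma'})$; so the image is exactly $\wedge^2(\theta_\gamma)(f_{\gamma'})$ in the normalization $c=2$. 2. Such a twist is unique up to the gauge action of $\mathfrak m_{G^*}^2$: if $\tilde f$ and $\tilde g$ are two twists with this image, then there is $\lambda\in\mathfrak m_{G^*}^2$ with $\tilde g=\lambda\cdot\tilde f:=\lambda^1\star_\gamma\lambda^2\star_\gamma\tilde f\star_\gamma(-\lambda)^{12}$, where $\lambda^1=\lambda\otimes 1$, $\lambda^2=1\otimes\lambda$, $\lambda^{12}=\Delta_\gamma(\lambda)$. 3. For every twist $\tilde f$ and every $\lambda\in\mathfrak m_{G^*}^2$, the products in $\lambda\cdot\tilde f$ converge and $\lambda\cdot\tilde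 f$ is again a twist. -/

import Mathlib

open scoped TensorProduct

namespace GammaLift

set_option linter.unusedSectionVars false

section LieBialgebras

variable (k : Type*) [Field k]

/-- The cyclic permutation `x ⊗ y ⊗ z ↦ y ⊗ z ⊗ x` of `V ⊗ V ⊗ V`. -/
noncomputable def cyc (V : Type*) [AddCommGroup V] [Module k V] :
    (V ⊗[k] V) ⊗[k] V →ₗ[k] (V ⊗[k] V) ⊗[k] V :=
  (TensorProduct.comm k V (V ⊗[k] V)).toLinearMap ∘ₗ (TensorProduct.assoc k V V V).toLinearMap

/-- `t` plus its two cyclic permutations. -/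
noncomputable def cycSum {V : Type*} [AddCommGroup V] [Module k V] :
    (V ⊗[k] V) ⊗[k] V →ₗ[k] (V ⊗[k] V) ⊗[k] V :=
  LinearMap.id + cyc k V + cyc k V ∘ₗ cyc k V

/-- A Lie bialgebra structure on the Lie algebra `L`: a cobracket `δ : L → ∧² L ⊂ L ⊗ L` which
satisfies the co-Jacobi identity and is a 1-cocycle for the adjoint action. Here `⁅x, t⁆`, for
`t ∈ L ⊗ L`, is the diagonal adjoint action `[x ⊗ 1 + 1 ⊗ x, t]`. -/
structure LieBialgebra (L : Type*) [LieRing L] [LieAlgebra k L] where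
  δ : L →ₗ[k] L ⊗[k] L
  antisymm : ∀ x, TensorProduct.comm k L L (δ x) = -δ x
  coJacobi : ∀ x, cycSum k (δ.rTensor L (δ x)) = 0
  cocycle : ∀ x y, δ ⁅x, y⁆ = ⁅x, δ y⁆ - ⁅y, δ x⁆

end LieBialgebras

section Conj

variable {k : Type*} [Field k] {L : Type*} [LieRing L] [LieAlgebra k L]

/-- `φ ⊗ φ` for a Lie algebra automorphism `φ`; on `∧² L` this is `∧²(φ)`. -/
noncomputable def sq (φ : L ≃ₗ⁅k⁆ L) : L ⊗[k] L →ₗ[k] L ⊗[k] L :=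
  TensorProduct.map φ.toLinearEquiv.toLinearMap φ.toLinearEquiv.toLinearMap

theorem sq_lie (φ : L ≃ₗ⁅k⁆ L) (x : L) (t : L ⊗[k] L) : sq φ ⁅x, t⁆ = ⁅φ x, sq φ t⁆ := by
  induction t with
  | zero => simp
  | add a b ha hb => simp [ha, hb]
  | tmul a b =>
    have h1 : φ ⁅x, a⁆ = ⁅φ x, φ a⁆ := φ.map_lie x a
    have h2 : φ ⁅x, b⁆ = ⁅φ x, φ b⁆ := φ.map_lie x b
    simp [sq, h1, h2]

/-- The transported cobracket `∧²(φ) ∘ δ ∘ φ⁻¹`. -/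
noncomputable def LieBialgebra.conj (D : LieBialgebra k L) (φ : L ≃ₗ⁅k⁆ L) :
    LieBialgebra k L where
  δ := sq φ ∘ₗ D.δ ∘ₗ φ.symm.toLinearEquiv.toLinearMap
  antisymm x := by
    have h := D.antisymm (φ.symm x)
    have h2 : ∀ t : L ⊗[k] L, TensorProduct.comm k L L (sq φ t)
        = sq φ (TensorProduct.comm k L L t) := by
      intro t
      induction t with
      | zero => simp
      | add a b ha hb => simp [ha, hb]
      | tmul a b => simp [sq]
    have h3 := h2 (D.δ (φ.symm x))
    rw [h, map_neg] at h3
    exact h3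
  coJacobi x := by
    set φ₃ : (L ⊗[k] L) ⊗[k] L →ₗ[k] (L ⊗[k] L) ⊗[k] L :=
      TensorProduct.map (sq φ) φ.toLinearEquiv.toLinearMap with hφ
    have h1 : ∀ t : (L ⊗[k] L) ⊗[k] L, cyc k L (φ₃ t) = φ₃ (cyc k L t) := by
      have : cyc k L ∘ₗ φ₃ = φ₃ ∘ₗ cyc k L := by
        ext a b c
        simp [cyc, hφ, sq]
      exact fun t => LinearMap.congr_fun this t
    have h2 : ∀ t : L ⊗[k] L,
        (sq φ ∘ₗ D.δ ∘ₗ φ.symm.toLinearEquiv.toLinearMap).rTensor L (sq φ t)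
          = φ₃ (D.δ.rTensor L t) := by
      intro t
      induction t with
      | zero => simp
      | add a b ha hb => simp only [map_add, ha, hb]
      | tmul a b => simp [sq, hφ]
    have h3 : ∀ t : (L ⊗[k] L) ⊗[k] L, cycSum k (φ₃ t) = φ₃ (cycSum k t) := by
      intro t
      simp [cycSum, h1]
    have h4 := D.coJacobi (φ.symm x)
    have h5 := h2 (D.δ (φ.symm x))
    refine (congrArg (cycSum k) h5).trans ?_
    rw [h3, h4, map_zero]
  cocycle x y := by
    have h := D.cocycle (φ.symm x) (φ.symm y)
    have h1 : φ.symm ⁅x, y⁆ = ⁅φ.symm x, φ.symm y⁆ := φ.symm.map_lie x y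
    change sq φ (D.δ (φ.symm ⁅x, y⁆)) = ⁅x, sq φ (D.δ (φ.symm y))⁆ - ⁅y, sq φ (D.δ (φ.symm x))⁆
    rw [h1, h, map_sub, sq_lie, sq_lie]
    simp

end Conj

section GroupLieBialgebras

variable (k : Type*) [Field k]

/-- The bilinear operation `(a ⊗ b, a' ⊗ b') ↦ a ⊗ a' ⊗ [b, b']`, that is
`(s, t) ↦ [s^{1,3}, t^{2,3}]`. -/
noncomputable def bracket13_23 {L : Type*} [LieRing L] [LieAlgebra k L] (s t : L ⊗[k] L) :
    (L ⊗[k] L) ⊗[k] L :=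
  (LieModule.toModuleHom k L L : L ⊗[k] L →ₗ[k] L).lTensor (L ⊗[k] L)
    (TensorProduct.tensorTensorTensorComm k L L L L (s ⊗ₜ[k] t))

/-- A `Γ` Lie bialgebra structure on the Lie algebra `L`. Elements of `∧² L` are antisymmetric
elements of `L ⊗ L`. -/
structure GroupLieBialgebra (L : Type*) [LieRing L] [LieAlgebra k L]
    (Γ : Type*) [Group Γ] extends LieBialgebra k L where
  /-- the action of `Γ` by Lie algebra automorphisms -/
  θ : Γ → (L ≃ₗ⁅k⁆ L)
  θ_mul : ∀ γ γ' x, θ (γ * γ') x = θ γ (θ γ' x)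
  f : Γ → L ⊗[k] L
  f_antisymm : ∀ γ, TensorProduct.comm k L L (f γ) = -f γ
  /-- `∧²(θ_γ) ∘ δ ∘ θ_γ⁻¹ (x) = δ(x) + [f_γ, x ⊗ 1 + 1 ⊗ x]` -/
  conj_δ : ∀ γ x, sq (θ γ) (δ ((θ γ).symm x)) = δ x - ⁅x, f γ⁆
  /-- `f_{γγ'} = f_γ + ∧²(θ_γ)(f_γ')` -/
  f_mul : ∀ γ γ', f (γ * γ') = f γ + sq (θ γ) (f γ')
  /-- `(δ ⊗ id)(f_γ) + [f_γ^{1,3}, f_γ^{2,3}] + cyclic permutations = 0` -/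
  f_twist : ∀ γ, cycSum k (δ.rTensor L (f γ) + bracket13_23 k (f γ) (f γ)) = 0

/-- The Lie bialgebra `(L, δ_γ)`, where `δ_γ = ∧²(θ_γ) ∘ δ ∘ θ_γ⁻¹`. -/
noncomputable def GroupLieBialgebra.at {k : Type*} [Field k] {L : Type*} [LieRing L]
    [LieAlgebra k L] {Γ : Type*} [Group Γ] (B : GroupLieBialgebra k L Γ) (γ : Γ) :
    LieBialgebra k L :=
  B.toLieBialgebra.conj (B.θ γ)

end GroupLieBialgebras

section Dual

variable {k : Type*} [Field k] {L : Type*} [LieRing L] [LieAlgebra k L]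

/-- The dual space of a Lie bialgebra `(L, δ)`, as the carrier of the dual Lie bialgebra. Its
bracket is `⟨[ξ, η], x⟩ = c ⟨ξ ⊗ η, δ x⟩`. The scalar `c` is the normalization of the duality: on
the dual formal group, the coproduct `Δ` induces `Δ - Δ^{2,1} = c δ` on `m / m² = L`. So `c = 1` is
the usual dual, and for `c = 2` the cobracket `δ` is the antisymmetric part `(Δ - Δ^{2,1}) / 2`. -/
def DualLie (_D : LieBialgebra k L) (_c : k) : Type _ := Module.Dual k L

namespace DualLie

variable (D : LieBialgebra k L) (c : k)

instance : AddCommGroup (DualLie D c) := inferInstanceAs (AddCommGroup (Module.Dual k L))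
instance : Module k (DualLie D c) := inferInstanceAs (Module k (Module.Dual k L))
instance [FiniteDimensional k L] : FiniteDimensional k (DualLie D c) :=
  inferInstanceAs (FiniteDimensional k (Module.Dual k L))

/-- A linear form on `L`, seen as an element of the dual Lie algebra. -/
def of : Module.Dual k L ≃ₗ[k] DualLie D c := LinearEquiv.refl k _

/-- An element of the dual Lie algebra, seen as a linear form on `L`. -/
def form : DualLie D c →ₗ[k] Module.Dual k L := LinearMap.id

variable {D c}

theorem form_injective : Function.Injective (form D c) := fun _ _ h => h

variable (D c)

/-- The linear form `x ↦ c ⟨ξ ⊗ η, δ x⟩`. -/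
noncomputable def brk (ξ η : DualLie D c) : DualLie D c :=
  of D c (c • (TensorProduct.dualDistrib k L L (form D c ξ ⊗ₜ[k] form D c η) ∘ₗ D.δ))

variable {D c}

theorem brk_apply (ξ η : DualLie D c) (x : L) :
    form D c (brk D c ξ η) x
      = c * TensorProduct.dualDistrib k L L (form D c ξ ⊗ₜ[k] form D c η) (D.δ x) := rfl

theorem swap_apply (ξ η : Module.Dual k L) (x : L) :
    TensorProduct.dualDistrib k L L (ξ ⊗ₜ[k] η) (D.δ x)
      = - TensorProduct.dualDistrib k L L (η ⊗ₜ[k] ξ) (D.δ x) := by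
  have h : ∀ t : L ⊗[k] L, TensorProduct.dualDistrib k L L (ξ ⊗ₜ[k] η) t
      = TensorProduct.dualDistrib k L L (η ⊗ₜ[k] ξ) (TensorProduct.comm k L L t) := by
    intro t
    induction t with
    | zero => simp
    | add a b ha hb => simp only [map_add, ha, hb]
    | tmul a b => simp [mul_comm]
  rw [h, D.antisymm, map_neg]

/-- The pairing of three linear forms with an element of `L ⊗ L ⊗ L`. -/
noncomputable def triple (ξ η ζ : Module.Dual k L) : (L ⊗[k] L) ⊗[k] L →ₗ[k] k :=
  TensorProduct.dualDistrib k (L ⊗[k] L) L (TensorProduct.dualDistrib k L L (ξ ⊗ₜ[k] η) ⊗ₜ[k] ζ)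

theorem triple_cyc (ξ η ζ : Module.Dual k L) (t : (L ⊗[k] L) ⊗[k] L) :
    triple ξ η ζ (cyc k L t) = triple ζ ξ η t := by
  have : triple ξ η ζ ∘ₗ cyc k L = triple ζ ξ η := by
    ext a b d
    simp [triple, cyc]
    ring
  exact LinearMap.congr_fun this t

theorem brk_brk (ξ η ζ : DualLie D c) (x : L) :
    form D c (brk D c (brk D c ξ η) ζ) x
      = c * c * triple (form D c ξ) (form D c η) (form D c ζ) (D.δ.rTensor L (D.δ x)) := by
  rw [brk_apply, mul_assoc]
  congr 1
  generalize D.δ x = t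
  induction t with
  | zero => simp
  | add a b ha hb => simp only [map_add, ha, hb, mul_add]
  | tmul a b =>
    simp only [TensorProduct.dualDistrib_apply, LinearMap.rTensor_tmul, triple, brk_apply]
    ring

theorem brk_skew (ξ η : DualLie D c) : brk D c ξ η = -brk D c η ξ := by
  apply form_injective
  ext x
  rw [map_neg, LinearMap.neg_apply, brk_apply, brk_apply, swap_apply]
  ring

theorem brk_jacobi (ξ η ζ : DualLie D c) :
    brk D c (brk D c ξ η) ζ + brk D c (brk D c η ζ) ξ + brk D c (brk D c ζ ξ) η = 0 := by
  apply form_injective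
  ext x
  simp only [map_add, LinearMap.add_apply, brk_brk, map_zero, LinearMap.zero_apply]
  have h := congrArg (triple (form D c ξ) (form D c η) (form D c ζ)) (D.coJacobi x)
  simp only [cycSum, LinearMap.add_apply, LinearMap.id_apply, LinearMap.comp_apply, map_add,
    triple_cyc, map_zero] at h
  linear_combination (c * c) * h

theorem brk_add_left (ξ ξ' η : DualLie D c) :
    brk D c (ξ + ξ') η = brk D c ξ η + brk D c ξ' η := by
  apply form_injective
  ext x
  simp only [map_add, LinearMap.add_apply, brk_apply, TensorProduct.add_tmul, mul_add]

theorem brk_add_right (ξ η η' : DualLie D c) :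
    brk D c ξ (η + η') = brk D c ξ η + brk D c ξ η' := by
  apply form_injective
  ext x
  simp only [map_add, LinearMap.add_apply, brk_apply, TensorProduct.tmul_add, mul_add]

theorem brk_smul_right (a : k) (ξ η : DualLie D c) :
    brk D c ξ (a • η) = a • brk D c ξ η := by
  apply form_injective
  ext x
  simp only [map_smul, LinearMap.smul_apply, brk_apply, TensorProduct.tmul_smul, smul_eq_mul]
  ring

variable [CharZero k]

noncomputable instance : LieRing (DualLie D c) where
  bracket ξ η := brk D c ξ η
  add_lie := brk_add_left
  lie_add := brk_add_right
  lie_self ξ := by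
    have h := brk_skew ξ ξ
    have h2 : (2 : k) • brk D c ξ ξ = 0 := by
      rw [two_smul]
      nth_rewrite 1 [h]
      exact neg_add_cancel _
    exact (smul_eq_zero.mp h2).resolve_left two_ne_zero
  leibniz_lie ξ η ζ := by
    change brk D c ξ (brk D c η ζ) = brk D c (brk D c ξ η) ζ + brk D c η (brk D c ξ ζ)
    have h := brk_jacobi ξ η ζ
    have h1 := brk_skew ξ (brk D c η ζ)
    have h2 := brk_skew η (brk D c ξ ζ)
    have h3 : brk D c (brk D c ξ ζ) η = -brk D c (brk D c ζ ξ) η := by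
      rw [brk_skew ξ ζ, brk_skew (-brk D c ζ ξ) η, brk_skew (brk D c ζ ξ) η]
      have := brk_smul_right (-1 : k) η (brk D c ζ ξ)
      rw [neg_one_smul, neg_one_smul] at this
      rw [this]
    rw [h1, h2, h3, neg_neg]
    rw [← sub_eq_zero, ← neg_eq_zero, ← h]
    abel

noncomputable instance : LieAlgebra k (DualLie D c) where
  lie_smul := brk_smul_right

theorem lie_def (ξ η : DualLie D c) : ⁅ξ, η⁆ = brk D c ξ η := rfl

end DualLie

namespace LieBialgebra

variable [CharZero k] [FiniteDimensional k L] (D : LieBialgebra k L) (c : k)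

open DualLie

/-- The pairing of `L* ⊗ L*` with `L ⊗ L`. -/
noncomputable def pair : DualLie D c ⊗[k] DualLie D c →ₗ[k] Module.Dual k (L ⊗[k] L) :=
  TensorProduct.dualDistrib k L L ∘ₗ TensorProduct.map (form D c) (form D c)

/-- The transpose of the Lie bracket of `L`: `⟨δ ξ, x ⊗ y⟩ = ⟨ξ, [x, y]⟩`. -/
noncomputable def dualCobracket : DualLie D c →ₗ[k] DualLie D c ⊗[k] DualLie D c :=
  TensorProduct.map (of D c).toLinearMap (of D c).toLinearMap ∘ₗ
    (TensorProduct.dualDistribEquiv k L L).symm.toLinearMap ∘ₗ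
    (LieModule.toModuleHom k L L : L ⊗[k] L →ₗ[k] L).dualMap ∘ₗ form D c

theorem pair_injective : Function.Injective (pair D c) := by
  have h : pair D c = (TensorProduct.congr (of D c).symm (of D c).symm ≪≫ₗ
      TensorProduct.dualDistribEquiv k L L).toLinearMap := by
    ext ξ η x y
    rfl
  rw [h]
  exact LinearEquiv.injective _

theorem pair_dualCobracket (ξ : DualLie D c) (x y : L) :
    pair D c (dualCobracket D c ξ) (x ⊗ₜ[k] y) = form D c ξ ⁅x, y⁆ := by
  have h : ∀ t, pair D c (TensorProduct.map (of D c).toLinearMap (of D c).toLinearMap t)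
      = TensorProduct.dualDistribEquiv k L L t := by
    intro t
    induction t with
    | zero => simp
    | add a b ha hb => simp only [map_add, ha, hb]
    | tmul a b => rfl
  simp only [dualCobracket, LinearMap.comp_apply, h, LinearEquiv.coe_coe,
    LinearEquiv.apply_symm_apply]
  simp

/-- The pairing of `L* ⊗ L* ⊗ L*` with `L ⊗ L ⊗ L`. -/
noncomputable def pair₃ : (DualLie D c ⊗[k] DualLie D c) ⊗[k] DualLie D c →ₗ[k]
    Module.Dual k ((L ⊗[k] L) ⊗[k] L) :=
  TensorProduct.dualDistrib k (L ⊗[k] L) L ∘ₗ TensorProduct.map (pair D c) (form D c)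

theorem pair₃_injective : Function.Injective (pair₃ D c) := by
  have h : pair₃ D c = (TensorProduct.congr (TensorProduct.congr (of D c).symm (of D c).symm ≪≫ₗ
      TensorProduct.dualDistribEquiv k L L) (of D c).symm ≪≫ₗ
      TensorProduct.dualDistribEquiv k (L ⊗[k] L) L).toLinearMap := by
    ext ξ η ζ x y z
    rfl
  rw [h]
  exact LinearEquiv.injective _

theorem pair₃_cyc (t : (DualLie D c ⊗[k] DualLie D c) ⊗[k] DualLie D c) (x y z : L) :
    pair₃ D c (cyc k (DualLie D c) t) ((x ⊗ₜ[k] y) ⊗ₜ[k] z)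
      = pair₃ D c t ((z ⊗ₜ[k] x) ⊗ₜ[k] y) := by
  induction t with
  | zero => simp
  | add a b ha hb => simp only [map_add, LinearMap.add_apply, ha, hb]
  | tmul s ζ =>
    induction s with
    | zero => simp
    | add a b ha hb => simp only [TensorProduct.add_tmul, map_add, LinearMap.add_apply, ha, hb]
    | tmul ξ η =>
      simp [pair₃, pair, cyc]
      ring

theorem pair₃_rTensor (t : DualLie D c ⊗[k] DualLie D c) (x y z : L) :
    pair₃ D c ((dualCobracket D c).rTensor _ t) ((x ⊗ₜ[k] y) ⊗ₜ[k] z)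
      = pair D c t (⁅x, y⁆ ⊗ₜ[k] z) := by
  induction t with
  | zero => simp
  | add a b ha hb => simp only [map_add, LinearMap.add_apply, ha, hb]
  | tmul ξ η =>
    have := pair_dualCobracket D c ξ x y
    simp [pair₃, this]
    simp [pair]

/-- Contraction of the first factor with a linear form. -/
noncomputable def contr (ξ : Module.Dual k L) : L ⊗[k] L →ₗ[k] L :=
  (TensorProduct.lid k L).toLinearMap ∘ₗ ξ.rTensor L

theorem pair_lie (ξ : DualLie D c) (t : DualLie D c ⊗[k] DualLie D c) (x y : L) :
    pair D c ⁅ξ, t⁆ (x ⊗ₜ[k] y) = c * pair D c t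
      (contr (form D c ξ) (D.δ x) ⊗ₜ[k] y + x ⊗ₜ[k] contr (form D c ξ) (D.δ y)) := by
  have key : ∀ (η : DualLie D c) (s : L ⊗[k] L),
      TensorProduct.dualDistrib k L L (form D c ξ ⊗ₜ[k] form D c η) s
        = form D c η (contr (form D c ξ) s) := by
    intro η s
    induction s with
    | zero => simp
    | add a b ha hb => simp only [map_add, ha, hb]
    | tmul a b => simp [contr]
  induction t with
  | zero => simp
  | add a b ha hb => simp only [lie_add, map_add, LinearMap.add_apply, ha, hb]; ring
  | tmul η η' =>
    rw [TensorProduct.LieModule.lie_tmul_right]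
    simp only [map_add, LinearMap.add_apply, pair, LinearMap.comp_apply, TensorProduct.map_tmul,
      TensorProduct.dualDistrib_apply, lie_def, brk_apply, key]
    ring

theorem pair_act (ξ η : Module.Dual k L) (x y : L) :
    TensorProduct.dualDistrib k L L (ξ ⊗ₜ[k] η) ⁅x, D.δ y⁆
      = η ⁅x, contr ξ (D.δ y)⁆ - ξ ⁅x, contr η (D.δ y)⁆ := by
  have key : ∀ s : L ⊗[k] L, TensorProduct.dualDistrib k L L (ξ ⊗ₜ[k] η) ⁅x, s⁆
      = η ⁅x, contr ξ s⁆ + ξ ⁅x, contr η (TensorProduct.comm k L L s)⁆ := by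
    intro s
    induction s with
    | zero => simp
    | add a b ha hb => simp only [lie_add, map_add, ha, hb]; ring
    | tmul a b =>
      simp [contr, TensorProduct.LieModule.lie_tmul_right]
      ring
  rw [key, D.antisymm, map_neg, lie_neg, map_neg, sub_eq_add_neg]

/-- The dual Lie bialgebra `L*`: its bracket is `c` times the transpose of the cobracket of `L`,
its cobracket is the transpose of the bracket of `L`. -/
noncomputable def dual : LieBialgebra k (DualLie D c) where
  δ := dualCobracket D c
  antisymm ξ := by
    apply pair_injective D c
    ext x y
    have h : ∀ t, pair D c (TensorProduct.comm k _ _ t) (x ⊗ₜ[k] y)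
        = pair D c t (y ⊗ₜ[k] x) := by
      intro t
      induction t with
      | zero => simp
      | add a b ha hb => simp only [map_add, LinearMap.add_apply, ha, hb]
      | tmul a b => simp [pair, mul_comm]
    simp only [TensorProduct.AlgebraTensorModule.curry_apply, TensorProduct.curry_apply,
      LinearMap.coe_restrictScalars, h, map_neg, LinearMap.neg_apply, pair_dualCobracket]
    rw [← lie_skew x y, map_neg, neg_neg]
  coJacobi ξ := by
    apply pair₃_injective D c
    ext x y z
    simp only [TensorProduct.AlgebraTensorModule.curry_apply, TensorProduct.curry_apply,
      LinearMap.coe_restrictScalars, cycSum, LinearMap.add_apply, LinearMap.id_apply,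
      LinearMap.comp_apply, map_add, pair₃_cyc, pair₃_rTensor, pair_dualCobracket, map_zero,
      LinearMap.zero_apply]
    rw [← map_add, ← map_add]
    have h := lie_jacobi z x y
    have h2 : ⁅⁅x, y⁆, z⁆ + ⁅⁅z, x⁆, y⁆ + ⁅⁅y, z⁆, x⁆ = 0 := by
      rw [← lie_skew ⁅x, y⁆ z, ← lie_skew ⁅z, x⁆ y, ← lie_skew ⁅y, z⁆ x, ← neg_eq_zero, ← h]
      abel
    rw [h2, map_zero]
  cocycle ξ η := by
    apply pair_injective D c
    ext x y
    simp only [TensorProduct.AlgebraTensorModule.curry_apply, TensorProduct.curry_apply,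
      LinearMap.coe_restrictScalars, map_sub, LinearMap.sub_apply, pair_dualCobracket, pair_lie,
      map_add, lie_def, brk_apply, D.cocycle, pair_act]
    rw [← lie_skew y (contr (form D c ξ) (D.δ x)), ← lie_skew y (contr (form D c η) (D.δ x)),
      map_neg, map_neg]
    ring

end LieBialgebra
end Dual

section Enveloping

variable (k : Type*) [Field k] (L : Type*) [LieRing L] [LieAlgebra k L]

/-- The universal enveloping algebra `U(L)`. -/
abbrev U := UniversalEnvelopingAlgebra k L

attribute [local instance] LieRing.ofAssociativeRing

/-- The coproduct `x ↦ x ⊗ 1 + 1 ⊗ x` of `U(L)`. -/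
noncomputable def comulU : U k L →ₐ[k] U k L ⊗[k] U k L :=
  UniversalEnvelopingAlgebra.lift k
    { toFun := fun x => UniversalEnvelopingAlgebra.ι k x ⊗ₜ[k] (1 : U k L)
        + (1 : U k L) ⊗ₜ[k] UniversalEnvelopingAlgebra.ι k x
      map_add' := fun x y => by
        simp only [map_add, TensorProduct.add_tmul, TensorProduct.tmul_add]
        abel
      map_smul' := fun a x => by
        simp only [map_smul, RingHom.id_apply, smul_add, TensorProduct.smul_tmul',
          TensorProduct.tmul_smul]
      map_lie' := fun {x y} => by
        simp only [LieHom.map_lie, LieRing.of_associative_ring_bracket, mul_add, add_mul,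
          Algebra.TensorProduct.tmul_mul_tmul, mul_one, one_mul, TensorProduct.sub_tmul,
          TensorProduct.tmul_sub]
        abel }

theorem comulU_ι (x : L) : comulU k L (UniversalEnvelopingAlgebra.ι k x)
    = UniversalEnvelopingAlgebra.ι k x ⊗ₜ[k] (1 : U k L)
      + (1 : U k L) ⊗ₜ[k] UniversalEnvelopingAlgebra.ι k x :=
  UniversalEnvelopingAlgebra.lift_ι_apply k _ x

/-- The augmentation of `U(L)`. -/
noncomputable def counitU : U k L →ₐ[k] k :=
  UniversalEnvelopingAlgebra.lift k (0 : L →ₗ⁅k⁆ k)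

theorem counitU_ι (x : L) : counitU k L (UniversalEnvelopingAlgebra.ι k x) = 0 :=
  UniversalEnvelopingAlgebra.lift_ι_apply k _ x

theorem algHom_ext_ι {A : Type*} [Ring A] [Algebra k A] {g h : U k L →ₐ[k] A}
    (H : ∀ x, g (UniversalEnvelopingAlgebra.ι k x) = h (UniversalEnvelopingAlgebra.ι k x)) :
    g = h := by
  apply UniversalEnvelopingAlgebra.hom_ext
  ext x
  exact H x

noncomputable instance : Bialgebra k (U k L) :=
  Bialgebra.ofAlgHom (comulU k L) (counitU k L)
    (algHom_ext_ι k L fun x => by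
      simp [comulU_ι, TensorProduct.add_tmul, TensorProduct.tmul_add,
        Algebra.TensorProduct.one_def, add_assoc, -UniversalEnvelopingAlgebra.ι_apply])
    (algHom_ext_ι k L fun x => by
      simp [comulU_ι, counitU_ι, -UniversalEnvelopingAlgebra.ι_apply])
    (algHom_ext_ι k L fun x => by
      simp [comulU_ι, counitU_ι, -UniversalEnvelopingAlgebra.ι_apply])

instance : Coalgebra.IsCocomm k (U k L) where
  comm_comp_comul := by
    have h : ((Algebra.TensorProduct.comm k (U k L) (U k L)).toAlgHom.comp (comulU k L))
        = comulU k L := algHom_ext_ι k L fun x => by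
      simp [comulU_ι, add_comm, -UniversalEnvelopingAlgebra.ι_apply]
    exact congrArg AlgHom.toLinearMap h

variable {k L}

/-- `ι ⊗ ι : L ⊗ L → U(L) ⊗ U(L)`. -/
noncomputable def ιι : L ⊗[k] L →ₗ[k] U k L ⊗[k] U k L :=
  TensorProduct.map (UniversalEnvelopingAlgebra.ι k : L →ₗ⁅k⁆ U k L).toLinearMap
    (UniversalEnvelopingAlgebra.ι k : L →ₗ⁅k⁆ U k L).toLinearMap

theorem ιι_lie (x : L) (t : L ⊗[k] L) :
    ιι ⁅x, t⁆ = comulU k L (UniversalEnvelopingAlgebra.ι k x) * ιι t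
      - ιι t * comulU k L (UniversalEnvelopingAlgebra.ι k x) := by
  induction t with
  | zero => simp
  | add a b ha hb => simp only [lie_add, map_add, ha, hb, mul_add, add_mul]; abel
  | tmul a b =>
    simp only [ιι, TensorProduct.LieModule.lie_tmul_right, map_add, TensorProduct.map_tmul,
      LieHom.coe_toLinearMap, LieHom.map_lie, comulU_ι, LieRing.of_associative_ring_bracket,
      TensorProduct.sub_tmul, TensorProduct.tmul_sub, mul_add, add_mul,
      Algebra.TensorProduct.tmul_mul_tmul, one_mul, mul_one]
    abel

/-- The algebra morphism `Δ + ε δ : U(L) → (U(L) ⊗ U(L))[ε]`, `ε² = 0`, which extends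
`x ↦ x ⊗ 1 + 1 ⊗ x + ε δ(x)`. -/
noncomputable def LieBialgebra.comulEps (D : LieBialgebra k L) :
    U k L →ₐ[k] DualNumber (U k L ⊗[k] U k L) :=
  UniversalEnvelopingAlgebra.lift k
    { toFun := fun x =>
        TrivSqZeroExt.inl (comulU k L (UniversalEnvelopingAlgebra.ι k x))
          + TrivSqZeroExt.inr (ιι (D.δ x))
      map_add' := fun x y => by
        simp only [map_add, TrivSqZeroExt.inl_add, TrivSqZeroExt.inr_add]
        abel
      map_smul' := fun a x => by
        simp only [map_smul, RingHom.id_apply, TrivSqZeroExt.inl_smul, TrivSqZeroExt.inr_smul,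
          smul_add]
      map_lie' := fun {x y} => by
        rw [LieRing.of_associative_ring_bracket]
        apply TrivSqZeroExt.ext
        · simp only [TrivSqZeroExt.fst_sub, TrivSqZeroExt.fst_mul, TrivSqZeroExt.fst_add,
            TrivSqZeroExt.fst_inl, TrivSqZeroExt.fst_inr, add_zero, LieHom.map_lie,
            LieRing.of_associative_ring_bracket, map_sub, map_mul]
        · simp only [TrivSqZeroExt.snd_sub, TrivSqZeroExt.snd_mul, TrivSqZeroExt.snd_add,
            TrivSqZeroExt.fst_add, TrivSqZeroExt.fst_inl, TrivSqZeroExt.fst_inr, add_zero,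
            TrivSqZeroExt.snd_inl, TrivSqZeroExt.snd_inr, zero_add, smul_eq_mul,
            MulOpposite.smul_eq_mul_unop, MulOpposite.unop_op, D.cocycle, map_sub, ιι_lie]
          abel }

/-- The co-Poisson structure of `U(L)`: the linear map `δ : U(L) → U(L) ⊗ U(L)` that extends the
cobracket of `L` and satisfies `δ(uv) = δ(u) Δ(v) + Δ(u) δ(v)`. -/
noncomputable def LieBialgebra.coPoisson (D : LieBialgebra k L) :
    U k L →ₗ[k] U k L ⊗[k] U k L where
  toFun u := (D.comulEps u).snd
  map_add' u v := by rw [map_add, TrivSqZeroExt.snd_add]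
  map_smul' a u := by rw [map_smul, TrivSqZeroExt.snd_smul, RingHom.id_apply]

theorem LieBialgebra.fst_comulEps (D : LieBialgebra k L) (u : U k L) :
    (D.comulEps u).fst = comulU k L u := by
  have h : (TrivSqZeroExt.fstHom k (U k L ⊗[k] U k L) (U k L ⊗[k] U k L)).comp D.comulEps
      = comulU k L := algHom_ext_ι k L fun x => by
    change (D.comulEps (UniversalEnvelopingAlgebra.ι k x)).fst = _
    rw [comulEps, UniversalEnvelopingAlgebra.lift_ι_apply]
    change (TrivSqZeroExt.inl (comulU k L (UniversalEnvelopingAlgebra.ι k x))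
      + TrivSqZeroExt.inr (ιι (D.δ x)) : DualNumber (U k L ⊗[k] U k L)).fst = _
    rw [TrivSqZeroExt.fst_add, TrivSqZeroExt.fst_inl, TrivSqZeroExt.fst_inr, add_zero]
  exact DFunLike.congr_fun h u

theorem LieBialgebra.coPoisson_ι (D : LieBialgebra k L) (x : L) :
    D.coPoisson (UniversalEnvelopingAlgebra.ι k x) = ιι (D.δ x) := by
  change (D.comulEps (UniversalEnvelopingAlgebra.ι k x)).snd = _
  rw [comulEps, UniversalEnvelopingAlgebra.lift_ι_apply]
  change (TrivSqZeroExt.inl (comulU k L (UniversalEnvelopingAlgebra.ι k x))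
      + TrivSqZeroExt.inr (ιι (D.δ x)) : DualNumber (U k L ⊗[k] U k L)).snd = _
  rw [TrivSqZeroExt.snd_add, TrivSqZeroExt.snd_inl, TrivSqZeroExt.snd_inr, zero_add]

theorem LieBialgebra.coPoisson_mul (D : LieBialgebra k L) (u v : U k L) :
    D.coPoisson (u * v) = D.coPoisson u * comulU k L v + comulU k L u * D.coPoisson v := by
  change (D.comulEps (u * v)).snd = (D.comulEps u).snd * _ + _ * (D.comulEps v).snd
  rw [map_mul, TrivSqZeroExt.snd_mul, fst_comulEps, fst_comulEps, add_comm]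
  rfl

end Enveloping

section Functions

open Coalgebra

variable (k : Type*) [Field k]

/-- The algebra dual to a coalgebra `C`, with the convolution product
`(φ ψ)(u) = (φ ⊗ ψ)(Δ u)`. For `C = U(L)^{⊗ n}` this is the algebra of functions on the `n`-th
power of the formal group with Lie algebra `L`. -/
abbrev Fun (C : Type*) [AddCommGroup C] [Module k C] := WithConv (C →ₗ[k] k)

variable {k}

/-- The pull-back of functions `φ ↦ φ ∘ g`. -/
def Fun.pull {C C' : Type*} [AddCommGroup C] [Module k C] [AddCommGroup C'] [Module k C']
    (g : C' →ₗ[k] C) (φ : Fun k C) : Fun k C' :=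
  WithConv.toConv (φ.ofConv ∘ₗ g)

/-- The bracket `{φ, ψ}(u) = (φ ⊗ ψ)(d u)` dual to `d : C → C ⊗ C`. -/
noncomputable def Fun.poisson {C : Type*} [AddCommGroup C] [Module k C] (d : C →ₗ[k] C ⊗[k] C)
    (φ ψ : Fun k C) : Fun k C :=
  WithConv.toConv (LinearMap.mul' k k ∘ₗ TensorProduct.map φ.ofConv ψ.ofConv ∘ₗ d)

/-- The co-Poisson structure of the tensor product of two co-Poisson coalgebras
(it is dual to the Poisson structure of a product of Poisson manifolds). -/
noncomputable def coPoissonTensor {C C' : Type*} [AddCommGroup C] [Module k C] [Coalgebra k C]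
    [AddCommGroup C'] [Module k C'] [Coalgebra k C']
    (d : C →ₗ[k] C ⊗[k] C) (d' : C' →ₗ[k] C' ⊗[k] C') :
    C ⊗[k] C' →ₗ[k] (C ⊗[k] C') ⊗[k] (C ⊗[k] C') :=
  (TensorProduct.tensorTensorTensorComm k C C C' C').toLinearMap ∘ₗ
    (TensorProduct.map d comul + TensorProduct.map comul d')

end Functions

section BCH

variable (k : Type*) [Field k] {V : Type*} [AddCommGroup V] [Module k V]

/-- The right-normed bracket `[a₁, [a₂, [… , aₙ]]]` of a word. -/
def nested (br : V → V → V) : List V → V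
  | [] => 0
  | [a] => a
  | a :: b :: l => br a (nested br (b :: l))

/-- The sequences `(r₁, s₁), …, (rₘ, sₘ)` of pairs of natural numbers with `rᵢ + sᵢ > 0` and
`∑ (rᵢ + sᵢ) = n`. -/
def dynkinIndex (m n : ℕ) : Finset (Fin m → Fin (n + 1) × Fin (n + 1)) :=
  Finset.univ.filter fun p =>
    (∀ i, 0 < ((p i).1 : ℕ) + ((p i).2 : ℕ)) ∧ ∑ i, (((p i).1 : ℕ) + ((p i).2 : ℕ)) = n

/-- The word `x^{r₁} y^{s₁} ⋯ x^{rₘ} y^{sₘ}`. -/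
def dynkinWord {m n : ℕ} (p : Fin m → Fin (n + 1) × Fin (n + 1)) (x y : V) : List V :=
  (List.ofFn fun i => List.replicate (p i).1 x ++ List.replicate (p i).2 y).flatten

/-- The homogeneous component `Bₙ(x, y)` of degree `n` of the Baker-Campbell-Hausdorff series
`log(exp(x) exp(y)) = x + y + [x, y] / 2 + ⋯`, for the bracket `br`, by Dynkin's formula. -/
def bchTerm (br : V → V → V) (n : ℕ) (x y : V) : V :=
  (n : k)⁻¹ • ∑ m ∈ Finset.Icc 1 n, ∑ p ∈ dynkinIndex m n,
    ((-1 : k) ^ (m - 1) / (m : k)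
      * ∏ i, (((Nat.factorial (p i).1 : k) * (Nat.factorial (p i).2 : k)))⁻¹) •
      nested br (dynkinWord p x y)

/-- `φ ⋆ ψ = χ`: the Baker-Campbell-Hausdorff series `∑_{n ≥ 1} Bₙ(φ, ψ)` of the bracket `br`
converges to `χ` in the topology of the dual space of `C` (pointwise convergence on `C`, for the
discrete topology of `k`). -/
def IsStar {C : Type*} [AddCommGroup C] [Module k C] (br : Fun k C → Fun k C → Fun k C)
    (φ ψ χ : Fun k C) : Prop :=
  ∀ u : C, ∃ N : ℕ, ∀ n ≥ N, (∑ i ∈ Finset.Icc 1 n, bchTerm k br i φ ψ) u = χ u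

end BCH

namespace LieBialgebra

/-! Functions on the formal Poisson-Lie group `H` with Lie bialgebra `(L, E)`. -/

open Coalgebra

variable {k : Type*} [Field k] {L : Type*} [LieRing L] [LieAlgebra k L]

variable (k L) in
/-- Functions on `H`. -/
abbrev O₁ := Fun k (U k L)

variable (k L) in
/-- Functions on `H × H`. -/
abbrev O₂ := Fun k (U k L ⊗[k] U k L)

variable (k L) in
/-- Functions on `H × H × H`. -/
abbrev O₃ := Fun k ((U k L ⊗[k] U k L) ⊗[k] U k L)

variable (k L) in
/-- The maximal ideal of the ring of functions on `H`: the functions that vanish at the unit. -/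
def maxIdeal : Ideal (O₁ k L) where
  carrier := {φ | φ (1 : U k L) = 0}
  add_mem' {φ ψ} hφ hψ := by
    simp only [Set.mem_ofPred_eq] at hφ hψ ⊢
    simp [hφ, hψ]
  zero_mem' := by simp
  smul_mem' φ ψ hψ := by
    simp only [Set.mem_ofPred_eq] at hψ ⊢
    rw [smul_eq_mul, LinearMap.convMul_apply, Bialgebra.comul_one,
      Algebra.TensorProduct.one_def, TensorProduct.map_tmul, hψ]
    simp

variable (E : LieBialgebra k L)

/-- The Poisson bracket on functions on `H × H`. -/
noncomputable def poisson₂ : O₂ k L → O₂ k L → O₂ k L :=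
  Fun.poisson (coPoissonTensor E.coPoisson E.coPoisson)

/-- The Poisson bracket on functions on `H × H × H`. -/
noncomputable def poisson₃ : O₃ k L → O₃ k L → O₃ k L :=
  Fun.poisson (coPoissonTensor (coPoissonTensor E.coPoisson E.coPoisson) E.coPoisson)

/-- `Δ(φ) = φ^{12}`. -/
noncomputable def cop (φ : O₁ k L) : O₂ k L := φ.pull (LinearMap.mul' k (U k L))

/-- `φ ⊗ 1 = φ^1`. -/
noncomputable def first (φ : O₁ k L) : O₂ k L :=
  φ.pull ((TensorProduct.rid k (U k L)).toLinearMap ∘ₗ (counit (R := k)).lTensor (U k L))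

/-- `1 ⊗ φ = φ^2`. -/
noncomputable def second (φ : O₁ k L) : O₂ k L :=
  φ.pull ((TensorProduct.lid k (U k L)).toLinearMap ∘ₗ (counit (R := k)).rTensor (U k L))

/-- `f ⊗ 1`. -/
noncomputable def tmulOne (f : O₂ k L) : O₃ k L :=
  f.pull ((TensorProduct.rid k (U k L ⊗[k] U k L)).toLinearMap ∘ₗ
    (counit (R := k)).lTensor (U k L ⊗[k] U k L))

/-- `1 ⊗ f`. -/
noncomputable def oneTmul (f : O₂ k L) : O₃ k L :=
  f.pull ((TensorProduct.lid k (U k L ⊗[k] U k L)).toLinearMap ∘ₗ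
    (counit (R := k)).rTensor (U k L ⊗[k] U k L) ∘ₗ
    (TensorProduct.assoc k (U k L) (U k L) (U k L)).toLinearMap)

/-- `(Δ ⊗ id)(f)`. -/
noncomputable def copLeft (f : O₂ k L) : O₃ k L :=
  f.pull ((LinearMap.mul' k (U k L)).rTensor (U k L))

/-- `(id ⊗ Δ)(f)`. -/
noncomputable def copRight (f : O₂ k L) : O₃ k L :=
  f.pull ((LinearMap.mul' k (U k L)).lTensor (U k L) ∘ₗ
    (TensorProduct.assoc k (U k L) (U k L) (U k L)).toLinearMap)

/-- The completed tensor square of the maximal ideal: it is the space of functions on `H × H`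
which vanish on `{1} × H` and on `H × {1}`. -/
def InMaxSq (f : O₂ k L) : Prop :=
  ∀ u : U k L, f ((1 : U k L) ⊗ₜ[k] u) = 0 ∧ f (u ⊗ₜ[k] (1 : U k L)) = 0

/-- `f` is a twist: it lies in the completed tensor square of the maximal ideal and
`(f ⊗ 1) ⋆ (Δ ⊗ id)(f) = (1 ⊗ f) ⋆ (id ⊗ Δ)(f)`, where both sides converge. -/
def IsTwist (f : O₂ k L) : Prop :=
  InMaxSq f ∧ ∃ g : O₃ k L, IsStar k E.poisson₃ (tmulOne f) (copLeft f) g ∧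
    IsStar k E.poisson₃ (oneTmul f) (copRight f) g

/-- `g = lam^1 ⋆ lam^2 ⋆ f ⋆ (-lam)^{12}`, where all the products converge. -/
def IsGauge (lam : O₁ k L) (f g : O₂ k L) : Prop :=
  ∃ p q : O₂ k L, IsStar k E.poisson₂ (first lam) (second lam) p ∧ IsStar k E.poisson₂ p f q ∧
    IsStar k E.poisson₂ q (cop (-lam)) g

end LieBialgebra

section Lift

variable {k : Type*} [Field k] [CharZero k] {L : Type*} [LieRing L] [LieAlgebra k L]
  [FiniteDimensional k L]

/-- The element `f` of the completed tensor square of the maximal ideal `m` of the functions on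
the dual formal group has image `r` in `(m / m²)^{⊗ 2} = L ⊗ L`. The isomorphism `m / m² = L` is
the restriction of the functions in `m ⊂ U(L*)*` to `L* ⊂ U(L*)`. -/
def HasImage (D : LieBialgebra k L) (c : k) (f : LieBialgebra.O₂ k (DualLie D c))
    (r : L ⊗[k] L) : Prop :=
  ∀ ξ η : Module.Dual k L,
    f (UniversalEnvelopingAlgebra.ι k (DualLie.of D c ξ) ⊗ₜ[k]
      UniversalEnvelopingAlgebra.ι k (DualLie.of D c η))
      = TensorProduct.dualDistrib k L L (ξ ⊗ₜ[k] η) r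

end Lift

end GammaLift

/-!
Twists are constructed, and compared, by successive approximation; the obstructions lie in the
cohomology of a vector group, which is computed by an explicit homotopy.

*Functions.* A function on a power of the formal group `G*` is a linear form on a tensor power `A`
of `U(𝔤*)`. Let `F n` be the space of the functions that vanish to order `n` at the unit, that is
on the products of fewer than `n` primitive elements. The Poisson structure vanishes at the unit,
hence `{F a, F b} ⊆ F (a + b - 1)`, and `F 2` is a complete filtered Lie algebra, in which the
Baker-Campbell-Hausdorff series converges (`isStar_iff`). Its sum `bch` is an associative product
(`bch_assoc`), which is deduced from the free associative algebra: there the Dynkin polynomials are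
the components of `log (exp x exp y)`, hence primitive, and right-normed bracketing multiplies a
primitive element by its degree. Since a function that vanishes on `{1} × G*` and `G* × {1}` lies
in `F 2`, all the products in the statement converge. All these facts only depend on the axioms of
`PoissonEnv`, which are inherited by tensor products; pull-backs along Poisson maps are morphisms
for `bch` (`pull_bch`).

*Leading terms.* A function in `F n` is determined modulo `F (n + 1)` by its symbol
`x ↦ φ (x ^ n)` on the primitive elements (`mem_F_succ_of_symbol`). If the two sides of the twist
equation agree modulo `F n`, the symbol of their difference, `defect φ`, is a 3-cocycle of the
additive group of `𝔤*`, by an argument around the pentagon formed by the five faces of a product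
of four factors (`pentagon`, `cobd₃_defect`). Adding to `φ` a function `ψ` of order `n` adds to the
symbol the coboundary of the symbol of `ψ`, up to sign. On cocycles of degree `n` the dilation by
two acts by `2 ^ n`, and it is homotopic to a combination of shuffles which is annihilated by
`(X - 2) (X - 4) (X - 8)` (`dilation_sub_shuffle`, `shuffle_cube`). Therefore the cocycles of
degree at least four are coboundaries, and so is a cocycle of degree three if its
antisymmetrization vanishes (`exists_cobd₂_eq`). Similarly, the 2-cocycles of degree at
least three are coboundaries of functions of one variable (`cocycle₂_eq`).

*Existence.* Let `φ` be a function with the prescribed bilinear part `r`, which exists because `𝔤*`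
is a direct summand of `U(𝔤*)` (`exists_ι_retraction`). Its defect lies in `F 3`, and the
antisymmetrization of the cubic symbol is the left-hand side of the classical Yang-Baxter equation
for `r` (`alt₃_defect`). For `r = (c / 2) ∧²(θ_γ)(f_γ')` this equation is the transport by `θ_γ` of
the equation satisfied by `f_γ'` (`yangBaxter_dual`, `LieBialgebra.cycSum_conj`). So the defect can
be removed order by order, and the corrections do not change the bilinear part
(`exists_twist_of_alt₃`).

*Uniqueness.* The gauge transform of a twist is a twist because `Δ` is a Poisson map and functions
of different variables commute (`defect_gauge`). If a gauge transform of a first twist agrees with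
a second twist modulo `F n`, with `n ≥ 3`, the symbol of the difference is a 2-cocycle, hence a
coboundary, and it is removed by changing the gauge parameter in order `n`
(`exists_gauge_succ`); the limit of these parameters lies in `F 2`, which is the square of the
maximal ideal (`mem_F_two_of_mem_sq`, `mem_sq_of_mem_F_two`).
-/

namespace GammaLift

set_option linter.unusedSectionVars false

/-! ### Exponential and logarithm of nilpotent elements -/

section NilpotentLog

open Polynomial

/-- The truncated logarithm `∑_{1 ≤ m ≤ n} (-1)^(m-1) w^m / m` of `1 + w`. -/
noncomputable def nilLog {A : Type*} [Ring A] [Algebra ℚ A] (n : ℕ) (w : A) : A :=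
  ∑ m ∈ Finset.Icc 1 n, ((-1 : ℚ) ^ (m - 1) / (m : ℚ)) • w ^ m

theorem map_nilLog {A B : Type*} [Ring A] [Algebra ℚ A] [Ring B] [Algebra ℚ B] (φ : A →ₐ[ℚ] B)
    (n : ℕ) (w : A) : φ (nilLog n w) = nilLog n (φ w) := by
  simp [nilLog, map_sum, map_smul]

/-- The truncated exponential series, as a polynomial. -/
noncomputable def expPoly (n : ℕ) : ℚ[X] :=
  ∑ i ∈ Finset.range (n + 1), ((i.factorial : ℚ)⁻¹) • X ^ i

theorem X_pow_succ_dvd_of_derivative {n : ℕ} {f : ℚ[X]} (h : X ^ n ∣ derivative f)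
    (h0 : f.coeff 0 = 0) : X ^ (n + 1) ∣ f := by
  rw [X_pow_dvd_iff] at h ⊢
  intro d hd
  rcases d with _ | d
  · exact h0
  · have := h d (by omega)
    rw [coeff_derivative] at this
    exact (mul_eq_zero.mp this).resolve_right (by positivity)

theorem derivative_expPoly (n : ℕ) :
    derivative (expPoly n) = expPoly n - ((n.factorial : ℚ)⁻¹) • X ^ n := by
  have h : expPoly n - ((n.factorial : ℚ)⁻¹) • X ^ n
      = ∑ i ∈ Finset.range n, ((i.factorial : ℚ)⁻¹) • (X : ℚ[X]) ^ i := by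
    rw [expPoly, Finset.sum_range_succ, add_sub_cancel_right]
  rw [h, expPoly, derivative_sum, Finset.sum_range_succ']
  simp only [derivative_smul, derivative_X_pow, pow_zero, derivative_one, smul_zero, add_zero]
  refine Finset.sum_congr rfl fun i _ => ?_
  rw [Nat.factorial_succ, Nat.add_sub_cancel]
  have h1 : ((i.factorial : ℚ)) ≠ 0 := by positivity
  have h2 : ((i : ℚ) + 1) ≠ 0 := by positivity
  rw [smul_eq_C_mul, smul_eq_C_mul, ← mul_assoc, ← C_mul]
  congr 2
  push_cast
  field_simp

theorem expPoly_coeff_zero (n : ℕ) : (expPoly n).coeff 0 = 1 := by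
  simp [expPoly, coeff_X_pow, Finset.sum_range_succ']

theorem one_add_X_mul_derivative_nilLog (n : ℕ) :
    (1 + X) * derivative (nilLog n (X : ℚ[X])) = 1 - (-X) ^ n := by
  have h : derivative (nilLog n (X : ℚ[X])) = ∑ j ∈ Finset.range n, (-X : ℚ[X]) ^ j := by
    rw [nilLog, derivative_sum, Finset.range_eq_Ico, Finset.sum_Ico_eq_sum_range,
      ← Finset.Ico_add_one_right_eq_Icc, Finset.sum_Ico_eq_sum_range]
    refine Finset.sum_congr (by simp) fun j _ => ?_
    rw [derivative_smul, derivative_X_pow, add_tsub_cancel_left, zero_add]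
    have h2 : ((1 + j : ℕ) : ℚ) ≠ 0 := by positivity
    rw [smul_eq_C_mul, ← mul_assoc, ← C_mul, div_mul_cancel₀ _ h2, neg_pow (X : ℚ[X]) j]
    simp
  rw [h]
  have := mul_neg_geom_sum (-X : ℚ[X]) n
  rw [← this]
  ring

theorem X_pow_dvd_log_exp (n : ℕ) :
    X ^ (n + 1) ∣ nilLog n (expPoly n - 1) - (X : ℚ[X]) := by
  have hX : (X : ℚ[X]) ∣ expPoly n - 1 := by
    rw [X_dvd_iff, coeff_sub, expPoly_coeff_zero]
    simp
  have hcomp : nilLog n (expPoly n - 1) = (nilLog n (X : ℚ[X])).comp (expPoly n - 1) := by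
    simp [nilLog]
  apply X_pow_succ_dvd_of_derivative
  · have hcop : IsCoprime ((X : ℚ[X]) ^ n) (expPoly n) := by
      apply IsCoprime.pow_left
      obtain ⟨q, hq⟩ := hX
      exact ⟨-q, 1, by linear_combination hq⟩
    apply hcop.dvd_of_dvd_mul_left
    have key : expPoly n * derivative (nilLog n (expPoly n - 1) - (X : ℚ[X]))
        = -(((n.factorial : ℚ)⁻¹) • X ^ n)
          - (-(expPoly n - 1)) ^ n * derivative (expPoly n) := by
      have h1 := congrArg (fun p => p.comp (expPoly n - 1)) (one_add_X_mul_derivative_nilLog n)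
      simp only [mul_comp, add_comp, one_comp, X_comp, sub_comp, pow_comp, neg_comp] at h1
      rw [hcomp, derivative_sub, derivative_comp, derivative_X]
      have h2 := derivative_expPoly n
      have h3 : derivative (expPoly n - 1) = derivative (expPoly n) := by simp
      rw [h3]
      linear_combination (derivative (expPoly n)) * h1 + h2
    rw [key]
    apply dvd_sub
    · rw [dvd_neg, smul_eq_C_mul]
      exact dvd_mul_left _ _
    · apply Dvd.dvd.mul_right
      exact pow_dvd_pow_of_dvd (by simpa using (dvd_neg.mpr hX)) n
  · have h4 : (expPoly n - 1).coeff 0 = 0 := X_dvd_iff.mp hX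
    rw [coeff_sub, hcomp, coeff_X_zero, sub_zero, coeff_zero_eq_eval_zero, eval_comp,
      ← coeff_zero_eq_eval_zero, h4, ← coeff_zero_eq_eval_zero, nilLog, finsetSum_coeff]
    refine Finset.sum_eq_zero fun m hm => ?_
    have : 1 ≤ m := (Finset.mem_Icc.mp hm).1
    simp [coeff_X_pow, show ¬ 0 = m by omega]

theorem X_dvd_nilLog (n : ℕ) : (X : ℚ[X]) ∣ nilLog n X := by
  refine Finset.dvd_sum fun m hm => ?_
  rw [smul_eq_C_mul]
  exact Dvd.dvd.mul_left (dvd_pow_self _ (by have := (Finset.mem_Icc.mp hm).1; omega)) _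

theorem X_pow_dvd_exp_log (n : ℕ) :
    X ^ (n + 1) ∣ (expPoly n).comp (nilLog n X) - (1 + X : ℚ[X]) := by
  set f := (expPoly n).comp (nilLog n X) - (1 + X : ℚ[X]) with hf
  -- the differential equation `(1 + X) f' = f` holds up to order `n`
  have key : X ^ n ∣ (1 + X) * derivative f - f := by
    have h1 := one_add_X_mul_derivative_nilLog n
    have h2 := congrArg (fun p => p.comp (nilLog n (X : ℚ[X]))) (derivative_expPoly n)
    simp only [sub_comp, smul_comp, X_pow_comp] at h2
    have h3 : (1 + X) * derivative f - f
        = -(((n.factorial : ℚ)⁻¹) • (nilLog n X) ^ n)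
          - (derivative (expPoly n)).comp (nilLog n X) * (-X) ^ n := by
      rw [hf, derivative_sub, derivative_comp]
      simp only [derivative_add, derivative_one, derivative_X]
      linear_combination ((derivative (expPoly n)).comp (nilLog n X)) * h1 + h2
    rw [h3]
    apply dvd_sub
    · rw [dvd_neg, smul_eq_C_mul]
      exact Dvd.dvd.mul_left (pow_dvd_pow_of_dvd (X_dvd_nilLog n) n) _
    · apply Dvd.dvd.mul_left
      rw [neg_pow]
      exact dvd_mul_left _ _
  have h0 : f.coeff 0 = 0 := by
    have h4 : (nilLog n (X : ℚ[X])).coeff 0 = 0 := X_dvd_iff.mp (X_dvd_nilLog n)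
    rw [hf, coeff_sub, coeff_zero_eq_eval_zero, eval_comp, ← coeff_zero_eq_eval_zero, h4,
      ← coeff_zero_eq_eval_zero, expPoly_coeff_zero]
    simp
  rw [X_pow_dvd_iff] at key ⊢
  intro d
  induction d with
  | zero => exact fun _ => h0
  | succ j ih =>
    intro hj
    have h5 := key j (by omega)
    have h6 := ih (by omega)
    rw [coeff_sub, add_mul, one_mul, coeff_add, coeff_derivative, h6, sub_zero] at h5
    have h7 : (X * derivative f).coeff j = 0 := by
      rcases j with _ | j
      · simp
      · rw [coeff_X_mul, coeff_derivative, h6, zero_mul]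
    rw [h7, add_zero] at h5
    exact (mul_eq_zero.mp h5).resolve_right (by positivity)

variable {A : Type*} [Ring A] [Algebra ℚ A]

theorem exp_eq_aeval {n : ℕ} {a : A} (ha : a ^ (n + 1) = 0) :
    IsNilpotent.exp a = aeval a (expPoly n) := by
  rw [IsNilpotent.exp_eq_sum ha, expPoly]
  simp

theorem aeval_eq_of_dvd {n : ℕ} {a : A} (ha : a ^ (n + 1) = 0) {p q : ℚ[X]}
    (h : X ^ (n + 1) ∣ p - q) : aeval a p = aeval a q := by
  obtain ⟨r, hr⟩ := h
  rw [← sub_eq_zero, ← map_sub, hr, map_mul, map_pow, aeval_X, ha, zero_mul]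

theorem nilLog_exp {n : ℕ} {a : A} (ha : a ^ (n + 1) = 0) :
    nilLog n (IsNilpotent.exp a - 1) = a := by
  have h := aeval_eq_of_dvd ha (X_pow_dvd_log_exp n)
  rw [map_nilLog, map_sub, map_one, ← exp_eq_aeval ha, aeval_X] at h
  exact h

theorem nilLog_pow {n : ℕ} {w : A} (hw : w ^ (n + 1) = 0) : nilLog n w ^ (n + 1) = 0 := by
  have h : nilLog n w = aeval w (nilLog n (X : ℚ[X])) := by rw [map_nilLog, aeval_X]
  obtain ⟨q, hq⟩ := X_dvd_nilLog n
  rw [h, hq, ← map_pow, mul_pow, map_mul, map_pow, aeval_X, hw, zero_mul]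

theorem exp_nilLog {n : ℕ} {w : A} (hw : w ^ (n + 1) = 0) :
    IsNilpotent.exp (nilLog n w) = 1 + w := by
  have h := aeval_eq_of_dvd hw (X_pow_dvd_exp_log n)
  rw [exp_eq_aeval (nilLog_pow hw)]
  rw [aeval_comp, map_nilLog, aeval_X] at h
  simpa using h

theorem exp_injective {n : ℕ} {a b : A} (ha : a ^ (n + 1) = 0) (hb : b ^ (n + 1) = 0)
    (h : IsNilpotent.exp a = IsNilpotent.exp b) : a = b := by
  rw [← nilLog_exp ha, h, nilLog_exp hb]

end NilpotentLog

/-! ### The Dynkin words and the logarithm of `exp a * exp b` -/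

section DynkinLog

variable {A : Type*} [Ring A] [Algebra ℚ A]

/-- The coefficient of the word `x^{r₁} y^{s₁} ⋯ x^{rₘ} y^{sₘ}` in `log(exp x exp y)`. -/
noncomputable def dynkinCoeff (R : Type*) [Field R] {m n : ℕ}
    (p : Fin m → Fin (n + 1) × Fin (n + 1)) : R :=
  (-1 : R) ^ (m - 1) / (m : R)
      * ∏ i, (((Nat.factorial (p i).1 : R) * (Nat.factorial (p i).2 : R)))⁻¹

/-- The homogeneous component of degree `n` of `log(exp a exp b)`, as an associative polynomial
in `a` and `b`. -/
noncomputable def dynkinLog (n : ℕ) (a b : A) : A :=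
  ∑ m ∈ Finset.Icc 1 n, ∑ p ∈ dynkinIndex m n, dynkinCoeff ℚ p • (dynkinWord p a b).prod

theorem map_dynkinWord {V W : Type*} (φ : V → W) {m n : ℕ}
    (p : Fin m → Fin (n + 1) × Fin (n + 1)) (x y : V) :
    (dynkinWord p x y).map φ = dynkinWord p (φ x) (φ y) := by
  simp [dynkinWord, List.map_flatten, List.map_ofFn, Function.comp_def]

theorem length_dynkinWord {V : Type*} {m n : ℕ} {p : Fin m → Fin (n + 1) × Fin (n + 1)}
    (hp : p ∈ dynkinIndex m n) (x y : V) : (dynkinWord p x y).length = n := by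
  rw [dynkinIndex, Finset.mem_filter] at hp
  rw [dynkinWord, List.length_flatten, List.map_ofFn, List.sum_ofFn]
  simpa [Function.comp_def] using hp.2.2

theorem mem_dynkinWord {V : Type*} {m n : ℕ} {p : Fin m → Fin (n + 1) × Fin (n + 1)}
    {x y z : V} (hz : z ∈ dynkinWord p x y) : z = x ∨ z = y := by
  simp only [dynkinWord, List.mem_flatten, List.mem_ofFn] at hz
  obtain ⟨l, ⟨i, rfl⟩, hz⟩ := hz
  rcases List.mem_append.mp hz with h | h
  · exact Or.inl (List.eq_of_mem_replicate h)
  · exact Or.inr (List.eq_of_mem_replicate h)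

theorem prod_dynkinWord {m n : ℕ} (p : Fin m → Fin (n + 1) × Fin (n + 1)) (a b : A) :
    (dynkinWord p a b).prod
      = (List.ofFn fun i => a ^ ((p i).1 : ℕ) * b ^ ((p i).2 : ℕ)).prod := by
  simp [dynkinWord, List.prod_flatten, List.map_ofFn, Function.comp_def]

theorem map_dynkinLog {B : Type*} [Ring B] [Algebra ℚ B] (φ : A →ₐ[ℚ] B) (n : ℕ) (a b : A) :
    φ (dynkinLog n a b) = dynkinLog n (φ a) (φ b) := by
  simp only [dynkinLog, map_sum, map_smul, map_list_prod, map_dynkinWord]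

theorem sum_pow_eq {ι : Type*} (Q : Finset ι) (c : ι → ℚ) (g : ι → A) (m : ℕ) :
    (∑ q ∈ Q, c q • g q) ^ m = ∑ p ∈ Fintype.piFinset (fun _ : Fin m => Q),
      (∏ i, c (p i)) • (List.ofFn fun i => g (p i)).prod := by
  have h := (MultilinearMap.mkPiAlgebraFin ℚ m A).map_sum_finset
    (fun (_ : Fin m) (q : ι) => c q • g q) (fun _ => Q)
  rw [MultilinearMap.mkPiAlgebraFin_apply_const] at h
  rw [h]
  refine Finset.sum_congr rfl fun p _ => ?_
  rw [MultilinearMap.map_smul_univ, MultilinearMap.mkPiAlgebraFin_apply]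

theorem eq_zero_of_mem_pow {I : Submodule ℚ A} {n m : ℕ} (hI : I ^ (n + 1) = ⊥) (hm : n < m)
    {a : A} (ha : a ∈ I ^ m) : a = 0 := by
  obtain ⟨j, rfl⟩ := Nat.exists_eq_add_of_le (show n + 1 ≤ m from hm)
  rw [pow_add, hI, Submodule.bot_mul] at ha
  exact (Submodule.mem_bot ℚ).mp ha

theorem pow_eq_zero_of_mem {I : Submodule ℚ A} {n : ℕ} (hI : I ^ (n + 1) = ⊥) {a : A}
    (ha : a ∈ I) : a ^ (n + 1) = 0 :=
  eq_zero_of_mem_pow hI (Nat.lt_succ_self n) (Submodule.pow_mem_pow I ha _)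

theorem sum_dynkinIndex {m i n : ℕ} (hi : i ≤ n) (f : (Fin m → ℕ × ℕ) → A) :
    ∑ p ∈ dynkinIndex m i, f (fun j => ((p j).1, (p j).2))
      = ∑ p ∈ (Fintype.piFinset fun _ : Fin m =>
          (Finset.range (n + 1) ×ˢ Finset.range (n + 1)).erase (0, 0)) with
          ∑ j, ((p j).1 + (p j).2) = i, f p := by
  refine Finset.sum_bij (fun p _ j => ((p j).1, (p j).2)) ?_ ?_ ?_ ?_
  · intro p hp
    rw [dynkinIndex, Finset.mem_filter] at hp
    simp only [Finset.mem_filter, Fintype.mem_piFinset, Finset.mem_erase, Finset.mem_product,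
      Finset.mem_range]
    refine ⟨fun j => ⟨?_, ?_, ?_⟩, hp.2.2⟩
    · have := hp.2.1 j
      intro h
      simp only [Prod.mk.injEq] at h
      omega
    · have := (p j).1.isLt; omega
    · have := (p j).2.isLt; omega
  · intro p _ q _ h
    funext j
    have := congrFun h j
    simp only [Prod.mk.injEq, Fin.val_inj] at this
    exact Prod.ext this.1 this.2
  · intro p hp
    simp only [Finset.mem_filter, Fintype.mem_piFinset, Finset.mem_erase, Finset.mem_product,
      Finset.mem_range] at hp
    have hle : ∀ j, (p j).1 + (p j).2 ≤ i := fun j => by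
      rw [← hp.2]
      exact Finset.single_le_sum (f := fun j => (p j).1 + (p j).2) (fun _ _ => Nat.zero_le _)
        (Finset.mem_univ j)
    refine ⟨fun j => (⟨(p j).1, by have := hle j; omega⟩, ⟨(p j).2, by have := hle j; omega⟩),
      ?_, rfl⟩
    rw [dynkinIndex, Finset.mem_filter]
    refine ⟨Finset.mem_univ _, fun j => ?_, hp.2⟩
    have := (hp.1 j).1
    by_contra h
    apply this
    ext <;> simp at h ⊢ <;> omega
  · intro p _
    rfl

/-- Dynkin's expansion of `log(exp a exp b)`, for `a` and `b` in a nilpotent subspace. -/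
theorem sum_dynkinLog {I : Submodule ℚ A} {n : ℕ} (hI : I ^ (n + 1) = ⊥) {a b : A}
    (ha : a ∈ I) (hb : b ∈ I) :
    ∑ i ∈ Finset.Icc 1 n, dynkinLog i a b
      = nilLog n (IsNilpotent.exp a * IsNilpotent.exp b - 1) := by
  set Q := (Finset.range (n + 1) ×ˢ Finset.range (n + 1)).erase (0, 0) with hQ
  set c : ℕ × ℕ → ℚ := fun q => ((q.1.factorial : ℚ) * (q.2.factorial : ℚ))⁻¹ with hc
  set g : ℕ × ℕ → A := fun q => a ^ q.1 * b ^ q.2 with hg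
  have hw : IsNilpotent.exp a * IsNilpotent.exp b - 1 = ∑ q ∈ Q, c q • g q := by
    rw [IsNilpotent.exp_eq_sum (pow_eq_zero_of_mem hI ha),
      IsNilpotent.exp_eq_sum (pow_eq_zero_of_mem hI hb), Finset.sum_mul_sum,
      ← Finset.sum_product', sub_eq_iff_eq_add,
      ← Finset.sum_erase_add _ _ (show (0, 0) ∈ Finset.range (n + 1) ×ˢ Finset.range (n + 1) by
        simp)]
    congr 1
    · refine Finset.sum_congr rfl fun q _ => ?_
      rw [smul_mul_smul_comm]
      simp only [hc, hg, mul_inv]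
    · simp
  -- the total degree of a word
  let tot {m : ℕ} (p : Fin m → ℕ × ℕ) : ℕ := ∑ j, ((p j).1 + (p j).2)
  have hprod : ∀ {m : ℕ} (p : Fin m → ℕ × ℕ),
      (List.ofFn fun i => g (p i)).prod ∈ I ^ tot p := by
    intro m p
    induction m with
    | zero => simp [tot]; exact ⟨1, map_one _⟩
    | succ m ih =>
      rw [List.ofFn_succ, List.prod_cons]
      have h1 : tot p = (p 0).1 + (p 0).2 + tot (fun i => p i.succ) := by
        simp only [tot, Fin.sum_univ_succ]
      rw [h1, pow_add, pow_add]
      exact Submodule.mul_mem_mul (Submodule.mul_mem_mul (Submodule.pow_mem_pow I ha _)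
        (Submodule.pow_mem_pow I hb _)) (ih _)
  have hpow : ∀ m ∈ Finset.Icc 1 n, (∑ q ∈ Q, c q • g q) ^ m
      = ∑ i ∈ Finset.Icc 1 n, ∑ p ∈ (Fintype.piFinset fun _ : Fin m => Q) with tot p = i,
        (∏ j, c (p j)) • (List.ofFn fun j => g (p j)).prod := by
    intro m hm
    rw [sum_pow_eq, ← Finset.sum_filter_add_sum_filter_not _ (fun p => tot p ≤ n)]
    have hz : ∑ p ∈ (Fintype.piFinset fun _ : Fin m => Q) with ¬ tot p ≤ n,
        (∏ j, c (p j)) • (List.ofFn fun j => g (p j)).prod = 0 := by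
      refine Finset.sum_eq_zero fun p hp => ?_
      rw [eq_zero_of_mem_pow hI (not_le.mp (Finset.mem_filter.mp hp).2) (hprod p), smul_zero]
    rw [hz, add_zero, ← Finset.sum_fiberwise_of_maps_to (g := tot) (t := Finset.Icc 1 n)]
    · refine Finset.sum_congr rfl fun i hi => Finset.sum_congr ?_ fun _ _ => rfl
      ext p
      have := (Finset.mem_Icc.mp hi).2
      simp only [Finset.mem_filter]
      constructor
      · rintro ⟨⟨h1, -⟩, h2⟩
        exact ⟨h1, h2⟩
      · rintro ⟨h1, h2⟩
        exact ⟨⟨h1, by omega⟩, h2⟩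
    · intro p hp
      rw [Finset.mem_filter, Fintype.mem_piFinset] at hp
      refine Finset.mem_Icc.mpr ⟨?_, hp.2⟩
      have hm1 := (Finset.mem_Icc.mp hm).1
      have h1 := hp.1 ⟨0, hm1⟩
      have h2 : (p ⟨0, hm1⟩).1 + (p ⟨0, hm1⟩).2 ≤ tot p :=
        Finset.single_le_sum (f := fun j => (p j).1 + (p j).2) (fun _ _ => Nat.zero_le _)
          (Finset.mem_univ _)
      rw [hQ, Finset.mem_erase] at h1
      have h3 : (p ⟨0, hm1⟩).1 + (p ⟨0, hm1⟩).2 ≠ 0 := fun h => h1.1 (by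
        ext <;> simp <;> omega)
      omega
  rw [hw, nilLog]
  have hL : ∀ m ∈ Finset.Icc 1 n, ((-1 : ℚ) ^ (m - 1) / (m : ℚ)) • (∑ q ∈ Q, c q • g q) ^ m
      = ∑ i ∈ Finset.Icc 1 n, ∑ p ∈ dynkinIndex m i,
        dynkinCoeff ℚ p • (dynkinWord p a b).prod := by
    intro m hm
    rw [hpow m hm, Finset.smul_sum]
    refine Finset.sum_congr rfl fun i hi => ?_
    rw [Finset.smul_sum, ← sum_dynkinIndex (Finset.mem_Icc.mp hi).2
      (fun p => ((-1 : ℚ) ^ (m - 1) / (m : ℚ)) • (∏ j, c (p j)) •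
        (List.ofFn fun j => g (p j)).prod)]
    refine Finset.sum_congr rfl fun p _ => ?_
    rw [prod_dynkinWord, smul_smul, dynkinCoeff]
  rw [Finset.sum_congr rfl hL, Finset.sum_comm]
  refine Finset.sum_congr rfl fun i hi => ?_
  rw [dynkinLog]
  refine Finset.sum_subset (Finset.Icc_subset_Icc_right (Finset.mem_Icc.mp hi).2) ?_
  -- a word with `m` nonempty blocks has degree at least `m`
  intro m hm1 hm
  refine Finset.sum_eq_zero fun p hp => ?_
  exfalso
  apply hm
  rw [dynkinIndex, Finset.mem_filter] at hp
  have h1 : ∑ _j : Fin m, 1 ≤ ∑ j, (((p j).1 : ℕ) + ((p j).2 : ℕ)) :=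
    Finset.sum_le_sum fun j _ => hp.2.1 j
  rw [hp.2.2] at h1
  simp only [Finset.sum_const, Finset.card_univ, Fintype.card_fin, smul_eq_mul, mul_one] at h1
  exact Finset.mem_Icc.mpr ⟨(Finset.mem_Icc.mp hm1).1, h1⟩

end DynkinLog

/-! ### Words: monoid algebras of graded monoids -/

section Words

variable {M : Type*} [Monoid M]

/-- The linear map on a monoid algebra with given values on the monoid. -/
noncomputable def wordMap {V : Type*} [AddCommGroup V] [Module ℚ V] (f : M → V) :
    MonoidAlgebra ℚ M →ₗ[ℚ] V :=
  Finsupp.linearCombination ℚ f ∘ₗ (MonoidAlgebra.coeffLinearEquiv ℚ).toLinearMap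

@[simp] theorem wordMap_single {V : Type*} [AddCommGroup V] [Module ℚ V] (f : M → V) (m : M)
    (c : ℚ) : wordMap f (MonoidAlgebra.single m c) = c • f m := by
  simp [wordMap]

@[elab_as_elim]
theorem word_induction {p : MonoidAlgebra ℚ M → Prop} (t : MonoidAlgebra ℚ M) (zero : p 0)
    (add : ∀ s t, p s → p t → p (s + t)) (word : ∀ (c : ℚ) m, p (c • MonoidAlgebra.single m 1)) :
    p t :=
  MonoidAlgebra.induction_linear t zero add fun m c => by simpa using word c m

variable (len : M →* Multiplicative ℕ)

/-- The span of the elements of the monoid of degree at least `n`. -/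
noncomputable def degGE (n : ℕ) : Submodule ℚ (MonoidAlgebra ℚ M) :=
  Submodule.span ℚ ((fun m => MonoidAlgebra.single m 1) '' {m | n ≤ (len m).toAdd})

/-- The span of the elements of the monoid of degree `n`. -/
noncomputable def homog (n : ℕ) : Submodule ℚ (MonoidAlgebra ℚ M) :=
  Submodule.span ℚ ((fun m => MonoidAlgebra.single m 1) '' {m | (len m).toAdd = n})

variable {len}

theorem single_mem_degGE {n : ℕ} {m : M} (h : n ≤ (len m).toAdd) :
    MonoidAlgebra.single m 1 ∈ degGE len n :=
  Submodule.subset_span ⟨m, h, rfl⟩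

theorem single_mem_homog {n : ℕ} {m : M} (h : (len m).toAdd = n) :
    MonoidAlgebra.single m 1 ∈ homog len n :=
  Submodule.subset_span ⟨m, h, rfl⟩

theorem degGE_mul_le (a b : ℕ) : degGE len a * degGE len b ≤ degGE len (a + b) := by
  rw [degGE, degGE, Submodule.span_mul_span, Submodule.span_le]
  rintro _ ⟨_, ⟨m, hm, rfl⟩, _, ⟨m', hm', rfl⟩, rfl⟩
  simp only [MonoidAlgebra.single_mul_single, mul_one]
  apply single_mem_degGE
  rw [map_mul, toAdd_mul]
  exact Nat.add_le_add hm hm'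

theorem degGE_zero : degGE len 0 = ⊤ := by
  rw [eq_top_iff]
  intro t _
  induction t using word_induction with
  | zero => exact Submodule.zero_mem _
  | add s t hs ht => exact Submodule.add_mem _ (hs trivial) (ht trivial)
  | word c m => exact Submodule.smul_mem _ _ (single_mem_degGE (Nat.zero_le _))

theorem degGE_pow_le (n : ℕ) : degGE len 1 ^ n ≤ degGE len n := by
  induction n with
  | zero => rw [degGE_zero]; exact le_top
  | succ n ih =>
    rw [pow_succ]
    exact (mul_le_mul' ih le_rfl).trans (degGE_mul_le n 1)

theorem coeff_eq_zero_of_mem_degGE {n : ℕ} {t : MonoidAlgebra ℚ M} (ht : t ∈ degGE len n) {m : M}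
    (hm : (len m).toAdd < n) : t.coeff m = 0 := by
  induction ht using Submodule.span_induction with
  | mem x hx =>
    obtain ⟨m', hm', rfl⟩ := hx
    classical
    rw [MonoidAlgebra.coeff_single, Finsupp.single_apply, if_neg]
    rintro rfl
    exact absurd hm (not_lt.mpr hm')
  | zero => simp
  | add x y _ _ hx hy => simp [hx, hy]
  | smul a x _ hx => simp [hx]

theorem coeff_eq_zero_of_mem_homog {n : ℕ} {t : MonoidAlgebra ℚ M} (ht : t ∈ homog len n) {m : M}
    (hm : (len m).toAdd ≠ n) : t.coeff m = 0 := by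
  induction ht using Submodule.span_induction with
  | mem x hx =>
    obtain ⟨m', hm', rfl⟩ := hx
    classical
    rw [MonoidAlgebra.coeff_single, Finsupp.single_apply, if_neg]
    rintro rfl
    exact hm hm'
  | zero => simp
  | add x y _ _ hx hy => simp [hx, hy]
  | smul a x _ hx => simp [hx]

/-- If a sum of homogeneous elements of degrees `1, …, n` lies in degrees greater than `n`, then
every summand vanishes. -/
theorem eq_zero_of_sum_mem {n : ℕ} {e : ℕ → MonoidAlgebra ℚ M} (he : ∀ i, e i ∈ homog len i)
    (h : ∑ i ∈ Finset.Icc 1 n, e i ∈ degGE len (n + 1)) {i : ℕ} (hi : i ∈ Finset.Icc 1 n) :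
    e i = 0 := by
  rw [← MonoidAlgebra.coeff_eq_zero]
  ext m
  rw [Finsupp.zero_apply]
  by_cases hm : (len m).toAdd = i
  · have h1 := coeff_eq_zero_of_mem_degGE h (m := m) (by
      have := (Finset.mem_Icc.mp hi).2; omega)
    rw [MonoidAlgebra.coeff_sum, Finsupp.finsetSum_apply, Finset.sum_eq_single i] at h1
    · exact h1
    · intro j _ hj
      exact coeff_eq_zero_of_mem_homog (he j) (by rw [hm]; exact hj.symm)
    · exact fun h => absurd hi h
  · exact coeff_eq_zero_of_mem_homog (he i) hm

variable (len) in
/-- The two-sided ideal of elements of degree greater than `n`. -/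
noncomputable def degIdeal (n : ℕ) : Ideal (MonoidAlgebra ℚ M) where
  __ := (degGE len (n + 1)).toAddSubmonoid
  smul_mem' c x hx := by
    have := degGE_mul_le (len := len) 0 (n + 1)
    rw [zero_add, degGE_zero] at this
    exact this (Submodule.mul_mem_mul Submodule.mem_top hx)

instance (n : ℕ) : (degIdeal len n).IsTwoSided where
  mul_mem_of_left b hx := by
    have := degGE_mul_le (len := len) (n + 1) 0
    rw [add_zero, degGE_zero] at this
    exact this (Submodule.mul_mem_mul hx Submodule.mem_top)

variable (len) in
/-- The quotient by the elements of degree greater than `n`. -/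
noncomputable def truncHom (n : ℕ) :
    MonoidAlgebra ℚ M →ₐ[ℚ] MonoidAlgebra ℚ M ⧸ degIdeal len n :=
  Ideal.Quotient.mkₐ ℚ (degIdeal len n)

theorem truncHom_eq_iff {n : ℕ} {s t : MonoidAlgebra ℚ M} :
    truncHom len n s = truncHom len n t ↔ s - t ∈ degGE len (n + 1) :=
  Ideal.Quotient.eq

variable (len) in
/-- The image of the augmentation ideal in the truncated algebra. -/
noncomputable def truncAug (n : ℕ) : Submodule ℚ (MonoidAlgebra ℚ M ⧸ degIdeal len n) :=
  (degGE len 1).map (truncHom len n).toLinearMap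

theorem truncAug_pow (n : ℕ) : truncAug len n ^ (n + 1) = ⊥ := by
  rw [truncAug, ← Submodule.map_pow, eq_bot_iff]
  rintro _ ⟨t, ht, rfl⟩
  rw [Submodule.mem_bot]
  have h : truncHom len n t = truncHom len n 0 := by
    rw [truncHom_eq_iff, sub_zero]
    exact degGE_pow_le (n + 1) ht
  exact h.trans (map_zero _)

theorem truncHom_mem {n : ℕ} {t : MonoidAlgebra ℚ M} (ht : t ∈ degGE len 1) :
    truncHom len n t ∈ truncAug len n := ⟨t, ht, rfl⟩

end Words

/-! ### The theorem of Dynkin, Specht and Wever -/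

section DynkinSpechtWever

variable {α : Type*}

/-- The length of a word. -/
def wordLen (α : Type*) : FreeMonoid α →* Multiplicative ℕ where
  toFun w := Multiplicative.ofAdd w.length
  map_one' := rfl
  map_mul' u v := by rw [FreeMonoid.length_mul, ofAdd_add]

@[simp] theorem toAdd_wordLen (w : FreeMonoid α) : (wordLen α w).toAdd = w.length := rfl

/-- The free associative algebra on `α`. -/
abbrev FreeAss (α : Type*) := MonoidAlgebra ℚ (FreeMonoid α)

/-- The tensor square of the free associative algebra. -/
abbrev FreeAssSq (α : Type*) := MonoidAlgebra ℚ (FreeMonoid α × FreeMonoid α)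

/-- A letter, as an element of the free associative algebra. -/
noncomputable def letter (a : α) : FreeAss α := MonoidAlgebra.single (FreeMonoid.of a) 1

/-- The commutator of a ring. -/
def ringComm {A : Type*} [Ring A] (x y : A) : A := x * y - y * x

/-- The linear map which sends a word to its right-normed bracket. -/
noncomputable def dynkinMap {V : Type*} [AddCommGroup V] [Module ℚ V] (br : V → V → V)
    (v : α → V) : FreeAss α →ₗ[ℚ] V :=
  wordMap fun w => nested br (w.toList.map v)

theorem reverse_one : (1 : FreeMonoid α).reverse = 1 := rfl

/-- `u ↦ u ⊗ 1`. -/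
noncomputable def inl₂ : FreeAss α →ₐ[ℚ] FreeAssSq α :=
  MonoidAlgebra.mapDomainAlgHom ℚ ℚ (MonoidHom.inl (FreeMonoid α) (FreeMonoid α))

/-- `u ↦ 1 ⊗ u`. -/
noncomputable def inr₂ : FreeAss α →ₐ[ℚ] FreeAssSq α :=
  MonoidAlgebra.mapDomainAlgHom ℚ ℚ (MonoidHom.inr (FreeMonoid α) (FreeMonoid α))

@[simp] theorem inl₂_single (w : FreeMonoid α) (c : ℚ) :
    inl₂ (MonoidAlgebra.single w c) = MonoidAlgebra.single (w, 1) c := by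
  simp [inl₂]

@[simp] theorem inr₂_single (w : FreeMonoid α) (c : ℚ) :
    inr₂ (MonoidAlgebra.single w c) = MonoidAlgebra.single (1, w) c := by
  simp [inr₂]

/-- The coproduct for which the letters are primitive. -/
noncomputable def shuffleCop : FreeAss α →ₐ[ℚ] FreeAssSq α :=
  MonoidAlgebra.lift ℚ _ _ (FreeMonoid.lift fun a => inl₂ (letter a) + inr₂ (letter a))

theorem shuffleCop_letter (a : α) : shuffleCop (letter a) = inl₂ (letter a) + inr₂ (letter a) := by
  simp [shuffleCop, letter]

/-- `u ⊗ v ↦ u S(v)`, where `S` is the antipode. -/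
noncomputable def mulAntipode : FreeAssSq α →ₗ[ℚ] FreeAss α :=
  wordMap fun p => (-1 : ℚ) ^ p.2.length • MonoidAlgebra.single (p.1 * p.2.reverse) 1

/-- `u ⊗ v ↦ E(u) S(v)`, where `S` is the antipode and `E` multiplies a word by its length. -/
noncomputable def eulerAntipode : FreeAssSq α →ₗ[ℚ] FreeAss α :=
  wordMap fun p => ((p.1.length : ℚ) * (-1 : ℚ) ^ p.2.length) •
    MonoidAlgebra.single (p.1 * p.2.reverse) 1

theorem mulAntipode_inl (a : α) (t : FreeAssSq α) :
    mulAntipode (inl₂ (letter a) * t) = letter a * mulAntipode t := by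
  induction t using word_induction with
  | zero => simp
  | add s t hs ht => simp only [mul_add, map_add, hs, ht]
  | word c m =>
    simp only [mul_smul_comm, map_smul]
    congr 1
    simp [mulAntipode, letter, MonoidAlgebra.single_mul_single, mul_assoc]

theorem mulAntipode_inr (a : α) (t : FreeAssSq α) :
    mulAntipode (inr₂ (letter a) * t) = -(mulAntipode t * letter a) := by
  induction t using word_induction with
  | zero => simp
  | add s t hs ht => simp only [mul_add, map_add, hs, ht, add_mul, neg_add]
  | word c m =>
    simp only [mul_smul_comm, map_smul, smul_mul_assoc, ← smul_neg]
    congr 1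
    simp [mulAntipode, letter, MonoidAlgebra.single_mul_single, mul_assoc, FreeMonoid.reverse_mul,
      FreeMonoid.length_mul, pow_add]

theorem eulerAntipode_inl (a : α) (t : FreeAssSq α) :
    eulerAntipode (inl₂ (letter a) * t)
      = letter a * mulAntipode t + letter a * eulerAntipode t := by
  induction t using word_induction with
  | zero => simp
  | add s t hs ht => simp only [mul_add, map_add, hs, ht]; abel
  | word c m =>
    simp only [mul_smul_comm, map_smul, ← smul_add]
    congr 1
    simp [mulAntipode, eulerAntipode, letter, MonoidAlgebra.single_mul_single, mul_assoc,
      FreeMonoid.length_mul, ← MonoidAlgebra.single_add]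
    ring_nf

theorem eulerAntipode_inr (a : α) (t : FreeAssSq α) :
    eulerAntipode (inr₂ (letter a) * t) = -(eulerAntipode t * letter a) := by
  induction t using word_induction with
  | zero => simp
  | add s t hs ht => simp only [mul_add, map_add, hs, ht, add_mul, neg_add]
  | word c m =>
    simp only [mul_smul_comm, map_smul, smul_mul_assoc, ← smul_neg]
    congr 1
    simp [eulerAntipode, letter, MonoidAlgebra.single_mul_single, mul_assoc, FreeMonoid.reverse_mul,
      FreeMonoid.length_mul, pow_add]

theorem mulAntipode_shuffleCop (a : α) (w : FreeMonoid α) :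
    mulAntipode (shuffleCop (MonoidAlgebra.single (FreeMonoid.of a * w) 1)) = 0 := by
  have hstep : ∀ (b : α) (v : FreeMonoid α),
      shuffleCop (MonoidAlgebra.single (FreeMonoid.of b * v) 1)
        = (inl₂ (letter b) + inr₂ (letter b)) * shuffleCop (MonoidAlgebra.single v 1) := by
    intro b v
    rw [← shuffleCop_letter, ← map_mul, letter, MonoidAlgebra.single_mul_single, mul_one]
  have h1 : mulAntipode (shuffleCop (1 : FreeAss α)) = 1 := by
    rw [map_one, MonoidAlgebra.one_def, mulAntipode, wordMap_single]
    simp [MonoidAlgebra.one_def, reverse_one]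
  induction w using FreeMonoid.inductionOn' generalizing a with
  | one =>
    rw [hstep, add_mul, map_add, mulAntipode_inl, mulAntipode_inr, ← MonoidAlgebra.one_def, h1]
    simp
  | of_mul b w ih =>
    rw [hstep, add_mul, map_add, mulAntipode_inl, mulAntipode_inr, ih]
    simp

/-- The right-normed bracketing is the convolution product of the Euler operator and of the
antipode. -/
theorem eulerAntipode_shuffleCop (t : FreeAss α) :
    eulerAntipode (shuffleCop t) = dynkinMap ringComm letter t := by
  have hstep : ∀ (b : α) (v : FreeMonoid α),
      shuffleCop (MonoidAlgebra.single (FreeMonoid.of b * v) 1)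
        = (inl₂ (letter b) + inr₂ (letter b)) * shuffleCop (MonoidAlgebra.single v 1) := by
    intro b v
    rw [← shuffleCop_letter, ← map_mul, letter, MonoidAlgebra.single_mul_single, mul_one]
  have h1 : mulAntipode (shuffleCop (1 : FreeAss α)) = 1 := by
    rw [map_one, MonoidAlgebra.one_def, mulAntipode, wordMap_single]
    simp [MonoidAlgebra.one_def, reverse_one]
  have h2 : eulerAntipode (shuffleCop (1 : FreeAss α)) = 0 := by
    rw [map_one, MonoidAlgebra.one_def, eulerAntipode, wordMap_single]
    simp
  induction t using word_induction with
  | zero => simp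
  | add s t hs ht => simp only [map_add, hs, ht]
  | word c w =>
  rw [map_smul, map_smul, map_smul]
  congr 1
  induction w using FreeMonoid.inductionOn' with
  | one =>
    rw [← MonoidAlgebra.one_def, h2, MonoidAlgebra.one_def, dynkinMap, wordMap_single]
    simp [nested]
  | of_mul a w ih =>
    rw [hstep, add_mul, map_add, eulerAntipode_inl, eulerAntipode_inr, ih]
    cases w using FreeMonoid.casesOn with
    | one =>
      rw [← MonoidAlgebra.one_def, h1, mul_one, MonoidAlgebra.one_def]
      simp [dynkinMap, nested]
    | of_mul b w =>
      rw [mulAntipode_shuffleCop]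
      simp [dynkinMap, nested, ringComm, sub_eq_add_neg]

theorem dynkinMap_of_primitive {n : ℕ} {t : FreeAss α} (ht : t ∈ homog (wordLen α) n)
    (h : shuffleCop t = inl₂ t + inr₂ t) : dynkinMap ringComm letter t = (n : ℚ) • t := by
  rw [← eulerAntipode_shuffleCop, h, map_add]
  have hl : eulerAntipode (inl₂ t) = (n : ℚ) • t := by
    clear h
    induction ht using Submodule.span_induction with
    | mem x hx =>
      obtain ⟨w, hw, rfl⟩ := hx
      simp only [Set.mem_ofPred_eq, toAdd_wordLen] at hw
      simp [eulerAntipode, hw, reverse_one]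
    | zero => simp
    | add x y _ _ hx hy => simp [hx, hy]
    | smul a x _ hx => rw [map_smul, map_smul, hx, smul_comm]
  have hr : eulerAntipode (inr₂ t) = 0 := by
    clear h ht hl
    induction t using word_induction with
    | zero => simp
    | add s t hs ht => simp only [map_add, hs, ht, add_zero]
    | word c m => simp [eulerAntipode]
  rw [hl, hr, add_zero]

end DynkinSpechtWever

/-! ### Associativity of the Baker-Campbell-Hausdorff series -/

section BCHAssociative

variable {α : Type*}

theorem homog_mul_le {M : Type*} [Monoid M] {len : M →* Multiplicative ℕ} (a b : ℕ) :
    homog len a * homog len b ≤ homog len (a + b) := by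
  rw [homog, homog, Submodule.span_mul_span, Submodule.span_le]
  rintro _ ⟨_, ⟨m, hm, rfl⟩, _, ⟨m', hm', rfl⟩, rfl⟩
  simp only [MonoidAlgebra.single_mul_single, mul_one]
  apply single_mem_homog
  rw [map_mul, toAdd_mul, hm, hm']

theorem list_prod_mem_homog {M : Type*} [Monoid M] {len : M →* Multiplicative ℕ}
    {l : List (MonoidAlgebra ℚ M)} (h : ∀ a ∈ l, a ∈ homog len 1) :
    l.prod ∈ homog len l.length := by
  induction l with
  | nil => exact single_mem_homog (by simp)
  | cons a l ih =>
    rw [List.prod_cons, List.length_cons, add_comm]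
    exact homog_mul_le _ _ (Submodule.mul_mem_mul (h a (by simp))
      (ih fun b hb => h b (by simp [hb])))

theorem dynkinLog_mem_homog {M : Type*} [Monoid M] {len : M →* Multiplicative ℕ}
    {x y : MonoidAlgebra ℚ M} (hx : x ∈ homog len 1) (hy : y ∈ homog len 1) (n : ℕ) :
    dynkinLog n x y ∈ homog len n := by
  refine Submodule.sum_mem _ fun m _ => Submodule.sum_mem _ fun p hp => Submodule.smul_mem _ _ ?_
  have h := list_prod_mem_homog (len := len) (l := dynkinWord p x y) (fun z hz => by
    rcases mem_dynkinWord hz with rfl | rfl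
    exacts [hx, hy])
  rwa [length_dynkinWord hp] at h

theorem homog_le_degGE {M : Type*} [Monoid M] {len : M →* Multiplicative ℕ} (n : ℕ) :
    homog len n ≤ degGE len n :=
  Submodule.span_mono (Set.image_mono fun _ h => (show _ = _ from h).ge)

theorem letter_mem_homog (a : α) : letter a ∈ homog (wordLen α) 1 :=
  single_mem_homog (by simp)

/-- The total length of a pair of words. -/
def wordLen₂ (α : Type*) : FreeMonoid α × FreeMonoid α →* Multiplicative ℕ :=
  (wordLen α).coprod (wordLen α)

theorem inl₂_mem_homog {n : ℕ} {t : FreeAss α} (ht : t ∈ homog (wordLen α) n) :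
    inl₂ t ∈ homog (wordLen₂ α) n := by
  have h : homog (wordLen α) n ≤ (homog (wordLen₂ α) n).comap (inl₂ (α := α)).toLinearMap := by
    rw [homog, Submodule.span_le]
    rintro _ ⟨w, hw, rfl⟩
    have : inl₂ (MonoidAlgebra.single w (1 : ℚ)) ∈ homog (wordLen₂ α) n := by
      rw [inl₂_single]
      exact single_mem_homog (by simpa [wordLen₂] using hw)
    exact this
  exact h ht

theorem inr₂_mem_homog {n : ℕ} {t : FreeAss α} (ht : t ∈ homog (wordLen α) n) :
    inr₂ t ∈ homog (wordLen₂ α) n := by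
  have h : homog (wordLen α) n ≤ (homog (wordLen₂ α) n).comap (inr₂ (α := α)).toLinearMap := by
    rw [homog, Submodule.span_le]
    rintro _ ⟨w, hw, rfl⟩
    have : inr₂ (MonoidAlgebra.single w (1 : ℚ)) ∈ homog (wordLen₂ α) n := by
      rw [inr₂_single]
      exact single_mem_homog (by simpa [wordLen₂] using hw)
    exact this
  exact h ht

theorem inl₂_commute_inr₂ (s t : FreeAss α) : Commute (inl₂ s) (inr₂ t) := by
  induction s using word_induction with
  | zero => simp
  | add s s' hs hs' => rw [map_add]; exact hs.add_left hs'
  | word c w =>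
    rw [map_smul]
    refine Commute.smul_left ?_ c
    induction t using word_induction with
    | zero => simp
    | add t t' ht ht' => rw [map_add]; exact ht.add_right ht'
    | word d v =>
      rw [map_smul]
      refine Commute.smul_right ?_ d
      simp [Commute, SemiconjBy, MonoidAlgebra.single_mul_single]

theorem commute_sum_dynkinLog {A : Type*} [Ring A] [Algebra ℚ A] {I : Submodule ℚ A} {n : ℕ}
    (hI : I ^ (n + 1) = ⊥) {a b : A} (ha : a ∈ I) (hb : b ∈ I) (hII : I * I ≤ I) :
    IsNilpotent.exp a * IsNilpotent.exp b - 1 ∈ I := by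
  have hpow : ∀ {x : A}, x ∈ I → ∀ i, x ^ (i + 1) ∈ I := by
    intro x hx i
    induction i with
    | zero => simpa using hx
    | succ i ih => rw [pow_succ]; exact hII (Submodule.mul_mem_mul ih hx)
  have hexp : ∀ {x : A}, x ∈ I → IsNilpotent.exp x - 1 ∈ I := by
    intro x hx
    rw [IsNilpotent.exp_eq_sum (pow_eq_zero_of_mem hI hx), Finset.sum_range_succ']
    simp only [Nat.factorial_zero, Nat.cast_one, inv_one, pow_zero, one_smul, add_sub_cancel_right]
    exact Submodule.sum_mem _ fun i _ => Submodule.smul_mem _ _ (hpow hx i)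
  have h : IsNilpotent.exp a * IsNilpotent.exp b - 1 = (IsNilpotent.exp a - 1) *
      (IsNilpotent.exp b - 1) + (IsNilpotent.exp a - 1) + (IsNilpotent.exp b - 1) := by
    noncomm_ring
  rw [h]
  exact I.add_mem (I.add_mem (hII (Submodule.mul_mem_mul (hexp ha) (hexp hb))) (hexp ha)) (hexp hb)

theorem truncAug_mul_le {M : Type*} [Monoid M] (len : M →* Multiplicative ℕ) (n : ℕ) :
    truncAug len n * truncAug len n ≤ truncAug len n := by
  rw [truncAug, ← Submodule.map_mul]
  refine Submodule.map_mono ((mul_le_mul' ?_ le_rfl).trans (degGE_mul_le 0 1))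
  rw [degGE_zero]
  exact le_top

theorem exp_sum_dynkinLog {A : Type*} [Ring A] [Algebra ℚ A] {I : Submodule ℚ A} {n : ℕ}
    (hI : I ^ (n + 1) = ⊥) (hII : I * I ≤ I) {a b : A} (ha : a ∈ I) (hb : b ∈ I) :
    IsNilpotent.exp (∑ i ∈ Finset.Icc 1 n, dynkinLog i a b)
      = IsNilpotent.exp a * IsNilpotent.exp b := by
  rw [sum_dynkinLog hI ha hb,
    exp_nilLog (pow_eq_zero_of_mem hI (commute_sum_dynkinLog hI ha hb hII))]
  abel

theorem sum_dynkinLog_mem {A : Type*} [Ring A] [Algebra ℚ A] {I : Submodule ℚ A} {n : ℕ}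
    (hII : I * I ≤ I) {a b : A} (ha : a ∈ I) (hb : b ∈ I) :
    ∑ i ∈ Finset.Icc 1 n, dynkinLog i a b ∈ I := by
  refine Submodule.sum_mem _ fun i hi => Submodule.sum_mem _ fun m _ => Submodule.sum_mem _
    fun p hp => Submodule.smul_mem _ _ ?_
  have h1 : (dynkinWord p a b).length ≠ 0 := by
    rw [length_dynkinWord hp]
    have := (Finset.mem_Icc.mp hi).1
    omega
  have h2 : ∀ z ∈ dynkinWord p a b, z ∈ I := fun z hz => by
    rcases mem_dynkinWord hz with rfl | rfl
    exacts [ha, hb]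
  generalize dynkinWord p a b = l at h1 h2
  induction l with
  | nil => simp at h1
  | cons c l ih =>
    by_cases hl : l = []
    · subst hl
      simpa using h2 c (by simp)
    · rw [List.prod_cons]
      exact hII (Submodule.mul_mem_mul (h2 c (by simp))
        (ih (by simpa using hl) fun z hz => h2 z (by simp [hz])))

/-- The components of `log(exp x exp y)` are primitive. -/
theorem shuffleCop_dynkinLog (a b : α) (i : ℕ) (hi : 1 ≤ i) :
    shuffleCop (dynkinLog i (letter a) (letter b))
      = inl₂ (dynkinLog i (letter a) (letter b)) + inr₂ (dynkinLog i (letter a) (letter b)) := by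
  set x := letter a
  set y := letter b
  have hx : x ∈ homog (wordLen α) 1 := letter_mem_homog a
  have hy : y ∈ homog (wordLen α) 1 := letter_mem_homog b
  set e : ℕ → FreeAssSq α := fun j => shuffleCop (dynkinLog j x y)
    - (inl₂ (dynkinLog j x y) + inr₂ (dynkinLog j x y)) with he
  have hx' : shuffleCop x ∈ homog (wordLen₂ α) 1 := by
    rw [shuffleCop_letter]
    exact Submodule.add_mem _ (inl₂_mem_homog hx) (inr₂_mem_homog hx)
  have hy' : shuffleCop y ∈ homog (wordLen₂ α) 1 := by
    rw [shuffleCop_letter]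
    exact Submodule.add_mem _ (inl₂_mem_homog hy) (inr₂_mem_homog hy)
  have h1 : ∀ j, e j ∈ homog (wordLen₂ α) j := fun j => by
    refine Submodule.sub_mem _ ?_ (Submodule.add_mem _
      (inl₂_mem_homog (dynkinLog_mem_homog hx hy j))
      (inr₂_mem_homog (dynkinLog_mem_homog hx hy j)))
    rw [map_dynkinLog]
    exact dynkinLog_mem_homog hx' hy' j
  suffices h2 : ∑ j ∈ Finset.Icc 1 i, e j ∈ degGE (wordLen₂ α) (i + 1) from
    sub_eq_zero.mp (eq_zero_of_sum_mem h1 h2 (Finset.mem_Icc.mpr ⟨hi, le_rfl⟩))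
  have h3 : ∑ j ∈ Finset.Icc 1 i, e j = ∑ j ∈ Finset.Icc 1 i, shuffleCop (dynkinLog j x y)
      - (∑ j ∈ Finset.Icc 1 i, inl₂ (dynkinLog j x y)
        + ∑ j ∈ Finset.Icc 1 i, inr₂ (dynkinLog j x y)) := by
    rw [he, Finset.sum_sub_distrib, Finset.sum_add_distrib]
  rw [h3, ← truncHom_eq_iff, map_add, map_sum, map_sum, map_sum]
  simp only [map_dynkinLog, x, y, shuffleCop_letter, map_add]
  set π := truncHom (wordLen₂ α) i
  have hI := truncAug_pow (len := wordLen₂ α) i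
  have hII := truncAug_mul_le (wordLen₂ α) i
  have hmem : ∀ {t}, t ∈ homog (wordLen₂ α) 1 → π t ∈ truncAug (wordLen₂ α) i := fun ht =>
    truncHom_mem (homog_le_degGE 1 ht)
  have mx := hmem (inl₂_mem_homog hx)
  have mx' := hmem (inr₂_mem_homog hx)
  have my := hmem (inl₂_mem_homog hy)
  have my' := hmem (inr₂_mem_homog hy)
  have nil : ∀ {t}, t ∈ truncAug (wordLen₂ α) i → IsNilpotent t := fun ht =>
    ⟨i + 1, pow_eq_zero_of_mem hI ht⟩
  have comm : ∀ s t : FreeAss α, Commute (π (inl₂ s)) (π (inr₂ t)) := fun s t =>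
    (inl₂_commute_inr₂ s t).map π
  have hc1 : Commute (∑ j ∈ Finset.Icc 1 i, dynkinLog j (π (inl₂ x)) (π (inl₂ y)))
      (∑ j ∈ Finset.Icc 1 i, dynkinLog j (π (inr₂ x)) (π (inr₂ y))) := by
    simp only [← map_dynkinLog, ← map_sum]
    exact comm _ _
  have hm1 := sum_dynkinLog_mem (n := i) hII mx my
  have hm2 := sum_dynkinLog_mem (n := i) hII mx' my'
  apply exp_injective (n := i)
  · exact pow_eq_zero_of_mem hI (sum_dynkinLog_mem hII (Submodule.add_mem _ mx mx')
      (Submodule.add_mem _ my my'))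
  · exact pow_eq_zero_of_mem hI (Submodule.add_mem _ hm1 hm2)
  rw [exp_sum_dynkinLog hI hII (Submodule.add_mem _ mx mx') (Submodule.add_mem _ my my'),
    IsNilpotent.exp_add_of_commute hc1 (nil hm1) (nil hm2), exp_sum_dynkinLog hI hII mx my,
    exp_sum_dynkinLog hI hII mx' my', IsNilpotent.exp_add_of_commute (comm _ _) (nil mx) (nil mx'),
    IsNilpotent.exp_add_of_commute (comm _ _) (nil my) (nil my')]
  have hc2 : Commute (IsNilpotent.exp (π (inr₂ x))) (IsNilpotent.exp (π (inl₂ y))) := by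
    rw [IsNilpotent.exp, IsNilpotent.exp]
    refine Commute.sum_left _ _ _ fun j _ => Commute.sum_right _ _ _ fun l _ => ?_
    exact ((((comm _ _).symm.pow_pow j l).smul_left _).smul_right _)
  rw [mul_assoc, ← mul_assoc (IsNilpotent.exp (π (inr₂ x))), hc2.eq]
  simp only [mul_assoc]

/-- A morphism for the brackets is compatible with the Baker-Campbell-Hausdorff terms. -/
theorem map_bchTerm {k : Type*} [Field k] {V W : Type*} [AddCommGroup V] [Module k V]
    [AddCommGroup W] [Module k W] (φ : V →ₗ[k] W) {br : V → V → V} {br' : W → W → W}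
    (h : ∀ x y, φ (br x y) = br' (φ x) (φ y)) (n : ℕ) (x y : V) :
    φ (bchTerm k br n x y) = bchTerm k br' n (φ x) (φ y) := by
  have hn : ∀ l : List V, φ (nested br l) = nested br' (l.map φ) := by
    intro l
    induction l with
    | nil => simp [nested]
    | cons a l ih =>
      cases l with
      | nil => simp [nested]
      | cons b l =>
        simp only [nested, List.map_cons, h] at ih ⊢
        rw [ih]
  simp only [bchTerm, map_smul, map_sum, hn, map_dynkinWord]

theorem bchTerm_eq_dynkinMap {V : Type*} [AddCommGroup V] [Module ℚ V] (br : V → V → V)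
    (v : α → V) (n : ℕ) (a b : α) :
    bchTerm ℚ br n (v a) (v b)
      = (n : ℚ)⁻¹ • dynkinMap br v (dynkinLog n (letter a) (letter b)) := by
  have h : ∀ l : List α, (l.map letter).prod = MonoidAlgebra.single (FreeMonoid.ofList l) 1 := by
    intro l
    induction l with
    | nil => rfl
    | cons a l ih =>
      rw [List.map_cons, List.prod_cons, ih, letter, MonoidAlgebra.single_mul_single, mul_one]
      rfl
  simp only [bchTerm, dynkinLog, map_sum, map_smul, ← map_dynkinWord, h]
  simp [dynkinMap, dynkinCoeff]

theorem bchTerm_ringComm {A : Type*} [Ring A] [Algebra ℚ A] {n : ℕ} (hn : 1 ≤ n) (a b : A) :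
    bchTerm ℚ ringComm n a b = dynkinLog n a b := by
  let φ : FreeAss Bool →ₐ[ℚ] A :=
    MonoidAlgebra.lift ℚ A (FreeMonoid Bool) (FreeMonoid.lift fun i => cond i a b)
  have ha : φ (letter true) = a := by simp [φ, letter]
  have hb : φ (letter false) = b := by simp [φ, letter]
  have h := map_bchTerm φ.toLinearMap (br := ringComm) (br' := ringComm)
    (fun x y => by simp [ringComm]) n (letter true) (letter false)
  simp only [AlgHom.toLinearMap_apply, ha, hb] at h
  rw [← h, bchTerm_eq_dynkinMap, dynkinMap_of_primitive (dynkinLog_mem_homog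
    (letter_mem_homog true) (letter_mem_homog false) n) (shuffleCop_dynkinLog true false n hn),
    smul_smul, inv_mul_cancel₀ (by positivity), one_smul, map_dynkinLog, ha, hb]

/-- The partial sum `∑_{1 ≤ i ≤ n} Bᵢ(x, y)` of the Baker-Campbell-Hausdorff series. -/
noncomputable def bchSum (k : Type*) [Field k] {V : Type*} [AddCommGroup V] [Module k V]
    (br : V → V → V) (n : ℕ) (x y : V) : V :=
  ∑ i ∈ Finset.Icc 1 n, bchTerm k br i x y

theorem map_bchSum {k : Type*} [Field k] {V W : Type*} [AddCommGroup V] [Module k V]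
    [AddCommGroup W] [Module k W] (φ : V →ₗ[k] W) {br : V → V → V} {br' : W → W → W}
    (h : ∀ x y, φ (br x y) = br' (φ x) (φ y)) (n : ℕ) (x y : V) :
    φ (bchSum k br n x y) = bchSum k br' n (φ x) (φ y) := by
  simp only [bchSum, map_sum, map_bchTerm φ h]

theorem bchSum_ringComm {A : Type*} [Ring A] [Algebra ℚ A] (n : ℕ) (a b : A) :
    bchSum ℚ ringComm n a b = ∑ i ∈ Finset.Icc 1 n, dynkinLog i a b :=
  Finset.sum_congr rfl fun _ hi => bchTerm_ringComm (Finset.mem_Icc.mp hi).1 a b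

theorem bchSum_ringComm_assoc {A : Type*} [Ring A] [Algebra ℚ A] {I : Submodule ℚ A} {n : ℕ}
    (hI : I ^ (n + 1) = ⊥) (hII : I * I ≤ I) {a b c : A} (ha : a ∈ I) (hb : b ∈ I) (hc : c ∈ I) :
    bchSum ℚ ringComm n (bchSum ℚ ringComm n a b) c
      = bchSum ℚ ringComm n a (bchSum ℚ ringComm n b c) := by
  simp only [bchSum_ringComm]
  have hab := sum_dynkinLog_mem (n := n) hII ha hb
  have hbc := sum_dynkinLog_mem (n := n) hII hb hc
  apply exp_injective (pow_eq_zero_of_mem hI (sum_dynkinLog_mem hII hab hc))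
    (pow_eq_zero_of_mem hI (sum_dynkinLog_mem hII ha hbc))
  simp only [exp_sum_dynkinLog hI hII, ha, hb, hc, hab, hbc, mul_assoc]

theorem bchSum_letter_assoc (n : ℕ) (a b c : α) :
    bchSum ℚ ringComm n (bchSum ℚ ringComm n (letter a) (letter b)) (letter c)
      - bchSum ℚ ringComm n (letter a) (bchSum ℚ ringComm n (letter b) (letter c))
      ∈ degGE (wordLen α) (n + 1) := by
  rw [← truncHom_eq_iff]
  have h : ∀ x y, truncHom (wordLen α) n (bchSum ℚ ringComm n x y)
      = bchSum ℚ ringComm n (truncHom (wordLen α) n x) (truncHom (wordLen α) n y) :=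
    map_bchSum (truncHom (wordLen α) n).toLinearMap (fun x y => by simp [ringComm]) n
  have hm : ∀ i : α, truncHom (wordLen α) n (letter i) ∈ truncAug (wordLen α) n := fun i =>
    truncHom_mem (homog_le_degGE 1 (letter_mem_homog i))
  simp only [h]
  exact bchSum_ringComm_assoc (truncAug_pow n) (truncAug_mul_le _ n) (hm a) (hm b) (hm c)

end BCHAssociative

/-! ### Associativity in arbitrary Lie algebras -/

section BCHTransfer

variable {α : Type*} {V : Type*} [LieRing V] [LieAlgebra ℚ V]

/-- The action of the free associative algebra on `V` for which the letters act by adjoint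
operators. -/
noncomputable def freeAd (v : α → V) : FreeAss α →ₐ[ℚ] Module.End ℚ V :=
  MonoidAlgebra.lift ℚ _ _ (FreeMonoid.lift fun a => LieAlgebra.ad ℚ V (v a))

theorem dynkinMap_mul (v : α → V) (t : FreeAss α) {q : ℕ} (hq : 1 ≤ q) {s : FreeAss α}
    (hs : s ∈ homog (wordLen α) q) :
    dynkinMap (fun x y => ⁅x, y⁆) v (t * s)
      = freeAd v t (dynkinMap (fun x y => ⁅x, y⁆) v s) := by
  induction hs using Submodule.span_induction with
  | mem x hx =>
    obtain ⟨w, hw, rfl⟩ := hx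
    have hw1 : w.length = q := by simpa using hw
    induction t using word_induction with
    | zero => simp
    | add t t' ht ht' => simp only [add_mul, map_add, ht, ht', LinearMap.add_apply]
    | word c u =>
      rw [smul_mul_assoc, map_smul, map_smul, LinearMap.smul_apply]
      congr 1
      rw [MonoidAlgebra.single_mul_single, mul_one]
      induction u using FreeMonoid.inductionOn' with
      | one => rw [one_mul, ← MonoidAlgebra.one_def, map_one]; rfl
      | of_mul a u ih =>
        have h1 : freeAd v (MonoidAlgebra.single (FreeMonoid.of a * u) 1)
            = (LieAlgebra.ad ℚ V (v a)) * freeAd v (MonoidAlgebra.single u 1) := by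
          rw [show (MonoidAlgebra.single (FreeMonoid.of a * u) 1 : FreeAss α)
            = letter a * MonoidAlgebra.single u 1 by
              rw [letter, MonoidAlgebra.single_mul_single, mul_one], map_mul]
          simp [freeAd, letter]
        rw [h1, Module.End.mul_apply, ← ih, mul_assoc]
        have h2 : (u * w).toList ≠ [] := by
          intro h
          have h3 : (u * w).length = 0 := by
            change (u * w).toList.length = 0
            rw [h]; rfl
          rw [FreeMonoid.length_mul] at h3
          omega
        generalize u * w = z at h2
        simp only [dynkinMap, wordMap_single, one_smul, FreeMonoid.toList_of_mul, List.map_cons,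
          LieAlgebra.ad_apply]
        cases h3 : z.toList with
        | nil => exact absurd h3 h2
        | cons b l => simp [nested]
  | zero => simp
  | add x y _ _ hx hy => simp only [mul_add, map_add, hx, hy]
  | smul a x _ hx => simp only [mul_smul_comm, map_smul, hx]

/-- The pairs `(t, x)` where `t` is homogeneous of degree `q` and behaves as a Lie polynomial in
the letters whose value in `V` is `x`. -/
noncomputable def liePairs (v : α → V) (q : ℕ) : Submodule ℚ (FreeAss α × V) where
  carrier := {p | p.1 ∈ homog (wordLen α) q ∧ freeAd v p.1 = LieAlgebra.ad ℚ V p.2 ∧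
    dynkinMap (fun x y => ⁅x, y⁆) v p.1 = (q : ℚ) • p.2}
  add_mem' := by
    rintro ⟨t, x⟩ ⟨t', x'⟩ ⟨h1, h2, h3⟩ ⟨h1', h2', h3'⟩
    dsimp only at *
    exact ⟨Submodule.add_mem _ h1 h1', by simp [h2, h2'], by simp [h3, h3']⟩
  zero_mem' := ⟨Submodule.zero_mem _, by simp, by simp⟩
  smul_mem' := by
    rintro c ⟨t, x⟩ ⟨h1, h2, h3⟩
    dsimp only at *
    exact ⟨Submodule.smul_mem _ _ h1, by simp [h2], by
      rw [Prod.smul_fst, Prod.smul_snd, map_smul, h3, smul_comm]⟩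

/-- The bracket of the product of the free associative algebra and `V`. -/
noncomputable def pairBr (p p' : FreeAss α × V) : FreeAss α × V := (ringComm p.1 p'.1, ⁅p.2, p'.2⁆)

theorem pairBr_mem_liePairs {v : α → V} {q q' : ℕ} (hq : 1 ≤ q) (hq' : 1 ≤ q')
    {p p' : FreeAss α × V} (h : p ∈ liePairs v q) (h' : p' ∈ liePairs v q') :
    pairBr p p' ∈ liePairs v (q + q') := by
  obtain ⟨t, x⟩ := p
  obtain ⟨t', x'⟩ := p'
  obtain ⟨h1, h2, h3⟩ := h
  obtain ⟨h1', h2', h3'⟩ := h'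
  dsimp only at *
  refine ⟨?_, ?_, ?_⟩
  · refine Submodule.sub_mem _ (homog_mul_le _ _ (Submodule.mul_mem_mul h1 h1')) ?_
    rw [add_comm q q']
    exact homog_mul_le _ _ (Submodule.mul_mem_mul h1' h1)
  · dsimp only [pairBr, ringComm]
    ext z
    simp only [map_sub, map_mul, h2, h2', LinearMap.sub_apply, Module.End.mul_apply,
      LieAlgebra.ad_apply, lie_lie]
  · dsimp only [pairBr, ringComm]
    rw [map_sub, dynkinMap_mul v t hq' h1', dynkinMap_mul v t' hq h1, h2, h2', h3, h3',
      LieAlgebra.ad_apply, LieAlgebra.ad_apply, lie_smul, lie_smul, ← lie_skew x x']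
    push_cast
    rw [add_smul]
    simp only [smul_neg]
    abel

/-- The span of the pairs in `liePairs`. -/
noncomputable def liePairSpan (v : α → V) : Submodule ℚ (FreeAss α × V) :=
  Submodule.span ℚ {p | ∃ q, 1 ≤ q ∧ p ∈ liePairs v q}

theorem pairBr_mem_liePairSpan {v : α → V} {p p' : FreeAss α × V} (h : p ∈ liePairSpan v)
    (h' : p' ∈ liePairSpan v) : pairBr p p' ∈ liePairSpan v := by
  induction h, h' using Submodule.span_induction₂ with
  | mem_mem x y hx hy =>
    obtain ⟨q, hq, hx⟩ := hx
    obtain ⟨q', hq', hy⟩ := hy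
    exact Submodule.subset_span ⟨q + q', by omega, pairBr_mem_liePairs hq hq' hx hy⟩
  | zero_left y hy =>
    have : pairBr (0 : FreeAss α × V) y = 0 := by simp [pairBr, ringComm]
    rw [this]; exact Submodule.zero_mem _
  | zero_right x hx =>
    have : pairBr x (0 : FreeAss α × V) = 0 := by simp [pairBr, ringComm]
    rw [this]; exact Submodule.zero_mem _
  | add_left x y z _ _ _ h1 h2 =>
    have : pairBr (x + y) z = pairBr x z + pairBr y z := by
      simp [pairBr, ringComm, add_mul, mul_add]; abel
    rw [this]; exact Submodule.add_mem _ h1 h2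
  | add_right x y z _ _ _ h1 h2 =>
    have : pairBr x (y + z) = pairBr x y + pairBr x z := by
      simp [pairBr, ringComm, add_mul, mul_add]; abel
    rw [this]; exact Submodule.add_mem _ h1 h2
  | smul_left r x y _ _ h1 =>
    have : pairBr (r • x) y = r • pairBr x y := by
      simp [pairBr, ringComm, smul_sub]
    rw [this]; exact Submodule.smul_mem _ _ h1
  | smul_right r x y _ _ h1 =>
    have : pairBr x (r • y) = r • pairBr x y := by
      simp [pairBr, ringComm, smul_sub]
    rw [this]; exact Submodule.smul_mem _ _ h1

theorem bchSum_mem {k : Type*} [Field k] {U : Type*} [AddCommGroup U] [Module k U]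
    {S : Submodule k U} {br : U → U → U} (hbr : ∀ x ∈ S, ∀ y ∈ S, br x y ∈ S) {x y : U}
    (hx : x ∈ S) (hy : y ∈ S) (n : ℕ) : bchSum k br n x y ∈ S := by
  refine Submodule.sum_mem _ fun i _ => Submodule.smul_mem _ _ (Submodule.sum_mem _ fun m _ =>
    Submodule.sum_mem _ fun p _ => Submodule.smul_mem _ _ ?_)
  have h2 : ∀ z ∈ dynkinWord p x y, z ∈ S := fun z hz => by
    rcases mem_dynkinWord hz with rfl | rfl
    exacts [hx, hy]
  generalize dynkinWord p x y = l at h2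
  induction l with
  | nil => exact Submodule.zero_mem _
  | cons c l ih =>
    cases l with
    | nil => exact h2 c (by simp)
    | cons d l => exact hbr _ (h2 c (by simp)) _ (ih fun z hz => h2 z (by simp [hz]))

/-- The map which sends a word of length `n` to the right-normed bracket of its letters, divided
by `n`. -/
noncomputable def dynkinIdem (v : α → V) : FreeAss α →ₗ[ℚ] V :=
  wordMap fun w => (w.length : ℚ)⁻¹ • nested (fun x y => ⁅x, y⁆) (w.toList.map v)

theorem dynkinIdem_of_mem_homog (v : α → V) {q : ℕ} {t : FreeAss α}
    (ht : t ∈ homog (wordLen α) q) :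
    dynkinIdem v t = (q : ℚ)⁻¹ • dynkinMap (fun x y => ⁅x, y⁆) v t := by
  induction ht using Submodule.span_induction with
  | mem x hx =>
    obtain ⟨w, hw, rfl⟩ := hx
    have hw1 : w.length = q := by simpa using hw
    simp [dynkinIdem, dynkinMap, hw1]
  | zero => simp
  | add x y _ _ hx hy => simp only [map_add, hx, hy, smul_add]
  | smul a x _ hx => rw [map_smul, map_smul, hx, smul_comm]

theorem dynkinIdem_of_mem {v : α → V} {p : FreeAss α × V} (h : p ∈ liePairSpan v) :
    dynkinIdem v p.1 = p.2 := by
  induction h using Submodule.span_induction with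
  | mem x hx =>
    obtain ⟨q, hq, h1, h2, h3⟩ := hx
    rw [dynkinIdem_of_mem_homog v h1, h3, smul_smul, inv_mul_cancel₀ (by positivity), one_smul]
  | zero => simp
  | add x y _ _ hx hy => simp only [Prod.fst_add, Prod.snd_add, map_add, hx, hy]
  | smul a x _ hx => rw [Prod.smul_fst, Prod.smul_snd, map_smul, hx]

theorem dynkinIdem_mem {W : Submodule ℚ V} {n : ℕ}
    (hW : ∀ l : List V, n ≤ l.length → nested (fun x y => ⁅x, y⁆) l ∈ W) (v : α → V)
    {t : FreeAss α} (ht : t ∈ degGE (wordLen α) n) : dynkinIdem v t ∈ W := by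
  induction ht using Submodule.span_induction with
  | mem x hx =>
    obtain ⟨w, hw, rfl⟩ := hx
    simp only [dynkinIdem, wordMap_single, one_smul]
    refine Submodule.smul_mem _ _ (hW _ ?_)
    rw [List.length_map]
    exact hw
  | zero => simp
  | add x y _ _ hx hy => rw [map_add]; exact Submodule.add_mem _ hx hy
  | smul a x _ hx => rw [map_smul]; exact Submodule.smul_mem _ _ hx

theorem letter_mem_liePairSpan (v : α → V) (a : α) : (letter a, v a) ∈ liePairSpan v := by
  refine Submodule.subset_span ⟨1, le_rfl, letter_mem_homog a, ?_, ?_⟩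
  · simp [freeAd, letter]
  · simp [dynkinMap, letter, nested]

theorem bchSum_pairBr_mem {v : α → V} {p q : FreeAss α × V} (hp : p ∈ liePairSpan v)
    (hq : q ∈ liePairSpan v) (n : ℕ) : bchSum ℚ pairBr n p q ∈ liePairSpan v :=
  bchSum_mem (fun _ hx _ hy => pairBr_mem_liePairSpan hx hy) hp hq n

theorem bchSum_pairBr (n : ℕ) (s t : FreeAss α) (x y : V) :
    bchSum ℚ pairBr n (s, x) (t, y)
      = (bchSum ℚ ringComm n s t, bchSum ℚ (fun x y => ⁅x, y⁆) n x y) :=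
  Prod.ext
    (map_bchSum (LinearMap.fst ℚ (FreeAss α) V) (br := pairBr) (br' := ringComm)
      (fun _ _ => rfl) n (s, x) (t, y))
    (map_bchSum (LinearMap.snd ℚ (FreeAss α) V) (br := pairBr) (br' := fun x y => ⁅x, y⁆)
      (fun _ _ => rfl) n (s, x) (t, y))

/-- The partial sums of the Baker-Campbell-Hausdorff series are associative up to brackets of
length greater than `n`. This holds for three letters of the free associative algebra, and is
transferred to `V` by `dynkinIdem`: on `liePairSpan` it maps the first component to the second. -/
theorem bchSum_assoc_rat {n : ℕ} {W : Submodule ℚ V}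
    (hW : ∀ l : List V, n + 1 ≤ l.length → nested (fun x y => ⁅x, y⁆) l ∈ W) (x y z : V) :
    bchSum ℚ (fun x y => ⁅x, y⁆) n (bchSum ℚ (fun x y => ⁅x, y⁆) n x y) z
      - bchSum ℚ (fun x y => ⁅x, y⁆) n x (bchSum ℚ (fun x y => ⁅x, y⁆) n y z) ∈ W := by
  have key : ∀ (v : Fin 3 → V),
      bchSum ℚ (fun x y => ⁅x, y⁆) n (bchSum ℚ (fun x y => ⁅x, y⁆) n (v 0) (v 1)) (v 2)
      - bchSum ℚ (fun x y => ⁅x, y⁆) n (v 0) (bchSum ℚ (fun x y => ⁅x, y⁆) n (v 1) (v 2)) ∈ W := by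
    intro v
    have h0 := letter_mem_liePairSpan v 0
    have h1 := letter_mem_liePairSpan v 1
    have h2 := letter_mem_liePairSpan v 2
    have h := dynkinIdem_of_mem (Submodule.sub_mem _
      (bchSum_pairBr_mem (bchSum_pairBr_mem h0 h1 n) h2 n)
      (bchSum_pairBr_mem h0 (bchSum_pairBr_mem h1 h2 n) n))
    rw [bchSum_pairBr, bchSum_pairBr, bchSum_pairBr, bchSum_pairBr, Prod.mk_sub_mk] at h
    dsimp only at h
    rw [← h]
    exact dynkinIdem_mem hW v (bchSum_letter_assoc n (0 : Fin 3) 1 2)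
  exact key ![x, y, z]

end BCHTransfer

/-! ### The Baker-Campbell-Hausdorff product of a complete filtered Lie algebra -/

section CompleteLie

variable (k : Type*) [Field k]

theorem bchSum_assoc [CharZero k] {V : Type*} [LieRing V] [LieAlgebra k V] {n : ℕ}
    {W : Submodule k V}
    (hW : ∀ l : List V, n + 1 ≤ l.length → nested (fun x y => ⁅x, y⁆) l ∈ W) (x y z : V) :
    bchSum k (fun x y => ⁅x, y⁆) n (bchSum k (fun x y => ⁅x, y⁆) n x y) z
      - bchSum k (fun x y => ⁅x, y⁆) n x (bchSum k (fun x y => ⁅x, y⁆) n y z) ∈ W := by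
  let _ : Module ℚ V := Module.compHom V (algebraMap ℚ k)
  have hs : ∀ (q : ℚ) (x : V), q • x = (q : k) • x := fun q x => by
    change (algebraMap ℚ k q) • x = _
    rw [eq_ratCast]
  let _ : LieAlgebra ℚ V := { lie_smul := fun q x y => by rw [hs, hs, lie_smul] }
  let W' : Submodule ℚ V :=
    { W.toAddSubmonoid with smul_mem' := fun q x hx => by rw [hs]; exact W.smul_mem _ hx }
  have hb : ∀ x y : V, bchSum k (fun x y => ⁅x, y⁆) n x y
      = bchSum ℚ (fun x y => ⁅x, y⁆) n x y := by
    intro x y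
    simp only [bchSum, bchTerm, hs]
    push_cast
    rfl
  simp only [hb]
  exact bchSum_assoc_rat (W := W') hW x y z

/-- A Lie algebra which is complete and separated for a filtration `W₁ ⊇ W₂ ⊇ ⋯` with
`[Wₐ, W_b] ⊆ W_{a+b}`, where `W₁` is the whole Lie algebra. -/
class CompleteLie (V : Type*) [LieRing V] [LieAlgebra k V] where
  W : ℕ → Submodule k V
  anti : Antitone W
  one : W 1 = ⊤
  lie_mem : ∀ {a b x y}, x ∈ W a → y ∈ W b → ⁅x, y⁆ ∈ W (a + b)
  sep : ∀ x, (∀ n, x ∈ W n) → x = 0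
  complete : ∀ s : ℕ → V, (∀ n, s (n + 1) - s n ∈ W n) → ∃ l, ∀ n, l - s n ∈ W n

variable {V : Type*} [LieRing V] [LieAlgebra k V] [CompleteLie k V]

open CompleteLie

/-- The `n`-th step of the filtration of a complete filtered Lie algebra. -/
abbrev filt (n : ℕ) : Submodule k V := W n

theorem mem_W_one (x : V) : x ∈ filt k 1 := by rw [filt, one]; trivial

theorem nested_mem_W (l : List V) : nested (fun x y => ⁅x, y⁆) l ∈ filt k l.length := by
  induction l with
  | nil => exact Submodule.zero_mem _
  | cons a l ih =>
    cases l with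
    | nil => exact mem_W_one k a
    | cons b l =>
      rw [List.length_cons, add_comm]
      exact lie_mem (mem_W_one k a) ih

theorem nested_sub_mem_W {M : ℕ} (l : List (V × V)) (h : ∀ p ∈ l, p.1 - p.2 ∈ filt k (M + 1)) :
    nested (fun x y => ⁅x, y⁆) (l.map Prod.fst) - nested (fun x y => ⁅x, y⁆) (l.map Prod.snd)
      ∈ filt k (M + l.length) := by
  induction l with
  | nil => simp [nested]
  | cons a l ih =>
    cases l with
    | nil => exact h a (by simp)
    | cons b l =>
      have ih' := ih fun p hp => h p (by simp [hp])
      have h1 := nested_mem_W k ((b :: l).map Prod.snd)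
      simp only [List.map_cons, nested] at ih' h1 ⊢
      set X := nested (fun x y => ⁅x, y⁆) (b.1 :: l.map Prod.fst)
      set Y := nested (fun x y => ⁅x, y⁆) (b.2 :: l.map Prod.snd)
      have h2 : ⁅a.1, X⁆ - ⁅a.2, Y⁆ = ⁅a.1, X - Y⁆ + ⁅a.1 - a.2, Y⁆ := by
        simp only [lie_sub, sub_lie]; abel
      rw [h2]
      refine Submodule.add_mem _ ?_ ?_
      · have := lie_mem (mem_W_one k a.1) ih'
        rwa [show 1 + (M + (b :: l).length) = M + (a :: b :: l).length by
          simp only [List.length_cons]; omega] at this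
      · have := lie_mem (h a (by simp)) h1
        rwa [show M + 1 + (b.2 :: l.map Prod.snd).length = M + (a :: b :: l).length by
          simp only [List.length_cons, List.length_map]; omega] at this

theorem bchTerm_mem_W (n : ℕ) (x y : V) : bchTerm k (fun x y => ⁅x, y⁆) n x y ∈ filt k n := by
  refine Submodule.smul_mem _ _ (Submodule.sum_mem _ fun m _ => Submodule.sum_mem _ fun p hp =>
    Submodule.smul_mem _ _ ?_)
  have := nested_mem_W k (dynkinWord p x y)
  rwa [length_dynkinWord hp] at this

theorem bchTerm_sub_mem_W (n : ℕ) {M : ℕ} {x x' y y' : V} (hx : x - x' ∈ filt k (M + 1))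
    (hy : y - y' ∈ filt k (M + 1)) :
    bchTerm k (fun x y => ⁅x, y⁆) n x y - bchTerm k (fun x y => ⁅x, y⁆) n x' y'
      ∈ filt k (M + n) := by
  simp only [bchTerm, ← smul_sub, ← Finset.sum_sub_distrib]
  refine Submodule.smul_mem _ _ (Submodule.sum_mem _ fun m _ => Submodule.sum_mem _ fun p hp =>
    Submodule.smul_mem _ _ ?_)
  have h := nested_sub_mem_W k (M := M) (dynkinWord p (x, x') (y, y')) (fun q hq => by
    rcases mem_dynkinWord hq with rfl | rfl
    exacts [hx, hy])
  rwa [map_dynkinWord, map_dynkinWord, length_dynkinWord hp] at h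

theorem exists_bch (x y : V) :
    ∃ z, ∀ n, z - bchSum k (fun x y => ⁅x, y⁆) n x y ∈ filt k (n + 1) := by
  obtain ⟨z, hz⟩ := complete (k := k) (fun n => bchSum k (fun x y => ⁅x, y⁆) n x y) fun n => by
    rw [bchSum, Finset.sum_Icc_succ_top (by omega), ← bchSum, add_sub_cancel_left]
    exact anti (Nat.le_succ n) (bchTerm_mem_W k (n + 1) x y)
  refine ⟨z, fun n => ?_⟩
  have h1 := hz (n + 1)
  rw [bchSum, Finset.sum_Icc_succ_top (by omega), ← bchSum] at h1
  have h2 := Submodule.add_mem _ h1 (bchTerm_mem_W k (n + 1) x y)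
  rwa [sub_add_eq_sub_sub, sub_add_cancel] at h2

/-- The sum `x ⋆ y` of the Baker-Campbell-Hausdorff series. -/
noncomputable def bch (x y : V) : V := (exists_bch k x y).choose

theorem bch_sub_bchSum (n : ℕ) (x y : V) :
    bch k x y - bchSum k (fun x y => ⁅x, y⁆) n x y ∈ filt k (n + 1) :=
  (exists_bch k x y).choose_spec n

variable {k}

theorem eq_of_sub_mem_W {x y : V} (h : ∀ n, x - y ∈ filt k (n + 1)) : x = y :=
  sub_eq_zero.mp (sep (k := k) _ fun n => anti (Nat.le_succ n) (h n))

theorem eq_bch {x y z : V}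
    (h : ∀ n, z - bchSum k (fun x y => ⁅x, y⁆) n x y ∈ filt k (n + 1)) : z = bch k x y := by
  apply eq_of_sub_mem_W (k := k)
  intro n
  have := Submodule.sub_mem _ (h n) (bch_sub_bchSum k n x y)
  rwa [sub_sub_sub_cancel_right] at this

theorem bchSum_sub_mem_W (n : ℕ) {M : ℕ} {x x' y y' : V} (hx : x - x' ∈ filt k (M + 1))
    (hy : y - y' ∈ filt k (M + 1)) :
    bchSum k (fun x y => ⁅x, y⁆) n x y - bchSum k (fun x y => ⁅x, y⁆) n x' y'
      ∈ filt k (M + 1) := by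
  simp only [bchSum, ← Finset.sum_sub_distrib]
  refine Submodule.sum_mem _ fun i hi => anti ?_ (bchTerm_sub_mem_W k i hx hy)
  have := (Finset.mem_Icc.mp hi).1
  omega

theorem bch_congr {M : ℕ} {x x' y y' : V} (hx : x - x' ∈ filt k (M + 1))
    (hy : y - y' ∈ filt k (M + 1)) : bch k x y - bch k x' y' ∈ filt k (M + 1) := by
  have h1 := bch_sub_bchSum k M x y
  have h2 := bch_sub_bchSum k M x' y'
  have h3 := bchSum_sub_mem_W M hx hy
  have := Submodule.sub_mem _ (Submodule.add_mem _ h1 h3) h2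
  convert this using 1
  abel

theorem bch_assoc [CharZero k] (x y z : V) :
    bch k (bch k x y) z = bch k x (bch k y z) := by
  apply eq_of_sub_mem_W (k := k)
  intro n
  have h0 : ∀ t : V, t - t ∈ filt k (n + 1) := fun t => by rw [sub_self]; exact Submodule.zero_mem _
  have h1 := bch_congr (bch_sub_bchSum k n x y) (h0 z)
  have h2 := bch_congr (h0 x) (bch_sub_bchSum k n y z)
  have h3 := bch_sub_bchSum k n (bchSum k (fun x y => ⁅x, y⁆) n x y) z
  have h4 := bch_sub_bchSum k n x (bchSum k (fun x y => ⁅x, y⁆) n y z)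
  have h5 := bchSum_assoc k (n := n) (W := filt k (n + 1))
    (fun l hl => anti hl (nested_mem_W k l)) x y z
  have := Submodule.sub_mem _ (Submodule.sub_mem _ (Submodule.add_mem _ (Submodule.add_mem _ h1 h3)
    h5) h4) h2
  convert this using 1
  abel

theorem dynkinIndex_one : dynkinIndex 1 1 = {![(1, 0)], ![(0, 1)]} := by decide

theorem bchSum_one {U : Type*} [AddCommGroup U] [Module k U] (br : U → U → U) (x y : U) :
    bchSum k br 1 x y = x + y := by
  have h : (![(1, 0)] : Fin 1 → Fin 2 × Fin 2) ≠ ![(0, 1)] := by decide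
  simp [bchSum, bchTerm, dynkinIndex_one, Finset.sum_pair h, dynkinWord, nested]

theorem bchTerm_eq_zero {n : ℕ} (hn : 2 ≤ n) {x y : V} (h : ⁅x, y⁆ = 0) :
    bchTerm k (fun x y => ⁅x, y⁆) n x y = 0 := by
  have h' : ⁅y, x⁆ = 0 := by rw [← lie_skew, h, neg_zero]
  rw [bchTerm, Finset.sum_eq_zero, smul_zero]
  refine fun m _ => Finset.sum_eq_zero fun p hp => ?_
  rw [show nested (fun x y => ⁅x, y⁆) (dynkinWord p x y) = 0 from ?_, smul_zero]
  have h1 := length_dynkinWord hp x y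
  have h2 : ∀ z ∈ dynkinWord p x y, z = x ∨ z = y := fun z hz => mem_dynkinWord hz
  rw [← h1] at hn
  clear h1
  generalize dynkinWord p x y = l at hn h2
  induction l with
  | nil => rfl
  | cons a l ih =>
    cases l with
    | nil => simp at hn
    | cons b l =>
      cases l with
      | nil =>
        have ha := h2 a (by simp)
        have hb := h2 b (by simp)
        rcases ha with rfl | rfl <;> rcases hb with rfl | rfl <;> simp [nested, h, h']
      | cons c l =>
        have := ih (by simp) fun z hz => h2 z (by simp [hz])
        rw [nested, this, lie_zero]

theorem bch_of_lie_eq_zero {x y : V} (h : ⁅x, y⁆ = 0) : bch k x y = x + y := by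
  symm
  apply eq_bch
  intro n
  rcases n with _ | n
  · exact mem_W_one k _
  · have h1 : bchSum k (fun x y => ⁅x, y⁆) (n + 1) x y = x + y := by
      rw [← bchSum_one (k := k) (fun x y => ⁅x, y⁆) x y]
      symm
      refine Finset.sum_subset (Finset.Icc_subset_Icc_right (by omega)) fun i hi hi' => ?_
      simp only [Finset.mem_Icc] at hi hi'
      exact bchTerm_eq_zero (by omega) h
    rw [h1, sub_self]
    exact Submodule.zero_mem _

theorem bch_comm {x y : V} (h : ⁅x, y⁆ = 0) : bch k x y = bch k y x := by
  rw [bch_of_lie_eq_zero h, bch_of_lie_eq_zero (by rw [← lie_skew, h, neg_zero]), add_comm]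

theorem bch_zero (x : V) : bch k x 0 = x := by
  rw [bch_of_lie_eq_zero (lie_zero x), add_zero]

theorem zero_bch (x : V) : bch k 0 x = x := by
  rw [bch_of_lie_eq_zero (zero_lie x), zero_add]

theorem bch_neg (x : V) : bch k x (-x) = 0 := by
  rw [bch_of_lie_eq_zero (by simp), add_neg_cancel]

theorem neg_bch (x : V) : bch k (-x) x = 0 := by
  rw [bch_of_lie_eq_zero (by simp), neg_add_cancel]

/-- `(x + ν) ⋆ y` is `x ⋆ y + ν` up to higher order terms. -/
theorem bch_perturb {M : ℕ} {x x' y y' ν μ : V} (hx : x - x' - ν ∈ filt k (M + 2))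
    (hy : y - y' - μ ∈ filt k (M + 2)) (hν : ν ∈ filt k (M + 1)) (hμ : μ ∈ filt k (M + 1)) :
    bch k x y - bch k x' y' - (ν + μ) ∈ filt k (M + 2) := by
  have hx1 : x - x' ∈ filt k (M + 1) := by
    have := Submodule.add_mem _ (anti (Nat.le_succ _) hx) hν
    rwa [sub_add_cancel] at this
  have hy1 : y - y' ∈ filt k (M + 1) := by
    have := Submodule.add_mem _ (anti (Nat.le_succ _) hy) hμ
    rwa [sub_add_cancel] at this
  have h1 := bch_sub_bchSum k (M + 1) x y
  have h2 := bch_sub_bchSum k (M + 1) x' y'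
  have h3 : bchSum k (fun x y => ⁅x, y⁆) (M + 1) x y - bchSum k (fun x y => ⁅x, y⁆) (M + 1) x' y'
      - (x + y - (x' + y')) ∈ filt k (M + 2) := by
    rw [← bchSum_one (k := k) (fun x y => ⁅x, y⁆) x y,
      ← bchSum_one (k := k) (fun x y => ⁅x, y⁆) x' y']
    have h4 : ∀ x y : V, bchSum k (fun x y => ⁅x, y⁆) (M + 1) x y
        = bchSum k (fun x y => ⁅x, y⁆) 1 x y
          + ∑ i ∈ Finset.Icc 2 (M + 1), bchTerm k (fun x y => ⁅x, y⁆) i x y := by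
      intro x y
      rw [bchSum, bchSum, Finset.Icc_self, Finset.sum_singleton,
        ← Finset.insert_Icc_add_one_left_eq_Icc (show 1 ≤ M + 1 by omega),
        Finset.sum_insert (by simp)]
      rfl
    rw [h4 x y, h4 x' y', show ∀ a b c d : V, a + b - (c + d) - (a - c) = b - d from
      fun a b c d => by abel, ← Finset.sum_sub_distrib]
    refine Submodule.sum_mem _ fun i hi => anti ?_ (bchTerm_sub_mem_W k i hx1 hy1)
    have := (Finset.mem_Icc.mp hi).1
    omega
  have := Submodule.add_mem _ (Submodule.add_mem _ (Submodule.sub_mem _ (Submodule.add_mem _ h1 h3)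
    h2) hx) hy
  convert this using 1
  abel

variable (k)

theorem dynkinIndex_one_two : dynkinIndex 1 2 = {![(2, 0)], ![(1, 1)], ![(0, 2)]} := by decide

theorem dynkinIndex_two_two : dynkinIndex 2 2 = {![(1, 0), (1, 0)], ![(1, 0), (0, 1)],
    ![(0, 1), (1, 0)], ![(0, 1), (0, 1)]} := by decide

theorem bchTerm_two [CharZero k] (x y : V) :
    bchTerm k (fun x y => ⁅x, y⁆) 2 x y = (2 : k)⁻¹ • ⁅x, y⁆ := by
  have h1 : (![(2, 0)] : Fin 1 → Fin 3 × Fin 3) ∉ ({![(1, 1)], ![(0, 2)]} : Finset _) := by decide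
  have h2 : (![(1, 1)] : Fin 1 → Fin 3 × Fin 3) ≠ ![(0, 2)] := by decide
  have h3 : (![(1, 0), (1, 0)] : Fin 2 → Fin 3 × Fin 3) ∉
    ({![(1, 0), (0, 1)], ![(0, 1), (1, 0)], ![(0, 1), (0, 1)]} : Finset _) := by decide
  have h4 : (![(1, 0), (0, 1)] : Fin 2 → Fin 3 × Fin 3) ∉
    ({![(0, 1), (1, 0)], ![(0, 1), (0, 1)]} : Finset _) := by decide
  have h5 : (![(0, 1), (1, 0)] : Fin 2 → Fin 3 × Fin 3) ≠ ![(0, 1), (0, 1)] := by decide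
  have h6 : Finset.Icc 1 2 = {1, 2} := rfl
  rw [bchTerm, h6, Finset.sum_pair (by decide), dynkinIndex_one_two, dynkinIndex_two_two,
    Finset.sum_insert h1, Finset.sum_pair h2, Finset.sum_insert h3, Finset.sum_insert h4,
    Finset.sum_pair h5]
  simp [dynkinWord, nested, Fin.prod_univ_two, List.replicate]
  rw [← lie_skew y x, smul_neg, smul_neg, add_neg_cancel]

/-- The Baker-Campbell-Hausdorff series to second order. -/
theorem bch_sub_mem_W_three [CharZero k] (x y : V) :
    bch k x y - (x + y + (2 : k)⁻¹ • ⁅x, y⁆) ∈ filt k 3 := by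
  have h := bch_sub_bchSum k 2 x y
  rwa [bchSum, Finset.sum_Icc_succ_top (by omega), ← bchSum, bchSum_one, bchTerm_two] at h

variable {k}

/-- A filtered morphism of Lie algebras respects the Baker-Campbell-Hausdorff product. -/
theorem map_bch {V' : Type*} [LieRing V'] [LieAlgebra k V'] [CompleteLie k V'] (φ : V →ₗ[k] V')
    (hbr : ∀ x y, φ ⁅x, y⁆ = ⁅φ x, φ y⁆) (hW : ∀ n, ∀ x ∈ filt k n, φ x ∈ filt k n) (x y : V) :
    φ (bch k x y) = bch k (φ x) (φ y) := by
  apply eq_bch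
  intro n
  rw [← map_bchSum φ (br := fun x y => ⁅x, y⁆) hbr, ← map_sub]
  exact hW _ _ (bch_sub_bchSum k n x y)

end CompleteLie

/-! ### A Lie algebra embeds into its enveloping algebra -/

section WordAction

variable {k : Type*} [Field k] {𝔥 : Type*} [LieRing 𝔥] [LieAlgebra k 𝔥] {I : Type*}
  [LinearOrder I] (b : Module.Basis I k 𝔥)

/-- The lower order terms of the action of the basis vector `a` on a sorted word, computed with
recursion depth at most `n`: `a` is moved to the right past the letters `c < a`, at the cost of the
brackets `[a, c]`. -/
noncomputable def wordCorr : ℕ → I → List I → (List I →₀ k)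
  | 0, _, _ => 0
  | _ + 1, _, [] => 0
  | n + 1, a, c :: w => if a ≤ c then 0 else
      Finsupp.linearCombination k
        (fun u => Finsupp.single (List.orderedInsert (· ≤ ·) c u) 1 + wordCorr n c u)
        (wordCorr n a w)
      + b.constr k (fun i => Finsupp.single (List.orderedInsert (· ≤ ·) i w) (1 : k)
          + wordCorr n i w) ⁅b a, b c⁆

/-- The action of a basis vector on words, with recursion depth `n`. -/
noncomputable def wordActDepth (n : ℕ) (a : I) : (List I →₀ k) →ₗ[k] (List I →₀ k) :=
  Finsupp.linearCombination k
    fun u => Finsupp.single (List.orderedInsert (· ≤ ·) a u) 1 + wordCorr b n a u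

/-- The action of a basis vector on words. -/
noncomputable def wordAct (a : I) : (List I →₀ k) →ₗ[k] (List I →₀ k) :=
  Finsupp.linearCombination k
    fun u => Finsupp.single (List.orderedInsert (· ≤ ·) a u) 1 + wordCorr b u.length a u

variable (k I) in
/-- The span of the sorted words of length at most `m`. -/
noncomputable def sortedSpan (m : ℕ) : Submodule k (List I →₀ k) :=
  Submodule.span k {v | ∃ w : List I, w.Pairwise (· ≤ ·) ∧ w.length ≤ m ∧ Finsupp.single w 1 = v}

theorem single_mem_sortedSpan {w : List I} (h : w.Pairwise (· ≤ ·)) {m : ℕ} (hm : w.length ≤ m) :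
    Finsupp.single w (1 : k) ∈ sortedSpan k I m :=
  Submodule.subset_span ⟨w, h, hm, rfl⟩

theorem sortedSpan_mono : Monotone (sortedSpan k I) := fun _ _ h =>
  Submodule.span_mono fun _ ⟨w, h1, h2, h3⟩ => ⟨w, h1, h2.trans h, h3⟩

theorem single_insert_mem {w : List I} (h : w.Pairwise (· ≤ ·)) (a : I) :
    Finsupp.single (List.orderedInsert (· ≤ ·) a w) (1 : k) ∈ sortedSpan k I (w.length + 1) :=
  single_mem_sortedSpan (h.orderedInsert a w) (by rw [List.orderedInsert_length])

theorem wordCorr_mem (n : ℕ) : ∀ (a : I) (w : List I), w.Pairwise (· ≤ ·) →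
    wordCorr b n a w ∈ sortedSpan k I w.length := by
  induction n with
  | zero => exact fun _ _ _ => Submodule.zero_mem _
  | succ n ih =>
    intro a w hw
    cases w with
    | nil => exact Submodule.zero_mem _
    | cons c w =>
      rw [wordCorr]
      split_ifs with h
      · exact Submodule.zero_mem _
      have hw' := hw.of_cons
      have h1 : ∀ i (u : List I), u.Pairwise (· ≤ ·) → u.length ≤ w.length →
          Finsupp.single (List.orderedInsert (· ≤ ·) i u) (1 : k) + wordCorr b n i u
            ∈ sortedSpan k I (w.length + 1) := fun i u hu hl =>
        Submodule.add_mem _ (sortedSpan_mono (by omega) (single_insert_mem hu i))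
          (sortedSpan_mono (by omega) (ih i u hu))
      refine Submodule.add_mem _ ?_ ?_
      · have h2 := ih a w hw'
        generalize wordCorr b n a w = v at h2 ⊢
        induction h2 using Submodule.span_induction with
        | mem v hv =>
          obtain ⟨u, hu, hl, rfl⟩ := hv
          rw [Finsupp.linearCombination_single, one_smul]
          exact h1 c u hu hl
        | zero => rw [map_zero]; exact Submodule.zero_mem _
        | add x y _ _ hx hy => rw [map_add]; exact Submodule.add_mem _ hx hy
        | smul r x _ hx => rw [map_smul]; exact Submodule.smul_mem _ _ hx
      · rw [Module.Basis.constr_apply]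
        exact Submodule.sum_mem _ fun i _ => Submodule.smul_mem _ _ (h1 i w hw' le_rfl)

theorem wordCorr_succ (n : ℕ) : ∀ (a : I) (w : List I), w.Pairwise (· ≤ ·) → w.length ≤ n →
    wordCorr b (n + 1) a w = wordCorr b n a w := by
  induction n with
  | zero =>
    intro a w _ h
    rw [List.length_eq_zero_iff.mp (Nat.le_zero.mp h)]
    rfl
  | succ n ih =>
    intro a w hw h
    cases w with
    | nil => rfl
    | cons c w =>
      have hw' := hw.of_cons
      have hl : w.length ≤ n := by simpa using h
      rw [wordCorr, wordCorr, ih a w hw' hl]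
      split_ifs with hac
      · rfl
      congr 1
      · have h2 := wordCorr_mem b n a w hw'
        generalize wordCorr b n a w = v at h2 ⊢
        induction h2 using Submodule.span_induction with
        | mem v hv =>
          obtain ⟨u, hu, hl', rfl⟩ := hv
          rw [Finsupp.linearCombination_single, Finsupp.linearCombination_single,
            ih c u hu (hl'.trans hl)]
        | zero => rw [map_zero, map_zero]
        | add x y _ _ hx hy => rw [map_add, map_add, hx, hy]
        | smul r x _ hx => rw [map_smul, map_smul, hx]
      · rw [Module.Basis.constr_apply, Module.Basis.constr_apply]
        exact Finsupp.sum_congr fun i _ => by rw [ih i w hw' hl]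

theorem wordCorr_eq {n : ℕ} (a : I) {w : List I} (hw : w.Pairwise (· ≤ ·)) (h : w.length ≤ n) :
    wordCorr b n a w = wordCorr b w.length a w := by
  induction n, h using Nat.le_induction with
  | base => rfl
  | succ n h ih => rw [wordCorr_succ b n a w hw h, ih]

theorem wordActDepth_eq {n : ℕ} (a : I) {v : List I →₀ k} (hv : v ∈ sortedSpan k I n) :
    wordActDepth b n a v = wordAct b a v := by
  induction hv using Submodule.span_induction with
  | mem v hv =>
    obtain ⟨u, hu, hl, rfl⟩ := hv
    rw [wordActDepth, wordAct, Finsupp.linearCombination_single, Finsupp.linearCombination_single,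
      wordCorr_eq b a hu hl]
  | zero => rw [map_zero, map_zero]
  | add x y _ _ hx hy => rw [map_add, map_add, hx, hy]
  | smul r x _ hx => rw [map_smul, map_smul, hx]

theorem wordAct_single (a : I) (w : List I) : wordAct b a (Finsupp.single w 1)
    = Finsupp.single (List.orderedInsert (· ≤ ·) a w) 1 + wordCorr b w.length a w := by
  rw [wordAct, Finsupp.linearCombination_single, one_smul]

theorem wordAct_mem {m : ℕ} (a : I) {v : List I →₀ k} (hv : v ∈ sortedSpan k I m) :
    wordAct b a v ∈ sortedSpan k I (m + 1) := by
  induction hv using Submodule.span_induction with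
  | mem v hv =>
    obtain ⟨u, hu, hl, rfl⟩ := hv
    rw [wordAct_single]
    exact Submodule.add_mem _ (sortedSpan_mono (by omega) (single_insert_mem hu a))
      (sortedSpan_mono (by omega) (wordCorr_mem b _ a u hu))
  | zero => rw [map_zero]; exact Submodule.zero_mem _
  | add x y _ _ hx hy => rw [map_add]; exact Submodule.add_mem _ hx hy
  | smul r x _ hx => rw [map_smul]; exact Submodule.smul_mem _ _ hx

/-- The action of the Lie algebra on words. -/
noncomputable def wordRep : 𝔥 →ₗ[k] Module.End k (List I →₀ k) := b.constr k (wordAct b)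

theorem wordRep_basis (a : I) : wordRep b (b a) = wordAct b a := b.constr_basis k _ a

theorem wordRep_mem {m : ℕ} (x : 𝔥) {v : List I →₀ k} (hv : v ∈ sortedSpan k I m) :
    wordRep b x v ∈ sortedSpan k I (m + 1) := by
  rw [wordRep, Module.Basis.constr_apply, Finsupp.sum, LinearMap.sum_apply]
  exact Submodule.sum_mem _ fun i _ => Submodule.smul_mem _ _ (wordAct_mem b i hv)

theorem wordAct_of_le {a : I} {w : List I} (h : (a :: w).Pairwise (· ≤ ·)) :
    wordAct b a (Finsupp.single w 1) = Finsupp.single (a :: w) 1 := by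
  rw [wordAct_single]
  cases w with
  | nil => simp [wordCorr]
  | cons c w =>
    have hac : a ≤ c := (List.pairwise_cons.mp h).1 c (by simp)
    rw [List.length_cons, wordCorr, if_pos hac, List.orderedInsert_cons_of_le _ _ hac, add_zero]

theorem wordAct_of_lt {a c : I} (hca : c < a) {w : List I} (h : (c :: w).Pairwise (· ≤ ·)) :
    wordAct b a (Finsupp.single (c :: w) 1) = wordAct b c (wordAct b a (Finsupp.single w 1))
      + wordRep b ⁅b a, b c⁆ (Finsupp.single w 1) := by
  have hw := h.of_cons
  have h1 : (c :: List.orderedInsert (· ≤ ·) a w).Pairwise (· ≤ ·) := by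
    refine List.pairwise_cons.mpr ⟨fun d hd => ?_, hw.orderedInsert a w⟩
    rcases (List.mem_orderedInsert (· ≤ ·)).mp hd with rfl | hd
    exacts [hca.le, (List.pairwise_cons.mp h).1 d hd]
  rw [wordAct_single, List.length_cons, wordCorr, if_neg (not_le.mpr hca),
    List.orderedInsert_of_not_le _ _ (not_le.mpr hca), wordAct_single b a w, map_add,
    wordAct_of_le b h1, ← wordActDepth_eq b c (wordCorr_mem b w.length a w hw), wordRep,
    Module.Basis.constr_apply, Module.Basis.constr_apply, add_assoc]
  congr 2
  rw [Finsupp.sum, Finsupp.sum, LinearMap.sum_apply]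
  exact Finset.sum_congr rfl fun i _ => by rw [LinearMap.smul_apply, wordAct_single]

/-- The relation of a representation, on a given vector. -/
def LieRel (v : List I →₀ k) : Prop :=
  ∀ x y : 𝔥, wordRep b x (wordRep b y v) - wordRep b y (wordRep b x v) = wordRep b ⁅x, y⁆ v

theorem lieRel_of_mem {n : ℕ} (H : ∀ w : List I, w.Pairwise (· ≤ ·) → w.length ≤ n →
    LieRel b (Finsupp.single w 1)) {v : List I →₀ k} (hv : v ∈ sortedSpan k I n) :
    LieRel b v := by
  induction hv using Submodule.span_induction with
  | mem v hv =>
    obtain ⟨u, hu, hl, rfl⟩ := hv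
    exact H u hu hl
  | zero => exact fun x y => by simp
  | add v v' _ _ h h' =>
    intro x y
    rw [map_add, map_add, map_add, map_add, map_add, ← h x y, ← h' x y]
    abel
  | smul r v _ h =>
    intro x y
    rw [map_smul, map_smul, map_smul, map_smul, map_smul, ← h x y, smul_sub]

theorem lieRel_of_basis {v : List I →₀ k} (H : ∀ a c : I, c < a →
    wordAct b a (wordAct b c v) - wordAct b c (wordAct b a v) = wordRep b ⁅b a, b c⁆ v) :
    LieRel b v := by
  have H' : ∀ a c : I,
      wordAct b a (wordAct b c v) - wordAct b c (wordAct b a v) = wordRep b ⁅b a, b c⁆ v := by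
    intro a c
    rcases lt_trichotomy a c with h | rfl | h
    · rw [← lie_skew, map_neg, LinearMap.neg_apply, ← H c a h, neg_sub]
    · rw [sub_self, lie_self, map_zero, LinearMap.zero_apply]
    · exact H a c h
  intro x y
  have hx := b.mem_span x
  have hy := b.mem_span y
  induction hx using Submodule.span_induction with
  | zero => simp
  | add x x' _ _ h h' =>
    rw [map_add, add_lie, map_add, LinearMap.add_apply, LinearMap.add_apply, LinearMap.add_apply,
      map_add, ← h, ← h']
    abel
  | smul r x _ h =>
    rw [map_smul, smul_lie, map_smul, LinearMap.smul_apply, LinearMap.smul_apply,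
      LinearMap.smul_apply, map_smul, ← h, smul_sub]
  | mem x hx =>
    obtain ⟨a, rfl⟩ := hx
    induction hy using Submodule.span_induction with
    | zero => simp
    | add x x' _ _ h h' =>
      rw [map_add, lie_add, map_add, LinearMap.add_apply, LinearMap.add_apply, LinearMap.add_apply,
        map_add, ← h, ← h']
      abel
    | smul r x _ h =>
      rw [map_smul, lie_smul, map_smul, LinearMap.smul_apply, LinearMap.smul_apply,
        LinearMap.smul_apply, map_smul, ← h, smul_sub]
    | mem y hy =>
      obtain ⟨c, rfl⟩ := hy
      rw [wordRep_basis, wordRep_basis, H']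

/-- The action on sorted words is a representation. If one of the two basis vectors precedes the
letters of the word, or is equal to the first letter, this is the definition of the action. The
remaining case is reduced to shorter words by the Jacobi identity. -/
theorem lieRel_single (n : ℕ) : ∀ w : List I, w.Pairwise (· ≤ ·) → w.length ≤ n →
    LieRel b (Finsupp.single w 1) := by
  have first : ∀ {a c : I} {w : List I}, c < a → (c :: w).Pairwise (· ≤ ·) →
      wordAct b a (wordAct b c (Finsupp.single w 1))
        - wordAct b c (wordAct b a (Finsupp.single w 1))
        = wordRep b ⁅b a, b c⁆ (Finsupp.single w 1) := fun hca hw => by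
    rw [wordAct_of_le b hw, wordAct_of_lt b hca hw, add_sub_cancel_left]
  induction n with
  | zero =>
    intro w _ h
    rw [List.length_eq_zero_iff.mp (Nat.le_zero.mp h)]
    exact lieRel_of_basis b fun a c hca => first hca (List.pairwise_singleton _ _)
  | succ n ih =>
    intro w hw hl
    have ihS := fun {v} (hv : v ∈ sortedSpan k I n) => lieRel_of_mem b ih hv
    refine lieRel_of_basis b fun a e hea => ?_
    cases w with
    | nil => exact first hea (List.pairwise_singleton _ _)
    | cons c w =>
      rcases le_or_gt e c with hec | hce
      · exact first hea (List.pairwise_cons.mpr ⟨fun d hd => by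
          rcases List.mem_cons.mp hd with rfl | hd
          exacts [hec, hec.trans ((List.pairwise_cons.mp hw).1 d hd)], hw⟩)
      have hw' := hw.of_cons
      have hl' : w.length ≤ n := by simpa using hl
      have hs := single_mem_sortedSpan (k := k) hw' hl'
      -- moving `x` past the smallest letter `c` and then `y` past `c`
      have key : ∀ x y : I, c < x → c < y →
          wordAct b x (wordAct b y (Finsupp.single (c :: w) 1))
            = wordAct b c (wordAct b x (wordAct b y (Finsupp.single w 1)))
              + wordRep b ⁅b x, b c⁆ (wordAct b y (Finsupp.single w 1))
              + wordRep b ⁅b y, b c⁆ (wordAct b x (Finsupp.single w 1))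
              + wordRep b ⁅b x, ⁅b y, b c⁆⁆ (Finsupp.single w 1) := by
        intro x y hx hy
        have h1 : wordAct b x (wordAct b c (wordAct b y (Finsupp.single w 1)))
            - wordAct b c (wordAct b x (wordAct b y (Finsupp.single w 1)))
            = wordRep b ⁅b x, b c⁆ (wordAct b y (Finsupp.single w 1)) := by
          have h2 : (c :: List.orderedInsert (· ≤ ·) y w).Pairwise (· ≤ ·) := by
            refine List.pairwise_cons.mpr ⟨fun d hd => ?_, hw'.orderedInsert y w⟩
            rcases (List.mem_orderedInsert (· ≤ ·)).mp hd with rfl | hd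
            exacts [hy.le, (List.pairwise_cons.mp hw).1 d hd]
          have h3 := first hx h2
          have h4 := ihS (sortedSpan_mono hl' (wordCorr_mem b w.length y w hw')) (b x) (b c)
          rw [wordRep_basis, wordRep_basis] at h4
          rw [wordAct_single b y w]
          simp only [map_add]
          rw [← h3, ← h4]
          abel
        have h5 := ihS hs (b x) ⁅b y, b c⁆
        rw [wordRep_basis] at h5
        rw [wordAct_of_lt b hy hw, map_add, ← h1, ← h5]
        abel
      have h6 := ihS hs ⁅b a, b e⁆ (b c)
      have h7 := ihS hs (b a) (b e)
      rw [wordRep_basis] at h6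
      rw [wordRep_basis, wordRep_basis] at h7
      rw [key a e (hce.trans hea) hce, key e a hce (hce.trans hea), ← wordAct_of_le b hw]
      rw [sub_eq_iff_eq_add] at h6
      rw [h6, ← h7, map_sub, lie_lie, map_sub, LinearMap.sub_apply]
      abel

theorem exists_isSorted_rep : ∃ (V : Submodule k (List I →₀ k)) (_ : Finsupp.single [] 1 ∈ V)
    (_ : ∀ x, ∀ v ∈ V, wordRep b x v ∈ V), ∀ v ∈ V, LieRel b v := by
  have hdir : Directed (· ≤ ·) (sortedSpan k I) := sortedSpan_mono.directed_le
  refine ⟨⨆ n, sortedSpan k I n, ?_, fun x v hv => ?_, fun v hv => ?_⟩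
  · exact Submodule.mem_iSup_of_mem 0 (single_mem_sortedSpan List.Pairwise.nil le_rfl)
  · obtain ⟨n, hn⟩ := (Submodule.mem_iSup_of_directed _ hdir).mp hv
    exact Submodule.mem_iSup_of_mem (n + 1) (wordRep_mem b x hn)
  · obtain ⟨n, hn⟩ := (Submodule.mem_iSup_of_directed _ hdir).mp hv
    exact lieRel_of_mem b (lieRel_single b n) hn

end WordAction

section Embedding

variable {k : Type*} [Field k] {𝔥 : Type*} [LieRing 𝔥] [LieAlgebra k 𝔥]

attribute [local instance] LieRing.ofAssociativeRing LieAlgebra.ofAssociativeAlgebra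

theorem ι_injective_of_rep {V : Type*} [AddCommGroup V] [Module k V]
    (R : 𝔥 →ₗ[k] Module.End k V) (hR : ∀ x y v, R x (R y v) - R y (R x v) = R ⁅x, y⁆ v)
    (hinj : Function.Injective R) :
    Function.Injective (UniversalEnvelopingAlgebra.ι k : 𝔥 →ₗ⁅k⁆ U k 𝔥) := by
  let R' : 𝔥 →ₗ⁅k⁆ Module.End k V :=
    { R with
      map_lie' := fun {x y} => by
        ext v
        exact (hR x y v).symm }
  intro x y hxy
  apply hinj
  have h := congrArg (UniversalEnvelopingAlgebra.lift k R') hxy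
  rwa [UniversalEnvelopingAlgebra.lift_ι_apply, UniversalEnvelopingAlgebra.lift_ι_apply] at h

/-- A weak form of the Poincaré-Birkhoff-Witt theorem. The Lie algebra acts on the span of the
sorted words, and a basis vector sends the empty word to the word with one letter. -/
theorem ι_injective [FiniteDimensional k 𝔥] :
    Function.Injective (UniversalEnvelopingAlgebra.ι k : 𝔥 →ₗ⁅k⁆ U k 𝔥) := by
  let b := Module.finBasis k 𝔥
  obtain ⟨V, h0, hV, hrel⟩ := exists_isSorted_rep b
  let R : 𝔥 →ₗ[k] Module.End k V :=
    { toFun := fun x => (wordRep b x).restrict (hV x)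
      map_add' := fun x y => LinearMap.ext fun v => Subtype.ext (by
        simp only [LinearMap.restrict_apply, LinearMap.add_apply, map_add, Submodule.coe_add])
      map_smul' := fun r x => LinearMap.ext fun v => Subtype.ext (by
        simp only [LinearMap.restrict_apply, LinearMap.smul_apply, map_smul, Submodule.coe_smul,
          RingHom.id_apply]) }
  refine ι_injective_of_rep R (fun x y v => Subtype.ext (hrel v.1 v.2 x y)) ?_
  rw [injective_iff_map_eq_zero]
  intro x h1
  have h2 : wordRep b x (Finsupp.single [] 1) = 0 :=
    congrArg Subtype.val (LinearMap.congr_fun h1 (⟨Finsupp.single [] 1, h0⟩ : V))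
  rw [wordRep, Module.Basis.constr_apply, Finsupp.sum, LinearMap.sum_apply] at h2
  apply b.repr.map_eq_zero_iff.mp
  ext i
  have h3 := DFunLike.congr_fun h2 [i]
  simp only [LinearMap.smul_apply, wordAct_of_le b (List.pairwise_singleton _ _),
    Finsupp.finsetSum_apply, Finsupp.smul_apply, Finsupp.single_apply, List.cons.injEq, and_true,
    smul_eq_mul, mul_ite, mul_one, mul_zero, Finset.sum_ite_eq', Finsupp.mem_support_iff] at h3
  by_contra h4
  exact h4 (by simpa [h4] using h3)

/-- The retraction plays the role of a symmetrization map: it extends linear forms on a Lie algebra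
to functions on the formal group. -/
theorem exists_ι_retraction [FiniteDimensional k 𝔥] :
    ∃ ρ : U k 𝔥 →ₗ[k] 𝔥, (∀ x, ρ (UniversalEnvelopingAlgebra.ι k x) = x) ∧ ρ 1 = 0 := by
  obtain ⟨σ, hσ⟩ := LinearMap.exists_leftInverse_of_injective
    (UniversalEnvelopingAlgebra.ι k : 𝔥 →ₗ⁅k⁆ U k 𝔥).toLinearMap
    (LinearMap.ker_eq_bot.mpr ι_injective)
  have hσ' : ∀ x, σ (UniversalEnvelopingAlgebra.ι k x) = x := LinearMap.congr_fun hσ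
  refine ⟨σ - (Coalgebra.counit (R := k) (A := U k 𝔥)).smulRight (σ 1), fun x => ?_, ?_⟩
  · have : Coalgebra.counit (R := k) (UniversalEnvelopingAlgebra.ι k x : U k 𝔥) = 0 :=
      counitU_ι k 𝔥 x
    rw [LinearMap.sub_apply, LinearMap.smulRight_apply, this, zero_smul, sub_zero, hσ']
  · rw [LinearMap.sub_apply, LinearMap.smulRight_apply, Bialgebra.counit_one, one_smul, sub_self]

end Embedding

/-! ### Poisson enveloping algebras -/

section CyclicSum

variable {k : Type*} [Field k] {V : Type*} [AddCommGroup V] [Module k V] {W : Type*}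
  [AddCommGroup W] [Module k W]

theorem cycSum_apply (t : (V ⊗[k] V) ⊗[k] V) :
    cycSum k t = t + cyc k V t + cyc k V (cyc k V t) := rfl

theorem comm_map (f : V →ₗ[k] W) (t : V ⊗[k] V) :
    TensorProduct.comm k W W (TensorProduct.map f f t)
      = TensorProduct.map f f (TensorProduct.comm k V V t) := by
  induction t with
  | zero => simp
  | add s t hs ht => simp only [map_add, hs, ht]
  | tmul a a' => rfl

theorem cyc_map (f : V →ₗ[k] W) (t : (V ⊗[k] V) ⊗[k] V) :
    cyc k W (TensorProduct.map (TensorProduct.map f f) f t)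
      = TensorProduct.map (TensorProduct.map f f) f (cyc k V t) := by
  have : cyc k W ∘ₗ TensorProduct.map (TensorProduct.map f f) f
      = TensorProduct.map (TensorProduct.map f f) f ∘ₗ cyc k V := by
    ext a b c
    rfl
  exact LinearMap.congr_fun this t

theorem cycSum_map (f : V →ₗ[k] W) (t : (V ⊗[k] V) ⊗[k] V) :
    cycSum k (TensorProduct.map (TensorProduct.map f f) f t)
      = TensorProduct.map (TensorProduct.map f f) f (cycSum k t) := by
  rw [cycSum_apply, cycSum_apply, cyc_map, cyc_map, map_add, map_add]

theorem rTensor_map {d : V →ₗ[k] V ⊗[k] V} {d' : W →ₗ[k] W ⊗[k] W} {f : V →ₗ[k] W}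
    (hf : ∀ a, d' (f a) = TensorProduct.map f f (d a)) (t : V ⊗[k] V) :
    d'.rTensor W (TensorProduct.map f f t)
      = TensorProduct.map (TensorProduct.map f f) f (d.rTensor V t) := by
  induction t with
  | zero => simp
  | add s t hs ht => simp only [map_add, hs, ht]
  | tmul a a' => simp [hf]

theorem comm_map_eq_neg (f : V →ₗ[k] W) {t : V ⊗[k] V} (h : TensorProduct.comm k V V t = -t) :
    TensorProduct.comm k W W (TensorProduct.map f f t) = -TensorProduct.map f f t := by
  rw [← map_neg, ← h, comm_map]

theorem cycSum_rTensor_eq_zero {d : V →ₗ[k] V ⊗[k] V} {d' : W →ₗ[k] W ⊗[k] W} {f : V →ₗ[k] W}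
    (hf : ∀ a, d' (f a) = TensorProduct.map f f (d a)) {x : V}
    (h : cycSum k (d.rTensor V (d x)) = 0) : cycSum k (d'.rTensor W (d' (f x))) = 0 := by
  rw [hf, rTensor_map hf, cycSum_map, h, map_zero]

end CyclicSum

section PoissonEnv

open Coalgebra

/-- A bialgebra `A` generated by a Lie algebra `P` of primitive elements, with a co-Poisson
structure `d` which is determined by a Lie cobracket on `P`. The examples are the tensor powers of
the enveloping algebra of a Lie bialgebra; the functions on `A` are then the functions on a formal
Poisson-Lie group, or on a power of it. -/
structure PoissonEnv (k : Type*) [Field k] (A : Type*) [Ring A] [Bialgebra k A] where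
  /-- the Lie algebra of primitive elements -/
  P : Submodule k A
  prim : ∀ x ∈ P, comul (R := k) x = x ⊗ₜ[k] (1 : A) + (1 : A) ⊗ₜ[k] x
  gen : Algebra.adjoin k (P : Set A) = ⊤
  lie_mem : ∀ x ∈ P, ∀ y ∈ P, x * y - y * x ∈ P
  /-- the co-Poisson structure -/
  d : A →ₗ[k] A ⊗[k] A
  d_mul : ∀ u v, d (u * v) = d u * comul v + comul u * d v
  d_mem : ∀ x ∈ P, d x ∈ Submodule.map₂ (TensorProduct.mk k A A) P P
  antisymm : ∀ x ∈ P, TensorProduct.comm k A A (d x) = -d x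
  coJacobi : ∀ x ∈ P, cycSum k (d.rTensor A (d x)) = 0

variable {k : Type*} [Field k] {A : Type*} [Ring A] [Bialgebra k A]

theorem cyc_tmul (a b c : A) : cyc k A ((a ⊗ₜ[k] b) ⊗ₜ[k] c) = (b ⊗ₜ[k] c) ⊗ₜ[k] a := rfl

theorem cyc_mul (s t : (A ⊗[k] A) ⊗[k] A) : cyc k A (s * t) = cyc k A s * cyc k A t := by
  have h : ∀ s : (A ⊗[k] A) ⊗[k] A, cyc k A s = Algebra.TensorProduct.comm k A (A ⊗[k] A)
    (Algebra.TensorProduct.assoc k k k A A A s) := fun _ => rfl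
  rw [h, h, h, map_mul, map_mul]

theorem cyc_cyc_cyc (t : (A ⊗[k] A) ⊗[k] A) : cyc k A (cyc k A (cyc k A t)) = t := by
  have : cyc k A ∘ₗ cyc k A ∘ₗ cyc k A = LinearMap.id := by
    ext a b c
    rfl
  exact LinearMap.congr_fun this t

theorem comul_rTensor_mul (s t : A ⊗[k] A) : (comul (R := k)).rTensor A (s * t)
    = (comul (R := k)).rTensor A s * (comul (R := k)).rTensor A t :=
  map_mul (Algebra.TensorProduct.map (Bialgebra.comulAlgHom k A) (AlgHom.id k A)) s t

@[elab_as_elim]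
theorem map₂_induction {V V' : Type*} [AddCommGroup V] [Module k V] [AddCommGroup V'] [Module k V']
    {P : Submodule k V} {Q : Submodule k V'}
    {p : (t : V ⊗[k] V') → t ∈ Submodule.map₂ (TensorProduct.mk k V V') P Q → Prop}
    (tmul : ∀ a b (ha : a ∈ P) (hb : b ∈ Q), p (a ⊗ₜ[k] b) (Submodule.apply_mem_map₂ _ ha hb))
    (zero : p 0 (Submodule.zero_mem _))
    (add : ∀ s t hs ht, p s hs → p t ht → p (s + t) (Submodule.add_mem _ hs ht))
    (smul : ∀ (r : k) t ht, p t ht → p (r • t) (Submodule.smul_mem _ r ht)) {t : V ⊗[k] V'}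
    (ht : t ∈ Submodule.map₂ (TensorProduct.mk k V V') P Q) : p t ht := by
  have h : ∃ h, p t h := by
    have ht' := ht
    rw [Submodule.map₂_eq_span_image2] at ht'
    induction ht' using Submodule.span_induction with
    | mem x hx =>
      obtain ⟨a, ha, b, hb, rfl⟩ := hx
      exact ⟨_, tmul a b ha hb⟩
    | zero => exact ⟨_, zero⟩
    | add x y hx hy h1 h2 =>
      rw [← Submodule.map₂_eq_span_image2] at hx hy
      obtain ⟨_, h1⟩ := h1 hx
      obtain ⟨_, h2⟩ := h2 hy
      exact ⟨_, add _ _ _ _ h1 h2⟩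
    | smul r x hx h1 =>
      rw [← Submodule.map₂_eq_span_image2] at hx
      obtain ⟨_, h1⟩ := h1 hx
      exact ⟨_, smul r _ _ h1⟩
  exact h.2

namespace PoissonEnv

variable (E : PoissonEnv k A)

theorem induction {p : A → Prop} (one : p 1) (prim : ∀ x ∈ E.P, p x)
    (mul : ∀ u v, p u → p v → p (u * v)) (add : ∀ u v, p u → p v → p (u + v))
    (smul : ∀ (r : k) u, p u → p (r • u)) (u : A) : p u := by
  have hu : u ∈ Algebra.adjoin k (E.P : Set A) := by rw [E.gen]; trivial
  induction hu using Algebra.adjoin_induction with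
  | mem x hx => exact prim x hx
  | algebraMap r => rw [Algebra.algebraMap_eq_smul_one]; exact smul r 1 one
  | add u v _ _ hu hv => exact add u v hu hv
  | mul u v _ _ hu hv => exact mul u v hu hv

theorem d_one : E.d 1 = 0 := by
  have h := E.d_mul 1 1
  rw [mul_one, Bialgebra.comul_one, mul_one, one_mul] at h
  exact left_eq_add.mp h

theorem comm_comul (E : PoissonEnv k A) (u : A) :
    TensorProduct.comm k A A (comul u) = comul (R := k) u := by
  have hmul : ∀ s t : A ⊗[k] A, TensorProduct.comm k A A (s * t)
      = TensorProduct.comm k A A s * TensorProduct.comm k A A t :=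
    fun s t => map_mul (Algebra.TensorProduct.comm k A A) s t
  induction u using E.induction with
  | one => rw [Bialgebra.comul_one]; rfl
  | prim x hx =>
    rw [E.prim x hx, map_add, TensorProduct.comm_tmul, TensorProduct.comm_tmul, add_comm]
  | mul u v hu hv => rw [Bialgebra.comul_mul, hmul, hu, hv]
  | add u v hu hv => rw [map_add, map_add, hu, hv]
  | smul r u hu => rw [map_smul, map_smul, hu]

theorem comm_d (u : A) : TensorProduct.comm k A A (E.d u) = -E.d u := by
  have hmul : ∀ s t : A ⊗[k] A, TensorProduct.comm k A A (s * t)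
      = TensorProduct.comm k A A s * TensorProduct.comm k A A t :=
    fun s t => map_mul (Algebra.TensorProduct.comm k A A) s t
  induction u using E.induction with
  | one => rw [E.d_one, map_zero, neg_zero]
  | prim x hx => exact E.antisymm x hx
  | mul u v hu hv =>
    rw [E.d_mul, map_add, hmul, hmul, hu, hv, E.comm_comul, E.comm_comul, neg_mul, mul_neg, neg_add]
  | add u v hu hv => rw [map_add, map_add, hu, hv, neg_add]
  | smul r u hu => rw [map_smul, map_smul, hu, smul_neg]

/-- The iterated coproduct. -/
noncomputable def comul₃ (u : A) : (A ⊗[k] A) ⊗[k] A := (comul (R := k)).rTensor A (comul u)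

theorem cyc_comul₃ (E : PoissonEnv k A) (u : A) : cyc k A (comul₃ u) = comul₃ (k := k) u := by
  unfold comul₃
  induction u using E.induction with
  | one =>
    rw [Bialgebra.comul_one, Algebra.TensorProduct.one_def, LinearMap.rTensor_tmul,
      Bialgebra.comul_one]; rfl
  | prim x hx =>
    rw [E.prim x hx, map_add, LinearMap.rTensor_tmul, LinearMap.rTensor_tmul,
      Bialgebra.comul_one, E.prim x hx, TensorProduct.add_tmul, Algebra.TensorProduct.one_def,
      map_add, map_add, cyc_tmul, cyc_tmul, cyc_tmul]
    abel
  | mul u v hu hv => rw [Bialgebra.comul_mul, comul_rTensor_mul, cyc_mul, hu, hv]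
  | add u v hu hv => rw [map_add, map_add, map_add, hu, hv]
  | smul r u hu => rw [map_smul, map_smul, map_smul, hu]

theorem d_rTensor_mul (s t : A ⊗[k] A) : E.d.rTensor A (s * t)
    = E.d.rTensor A s * (comul (R := k)).rTensor A t
      + (comul (R := k)).rTensor A s * E.d.rTensor A t := by
  induction s with
  | zero => simp
  | add a b ha hb => rw [add_mul, map_add, ha, hb, map_add, map_add, add_mul, add_mul]; abel
  | tmul a b =>
    induction t with
    | zero => simp
    | add a b ha hb => rw [mul_add, map_add, ha, hb, map_add, map_add, mul_add, mul_add]; abel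
    | tmul a' b' =>
      simp only [Algebra.TensorProduct.tmul_mul_tmul, LinearMap.rTensor_tmul, E.d_mul,
        TensorProduct.add_tmul]

/-- `D(u) = (d ⊗ id)(Δ u)`. -/
noncomputable def dcomul (u : A) : (A ⊗[k] A) ⊗[k] A := E.d.rTensor A (comul u)

theorem dcomul_mul (u v : A) :
    E.dcomul (u * v) = E.dcomul u * comul₃ v + comul₃ u * E.dcomul v := by
  rw [dcomul, Bialgebra.comul_mul, d_rTensor_mul]; rfl

/-- The co-Leibniz rule. -/
theorem comul_d (u : A) : (comul (R := k)).rTensor A (E.d u)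
    = cyc k A (cyc k A (E.dcomul u)) - cyc k A (E.dcomul u) := by
  induction u using E.induction with
  | one =>
    rw [E.d_one, dcomul, Bialgebra.comul_one, Algebra.TensorProduct.one_def,
      LinearMap.rTensor_tmul, E.d_one]
    simp
  | prim x hx =>
    have h1 : E.dcomul x = E.d x ⊗ₜ[k] (1 : A) := by
      rw [dcomul, E.prim x hx, map_add, LinearMap.rTensor_tmul, LinearMap.rTensor_tmul, E.d_one,
        TensorProduct.zero_tmul, add_zero]
    have h2 : ∀ t ∈ Submodule.map₂ (TensorProduct.mk k A A) E.P E.P,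
        (comul (R := k)).rTensor A t = cyc k A (cyc k A (t ⊗ₜ[k] (1 : A)))
          + cyc k A (TensorProduct.comm k A A t ⊗ₜ[k] (1 : A)) := by
      intro t ht
      induction ht using map₂_induction with
      | tmul a b ha hb =>
        rw [LinearMap.rTensor_tmul, E.prim a ha, TensorProduct.comm_tmul, cyc_tmul, cyc_tmul,
          cyc_tmul, TensorProduct.add_tmul, add_comm]
      | zero => simp
      | add s t _ _ hs ht =>
        rw [map_add, hs, ht]
        simp only [map_add, TensorProduct.add_tmul]
        abel
      | smul r t _ ht =>
        rw [map_smul, ht]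
        simp only [map_smul, ← TensorProduct.smul_tmul', smul_add]
    rw [h2 _ (E.d_mem x hx), E.antisymm x hx, h1, TensorProduct.neg_tmul, map_neg, sub_eq_add_neg]
  | mul u v hu hv =>
    rw [E.d_mul, map_add, comul_rTensor_mul, comul_rTensor_mul, hu, hv, E.dcomul_mul]
    change _ * comul₃ v + comul₃ u * _ = _
    simp only [map_add, cyc_mul, E.cyc_comul₃]
    simp only [sub_mul, mul_sub]
    abel
  | add u v hu hv =>
    simp only [map_add, hu, hv, dcomul]
    abel
  | smul r u hu => simp only [map_smul, hu, dcomul, smul_sub]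

theorem coJacobi' (u : A) : cycSum k (E.d.rTensor A (E.d u)) = 0 := by
  induction u using E.induction with
  | one => simp [E.d_one]
  | prim x hx => exact E.coJacobi x hx
  | add u v hu hv => simp only [map_add, hu, hv, add_zero]
  | smul r u hu => simp only [map_smul, hu, smul_zero]
  | mul u v hu hv =>
    have h1 : E.d.rTensor A (E.d (u * v)) = E.d.rTensor A (E.d u) * comul₃ v
        + (cyc k A (cyc k A (E.dcomul u)) - cyc k A (E.dcomul u)) * E.dcomul v
        + (E.dcomul u * (cyc k A (cyc k A (E.dcomul v)) - cyc k A (E.dcomul v))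
        + comul₃ u * E.d.rTensor A (E.d v)) := by
      rw [E.d_mul, map_add, d_rTensor_mul, d_rTensor_mul, E.comul_d, E.comul_d]
      rfl
    have h2 : cycSum k (E.d.rTensor A (E.d u)) * comul₃ v = 0 := by rw [hu, zero_mul]
    have h3 : comul₃ u * cycSum k (E.d.rTensor A (E.d v)) = 0 := by rw [hv, mul_zero]
    rw [h1]
    simp only [cycSum_apply, map_add, map_sub, cyc_mul, E.cyc_comul₃, cyc_cyc_cyc, add_mul,
      mul_add, sub_mul, mul_sub] at h2 h3 ⊢
    refine Eq.trans ?_ ((congrArg₂ HAdd.hAdd h2 h3).trans (add_zero 0))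
    abel

end PoissonEnv

end PoissonEnv

/-! ### The complete Lie algebra of functions that vanish to order two -/

section Filtration

open Coalgebra

variable {k : Type*} [Field k] {A : Type*} [Ring A] [Bialgebra k A] {B : Type*} [Ring B]
  [Bialgebra k B]

/-- The external product `φ ⊠ ψ` of two functions. -/
noncomputable def extProd {V V' : Type*} [AddCommGroup V] [Module k V] [AddCommGroup V']
    [Module k V'] (φ : V →ₗ[k] k) (ψ : V' →ₗ[k] k) : V ⊗[k] V' →ₗ[k] k :=
  LinearMap.mul' k k ∘ₗ TensorProduct.map φ ψ

@[simp] theorem extProd_tmul {V V' : Type*} [AddCommGroup V] [Module k V] [AddCommGroup V']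
    [Module k V'] (φ : V →ₗ[k] k) (ψ : V' →ₗ[k] k) (a : V) (b : V') :
    extProd φ ψ (a ⊗ₜ[k] b) = φ a * ψ b := by
  simp [extProd]

theorem extProd_comp {V V' W W' : Type*} [AddCommGroup V] [Module k V] [AddCommGroup V']
    [Module k V'] [AddCommGroup W] [Module k W] [AddCommGroup W'] [Module k W']
    (φ : V →ₗ[k] k) (ψ : V' →ₗ[k] k) (g : W →ₗ[k] V) (h : W' →ₗ[k] V') (t : W ⊗[k] W') :
    extProd φ ψ (TensorProduct.map g h t) = extProd (φ ∘ₗ g) (ψ ∘ₗ h) t := by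
  have : extProd φ ψ ∘ₗ TensorProduct.map g h = extProd (φ ∘ₗ g) (ψ ∘ₗ h) := by
    ext a b
    simp
  exact LinearMap.congr_fun this t

namespace PoissonEnv

variable (E : PoissonEnv k A) (E' : PoissonEnv k B)

/-- The Poisson bracket of two functions. -/
noncomputable def pb (φ ψ : A →ₗ[k] k) : A →ₗ[k] k := extProd φ ψ ∘ₗ E.d

theorem pb_apply (φ ψ : A →ₗ[k] k) (u : A) : E.pb φ ψ u = extProd φ ψ (E.d u) := rfl

theorem pb_add_left (φ φ' ψ : A →ₗ[k] k) : E.pb (φ + φ') ψ = E.pb φ ψ + E.pb φ' ψ := by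
  have h : extProd (φ + φ') ψ = extProd φ ψ + extProd φ' ψ := by
    ext a b; simp [add_mul]
  rw [pb, h, LinearMap.add_comp]; rfl

theorem pb_smul_left (r : k) (φ ψ : A →ₗ[k] k) : E.pb (r • φ) ψ = r • E.pb φ ψ := by
  have h : extProd (r • φ) ψ = r • extProd φ ψ := by
    ext a b; simp [mul_assoc]
  rw [pb, h, LinearMap.smul_comp]; rfl

theorem pb_skew (φ ψ : A →ₗ[k] k) : E.pb ψ φ = -E.pb φ ψ := by
  have h : ∀ t : A ⊗[k] A, extProd ψ φ t = extProd φ ψ (TensorProduct.comm k A A t) := by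
    have : extProd ψ φ = extProd φ ψ ∘ₗ (TensorProduct.comm k A A).toLinearMap := by
      ext a b; simp [mul_comm]
    exact fun t => LinearMap.congr_fun this t
  ext u
  rw [pb_apply, h, E.comm_d, map_neg]; rfl

theorem pb_add_right (φ ψ ψ' : A →ₗ[k] k) : E.pb φ (ψ + ψ') = E.pb φ ψ + E.pb φ ψ' := by
  rw [E.pb_skew (ψ + ψ'), pb_add_left, neg_add, ← E.pb_skew, ← E.pb_skew]

theorem pb_smul_right (r : k) (φ ψ : A →ₗ[k] k) : E.pb φ (r • ψ) = r • E.pb φ ψ := by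
  rw [E.pb_skew (r • ψ), pb_smul_left, E.pb_skew φ ψ, smul_neg, neg_neg]

theorem pb_neg_right (φ ψ : A →ₗ[k] k) : E.pb φ (-ψ) = -E.pb φ ψ := by
  rw [← neg_one_smul k ψ, pb_smul_right]
  exact neg_one_smul k (E.pb φ ψ)

theorem pb_pb (φ ψ χ : A →ₗ[k] k) (u : A) :
    E.pb (E.pb φ ψ) χ u = extProd (extProd φ ψ) χ (E.d.rTensor A (E.d u)) := by
  have : extProd (E.pb φ ψ) χ = extProd (extProd φ ψ) χ ∘ₗ E.d.rTensor A := by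
    ext a b
    simp [pb_apply]
  rw [pb_apply, this]; rfl

theorem pb_jacobi (φ ψ χ : A →ₗ[k] k) :
    E.pb (E.pb φ ψ) χ + E.pb (E.pb χ φ) ψ + E.pb (E.pb ψ χ) φ = 0 := by
  have h : ∀ (φ ψ χ : A →ₗ[k] k) t, extProd (extProd φ ψ) χ (cyc k A t)
      = extProd (extProd χ φ) ψ t := by
    intro φ ψ χ t
    have : extProd (extProd φ ψ) χ ∘ₗ cyc k A = extProd (extProd χ φ) ψ := by
      ext a b c
      simp [cyc]
      ring
    exact LinearMap.congr_fun this t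
  ext u
  have h1 := congrArg (extProd (extProd φ ψ) χ) (E.coJacobi' u)
  rw [cycSum_apply, map_add, map_add, h, h, h, map_zero] at h1
  rw [LinearMap.add_apply, LinearMap.add_apply, pb_pb, pb_pb, pb_pb, h1]; rfl

/-- The filtration of `A` by the number of factors in products of primitive elements. -/
noncomputable def C (n : ℕ) : Submodule k A := (1 ⊔ E.P) ^ n

theorem C_mono : Monotone E.C := by
  refine monotone_nat_of_le_succ fun n => ?_
  rw [C, C, pow_succ]
  exact (mul_one _).symm.le.trans (mul_le_mul' le_rfl le_sup_left)

theorem one_mem_C (n : ℕ) : (1 : A) ∈ E.C n :=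
  E.C_mono (Nat.zero_le n) (by rw [C, pow_zero]; exact Submodule.one_le.mp le_rfl)

theorem mul_mem_C {m n : ℕ} {u v : A} (hu : u ∈ E.C m) (hv : v ∈ E.C n) : u * v ∈ E.C (m + n) := by
  rw [C, pow_add]; exact Submodule.mul_mem_mul hu hv

theorem mem_C_one {x : A} (hx : x ∈ E.P) : x ∈ E.C 1 := by
  rw [C, pow_one]; exact Submodule.mem_sup_right hx

theorem pow_mem_C {x : A} (hx : x ∈ E.P) (n : ℕ) : x ^ n ∈ E.C n :=
  Submodule.pow_mem_pow _ (Submodule.mem_sup_right hx) n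

theorem exists_mem_C (u : A) : ∃ n, u ∈ E.C n := by
  induction u using E.induction with
  | one => exact ⟨0, E.one_mem_C 0⟩
  | prim x hx => exact ⟨1, E.mem_C_one hx⟩
  | mul u v hu hv =>
    obtain ⟨m, hm⟩ := hu
    obtain ⟨n, hn⟩ := hv
    exact ⟨m + n, E.mul_mem_C hm hn⟩
  | add u v hu hv =>
    obtain ⟨m, hm⟩ := hu
    obtain ⟨n, hn⟩ := hv
    exact ⟨m + n, Submodule.add_mem _ (E.C_mono (by omega) hm) (E.C_mono (by omega) hn)⟩
  | smul r u hu =>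
    obtain ⟨m, hm⟩ := hu
    exact ⟨m, Submodule.smul_mem _ r hm⟩

theorem C_le {G : ℕ → Submodule k A} (one : 1 ∈ G 0) (succ : ∀ n, ∀ u ∈ G n, u ∈ G (n + 1))
    (mul : ∀ n, ∀ u ∈ E.C n, u ∈ G n → ∀ x ∈ E.P, u * x ∈ G (n + 1)) (n : ℕ) : E.C n ≤ G n := by
  induction n with
  | zero =>
    intro u hu
    rw [C, pow_zero] at hu
    obtain ⟨r, rfl⟩ := Submodule.mem_one.mp hu
    rw [Algebra.algebraMap_eq_smul_one]
    exact Submodule.smul_mem _ r one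
  | succ n ih =>
    rw [C, pow_succ, Submodule.mul_le]
    intro u hu v hv
    obtain ⟨c, hc, x, hx, rfl⟩ := Submodule.mem_sup.mp hv
    obtain ⟨r, rfl⟩ := Submodule.mem_one.mp hc
    rw [mul_add, Algebra.algebraMap_eq_smul_one, mul_smul_comm, mul_one]
    exact Submodule.add_mem _ (Submodule.smul_mem _ r (succ n u (ih hu))) (mul n u hu (ih hu) x hx)

/-- The filtration of `A ⊗ B` induced by those of `A` and `B`. -/
def tensorFilt (n : ℕ) : Submodule k (A ⊗[k] B) :=
  Submodule.span k {t | ∃ i j a b, i + j ≤ n ∧ a ∈ E.C i ∧ b ∈ E'.C j ∧ a ⊗ₜ[k] b = t}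

variable {E E'}

theorem tmul_mem_tensorFilt {i j n : ℕ} (h : i + j ≤ n) {a : A} {b : B} (ha : a ∈ E.C i)
    (hb : b ∈ E'.C j) : a ⊗ₜ[k] b ∈ E.tensorFilt E' n :=
  Submodule.subset_span ⟨i, j, a, b, h, ha, hb, rfl⟩

theorem tensorFilt_mono : Monotone (E.tensorFilt E') := fun _ _ h =>
  Submodule.span_mono fun _ ⟨i, j, a, b, h1, h2⟩ => ⟨i, j, a, b, h1.trans h, h2⟩

theorem mul_mem_tensorFilt {m n : ℕ} {s t : A ⊗[k] B} (hs : s ∈ E.tensorFilt E' m)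
    (ht : t ∈ E.tensorFilt E' n) : s * t ∈ E.tensorFilt E' (m + n) := by
  have h : E.tensorFilt E' m * E.tensorFilt E' n ≤ E.tensorFilt E' (m + n) := by
    rw [tensorFilt, tensorFilt, Submodule.span_mul_span, Submodule.span_le]
    rintro _ ⟨_, ⟨i, j, a, b, h, ha, hb, rfl⟩, _, ⟨i', j', a', b', h', ha', hb', rfl⟩, rfl⟩
    dsimp only
    rw [Algebra.TensorProduct.tmul_mul_tmul]
    exact tmul_mem_tensorFilt (i := i + i') (j := j + j') (by omega) (E.mul_mem_C ha ha')
      (E'.mul_mem_C hb hb')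
  exact h (Submodule.mul_mem_mul hs ht)

theorem map₂_le_tensorFilt :
    Submodule.map₂ (TensorProduct.mk k A B) E.P E'.P ≤ E.tensorFilt E' 2 :=
  Submodule.map₂_le.mpr fun _ ha _ hb =>
    tmul_mem_tensorFilt (by omega) (E.mem_C_one ha) (E'.mem_C_one hb)

variable (E)

theorem comul_mem (n : ℕ) : ∀ u ∈ E.C n, comul u ∈ E.tensorFilt E n := by
  refine E.C_le (G := fun n => (E.tensorFilt E n).comap (comul (R := k))) ?_ ?_ ?_ n
  · rw [Submodule.mem_comap, Bialgebra.comul_one, Algebra.TensorProduct.one_def]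
    exact tmul_mem_tensorFilt (i := 0) (j := 0) (by omega) (E.one_mem_C 0) (E.one_mem_C 0)
  · exact fun n u hu => tensorFilt_mono (Nat.le_succ n) hu
  · intro n u _ hu x hx
    rw [Submodule.mem_comap, Bialgebra.comul_mul, E.prim x hx]
    exact mul_mem_tensorFilt hu (Submodule.add_mem _
      (tmul_mem_tensorFilt (i := 1) (j := 0) (by omega) (E.mem_C_one hx) (E.one_mem_C 0))
      (tmul_mem_tensorFilt (i := 0) (j := 1) (by omega) (E.one_mem_C 0) (E.mem_C_one hx)))

theorem d_mem_tensorFilt (n : ℕ) : ∀ u ∈ E.C n, E.d u ∈ E.tensorFilt E (n + 1) := by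
  refine E.C_le (G := fun n => (E.tensorFilt E (n + 1)).comap E.d) ?_ ?_ ?_ n
  · rw [Submodule.mem_comap, E.d_one]
    exact Submodule.zero_mem _
  · exact fun n u hu => tensorFilt_mono (Nat.le_succ _) hu
  · intro n u hu' hu x hx
    rw [Submodule.mem_comap, E.d_mul]
    refine Submodule.add_mem _ ?_ ?_
    · exact mul_mem_tensorFilt hu (E.comul_mem 1 x (E.mem_C_one hx))
    · have := mul_mem_tensorFilt (E.comul_mem n u hu') (map₂_le_tensorFilt (E.d_mem x hx))
      rwa [show n + 2 = n + 1 + 1 from rfl] at this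

/-- The functions that vanish to order `n` at the unit. -/
def F (n : ℕ) : Submodule k (A →ₗ[k] k) where
  carrier := {φ | ∀ m < n, ∀ u ∈ E.C m, φ u = 0}
  add_mem' {φ ψ} hφ hψ m hm u hu := by
    rw [LinearMap.add_apply, hφ m hm u hu, hψ m hm u hu, add_zero]
  zero_mem' _ _ _ _ := rfl
  smul_mem' r φ hφ m hm u hu := by rw [LinearMap.smul_apply, hφ m hm u hu, smul_zero]

variable {E}

theorem mem_F {n : ℕ} {φ : A →ₗ[k] k} : φ ∈ E.F n ↔ ∀ m < n, ∀ u ∈ E.C m, φ u = 0 := Iff.rfl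

theorem mem_F_succ {n : ℕ} {φ : A →ₗ[k] k} : φ ∈ E.F (n + 1) ↔ ∀ u ∈ E.C n, φ u = 0 :=
  ⟨fun h u hu => h n (Nat.lt_succ_self n) u hu,
    fun h _ hm u hu => h u (E.C_mono (Nat.le_of_lt_succ hm) hu)⟩

theorem F_anti : Antitone E.F := fun _ _ h _ hφ _ hm => hφ _ (lt_of_lt_of_le hm h)

theorem mem_F_two {φ : A →ₗ[k] k} : φ ∈ E.F 2 ↔ φ 1 = 0 ∧ ∀ x ∈ E.P, φ x = 0 := by
  rw [mem_F_succ, C, pow_one]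
  refine ⟨fun h => ⟨h 1 (Submodule.mem_sup_left (Submodule.one_le.mp le_rfl)),
    fun x hx => h x (Submodule.mem_sup_right hx)⟩, fun h u hu => ?_⟩
  obtain ⟨c, hc, x, hx, rfl⟩ := Submodule.mem_sup.mp hu
  obtain ⟨r, rfl⟩ := Submodule.mem_one.mp hc
  rw [map_add, h.2 x hx, Algebra.algebraMap_eq_smul_one, map_smul, h.1, smul_zero, add_zero]

theorem extProd_eq_zero {a b n : ℕ} (h : n < a + b) {φ : A →ₗ[k] k} {ψ : B →ₗ[k] k}
    (hφ : φ ∈ E.F a) (hψ : ψ ∈ E'.F b) {t : A ⊗[k] B} (ht : t ∈ E.tensorFilt E' n) :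
    extProd φ ψ t = 0 := by
  induction ht using Submodule.span_induction with
  | mem x hx =>
    obtain ⟨i, j, x, y, hij, hx, hy, rfl⟩ := hx
    rw [extProd_tmul]
    rcases lt_or_ge i a with hi | hi
    · rw [hφ i hi x hx, zero_mul]
    · rw [hψ j (by omega) y hy, mul_zero]
  | zero => exact map_zero _
  | add x y _ _ hx hy => rw [map_add, hx, hy, add_zero]
  | smul r x _ hx => rw [map_smul, hx, smul_zero]

/-- The Poisson structure vanishes at the unit, so that the bracket lowers the sum of the orders of
vanishing by one only. -/
theorem pb_mem {a b n : ℕ} (h : n + 1 ≤ a + b) {φ ψ : A →ₗ[k] k} (hφ : φ ∈ E.F a)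
    (hψ : ψ ∈ E.F b) : E.pb φ ψ ∈ E.F n := fun m hm u hu =>
  extProd_eq_zero (by omega) hφ hψ (E.d_mem_tensorFilt m u hu)

variable (E)

/-- The Lie algebra of the functions which vanish to order two at the unit. -/
abbrev V := E.F 2

variable [CharZero k]

noncomputable instance : LieRing E.V where
  bracket φ ψ := ⟨E.pb φ.1 ψ.1, pb_mem (by omega) φ.2 ψ.2⟩
  add_lie _ _ _ := Subtype.ext (E.pb_add_left _ _ _)
  lie_add _ _ _ := Subtype.ext (E.pb_add_right _ _ _)
  lie_self φ := Subtype.ext (by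
    change E.pb φ.1 φ.1 = 0
    have h := E.pb_skew φ.1 φ.1
    rw [eq_neg_iff_add_eq_zero, ← two_smul k] at h
    exact (smul_eq_zero.mp h).resolve_left two_ne_zero)
  leibniz_lie φ ψ χ := Subtype.ext (by
    change E.pb φ.1 (E.pb ψ.1 χ.1) = E.pb (E.pb φ.1 ψ.1) χ.1 + E.pb ψ.1 (E.pb φ.1 χ.1)
    have h := E.pb_jacobi φ.1 ψ.1 χ.1
    have h1 : E.pb (E.pb χ.1 φ.1) ψ.1 = E.pb ψ.1 (E.pb φ.1 χ.1) := by
      rw [E.pb_skew ψ.1, E.pb_skew φ.1 χ.1, pb_neg_right, neg_neg]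
    have h2 := E.pb_skew φ.1 (E.pb ψ.1 χ.1)
    rw [h2, h1] at h
    exact (add_neg_eq_zero.mp h).symm)

noncomputable instance : LieAlgebra k E.V where
  lie_smul r _ _ := Subtype.ext (E.pb_smul_right r _ _)

theorem exists_limit {G : ℕ → A →ₗ[k] k} (hG : ∀ n, G (n + 1) - G n ∈ E.F (n + 1)) :
    ∃ l : A →ₗ[k] k, ∀ n, l - G n ∈ E.F (n + 1) := by
  have hs : ∀ n m, n ≤ m → ∀ u ∈ E.C n, G m u = G n u := by
    intro n m h u hu
    induction m, h using Nat.le_induction with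
    | base => rfl
    | succ m h ih =>
      rw [← ih, ← sub_eq_zero, ← LinearMap.sub_apply]
      exact hG m n (by omega) u hu
  choose N hN using E.exists_mem_C
  have hN' : ∀ u n, u ∈ E.C n → G (N u) u = G n u := fun u n hu => by
    rw [← hs (N u) (max (N u) n) (le_max_left _ _) u (hN u),
      ← hs n (max (N u) n) (le_max_right _ _) u hu]
  refine ⟨{ toFun := fun u => G (N u) u, map_add' := fun u v => ?_, map_smul' := fun r u => ?_ },
    fun n => mem_F_succ.mpr fun u hu => ?_⟩
  · have hu := E.C_mono (le_max_left (N u) (N v)) (hN u)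
    have hv := E.C_mono (le_max_right (N u) (N v)) (hN v)
    rw [hN' _ _ (Submodule.add_mem _ hu hv), hN' u _ hu, hN' v _ hv, map_add]
  · rw [hN' _ _ (Submodule.smul_mem _ r (hN u)), map_smul, RingHom.id_apply]
  · rw [LinearMap.sub_apply, sub_eq_zero]
    exact hN' u n hu

noncomputable instance : CompleteLie k E.V where
  W n := (E.F (n + 1)).comap (E.F 2).subtype
  anti _ _ h _ hφ := F_anti (Nat.succ_le_succ h) hφ
  one := eq_top_iff.mpr fun φ _ => φ.2
  lie_mem hφ hψ := pb_mem (by omega) hφ hψ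
  sep φ h := Subtype.ext (LinearMap.ext fun u => by
    obtain ⟨n, hn⟩ := E.exists_mem_C u
    exact h n n (Nat.lt_succ_self n) u hn)
  complete s hs := by
    obtain ⟨l, hl⟩ := E.exists_limit (G := fun n => (s n).1) hs
    refine ⟨⟨l, ?_⟩, hl⟩
    have := Submodule.add_mem _ (hl 1) (s 1).2
    rwa [sub_add_cancel] at this

variable {E}

theorem mem_filt {n : ℕ} {φ : E.V} : φ ∈ filt k n ↔ φ.1 ∈ E.F (n + 1) := Iff.rfl

theorem isStar_iff {φ ψ : E.V} {χ : Fun k A} :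
    IsStar k (Fun.poisson E.d) (WithConv.toConv φ.1) (WithConv.toConv ψ.1) χ
      ↔ χ.ofConv = (bch k φ ψ).1 := by
  have h : ∀ n u, (∑ i ∈ Finset.Icc 1 n, bchTerm k (Fun.poisson E.d) i (WithConv.toConv φ.1)
      (WithConv.toConv ψ.1)) u = (bchSum k (fun x y => ⁅x, y⁆) n φ ψ).1 u := by
    intro n u
    have := map_bchSum ((WithConv.linearEquiv k (A →ₗ[k] k)).symm.toLinearMap ∘ₗ (E.F 2).subtype)
      (br := fun x y => ⁅x, y⁆) (br' := Fun.poisson E.d) (fun _ _ => rfl) n φ ψ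
    exact (congrArg (fun f : Fun k A => f.ofConv u) this).symm
  have h2 : ∀ n, ∀ u ∈ E.C n, ∀ m ≥ n,
      (bchSum k (fun x y => ⁅x, y⁆) m φ ψ).1 u = (bch k φ ψ).1 u := by
    intro n u hu m hm
    have := bch_sub_bchSum k m φ ψ
    exact (sub_eq_zero.mp (mem_filt.mp this n (by omega) u hu)).symm
  constructor
  · intro H
    ext u
    obtain ⟨N, hN⟩ := H u
    obtain ⟨n, hn⟩ := E.exists_mem_C u
    rw [← hN (max N n) (le_max_left _ _), h, h2 n u hn _ (le_max_right _ _)]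
  · intro H u
    obtain ⟨n, hn⟩ := E.exists_mem_C u
    refine ⟨n, fun m hm => ?_⟩
    rw [h, h2 n u hn m hm, ← H]

end PoissonEnv

end Filtration

/-! ### Products of Poisson enveloping algebras -/

section TensorEnv

open Coalgebra

variable {k : Type*} [Field k] {A : Type*} [Ring A] [Bialgebra k A] {B : Type*} [Ring B]
  [Bialgebra k B]

/-- The permutation of the middle factors of `A ⊗ A ⊗ B ⊗ B`. -/
noncomputable def midSwap : (A ⊗[k] A) ⊗[k] (B ⊗[k] B) →ₐ[k] (A ⊗[k] B) ⊗[k] (A ⊗[k] B) :=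
  (Algebra.TensorProduct.tensorTensorTensorComm k k k k A A B B).toAlgHom

@[simp] theorem midSwap_tmul (a a' : A) (b b' : B) :
    midSwap ((a ⊗ₜ[k] a') ⊗ₜ[k] (b ⊗ₜ[k] b')) = (a ⊗ₜ[k] b) ⊗ₜ[k] (a' ⊗ₜ[k] b') := rfl

theorem comul_tensor (a : A) (b : B) :
    comul (R := k) (a ⊗ₜ[k] b) = midSwap (comul (R := k) a ⊗ₜ[k] comul (R := k) b) := rfl

theorem coPoissonTensor_tmul (d : A →ₗ[k] A ⊗[k] A) (d' : B →ₗ[k] B ⊗[k] B) (a : A) (b : B) :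
    coPoissonTensor d d' (a ⊗ₜ[k] b)
      = midSwap (d a ⊗ₜ[k] comul (R := k) b) + midSwap (comul (R := k) a ⊗ₜ[k] d' b) := by
  rw [← map_add]; rfl

/-- The inclusion of the first factor. -/
noncomputable def incl₁ (k A B : Type*) [Field k] [Ring A] [Bialgebra k A] [Ring B]
    [Bialgebra k B] : A →ₐ[k] A ⊗[k] B := Algebra.TensorProduct.includeLeft

/-- The inclusion of the second factor. -/
noncomputable def incl₂ (k A B : Type*) [Field k] [Ring A] [Bialgebra k A] [Ring B]
    [Bialgebra k B] : B →ₐ[k] A ⊗[k] B := Algebra.TensorProduct.includeRight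

theorem incl₁_apply (a : A) : incl₁ k A B a = a ⊗ₜ[k] (1 : B) := rfl

theorem incl₂_apply (b : B) : incl₂ k A B b = (1 : A) ⊗ₜ[k] b := rfl

theorem midSwap_tmul_one (t : A ⊗[k] A) : midSwap (t ⊗ₜ[k] (1 : B ⊗[k] B))
    = TensorProduct.map (incl₁ k A B).toLinearMap (incl₁ k A B).toLinearMap t := by
  induction t with
  | zero => simp
  | add s t hs ht => rw [TensorProduct.add_tmul, map_add, map_add, hs, ht]
  | tmul a a' => rfl

theorem midSwap_one_tmul (t : B ⊗[k] B) : midSwap ((1 : A ⊗[k] A) ⊗ₜ[k] t)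
    = TensorProduct.map (incl₂ k A B).toLinearMap (incl₂ k A B).toLinearMap t := by
  induction t with
  | zero => simp
  | add s t hs ht => rw [TensorProduct.tmul_add, map_add, map_add, hs, ht]
  | tmul a a' => rfl

theorem map_mem_map₂ {f : A →ₗ[k] B} {P : Submodule k A} {Q : Submodule k B}
    (hf : ∀ x ∈ P, f x ∈ Q) {t : A ⊗[k] A} (ht : t ∈ Submodule.map₂ (TensorProduct.mk k A A) P P) :
    TensorProduct.map f f t ∈ Submodule.map₂ (TensorProduct.mk k B B) Q Q := by
  induction ht using map₂_induction with
  | tmul a b ha hb => exact Submodule.apply_mem_map₂ _ (hf a ha) (hf b hb)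
  | zero => rw [map_zero]; exact Submodule.zero_mem _
  | add s t _ _ hs ht => rw [map_add]; exact Submodule.add_mem _ hs ht
  | smul r t _ ht => rw [map_smul]; exact Submodule.smul_mem _ _ ht

namespace PoissonEnv

variable (E : PoissonEnv k A) (E' : PoissonEnv k B)

theorem coPoissonTensor_incl₁ (a : A) : coPoissonTensor E.d E'.d (incl₁ k A B a)
    = TensorProduct.map (incl₁ k A B).toLinearMap (incl₁ k A B).toLinearMap (E.d a) := by
  rw [incl₁_apply, coPoissonTensor_tmul, E'.d_one, TensorProduct.tmul_zero, map_zero, add_zero,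
    Bialgebra.comul_one, midSwap_tmul_one]

theorem coPoissonTensor_incl₂ (b : B) : coPoissonTensor E.d E'.d (incl₂ k A B b)
    = TensorProduct.map (incl₂ k A B).toLinearMap (incl₂ k A B).toLinearMap (E'.d b) := by
  rw [incl₂_apply, coPoissonTensor_tmul, E.d_one, TensorProduct.zero_tmul, map_zero, zero_add,
    Bialgebra.comul_one, midSwap_one_tmul]

theorem coPoissonTensor_mul (u v : A ⊗[k] B) : coPoissonTensor E.d E'.d (u * v)
    = coPoissonTensor E.d E'.d u * comul (R := k) v
      + comul (R := k) u * coPoissonTensor E.d E'.d v := by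
  induction u with
  | zero => simp
  | add a b ha hb => rw [add_mul, map_add, ha, hb, map_add, map_add, add_mul, add_mul]; abel
  | tmul a b =>
    induction v with
    | zero => simp
    | add a b ha hb => rw [mul_add, map_add, ha, hb, map_add, map_add, mul_add, mul_add]; abel
    | tmul a' b' =>
      rw [Algebra.TensorProduct.tmul_mul_tmul, coPoissonTensor_tmul, coPoissonTensor_tmul,
        coPoissonTensor_tmul, comul_tensor, comul_tensor, E.d_mul, E'.d_mul, Bialgebra.comul_mul,
        Bialgebra.comul_mul, add_mul, mul_add]
      simp only [← map_mul, Algebra.TensorProduct.tmul_mul_tmul, TensorProduct.add_tmul,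
        TensorProduct.tmul_add, map_add]
      abel

/-- The primitive elements of `A ⊗ B`. -/
noncomputable def tensorP : Submodule k (A ⊗[k] B) :=
  E.P.map (incl₁ k A B).toLinearMap ⊔ E'.P.map (incl₂ k A B).toLinearMap

variable {E E'} in
theorem mem_tensorP {t : A ⊗[k] B} : t ∈ E.tensorP E' ↔
    ∃ x ∈ E.P, ∃ y ∈ E'.P, incl₁ k A B x + incl₂ k A B y = t := by
  rw [tensorP, Submodule.mem_sup]
  constructor
  · rintro ⟨_, ⟨x, hx, rfl⟩, _, ⟨y, hy, rfl⟩, rfl⟩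
    exact ⟨x, hx, y, hy, rfl⟩
  · rintro ⟨x, hx, y, hy, rfl⟩
    exact ⟨_, ⟨x, hx, rfl⟩, _, ⟨y, hy, rfl⟩, rfl⟩

variable {E} in
theorem incl₁_mem {x : A} (hx : x ∈ E.P) : incl₁ k A B x ∈ E.tensorP E' :=
  mem_tensorP.mpr ⟨x, hx, 0, E'.P.zero_mem, by rw [map_zero, add_zero]⟩

variable {E'} in
theorem incl₂_mem {x : B} (hx : x ∈ E'.P) : incl₂ k A B x ∈ E.tensorP E' :=
  mem_tensorP.mpr ⟨0, E.P.zero_mem, x, hx, by rw [map_zero, zero_add]⟩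

theorem tmul_eq (a : A) (b : B) : a ⊗ₜ[k] b = incl₁ k A B a * incl₂ k A B b := by
  rw [incl₁_apply, incl₂_apply, Algebra.TensorProduct.tmul_mul_tmul, mul_one, one_mul]

theorem incl_commute (a : A) (b : B) : incl₂ k A B b * incl₁ k A B a
    = incl₁ k A B a * incl₂ k A B b := by
  rw [incl₁_apply, incl₂_apply, Algebra.TensorProduct.tmul_mul_tmul,
    Algebra.TensorProduct.tmul_mul_tmul, mul_one, one_mul, mul_one, one_mul]

/-- The product of two Poisson enveloping algebras. -/
noncomputable def tensor : PoissonEnv k (A ⊗[k] B) where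
  P := E.tensorP E'
  prim t ht := by
    obtain ⟨x, hx, y, hy, rfl⟩ := mem_tensorP.mp ht
    rw [map_add, incl₁_apply, incl₂_apply, comul_tensor, comul_tensor, E.prim x hx, E'.prim y hy,
      Bialgebra.comul_one, Bialgebra.comul_one, midSwap_tmul_one, midSwap_one_tmul, map_add,
      map_add, TensorProduct.add_tmul, TensorProduct.tmul_add]
    simp only [TensorProduct.map_tmul, AlgHom.toLinearMap_apply, map_one, incl₁_apply, incl₂_apply]
    abel
  gen := by
    have h1 : ∀ a, incl₁ k A B a ∈ Algebra.adjoin k (E.tensorP E' : Set (A ⊗[k] B)) := by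
      intro a
      induction a using E.induction with
      | one => rw [map_one]; exact Subalgebra.one_mem _
      | prim x hx => exact Algebra.subset_adjoin (incl₁_mem E' hx)
      | mul u v hu hv => rw [map_mul]; exact Subalgebra.mul_mem _ hu hv
      | add u v hu hv => rw [map_add]; exact Subalgebra.add_mem _ hu hv
      | smul r u hu => rw [map_smul]; exact Subalgebra.smul_mem _ hu r
    have h2 : ∀ b, incl₂ k A B b ∈ Algebra.adjoin k (E.tensorP E' : Set (A ⊗[k] B)) := by
      intro b
      induction b using E'.induction with
      | one => rw [map_one]; exact Subalgebra.one_mem _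
      | prim x hx => exact Algebra.subset_adjoin (incl₂_mem E hx)
      | mul u v hu hv => rw [map_mul]; exact Subalgebra.mul_mem _ hu hv
      | add u v hu hv => rw [map_add]; exact Subalgebra.add_mem _ hu hv
      | smul r u hu => rw [map_smul]; exact Subalgebra.smul_mem _ hu r
    rw [eq_top_iff]
    intro t _
    induction t with
    | zero => exact Subalgebra.zero_mem _
    | add s t hs ht => exact Subalgebra.add_mem _ (hs trivial) (ht trivial)
    | tmul a b => rw [tmul_eq]; exact Subalgebra.mul_mem _ (h1 a) (h2 b)
  lie_mem s hs t ht := by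
    obtain ⟨x, hx, y, hy, rfl⟩ := mem_tensorP.mp hs
    obtain ⟨x', hx', y', hy', rfl⟩ := mem_tensorP.mp ht
    refine mem_tensorP.mpr ⟨_, E.lie_mem x hx x' hx', _, E'.lie_mem y hy y' hy', ?_⟩
    simp only [map_sub, map_mul, add_mul, mul_add, incl_commute]
    abel
  d := coPoissonTensor E.d E'.d
  d_mul := coPoissonTensor_mul E E'
  d_mem t ht := by
    obtain ⟨x, hx, y, hy, rfl⟩ := mem_tensorP.mp ht
    rw [map_add, coPoissonTensor_incl₁, coPoissonTensor_incl₂]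
    exact Submodule.add_mem _ (map_mem_map₂ (fun x hx => incl₁_mem E' hx) (E.d_mem x hx))
      (map_mem_map₂ (fun x hx => incl₂_mem E hx) (E'.d_mem y hy))
  antisymm t ht := by
    obtain ⟨x, hx, y, hy, rfl⟩ := mem_tensorP.mp ht
    rw [map_add, coPoissonTensor_incl₁, coPoissonTensor_incl₂, map_add, comm_map, comm_map,
      E.antisymm x hx, E'.antisymm y hy, map_neg, map_neg, neg_add]
  coJacobi t ht := by
    obtain ⟨x, hx, y, hy, rfl⟩ := mem_tensorP.mp ht
    rw [map_add, coPoissonTensor_incl₁, coPoissonTensor_incl₂, map_add,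
      rTensor_map (d := E.d) (fun a => coPoissonTensor_incl₁ E E' a),
      rTensor_map (d := E'.d) (fun a => coPoissonTensor_incl₂ E E' a), map_add,
      cycSum_map, cycSum_map, E.coJacobi x hx, E'.coJacobi y hy, map_zero, map_zero, add_zero]

theorem tensor_d : (E.tensor E').d = coPoissonTensor E.d E'.d := rfl

theorem C_tensor_le (n : ℕ) : (E.tensor E').C n ≤ E.tensorFilt E' n := by
  refine (E.tensor E').C_le ?_ (fun n u hu => tensorFilt_mono (Nat.le_succ n) hu) ?_ n
  · rw [Algebra.TensorProduct.one_def]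
    exact tmul_mem_tensorFilt (i := 0) (j := 0) (by omega) (E.one_mem_C 0) (E'.one_mem_C 0)
  · intro n u _ hu t ht
    obtain ⟨x, hx, y, hy, rfl⟩ := mem_tensorP.mp ht
    exact mul_mem_tensorFilt hu (Submodule.add_mem _
      (tmul_mem_tensorFilt (i := 1) (j := 0) (by omega) (E.mem_C_one hx) (E'.one_mem_C 0))
      (tmul_mem_tensorFilt (i := 0) (j := 1) (by omega) (E.one_mem_C 0) (E'.mem_C_one hy)))

theorem incl₁_mem_C {n : ℕ} {u : A} (hu : u ∈ E.C n) : incl₁ k A B u ∈ (E.tensor E').C n := by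
  refine E.C_le (G := fun n => ((E.tensor E').C n).comap (incl₁ k A B).toLinearMap) ?_ ?_ ?_ n hu
  · rw [Submodule.mem_comap, AlgHom.toLinearMap_apply, map_one]
    exact (E.tensor E').one_mem_C 0
  · exact fun n u hu => (E.tensor E').C_mono (Nat.le_succ n) hu
  · intro n u _ hu x hx
    rw [Submodule.mem_comap, AlgHom.toLinearMap_apply, map_mul]
    exact (E.tensor E').mul_mem_C hu ((E.tensor E').mem_C_one (incl₁_mem E' hx))

theorem incl₂_mem_C {n : ℕ} {u : B} (hu : u ∈ E'.C n) : incl₂ k A B u ∈ (E.tensor E').C n := by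
  refine E'.C_le (G := fun n => ((E.tensor E').C n).comap (incl₂ k A B).toLinearMap) ?_ ?_ ?_ n hu
  · rw [Submodule.mem_comap, AlgHom.toLinearMap_apply, map_one]
    exact (E.tensor E').one_mem_C 0
  · exact fun n u hu => (E.tensor E').C_mono (Nat.le_succ n) hu
  · intro n u _ hu x hx
    rw [Submodule.mem_comap, AlgHom.toLinearMap_apply, map_mul]
    exact (E.tensor E').mul_mem_C hu ((E.tensor E').mem_C_one (incl₂_mem E hx))

theorem C_tensor (n : ℕ) : (E.tensor E').C n = E.tensorFilt E' n := by
  refine le_antisymm (C_tensor_le E E' n) (Submodule.span_le.mpr ?_)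
  rintro _ ⟨i, j, a, b, h, ha, hb, rfl⟩
  rw [tmul_eq]
  exact (E.tensor E').C_mono h ((E.tensor E').mul_mem_C (incl₁_mem_C E E' ha) (incl₂_mem_C E E' hb))

theorem lie_mem_C {y : A} (hy : y ∈ E.P) (n : ℕ) : ∀ u ∈ E.C n, y * u - u * y ∈ E.C n := by
  refine E.C_le (G := fun n => (E.C n).comap (LinearMap.mulLeft k y - LinearMap.mulRight k y))
    ?_ ?_ ?_ n
  · simp
  · exact fun n u hu => E.C_mono (Nat.le_succ n) hu
  · intro n u hu' hu x hx
    have h : y * (u * x) - u * x * y = (y * u - u * y) * x + u * (y * x - x * y) := by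
      noncomm_ring
    change y * (u * x) - u * x * y ∈ E.C (n + 1)
    rw [h]
    exact Submodule.add_mem _ (E.mul_mem_C hu (E.mem_C_one hx))
      (E.mul_mem_C hu' (E.mem_C_one (E.lie_mem y hy x hx)))

end PoissonEnv

end TensorEnv

/-! ### Morphisms of Poisson enveloping algebras -/

section Morphisms

open PoissonEnv

variable {k : Type*} [Field k] {A₁ : Type*} [Ring A₁] [Bialgebra k A₁] {A₂ : Type*} [Ring A₂]
  [Bialgebra k A₂] {A₃ : Type*} [Ring A₃] [Bialgebra k A₃] {A₄ : Type*} [Ring A₄]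
  [Bialgebra k A₄]

/-- A linear map which respects the filtrations, and whose symbol is the symmetric power of a
linear map between the spaces of primitive elements. -/
structure IsFilt (E₁ : PoissonEnv k A₁) (E₂ : PoissonEnv k A₂) (m : A₁ →ₗ[k] A₂) : Prop where
  one : m 1 = 1
  mem_C : ∀ n, ∀ u ∈ E₁.C n, m u ∈ E₂.C n
  mem_P : ∀ x ∈ E₁.P, m x ∈ E₂.P
  pow : ∀ x ∈ E₁.P, ∀ n, m (x ^ (n + 1)) - m x ^ (n + 1) ∈ E₂.C n

/-- The transpose of the pull-back of functions along a Poisson map. -/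
structure IsPoisson (E₁ : PoissonEnv k A₁) (E₂ : PoissonEnv k A₂) (m : A₁ →ₗ[k] A₂) : Prop
    extends IsFilt E₁ E₂ m where
  comul : ∀ u, Coalgebra.comul (R := k) (m u) = TensorProduct.map m m (Coalgebra.comul (R := k) u)
  d : ∀ u, E₂.d (m u) = TensorProduct.map m m (E₁.d u)

/-- A morphism of algebras which respects the primitive elements and their cobrackets. -/
structure IsMor (E₁ : PoissonEnv k A₁) (E₂ : PoissonEnv k A₂) (m : A₁ →ₐ[k] A₂) : Prop where
  mem_P : ∀ x ∈ E₁.P, m x ∈ E₂.P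
  d : ∀ x ∈ E₁.P, E₂.d (m x) = TensorProduct.map m.toLinearMap m.toLinearMap (E₁.d x)

variable {E₁ : PoissonEnv k A₁} {E₂ : PoissonEnv k A₂} {E₃ : PoissonEnv k A₃}
  {E₄ : PoissonEnv k A₄}

theorem IsFilt.of_algHom {m : A₁ →ₐ[k] A₂} (h : ∀ x ∈ E₁.P, m x ∈ E₂.P) :
    IsFilt E₁ E₂ m.toLinearMap where
  one := map_one m
  mem_C := E₁.C_le (G := fun n => (E₂.C n).comap m.toLinearMap)
    (by rw [Submodule.mem_comap, AlgHom.toLinearMap_apply, map_one]; exact E₂.one_mem_C 0)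
    (fun n u hu => E₂.C_mono (Nat.le_succ n) hu) fun n u _ hu x hx => by
      rw [Submodule.mem_comap, AlgHom.toLinearMap_apply, map_mul]
      exact E₂.mul_mem_C hu (E₂.mem_C_one (h x hx))
  mem_P := h
  pow x hx n := by
    rw [AlgHom.toLinearMap_apply, AlgHom.toLinearMap_apply, map_pow, sub_self]
    exact Submodule.zero_mem _

theorem map_algHom_mul (m : A₁ →ₐ[k] A₂) (s t : A₁ ⊗[k] A₁) :
    TensorProduct.map m.toLinearMap m.toLinearMap (s * t)
      = TensorProduct.map m.toLinearMap m.toLinearMap s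
        * TensorProduct.map m.toLinearMap m.toLinearMap t :=
  map_mul (Algebra.TensorProduct.map m m) s t

theorem IsMor.comul {m : A₁ →ₐ[k] A₂} (h : IsMor E₁ E₂ m) (u : A₁) :
    Coalgebra.comul (R := k) (m u)
      = TensorProduct.map m.toLinearMap m.toLinearMap (Coalgebra.comul (R := k) u) := by
  induction u using E₁.induction with
  | one =>
    rw [map_one, Bialgebra.comul_one, Bialgebra.comul_one]
    exact (map_one (Algebra.TensorProduct.map m m)).symm
  | prim x hx =>
    rw [E₁.prim x hx, E₂.prim _ (h.mem_P x hx), map_add, TensorProduct.map_tmul,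
      TensorProduct.map_tmul, AlgHom.toLinearMap_apply, AlgHom.toLinearMap_apply, map_one]
  | mul u v hu hv => rw [map_mul, Bialgebra.comul_mul, Bialgebra.comul_mul, map_algHom_mul, hu, hv]
  | add u v hu hv => rw [map_add, map_add, map_add, map_add, hu, hv]
  | smul r u hu => rw [map_smul, map_smul, map_smul, map_smul, hu]

theorem IsMor.isPoisson {m : A₁ →ₐ[k] A₂} (h : IsMor E₁ E₂ m) :
    IsPoisson E₁ E₂ m.toLinearMap where
  toIsFilt := IsFilt.of_algHom h.mem_P
  comul := h.comul
  d u := by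
    rw [AlgHom.toLinearMap_apply]
    induction u using E₁.induction with
    | one => rw [map_one, d_one, d_one, map_zero]
    | prim x hx => exact h.d x hx
    | mul u v hu hv =>
      rw [map_mul, E₁.d_mul, E₂.d_mul, map_add, map_algHom_mul, map_algHom_mul, hu, hv, h.comul,
        h.comul]
    | add u v hu hv => rw [map_add, map_add, map_add, map_add, hu, hv]
    | smul r u hu => rw [map_smul, map_smul, map_smul, map_smul, hu]

theorem IsFilt.comp {m : A₁ →ₗ[k] A₂} {m' : A₂ →ₗ[k] A₃} (h' : IsFilt E₂ E₃ m')
    (h : IsFilt E₁ E₂ m) : IsFilt E₁ E₃ (m' ∘ₗ m) where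
  one := by rw [LinearMap.comp_apply, h.one, h'.one]
  mem_C n u hu := h'.mem_C n _ (h.mem_C n u hu)
  mem_P x hx := h'.mem_P _ (h.mem_P x hx)
  pow x hx n := by
    have h1 := h'.mem_C n _ (h.pow x hx n)
    have h2 := h'.pow _ (h.mem_P x hx) n
    rw [map_sub] at h1
    have := Submodule.add_mem _ h1 h2
    rwa [sub_add_sub_cancel] at this

theorem IsPoisson.comp {m : A₁ →ₗ[k] A₂} {m' : A₂ →ₗ[k] A₃} (h' : IsPoisson E₂ E₃ m')
    (h : IsPoisson E₁ E₂ m) : IsPoisson E₁ E₃ (m' ∘ₗ m) where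
  toIsFilt := h'.toIsFilt.comp h.toIsFilt
  comul u := by
    rw [LinearMap.comp_apply, h'.comul, h.comul, TensorProduct.map_comp]; rfl
  d u := by
    rw [LinearMap.comp_apply, h'.d, h.d, TensorProduct.map_comp]; rfl

theorem IsMor.id : IsMor E₁ E₁ (AlgHom.id k A₁) where
  mem_P _ hx := hx
  d x _ := by simp

theorem IsPoisson.id : IsPoisson E₁ E₁ LinearMap.id := IsMor.id.isPoisson

theorem IsMor.comp {m : A₁ →ₐ[k] A₂} {m' : A₂ →ₐ[k] A₃} (h' : IsMor E₂ E₃ m')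
    (h : IsMor E₁ E₂ m) : IsMor E₁ E₃ (m'.comp m) where
  mem_P x hx := h'.mem_P _ (h.mem_P x hx)
  d x _ := (h'.isPoisson.comp h.isPoisson).d x

theorem isMor_incl₁ : IsMor E₁ (E₁.tensor E₂) (incl₁ k A₁ A₂) where
  mem_P _ hx := incl₁_mem E₂ hx
  d x _ := coPoissonTensor_incl₁ E₁ E₂ x

theorem isMor_incl₂ : IsMor E₂ (E₁.tensor E₂) (incl₂ k A₁ A₂) where
  mem_P _ hx := incl₂_mem E₁ hx
  d x _ := coPoissonTensor_incl₂ E₁ E₂ x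

theorem IsMor.of_incl {m : A₁ ⊗[k] A₂ →ₐ[k] A₃} (h₁ : IsMor E₁ E₃ (m.comp (incl₁ k A₁ A₂)))
    (h₂ : IsMor E₂ E₃ (m.comp (incl₂ k A₁ A₂))) : IsMor (E₁.tensor E₂) E₃ m where
  mem_P t ht := by
    obtain ⟨x, hx, y, hy, rfl⟩ := mem_tensorP.mp ht
    rw [map_add]
    exact Submodule.add_mem _ (h₁.mem_P x hx) (h₂.mem_P y hy)
  d t ht := by
    obtain ⟨x, hx, y, hy, rfl⟩ := mem_tensorP.mp ht
    have h1 := h₁.d x hx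
    have h2 := h₂.d y hy
    rw [AlgHom.comp_toLinearMap, TensorProduct.map_comp, LinearMap.comp_apply,
      ← coPoissonTensor_incl₁ E₁ E₂, AlgHom.comp_apply] at h1
    rw [AlgHom.comp_toLinearMap, TensorProduct.map_comp, LinearMap.comp_apply,
      ← coPoissonTensor_incl₂ E₁ E₂, AlgHom.comp_apply] at h2
    rw [map_add, map_add, map_add, map_add, h1, h2]; rfl

theorem PoissonEnv.counit_eq_zero (E : PoissonEnv k A₁) {x : A₁} (hx : x ∈ E.P) :
    Coalgebra.counit (R := k) x = 0 := by
  have h := congrArg (TensorProduct.lid k A₁) (Coalgebra.rTensor_counit_comul (R := k) x)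
  rw [E.prim x hx, map_add, LinearMap.rTensor_tmul, LinearMap.rTensor_tmul, Bialgebra.counit_one,
    map_add, TensorProduct.lid_tmul, TensorProduct.lid_tmul, add_eq_right] at h
  have h2 := congrArg (Coalgebra.counit (R := k)) h
  rwa [map_smul, Bialgebra.counit_one, map_zero, smul_eq_mul, mul_one] at h2

/-- The transpose of the constant map to the unit. -/
noncomputable def trivHom (k A₁ A₂ : Type*) [Field k] [Ring A₁] [Bialgebra k A₁] [Ring A₂]
    [Bialgebra k A₂] : A₁ →ₐ[k] A₂ := (Algebra.ofId k A₂).comp (Bialgebra.counitAlgHom k A₁)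

theorem trivHom_apply (u : A₁) : trivHom k A₁ A₂ u = (Coalgebra.counit (R := k) u) • (1 : A₂) := by
  rw [← Algebra.algebraMap_eq_smul_one]; rfl

theorem isMor_trivHom : IsMor E₁ E₂ (trivHom k A₁ A₂) where
  mem_P x hx := by
    rw [trivHom_apply, E₁.counit_eq_zero hx, zero_smul]; exact Submodule.zero_mem _
  d x hx := by
    rw [trivHom_apply, map_smul, d_one, smul_zero]
    have h := E₁.d_mem x hx
    generalize E₁.d x = t at h ⊢
    induction h using map₂_induction with
    | tmul a b ha hb =>
      rw [TensorProduct.map_tmul, AlgHom.toLinearMap_apply, trivHom_apply, E₁.counit_eq_zero ha,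
        zero_smul, TensorProduct.zero_tmul]
    | zero => rw [map_zero]
    | add s t _ _ hs ht => rw [map_add, ← hs, ← ht, add_zero]
    | smul r t _ ht => rw [map_smul, ← ht, smul_zero]

/-- The transpose of the pull-back along the first projection. -/
noncomputable def projL (k A₁ A₂ : Type*) [Field k] [Ring A₁] [Bialgebra k A₁] [Ring A₂]
    [Bialgebra k A₂] : A₁ ⊗[k] A₂ →ₗ[k] A₁ :=
  (TensorProduct.rid k A₁).toLinearMap ∘ₗ (Coalgebra.counit (R := k)).lTensor A₁

/-- The transpose of the pull-back along the second projection. -/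
noncomputable def projR (k A₁ A₂ : Type*) [Field k] [Ring A₁] [Bialgebra k A₁] [Ring A₂]
    [Bialgebra k A₂] : A₁ ⊗[k] A₂ →ₗ[k] A₂ :=
  (TensorProduct.lid k A₂).toLinearMap ∘ₗ (Coalgebra.counit (R := k)).rTensor A₂

@[simp] theorem projL_tmul (a : A₁) (b : A₂) :
    projL k A₁ A₂ (a ⊗ₜ[k] b) = (Coalgebra.counit (R := k) b) • a := by
  simp [projL]

@[simp] theorem projR_tmul (a : A₁) (b : A₂) :
    projR k A₁ A₂ (a ⊗ₜ[k] b) = (Coalgebra.counit (R := k) a) • b := by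
  simp [projR]

theorem isPoisson_projL : IsPoisson (E₁.tensor E₂) E₁ (projL k A₁ A₂) := by
  let m : A₁ ⊗[k] A₂ →ₐ[k] A₁ := Algebra.TensorProduct.lift (AlgHom.id k A₁) (trivHom k A₂ A₁)
    fun a b => by rw [trivHom_apply]; exact ((Commute.one_right _).smul_right _)
  have h : projL k A₁ A₂ = m.toLinearMap := by
    ext a b
    simp [m, trivHom_apply]
  rw [h]
  refine (IsMor.of_incl (E₁ := E₁) (E₂ := E₂) ?_ ?_).isPoisson
  · have : m.comp (incl₁ k A₁ A₂) = AlgHom.id k A₁ := by ext a; simp [m, incl₁_apply]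
    rw [this]; exact IsMor.id
  · have : m.comp (incl₂ k A₁ A₂) = trivHom k A₂ A₁ := by ext a; simp [m, incl₂_apply]
    rw [this]; exact isMor_trivHom

theorem isPoisson_projR : IsPoisson (E₁.tensor E₂) E₂ (projR k A₁ A₂) := by
  let m : A₁ ⊗[k] A₂ →ₐ[k] A₂ := Algebra.TensorProduct.lift (trivHom k A₁ A₂) (AlgHom.id k A₂)
    fun a b => by rw [trivHom_apply]; exact ((Commute.one_left _).smul_left _)
  have h : projR k A₁ A₂ = m.toLinearMap := by
    ext a b
    simp [m, trivHom_apply]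
  rw [h]
  refine (IsMor.of_incl (E₁ := E₁) (E₂ := E₂) ?_ ?_).isPoisson
  · have : m.comp (incl₁ k A₁ A₂) = trivHom k A₁ A₂ := by ext a; simp [m, incl₁_apply]
    rw [this]; exact isMor_trivHom
  · have : m.comp (incl₂ k A₁ A₂) = AlgHom.id k A₂ := by ext a; simp [m, incl₂_apply]
    rw [this]; exact IsMor.id

theorem isPoisson_assoc : IsPoisson ((E₁.tensor E₂).tensor E₃) (E₁.tensor (E₂.tensor E₃))
    (TensorProduct.assoc k A₁ A₂ A₃).toLinearMap := by
  let m : (A₁ ⊗[k] A₂) ⊗[k] A₃ →ₐ[k] A₁ ⊗[k] (A₂ ⊗[k] A₃) :=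
    (Algebra.TensorProduct.assoc k k k A₁ A₂ A₃).toAlgHom
  have h : (TensorProduct.assoc k A₁ A₂ A₃).toLinearMap = m.toLinearMap := rfl
  rw [h]
  refine (IsMor.of_incl (E₁ := E₁.tensor E₂) (E₂ := E₃) (IsMor.of_incl (E₁ := E₁) (E₂ := E₂) ?_ ?_)
    ?_).isPoisson
  · have : (m.comp (incl₁ k _ A₃)).comp (incl₁ k A₁ A₂) = incl₁ k A₁ (A₂ ⊗[k] A₃) := by
      ext a; rfl
    rw [this]; exact isMor_incl₁
  · have : (m.comp (incl₁ k _ A₃)).comp (incl₂ k A₁ A₂)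
      = (incl₂ k A₁ (A₂ ⊗[k] A₃)).comp (incl₁ k A₂ A₃) := by
      ext a; rfl
    rw [this]; exact isMor_incl₂.comp isMor_incl₁
  · have : m.comp (incl₂ k _ A₃) = (incl₂ k A₁ (A₂ ⊗[k] A₃)).comp (incl₂ k A₂ A₃) := by
      ext a; rfl
    rw [this]; exact isMor_incl₂.comp isMor_incl₂

theorem map_midSwap (m : A₁ →ₗ[k] A₃) (m' : A₂ →ₗ[k] A₄) (s : A₁ ⊗[k] A₁) (t : A₂ ⊗[k] A₂) :
    midSwap (TensorProduct.map m m s ⊗ₜ[k] TensorProduct.map m' m' t)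
      = TensorProduct.map (TensorProduct.map m m') (TensorProduct.map m m')
        (midSwap (s ⊗ₜ[k] t)) := by
  induction s with
  | zero => simp
  | add a b ha hb => simp only [map_add, TensorProduct.add_tmul, ha, hb]
  | tmul a b =>
    induction t with
    | zero => simp
    | add a b ha hb => simp only [map_add, TensorProduct.tmul_add, ha, hb]
    | tmul c d => rfl

theorem incl_add_pow (x : A₁) (y : A₂) (n : ℕ) : (incl₁ k A₁ A₂ x + incl₂ k A₁ A₂ y) ^ n
    = ∑ i ∈ Finset.range (n + 1), n.choose i • ((x ^ i) ⊗ₜ[k] (y ^ (n - i))) := by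
  have h : Commute (incl₁ k A₁ A₂ x) (incl₂ k A₁ A₂ y) := (incl_commute x y).symm
  rw [h.add_pow]
  refine Finset.sum_congr rfl fun i _ => ?_
  rw [← map_pow, ← map_pow, ← tmul_eq, nsmul_eq_mul']

theorem map_incl_add {m : A₁ →ₗ[k] A₃} {m' : A₂ →ₗ[k] A₄} (h : m 1 = 1) (h' : m' 1 = 1) (x : A₁)
    (y : A₂) : TensorProduct.map m m' (incl₁ k A₁ A₂ x + incl₂ k A₁ A₂ y)
      = incl₁ k A₃ A₄ (m x) + incl₂ k A₃ A₄ (m' y) := by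
  rw [map_add, incl₁_apply, incl₂_apply, TensorProduct.map_tmul, TensorProduct.map_tmul, h, h']
  rfl

theorem IsFilt.map {m : A₁ →ₗ[k] A₃} {m' : A₂ →ₗ[k] A₄} (h : IsFilt E₁ E₃ m)
    (h' : IsFilt E₂ E₄ m') :
    IsFilt (E₁.tensor E₂) (E₃.tensor E₄) (TensorProduct.map m m') where
  one := by
    rw [Algebra.TensorProduct.one_def, TensorProduct.map_tmul, h.one, h'.one]; rfl
  mem_C n := by
    rw [C_tensor, C_tensor]
    have hle : E₁.tensorFilt E₂ n ≤ (E₃.tensorFilt E₄ n).comap (TensorProduct.map m m') := by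
      rw [tensorFilt, Submodule.span_le]
      rintro _ ⟨i, j, a, b, hij, ha, hb, rfl⟩
      exact tmul_mem_tensorFilt hij (h.mem_C i a ha) (h'.mem_C j b hb)
    exact fun u hu => hle hu
  mem_P t ht := by
    obtain ⟨x, hx, y, hy, rfl⟩ := mem_tensorP.mp ht
    exact mem_tensorP.mpr ⟨m x, h.mem_P x hx, m' y, h'.mem_P y hy,
      (map_incl_add h.one h'.one x y).symm⟩
  pow t ht n := by
    obtain ⟨x, hx, y, hy, rfl⟩ := mem_tensorP.mp ht
    rw [map_incl_add h.one h'.one, incl_add_pow, incl_add_pow, map_sum, ← Finset.sum_sub_distrib]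
    refine Submodule.sum_mem _ fun i hi => ?_
    rw [map_nsmul, ← nsmul_sub, C_tensor]
    refine Submodule.smul_of_tower_mem _ _ ?_
    rw [TensorProduct.map_tmul, show ∀ (a a' : A₃) (b b' : A₄), a ⊗ₜ[k] b - a' ⊗ₜ[k] b'
      = (a - a') ⊗ₜ[k] b + a' ⊗ₜ[k] (b - b') from fun a a' b b' => by
        rw [TensorProduct.sub_tmul, TensorProduct.tmul_sub]; abel]
    have hi' : i ≤ n + 1 := Nat.lt_succ_iff.mp (Finset.mem_range.mp hi)
    refine Submodule.add_mem _ ?_ ?_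
    · rcases i with _ | i
      · rw [pow_zero, pow_zero, h.one, sub_self, TensorProduct.zero_tmul]
        exact Submodule.zero_mem _
      · exact tmul_mem_tensorFilt (i := i) (j := n + 1 - (i + 1)) (by omega) (h.pow x hx i)
          (h'.mem_C _ _ (E₂.pow_mem_C hy _))
    · obtain ⟨j, hj⟩ : ∃ j, n + 1 - i = j := ⟨_, rfl⟩
      rw [hj]
      rcases j with _ | j
      · rw [pow_zero, pow_zero, h'.one, sub_self, TensorProduct.tmul_zero]
        exact Submodule.zero_mem _
      · exact tmul_mem_tensorFilt (i := i) (j := j) (by omega)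
          (E₃.pow_mem_C (h.mem_P x hx) i) (h'.pow y hy j)

theorem IsPoisson.map {m : A₁ →ₗ[k] A₃} {m' : A₂ →ₗ[k] A₄} (h : IsPoisson E₁ E₃ m)
    (h' : IsPoisson E₂ E₄ m') :
    IsPoisson (E₁.tensor E₂) (E₃.tensor E₄) (TensorProduct.map m m') where
  toIsFilt := h.toIsFilt.map h'.toIsFilt
  comul t := by
    induction t with
    | zero => simp
    | add s t hs ht => simp only [map_add, hs, ht]
    | tmul a b =>
      rw [TensorProduct.map_tmul, comul_tensor, comul_tensor, h.comul, h'.comul, map_midSwap]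
  d t := by
    induction t with
    | zero => simp
    | add s t hs ht => simp only [map_add, hs, ht]
    | tmul a b =>
      rw [TensorProduct.map_tmul, tensor_d, tensor_d, coPoissonTensor_tmul, coPoissonTensor_tmul,
        h.comul, h'.comul, h.d, h'.d, map_midSwap, map_midSwap, map_add]

theorem mul'_midSwap (s t : A₁ ⊗[k] A₁) :
    TensorProduct.map (LinearMap.mul' k A₁) (LinearMap.mul' k A₁) (midSwap (s ⊗ₜ[k] t))
      = s * t := by
  induction s with
  | zero => simp
  | add a b ha hb => simp only [map_add, TensorProduct.add_tmul, ha, hb, add_mul]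
  | tmul a b =>
    induction t with
    | zero => simp
    | add a b ha hb => simp only [map_add, TensorProduct.tmul_add, ha, hb, mul_add]
    | tmul c d =>
      rw [midSwap_tmul, TensorProduct.map_tmul, Algebra.TensorProduct.tmul_mul_tmul,
        LinearMap.mul'_apply, LinearMap.mul'_apply]

theorem mul'_incl₁_mul (p : A₁) (t : A₁ ⊗[k] A₁) :
    LinearMap.mul' k A₁ (incl₁ k A₁ A₁ p * t) = p * LinearMap.mul' k A₁ t := by
  induction t with
  | zero => simp
  | add a b ha hb => simp only [map_add, mul_add, ha, hb]
  | tmul a b =>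
    rw [incl₁_apply, Algebra.TensorProduct.tmul_mul_tmul, LinearMap.mul'_apply,
      LinearMap.mul'_apply, one_mul, mul_assoc]

theorem mul'_mul_incl₂ (q : A₁) (t : A₁ ⊗[k] A₁) :
    LinearMap.mul' k A₁ (t * incl₂ k A₁ A₁ q) = LinearMap.mul' k A₁ t * q := by
  induction t with
  | zero => simp
  | add a b ha hb => simp only [map_add, add_mul, ha, hb]
  | tmul a b =>
    rw [incl₂_apply, Algebra.TensorProduct.tmul_mul_tmul, LinearMap.mul'_apply,
      LinearMap.mul'_apply, mul_one, mul_assoc]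

variable (E₁) in
/-- The multiplication of `A` is the transpose of the pull-back along the product map. -/
theorem isPoisson_mul' : IsPoisson (E₁.tensor E₁) E₁ (LinearMap.mul' k A₁) where
  one := by rw [Algebra.TensorProduct.one_def, LinearMap.mul'_apply, mul_one]
  mem_C n := by
    rw [C_tensor]
    have hle : E₁.tensorFilt E₁ n ≤ (E₁.C n).comap (LinearMap.mul' k A₁) := by
      rw [tensorFilt, Submodule.span_le]
      rintro _ ⟨i, j, a, b, hij, ha, hb, rfl⟩
      exact E₁.C_mono hij (E₁.mul_mem_C ha hb)
    exact fun u hu => hle hu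
  mem_P t ht := by
    obtain ⟨x, hx, y, hy, rfl⟩ := mem_tensorP.mp ht
    rw [map_add, incl₁_apply, incl₂_apply, LinearMap.mul'_apply, LinearMap.mul'_apply, mul_one,
      one_mul]
    exact Submodule.add_mem _ hx hy
  pow t ht n := by
    obtain ⟨x, hx, y, hy, rfl⟩ := mem_tensorP.mp ht
    have h0 : LinearMap.mul' k A₁ (incl₁ k A₁ A₁ x + incl₂ k A₁ A₁ y) = x + y := by
      rw [map_add, incl₁_apply, incl₂_apply, LinearMap.mul'_apply, LinearMap.mul'_apply, mul_one,
        one_mul]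
    rw [h0]
    induction n with
    | zero => rw [zero_add, pow_one, pow_one, h0, sub_self]; exact Submodule.zero_mem _
    | succ n ih =>
      set X := incl₁ k A₁ A₁ x + incl₂ k A₁ A₁ y with hX
      have hc : incl₂ k A₁ A₁ y * X ^ (n + 1) = X ^ (n + 1) * incl₂ k A₁ A₁ y := by
        refine Commute.pow_right ?_ _
        rw [hX]
        exact Commute.add_right (incl_commute x y) (Commute.refl _)
      have h1 : LinearMap.mul' k A₁ (X ^ (n + 1 + 1))
          = x * LinearMap.mul' k A₁ (X ^ (n + 1)) + LinearMap.mul' k A₁ (X ^ (n + 1)) * y := by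
        rw [pow_succ' X (n + 1)]
        nth_rewrite 1 [hX]
        rw [add_mul, map_add, mul'_incl₁_mul, hc, mul'_mul_incl₂]
      have h2 : LinearMap.mul' k A₁ (X ^ (n + 1 + 1)) - (x + y) ^ (n + 1 + 1)
          = (x + y) * (LinearMap.mul' k A₁ (X ^ (n + 1)) - (x + y) ^ (n + 1))
            - (y * LinearMap.mul' k A₁ (X ^ (n + 1)) - LinearMap.mul' k A₁ (X ^ (n + 1)) * y) := by
        rw [h1, pow_succ' (x + y) (n + 1)]
        noncomm_ring
      have h3 : LinearMap.mul' k A₁ (X ^ (n + 1)) ∈ E₁.C (n + 1) := by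
        have h4 := Submodule.add_mem _ (E₁.C_mono (Nat.le_succ n) ih)
          (E₁.pow_mem_C (Submodule.add_mem _ hx hy) (n + 1))
        rwa [sub_add_cancel] at h4
      rw [h2]
      refine Submodule.sub_mem _ ?_ (E₁.lie_mem_C hy _ _ h3)
      have h5 := E₁.mul_mem_C (E₁.mem_C_one (Submodule.add_mem _ hx hy)) ih
      rwa [add_comm 1 n] at h5
  comul t := by
    induction t with
    | zero => simp
    | add s t hs ht => simp only [map_add, hs, ht]
    | tmul a b => rw [LinearMap.mul'_apply, Bialgebra.comul_mul, comul_tensor, mul'_midSwap]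
  d t := by
    induction t with
    | zero => simp
    | add s t hs ht => simp only [map_add, hs, ht]
    | tmul a b =>
      rw [LinearMap.mul'_apply, d_mul, tensor_d, coPoissonTensor_tmul, map_add, mul'_midSwap,
        mul'_midSwap]

theorem isFilt_comul : IsFilt E₁ (E₁.tensor E₁) (Coalgebra.comul (R := k)) :=
  IsFilt.of_algHom (m := Bialgebra.comulAlgHom k A₁) fun x hx => by
    rw [Bialgebra.comulAlgHom_apply, E₁.prim x hx]
    exact mem_tensorP.mpr ⟨x, hx, x, hx, rfl⟩

/-- The transpose of the pull-back along the map `(a, b)` to a product. -/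
noncomputable def pairMap (a : A₁ →ₗ[k] A₂) (b : A₁ →ₗ[k] A₃) : A₁ →ₗ[k] A₂ ⊗[k] A₃ :=
  TensorProduct.map a b ∘ₗ Coalgebra.comul (R := k)

theorem isFilt_pairMap {a : A₁ →ₗ[k] A₂} {b : A₁ →ₗ[k] A₃} (ha : IsFilt E₁ E₂ a)
    (hb : IsFilt E₁ E₃ b) : IsFilt E₁ (E₂.tensor E₃) (pairMap a b) :=
  (ha.map hb).comp isFilt_comul

theorem pairMap_apply {a : A₁ →ₗ[k] A₂} {b : A₁ →ₗ[k] A₃} (ha : IsFilt E₁ E₂ a)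
    (hb : IsFilt E₁ E₃ b) {x : A₁} (hx : x ∈ E₁.P) :
    pairMap a b x = incl₁ k A₂ A₃ (a x) + incl₂ k A₂ A₃ (b x) := by
  rw [pairMap, LinearMap.comp_apply, E₁.prim x hx, map_add, TensorProduct.map_tmul,
    TensorProduct.map_tmul, ha.one, hb.one]; rfl

theorem isFilt_mulPair {a b : A₁ →ₗ[k] A₂} (ha : IsFilt E₁ E₂ a) (hb : IsFilt E₁ E₂ b) :
    IsFilt E₁ E₂ (LinearMap.mul' k A₂ ∘ₗ pairMap a b) :=
  (isPoisson_mul' E₂).toIsFilt.comp (isFilt_pairMap ha hb)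

theorem mulPair_apply {a b : A₁ →ₗ[k] A₂} (ha : IsFilt E₁ E₂ a) (hb : IsFilt E₁ E₂ b) {x : A₁}
    (hx : x ∈ E₁.P) : (LinearMap.mul' k A₂ ∘ₗ pairMap a b) x = a x + b x := by
  rw [LinearMap.comp_apply, pairMap_apply ha hb hx, map_add, incl₁_apply, incl₂_apply,
    LinearMap.mul'_apply, LinearMap.mul'_apply, mul_one, one_mul]

end Morphisms

/-! ### Pull-back of functions -/

section PullBack

open PoissonEnv

variable {k : Type*} [Field k] [CharZero k] {A₁ : Type*} [Ring A₁] [Bialgebra k A₁] {A₂ : Type*}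
  [Ring A₂] [Bialgebra k A₂] {E₁ : PoissonEnv k A₁} {E₂ : PoissonEnv k A₂}

theorem IsFilt.comp_mem {m : A₁ →ₗ[k] A₂} (h : IsFilt E₁ E₂ m) {n : ℕ} {φ : A₂ →ₗ[k] k}
    (hφ : φ ∈ E₂.F n) : φ ∘ₗ m ∈ E₁.F n := fun i hi u hu => hφ i hi _ (h.mem_C i u hu)

/-- The pull-back of functions, on the functions that vanish to order two at the unit. -/
noncomputable def pull {m : A₁ →ₗ[k] A₂} (h : IsPoisson E₁ E₂ m) : E₂.V →ₗ[k] E₁.V where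
  toFun φ := ⟨φ.1 ∘ₗ m, h.toIsFilt.comp_mem φ.2⟩
  map_add' _ _ := rfl
  map_smul' _ _ := rfl

theorem pull_val {m : A₁ →ₗ[k] A₂} (h : IsPoisson E₁ E₂ m) (φ : E₂.V) :
    (pull h φ).1 = φ.1 ∘ₗ m := rfl

theorem pull_lie {m : A₁ →ₗ[k] A₂} (h : IsPoisson E₁ E₂ m) (φ ψ : E₂.V) :
    pull h ⁅φ, ψ⁆ = ⁅pull h φ, pull h ψ⁆ := by
  apply Subtype.ext
  ext u
  change extProd φ.1 ψ.1 (E₂.d (m u)) = extProd (φ.1 ∘ₗ m) (ψ.1 ∘ₗ m) (E₁.d u)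
  rw [h.d, extProd_comp]

theorem pull_bch {m : A₁ →ₗ[k] A₂} (h : IsPoisson E₁ E₂ m) (φ ψ : E₂.V) :
    pull h (bch k φ ψ) = bch k (pull h φ) (pull h ψ) :=
  map_bch (pull h) (pull_lie h) (fun _ _ hφ => h.toIsFilt.comp_mem hφ) φ ψ

theorem PoissonEnv.extProd_counit_d (E : PoissonEnv k A₁) (φ : A₁ →ₗ[k] k) (u : A₁) :
    extProd φ (Coalgebra.counit (R := k)) (E.d u) = 0 := by
  -- `id ⊗ ε` is a morphism of algebras which kills `P ⊗ P`
  have hm : ∀ s t : A₁ ⊗[k] A₁, (TensorProduct.rid k A₁) ((Coalgebra.counit (R := k)).lTensor A₁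
      (s * t)) = (TensorProduct.rid k A₁) ((Coalgebra.counit (R := k)).lTensor A₁ s)
        * (TensorProduct.rid k A₁) ((Coalgebra.counit (R := k)).lTensor A₁ t) := by
    intro s t
    induction s with
    | zero => simp
    | add a b ha hb => simp only [map_add, add_mul, ha, hb]
    | tmul a b =>
      induction t with
      | zero => simp
      | add a b ha hb => simp only [map_add, mul_add, ha, hb]
      | tmul c d => simp [mul_smul, smul_comm (Coalgebra.counit (R := k) b)]
  have h : (TensorProduct.rid k A₁) ((Coalgebra.counit (R := k)).lTensor A₁ (E.d u)) = 0 := by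
    induction u using E.induction with
    | one => rw [E.d_one]; simp
    | prim x hx =>
      have h := E.d_mem x hx
      generalize E.d x = t at h ⊢
      induction h using map₂_induction with
      | tmul a b ha hb => simp [E.counit_eq_zero hb]
      | zero => simp
      | add s t _ _ hs ht => rw [map_add, map_add, hs, ht, add_zero]
      | smul r t _ ht => rw [map_smul, map_smul, ht, smul_zero]
    | mul u v hu hv => rw [E.d_mul, map_add, map_add, hm, hm, hu, hv, zero_mul, mul_zero, add_zero]
    | add u v hu hv => rw [map_add, map_add, map_add, hu, hv, add_zero]
    | smul r u hu => rw [map_smul, map_smul, map_smul, hu, smul_zero]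
  have h2 : ∀ t : A₁ ⊗[k] A₁, extProd φ (Coalgebra.counit (R := k)) t
      = φ ((TensorProduct.rid k A₁) ((Coalgebra.counit (R := k)).lTensor A₁ t)) := by
    intro t
    induction t with
    | zero => simp
    | add a b ha hb => simp only [map_add, ha, hb]
    | tmul a b => simp [mul_comm]
  rw [h2, h, map_zero]

theorem PoissonEnv.extProd_d_counit (E : PoissonEnv k A₁) (φ : A₁ →ₗ[k] k) (u : A₁) :
    extProd (Coalgebra.counit (R := k)) φ (E.d u) = 0 := by
  have h := LinearMap.congr_fun (E.pb_skew φ (Coalgebra.counit (R := k))) u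
  rw [pb_apply, LinearMap.neg_apply, pb_apply, extProd_counit_d, neg_zero] at h
  exact h

/-- Functions of different variables commute. -/
theorem lie_projL_projR (φ : E₁.V) (ψ : E₂.V) :
    ⁅pull (isPoisson_projL (E₁ := E₁) (E₂ := E₂)) φ, pull (isPoisson_projR (E₁ := E₁) (E₂ := E₂)) ψ⁆
      = 0 := by
  have h : ∀ (s : A₁ ⊗[k] A₁) (t : A₂ ⊗[k] A₂),
      extProd (φ.1 ∘ₗ projL k A₁ A₂) (ψ.1 ∘ₗ projR k A₁ A₂) (midSwap (s ⊗ₜ[k] t))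
        = extProd φ.1 (Coalgebra.counit (R := k)) s
          * extProd (Coalgebra.counit (R := k)) ψ.1 t := by
    intro s t
    induction s with
    | zero => simp
    | add a b ha hb => simp only [map_add, TensorProduct.add_tmul, ha, hb, add_mul]
    | tmul a b =>
      induction t with
      | zero => simp
      | add a b ha hb => simp only [map_add, TensorProduct.tmul_add, ha, hb, mul_add]
      | tmul c d => simp; ring
  apply Subtype.ext
  ext a b
  change extProd (φ.1 ∘ₗ projL k A₁ A₂) (ψ.1 ∘ₗ projR k A₁ A₂)
    (coPoissonTensor E₁.d E₂.d (a ⊗ₜ[k] b)) = 0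
  rw [coPoissonTensor_tmul, map_add, h, h, E₁.extProd_counit_d, E₂.extProd_d_counit, zero_mul,
    mul_zero, add_zero]

end PullBack

/-! ### Cohomology of homogeneous cochains on a vector group -/

section Cochains

variable {k : Type*} [Field k] {M : Type*} [AddCommGroup M]

/-- The coboundary of a 2-cochain. -/
def cobd₂ (g : M → M → k) (x y z : M) : k := g y z - g (x + y) z + g x (y + z) - g x y

/-- The coboundary of a 3-cochain. -/
def cobd₃ (f : M → M → M → k) (x y z w : M) : k :=
  f y z w - f (x + y) z w + f x (y + z) w - f x y (z + w) + f x y z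

theorem cobd₃_cobd₂ (g : M → M → k) (x y z w : M) : cobd₃ (cobd₂ g) x y z w = 0 := by
  simp only [cobd₃, cobd₂, add_assoc]
  ring

/-- A homogeneous 2-cocycle of degree at least three is the coboundary of a multiple of its
restriction to the diagonal: the antisymmetric part is biadditive, and so vanishes. -/
theorem cocycle₂_eq {f : M → M → k} (h : ∀ x y z, cobd₂ f x y z = 0) {s : k}
    (hs : ∀ x y, f (x + x) (y + y) = s * f x y) (h2 : s ≠ 2) (h4 : s ≠ 4) (x y : M) :
    f x y = (f x x + f y y - f (x + y) (x + y)) / (2 - s) := by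
  have hadd : ∀ x y z, f (x + y) z - f z (x + y) = f x z - f z x + (f y z - f z y) := by
    intro x y z
    have h1 := h x y z
    have h2 := h x z y
    have h3 := h z x y
    simp only [cobd₂, add_comm z y, add_comm z x] at h1 h2 h3
    linear_combination -h1 + h2 - h3
  have hsym : ∀ x y, f x y = f y x := by
    intro x y
    have h1 := hadd x x (y + y)
    have h2 := hadd y y x
    have h3 := hs x y
    have h5 := hs y x
    have h6 : (s - 4) * (f x y - f y x) = 0 := by linear_combination h1 - 2 * h2 - h3 + h5
    exact sub_eq_zero.mp ((mul_eq_zero.mp h6).resolve_left (sub_ne_zero.mpr h4))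
  rw [eq_div_iff (sub_ne_zero.mpr h2.symm)]
  have h1 := h x x (y + y)
  have h3 := h x y y
  have h5 := h x y (x + y)
  have h6 := hsym (x + y) y
  have h7 := hs x y
  have h8 : y + (x + y) = x + (y + y) := by abel
  simp only [cobd₂, h8] at h1 h3 h5
  linear_combination h7 + h1 - h3 - h5 - h6

/-- Twice the identity plus the shuffles of one and two letters, on 3-cochains. This operator `X`
satisfies `(X - 2) (X - 4) (X - 8) = 0`, and `(X - 2) (X - 4)` is four times the
antisymmetrization. -/
def shuffle (f : M → M → M → k) (x y z : M) : k :=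
  4 * f x y z - f x z y + f z x y - f y x z + f y z x

/-- A homotopy between the dilation by two and `shuffle`. -/
def homotopy (f : M → M → M → k) (x y : M) : k :=
  f x y (x + y) - f x x (y + y) + f x y y - f y x y

/-- The antisymmetrization of a 3-cochain. -/
def alt₃ (f : M → M → M → k) (x y z : M) : k :=
  f x y z + f y z x + f z x y - f y x z - f x z y - f z y x

/-- On cocycles the dilation by two and `shuffle` differ by a coboundary, so that the cohomology
in degree three is graded by the eigenvalues `2`, `4` and `8`. -/
theorem dilation_sub_shuffle {f : M → M → M → k} (h : ∀ x y z w, cobd₃ f x y z w = 0) (x y z : M) :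
    f (x + x) (y + y) (z + z) - shuffle f x y z = cobd₂ (homotopy f) x y z := by
  have h1 := h y z x (y + z)
  have h2 := h x y z (y + z)
  have h3 := h y x z (y + z)
  have h4 := h x y z (x + y + z)
  have h5 := h x y (x + y) (z + z)
  have h6 := h x z y z
  have h7 := h x y z z
  have h8 := h y x y (z + z)
  have h9 := h z x y z
  have h10 := h x y y (z + z)
  have h11 := h x x (y + y) (z + z)
  simp only [cobd₃, cobd₂, homotopy, shuffle, add_comm, add_left_comm] at *
  linear_combination -h1 - h2 + h3 - h4 + h5 + h6 - h7 - h8 - h9 + h10 - h11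

theorem shuffle_cube (f : M → M → M → k) (x y z : M) :
    shuffle (shuffle (shuffle f)) x y z
      = 14 * shuffle (shuffle f) x y z - 56 * shuffle f x y z + 64 * f x y z := by
  simp only [shuffle]
  ring

theorem shuffle_sq (f : M → M → M → k) (x y z : M) :
    shuffle (shuffle f) x y z = 6 * shuffle f x y z - 8 * f x y z + 4 * alt₃ f x y z := by
  simp only [shuffle, alt₃]
  ring

theorem cobd₃_shuffle {f : M → M → M → k} (h : ∀ x y z w, cobd₃ f x y z w = 0) {s : k}
    (hs : ∀ x y z, f (x + x) (y + y) (z + z) = s * f x y z) (x y z w : M) :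
    cobd₃ (shuffle f) x y z w = 0 := by
  have h1 : ∀ x y z, shuffle f x y z = s * f x y z - cobd₂ (homotopy f) x y z := fun x y z => by
    rw [← dilation_sub_shuffle h, hs, sub_sub_cancel]
  have h2 := h x y z w
  have h3 := cobd₃_cobd₂ (homotopy f) x y z w
  simp only [cobd₃, h1] at h2 h3 ⊢
  linear_combination s * h2 - h3

theorem shuffle_dilation {f : M → M → M → k} {s : k}
    (hs : ∀ x y z, f (x + x) (y + y) (z + z) = s * f x y z) (x y z : M) :
    shuffle f (x + x) (y + y) (z + z) = s * shuffle f x y z := by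
  simp only [shuffle, hs]
  ring

/-- A homogeneous 3-cocycle `f` of degree at least three, which is antisymmetrization-free if the
degree is three, is a coboundary. The primitive is a linear combination of substitutions in `f`. -/
theorem exists_cobd₂_eq [CharZero k] {S : Submodule k (M → M → k)} {T : Set (M → M → M)}
    (hT₁ : (fun x _ => x) ∈ T) (hT₂ : (fun _ y => y) ∈ T)
    (hT : ∀ α ∈ T, ∀ β ∈ T, (fun x y => α x y + β x y) ∈ T) {f : M → M → M → k}
    (hS : ∀ α ∈ T, ∀ β ∈ T, ∀ γ ∈ T, (fun x y => f (α x y) (β x y) (γ x y)) ∈ S)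
    (h : ∀ x y z w, cobd₃ f x y z w = 0) {s : k}
    (hs : ∀ x y z, f (x + x) (y + y) (z + z) = s * f x y z) (h2 : s ≠ 2) (h4 : s ≠ 4)
    (h8 : s ≠ 8 ∨ ∀ x y z, alt₃ f x y z = 0) :
    ∃ g ∈ S, ∀ x y z, cobd₂ g x y z = f x y z := by
  have hP : ∀ f : M → M → M → k,
      (∀ α ∈ T, ∀ β ∈ T, ∀ γ ∈ T, (fun x y => f (α x y) (β x y) (γ x y)) ∈ S) →
      ∀ α ∈ T, ∀ β ∈ T, ∀ γ ∈ T, (fun x y => shuffle f (α x y) (β x y) (γ x y)) ∈ S :=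
    fun f hf α hα β hβ γ hγ => S.add_mem (S.sub_mem (S.add_mem (S.sub_mem
      (S.smul_mem 4 (hf α hα β hβ γ hγ)) (hf α hα γ hγ β hβ)) (hf γ hγ α hα β hβ))
      (hf β hβ α hα γ hγ)) (hf β hβ γ hγ α hα)
  have hG : ∀ f : M → M → M → k,
      (∀ α ∈ T, ∀ β ∈ T, ∀ γ ∈ T, (fun x y => f (α x y) (β x y) (γ x y)) ∈ S) →
      homotopy f ∈ S := fun f hf => S.sub_mem (S.add_mem (S.sub_mem
        (hf _ hT₁ _ hT₂ _ (hT _ hT₁ _ hT₂)) (hf _ hT₁ _ hT₁ _ (hT _ hT₂ _ hT₂)))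
        (hf _ hT₁ _ hT₂ _ hT₂)) (hf _ hT₂ _ hT₁ _ hT₂)
  -- modulo coboundaries `shuffle` is the multiplication by `s`
  have key : ∀ f : M → M → M → k, (∀ x y z w, cobd₃ f x y z w = 0) →
      (∀ x y z, f (x + x) (y + y) (z + z) = s * f x y z) → ∀ x y z,
      s * f x y z - shuffle f x y z = cobd₂ (homotopy f) x y z := fun f h hs x y z => by
    rw [← dilation_sub_shuffle h, hs]
  have k0 := key f h hs
  have k1 := key _ (cobd₃_shuffle h hs) (shuffle_dilation hs)
  have k2 := key _ (cobd₃_shuffle (cobd₃_shuffle h hs) (shuffle_dilation hs))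
    (shuffle_dilation (shuffle_dilation hs))
  have m0 := hG f hS
  have m1 := hG _ (hP f hS)
  have m2 := hG _ (hP _ (hP f hS))
  have e2 := sub_ne_zero.mpr h2
  have e4 := sub_ne_zero.mpr h4
  by_cases e8 : s = 8
  · have halt := h8.resolve_left (not_not.mpr e8)
    -- `(X - 2) (X - 4) - 24 = (X - 8) (X + 2)`, and `X` acts as `8` modulo coboundaries
    refine ⟨(24 : k)⁻¹ • (homotopy (shuffle f) + (2 : k) • homotopy f),
      S.smul_mem _ (S.add_mem m1 (S.smul_mem _ m0)), fun x y z => ?_⟩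
    have a0 := k0 x y z
    have a1 := k1 x y z
    have a2 := shuffle_sq f x y z
    rw [halt] at a2
    rw [e8] at a0 a1
    simp only [cobd₂, Pi.smul_apply, Pi.add_apply, smul_eq_mul] at a0 a1 ⊢
    linear_combination (-(2 : k) / 24) * a0 - 1 / 24 * a1 - 1 / 24 * a2
  · have e8' := sub_ne_zero.mpr e8
    have e : (s - 2) * (s - 4) * (s - 8) ≠ 0 := mul_ne_zero (mul_ne_zero e2 e4) e8'
    -- the quotient of `(X - 2) (X - 4) (X - 8) - (s - 2) (s - 4) (s - 8)` by `X - s`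
    refine ⟨((s - 2) * (s - 4) * (s - 8))⁻¹ • ((s ^ 2 - 14 * s + 56) • homotopy f
      + (s - 14) • homotopy (shuffle f) + homotopy (shuffle (shuffle f))),
      S.smul_mem _ (S.add_mem (S.add_mem (S.smul_mem _ m0) (S.smul_mem _ m1)) m2),
      fun x y z => ?_⟩
    have a0 := k0 x y z
    have a1 := k1 x y z
    have a2 := k2 x y z
    have a3 := shuffle_cube f x y z
    apply mul_left_cancel₀ e
    have hc : ∀ t : k, (s - 2) * (s - 4) * (s - 8) * (((s - 2) * (s - 4) * (s - 8))⁻¹ * t) = t :=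
      fun t => mul_inv_cancel_left₀ e t
    have hl : ∀ (c : k) (g : M → M → k), cobd₂ (c • g) x y z = c * cobd₂ g x y z := fun c g => by
      simp only [cobd₂, Pi.smul_apply, smul_eq_mul]; ring
    have ha : ∀ (g g' : M → M → k), cobd₂ (g + g') x y z = cobd₂ g x y z + cobd₂ g' x y z :=
      fun g g' => by simp only [cobd₂, Pi.add_apply]; ring
    rw [hl, hc, ha, ha, hl, hl, ← a0, ← a1, ← a2, a3]
    ring

end Cochains

/-! ### Symbols -/

section Symbols

open PoissonEnv

variable {k : Type*} [Field k] [CharZero k] {A : Type*} [Ring A] [Bialgebra k A] {B : Type*}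
  [Ring B] [Bialgebra k B] {E : PoissonEnv k A} {E' : PoissonEnv k B}

/-- A function which vanishes to order `N` is determined to first order by its symbol, the
homogeneous function `x ↦ φ(x ^ N)` on the primitive elements. -/
theorem mem_F_succ_of_symbol {N : ℕ} : ∀ {φ : A →ₗ[k] k}, φ ∈ E.F N →
    (∀ x ∈ E.P, φ (x ^ N) = 0) → φ ∈ E.F (N + 1) := by
  induction N with
  | zero =>
    intro φ _ h
    rw [mem_F_succ, C, pow_zero]
    intro u hu
    obtain ⟨r, rfl⟩ := Submodule.mem_one.mp hu
    have h0 := h 0 (Submodule.zero_mem _)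
    rw [pow_zero] at h0
    rw [Algebra.algebraMap_eq_smul_one, map_smul, h0, smul_zero]
  | succ n ih =>
    intro φ hφ h
    have hpol : ∀ x ∈ E.P, ∀ y ∈ E.P, φ (x ^ n * y) = 0 := by
      intro x hx y hy
      -- the terms of degree one in `t` of `φ((x + t y) ^ (n + 1)) = 0`
      let q : Polynomial k := ∑ i ∈ Finset.range (n + 1 + 1),
        Polynomial.monomial (n + 1 - i) (((n + 1).choose i : k) * φ (x ^ i * y ^ (n + 1 - i)))
      have hq : q = 0 := by
        refine Polynomial.funext fun t => ?_
        have hty : t • y ∈ E.P := Submodule.smul_mem _ t hy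
        have h1 := (isPoisson_mul' E).pow (incl₁ k A A x + incl₂ k A A (t • y))
          (mem_tensorP.mpr ⟨x, hx, _, hty, rfl⟩) n
        have h2 := mem_F_succ.mp hφ _ h1
        rw [map_sub, map_add, incl₁_apply, incl₂_apply, LinearMap.mul'_apply, LinearMap.mul'_apply,
          mul_one, one_mul, h _ (Submodule.add_mem _ hx hty), sub_zero, ← incl₁_apply,
          ← incl₂_apply, incl_add_pow, map_sum, map_sum] at h2
        rw [Polynomial.eval_zero, ← h2, Polynomial.eval_finsetSum]
        refine Finset.sum_congr rfl fun i _ => ?_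
        rw [Polynomial.eval_monomial, map_nsmul, map_nsmul, LinearMap.mul'_apply, smul_pow,
          mul_smul_comm, map_smul, nsmul_eq_mul, smul_eq_mul]
        ring
      have h3 := congrArg (fun p => Polynomial.coeff p 1) hq
      simp only [q, Polynomial.finsetSum_coeff, Polynomial.coeff_monomial, Polynomial.coeff_zero]
        at h3
      rw [Finset.sum_eq_single n] at h3
      · rw [if_pos (by omega), Nat.add_sub_cancel_left, pow_one, Nat.choose_succ_self_right] at h3
        exact (mul_eq_zero.mp h3).resolve_left (Nat.cast_ne_zero.mpr (Nat.succ_ne_zero n))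
      · intro i hi hin
        have := Finset.mem_range.mp hi
        rw [if_neg (by omega)]
      · intro hn
        exact absurd (Finset.mem_range.mpr (by omega)) hn
    rw [mem_F_succ, C, pow_succ]
    intro u hu
    induction hu using Submodule.mul_induction_on' with
    | mem_mul_mem a ha b hb =>
      obtain ⟨c, hc, y, hy, rfl⟩ := Submodule.mem_sup.mp hb
      obtain ⟨r, rfl⟩ := Submodule.mem_one.mp hc
      have h1 : φ ∘ₗ LinearMap.mulRight k y ∈ E.F n := fun m hm u hu =>
        hφ (m + 1) (by omega) _ (E.mul_mem_C hu (E.mem_C_one hy))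
      have h2 := mem_F_succ.mp (ih h1 fun x hx => hpol x hx y hy) a ha
      have h3 := mem_F_succ.mp hφ a ha
      rw [mul_add, map_add, Algebra.algebraMap_eq_smul_one, mul_smul_comm, mul_one, map_smul, h3,
        smul_zero, zero_add]
      exact h2
    | add x _ y _ hx hy => rw [map_add, hx, hy, add_zero]

theorem symbol_comp {m : A →ₗ[k] B} (h : IsFilt E E' m) {N : ℕ} {φ : B →ₗ[k] k}
    (hφ : φ ∈ E'.F N) {x : A} (hx : x ∈ E.P) : (φ ∘ₗ m) (x ^ N) = φ (m x ^ N) := by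
  rcases N with _ | n
  · rw [pow_zero, pow_zero, LinearMap.comp_apply, h.one]
  · rw [LinearMap.comp_apply, ← sub_eq_zero, ← map_sub]
    exact mem_F_succ.mp hφ _ (h.pow x hx n)

end Symbols

/-! ### Functions of several variables -/

section Powers

open PoissonEnv

variable {k : Type*} [Field k] [CharZero k] {A : Type*} [Ring A] [Bialgebra k A]

namespace PoissonEnv

variable (E : PoissonEnv k A)

/-- The second tensor power. -/
noncomputable abbrev E₂ := E.tensor E

/-- The third tensor power. -/
noncomputable abbrev E₃ := E.E₂.tensor E

/-- The fourth tensor power. -/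
noncomputable abbrev E₄ := E.E₃.tensor E

variable {E}

/-- The primitive element `x ⊗ 1 + 1 ⊗ y`. -/
noncomputable def pt₂ (x y : E.P) : A ⊗[k] A := incl₁ k A A x + incl₂ k A A y

/-- The primitive element `x ⊗ 1 ⊗ 1 + 1 ⊗ y ⊗ 1 + 1 ⊗ 1 ⊗ z`. -/
noncomputable def pt₃ (x y z : E.P) : (A ⊗[k] A) ⊗[k] A := incl₁ k _ A (pt₂ x y) + incl₂ k _ A z

/-- The primitive element of `A ⊗ A ⊗ A ⊗ A` with components `x`, `y`, `z`, `w`. -/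
noncomputable def pt₄ (x y z w : E.P) : ((A ⊗[k] A) ⊗[k] A) ⊗[k] A :=
  incl₁ k _ A (pt₃ x y z) + incl₂ k _ A w

theorem pt₂_mem (x y : E.P) : pt₂ x y ∈ E.E₂.P := mem_tensorP.mpr ⟨x, x.2, y, y.2, rfl⟩

theorem pt₃_mem (x y z : E.P) : pt₃ x y z ∈ E.E₃.P :=
  mem_tensorP.mpr ⟨_, pt₂_mem x y, z, z.2, rfl⟩

theorem pt₄_mem (x y z w : E.P) : pt₄ x y z w ∈ E.E₄.P :=
  mem_tensorP.mpr ⟨_, pt₃_mem x y z, w, w.2, rfl⟩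

theorem exists_pt₂ {t : A ⊗[k] A} (ht : t ∈ E.E₂.P) : ∃ x y : E.P, pt₂ x y = t := by
  obtain ⟨x, hx, y, hy, h⟩ := mem_tensorP.mp ht
  exact ⟨⟨x, hx⟩, ⟨y, hy⟩, h⟩

theorem exists_pt₃ {t : (A ⊗[k] A) ⊗[k] A} (ht : t ∈ E.E₃.P) : ∃ x y z : E.P, pt₃ x y z = t := by
  obtain ⟨s, hs, z, hz, h⟩ := mem_tensorP.mp ht
  obtain ⟨x, y, rfl⟩ := exists_pt₂ hs
  exact ⟨x, y, ⟨z, hz⟩, h⟩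

end PoissonEnv

variable {E : PoissonEnv k A} {B : Type*} [Ring B] [Bialgebra k B] {E' : PoissonEnv k B}
  {D : Type*} [Ring D] [Bialgebra k D] {E'' : PoissonEnv k D}

theorem projL_incl {x : A} {y : B} (hy : y ∈ E'.P) :
    projL k A B (incl₁ k A B x + incl₂ k A B y) = x := by
  rw [map_add, incl₁_apply, incl₂_apply, projL_tmul, projL_tmul, Bialgebra.counit_one, one_smul,
    E'.counit_eq_zero hy, zero_smul, add_zero]

theorem projR_incl {x : A} {y : B} (hx : x ∈ E.P) :
    projR k A B (incl₁ k A B x + incl₂ k A B y) = y := by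
  rw [map_add, incl₁_apply, incl₂_apply, projR_tmul, projR_tmul, Bialgebra.counit_one, one_smul,
    E.counit_eq_zero hx, zero_smul, zero_add]

theorem mul'_incl (x y : A) : LinearMap.mul' k A (incl₁ k A A x + incl₂ k A A y) = x + y := by
  rw [map_add, incl₁_apply, incl₂_apply, LinearMap.mul'_apply, LinearMap.mul'_apply, mul_one,
    one_mul]

theorem assoc_incl (x : A) (y : B) (z : D) :
    TensorProduct.assoc k A B D (incl₁ k _ D (incl₁ k A B x + incl₂ k A B y) + incl₂ k _ D z)
      = incl₁ k A _ x + incl₂ k A _ (incl₁ k B D y + incl₂ k B D z) := by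
  rw [map_add, map_add, map_add, map_add, ← add_assoc]; rfl

section Faces

variable (k A)

/-- The transpose of the pull-back along `(a, b, c) ↦ (a, b)`. -/
noncomputable def face₁₂ : (A ⊗[k] A) ⊗[k] A →ₗ[k] A ⊗[k] A := projL k (A ⊗[k] A) A

/-- The transpose of the pull-back along `(a, b, c) ↦ (b, c)`. -/
noncomputable def face₂₃ : (A ⊗[k] A) ⊗[k] A →ₗ[k] A ⊗[k] A :=
  projR k A (A ⊗[k] A) ∘ₗ (TensorProduct.assoc k A A A).toLinearMap

/-- The transpose of the pull-back along `(a, b, c) ↦ (a b, c)`. -/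
noncomputable def faceL : (A ⊗[k] A) ⊗[k] A →ₗ[k] A ⊗[k] A :=
  TensorProduct.map (LinearMap.mul' k A) LinearMap.id

/-- The transpose of the pull-back along `(a, b, c) ↦ (a, b c)`. -/
noncomputable def faceR : (A ⊗[k] A) ⊗[k] A →ₗ[k] A ⊗[k] A :=
  TensorProduct.map LinearMap.id (LinearMap.mul' k A) ∘ₗ
    (TensorProduct.assoc k A A A).toLinearMap

/-- The transpose of the pull-back along `(a, b, c, d) ↦ (a, b, c)`. -/
noncomputable def face₁₂₃ : ((A ⊗[k] A) ⊗[k] A) ⊗[k] A →ₗ[k] (A ⊗[k] A) ⊗[k] A := projL k _ A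

/-- The transpose of the pull-back along `(a, b, c, d) ↦ (b, c, d)`. -/
noncomputable def face₂₃₄ : ((A ⊗[k] A) ⊗[k] A) ⊗[k] A →ₗ[k] (A ⊗[k] A) ⊗[k] A :=
  TensorProduct.map (face₂₃ k A) LinearMap.id

/-- The transpose of the pull-back along `(a, b, c, d) ↦ (a b, c, d)`. -/
noncomputable def faceL₄ : ((A ⊗[k] A) ⊗[k] A) ⊗[k] A →ₗ[k] (A ⊗[k] A) ⊗[k] A :=
  TensorProduct.map (faceL k A) LinearMap.id

/-- The transpose of the pull-back along `(a, b, c, d) ↦ (a, b c, d)`. -/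
noncomputable def faceM₄ : ((A ⊗[k] A) ⊗[k] A) ⊗[k] A →ₗ[k] (A ⊗[k] A) ⊗[k] A :=
  TensorProduct.map (faceR k A) LinearMap.id

/-- The transpose of the pull-back along `(a, b, c, d) ↦ (a, b, c d)`. -/
noncomputable def faceR₄ : ((A ⊗[k] A) ⊗[k] A) ⊗[k] A →ₗ[k] (A ⊗[k] A) ⊗[k] A :=
  TensorProduct.map LinearMap.id (LinearMap.mul' k A) ∘ₗ
    (TensorProduct.assoc k (A ⊗[k] A) A A).toLinearMap

variable {k A} (E)

theorem isPoisson_face₁₂ : IsPoisson E.E₃ E.E₂ (face₁₂ k A) := isPoisson_projL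

theorem isPoisson_face₂₃ : IsPoisson E.E₃ E.E₂ (face₂₃ k A) :=
  (isPoisson_projR (E₁ := E) (E₂ := E.E₂)).comp isPoisson_assoc

theorem isPoisson_faceL : IsPoisson E.E₃ E.E₂ (faceL k A) := (isPoisson_mul' E).map IsPoisson.id

theorem isPoisson_faceR : IsPoisson E.E₃ E.E₂ (faceR k A) :=
  ((IsPoisson.id (E₁ := E)).map (isPoisson_mul' E)).comp isPoisson_assoc

theorem isPoisson_face₁₂₃ : IsPoisson E.E₄ E.E₃ (face₁₂₃ k A) := isPoisson_projL

theorem isPoisson_face₂₃₄ : IsPoisson E.E₄ E.E₃ (face₂₃₄ k A) :=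
  (isPoisson_face₂₃ E).map IsPoisson.id

theorem isPoisson_faceL₄ : IsPoisson E.E₄ E.E₃ (faceL₄ k A) := (isPoisson_faceL E).map IsPoisson.id

theorem isPoisson_faceM₄ : IsPoisson E.E₄ E.E₃ (faceM₄ k A) := (isPoisson_faceR E).map IsPoisson.id

theorem isPoisson_faceR₄ : IsPoisson E.E₄ E.E₃ (faceR₄ k A) :=
  ((IsPoisson.id (E₁ := E.E₂)).map (isPoisson_mul' E)).comp isPoisson_assoc

variable {E}

theorem face₁₂_pt (x y z : E.P) : face₁₂ k A (pt₃ x y z) = pt₂ x y := projL_incl z.2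

theorem face₂₃_pt (x y z : E.P) : face₂₃ k A (pt₃ x y z) = pt₂ y z := by
  rw [face₂₃, LinearMap.comp_apply, LinearEquiv.coe_coe, pt₃, pt₂, assoc_incl, projR_incl x.2]; rfl

theorem faceL_pt (x y z : E.P) : faceL k A (pt₃ x y z) = pt₂ (x + y) z := by
  rw [faceL, pt₃, map_incl_add (isPoisson_mul' E).one rfl, pt₂, mul'_incl]; rfl

theorem faceR_pt (x y z : E.P) : faceR k A (pt₃ x y z) = pt₂ x (y + z) := by
  rw [faceR, LinearMap.comp_apply, LinearEquiv.coe_coe, pt₃, pt₂, assoc_incl,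
    map_incl_add rfl (isPoisson_mul' E).one, mul'_incl]; rfl

theorem face₁₂₃_pt (x y z w : E.P) : face₁₂₃ k A (pt₄ x y z w) = pt₃ x y z := projL_incl w.2

theorem face₂₃₄_pt (x y z w : E.P) : face₂₃₄ k A (pt₄ x y z w) = pt₃ y z w := by
  rw [face₂₃₄, pt₄, map_incl_add (isPoisson_face₂₃ E).one rfl, face₂₃_pt]; rfl

theorem faceL₄_pt (x y z w : E.P) : faceL₄ k A (pt₄ x y z w) = pt₃ (x + y) z w := by
  rw [faceL₄, pt₄, map_incl_add (isPoisson_faceL E).one rfl, faceL_pt]; rfl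

theorem faceM₄_pt (x y z w : E.P) : faceM₄ k A (pt₄ x y z w) = pt₃ x (y + z) w := by
  rw [faceM₄, pt₄, map_incl_add (isPoisson_faceR E).one rfl, faceR_pt]; rfl

theorem faceR₄_pt (x y z w : E.P) : faceR₄ k A (pt₄ x y z w) = pt₃ x y (z + w) := by
  rw [faceR₄, LinearMap.comp_apply, LinearEquiv.coe_coe, pt₄, pt₃, assoc_incl,
    map_incl_add rfl (isPoisson_mul' E).one, mul'_incl]; rfl

variable (k A)

theorem faces_1_2 : face₁₂ k A ∘ₗ face₁₂₃ k A = face₁₂ k A ∘ₗ faceR₄ k A := by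
  ext a b c d
  simp [face₁₂, face₁₂₃, faceR₄, smul_smul, mul_comm]

theorem faces_12_3 : faceL k A ∘ₗ face₁₂₃ k A = face₁₂ k A ∘ₗ faceL₄ k A := by
  ext a b c d
  simp [face₁₂, face₁₂₃, faceL₄, faceL]

theorem faces_123_4 : faceL k A ∘ₗ faceL₄ k A = faceL k A ∘ₗ faceM₄ k A := by
  ext a b c d
  simp [faceL₄, faceM₄, faceL, faceR, mul_assoc]

theorem faces_2_3 : face₂₃ k A ∘ₗ face₁₂₃ k A = face₁₂ k A ∘ₗ face₂₃₄ k A := by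
  ext a b c d
  simp [face₁₂, face₁₂₃, face₂₃, face₂₃₄, TensorProduct.smul_tmul', smul_smul, mul_comm]

theorem faces_1_23 : faceR k A ∘ₗ face₁₂₃ k A = face₁₂ k A ∘ₗ faceM₄ k A := by
  ext a b c d
  simp [face₁₂, face₁₂₃, faceR, faceM₄]

theorem faces_23_4 : face₂₃ k A ∘ₗ faceM₄ k A = faceL k A ∘ₗ face₂₃₄ k A := by
  ext a b c d
  simp [faceL, face₂₃₄, face₂₃, faceR, faceM₄, TensorProduct.smul_tmul']

theorem faces_1_234 : faceR k A ∘ₗ faceM₄ k A = faceR k A ∘ₗ faceR₄ k A := by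
  ext a b c d
  simp [faceR₄, faceR, faceM₄, mul_assoc]

theorem faces_3_4 : face₂₃ k A ∘ₗ face₂₃₄ k A = face₂₃ k A ∘ₗ faceL₄ k A := by
  ext a b c d
  simp [face₂₃, face₂₃₄, faceL₄, faceL, TensorProduct.smul_tmul']

theorem faces_2_34 : faceR k A ∘ₗ face₂₃₄ k A = face₂₃ k A ∘ₗ faceR₄ k A := by
  ext a b c d
  change TensorProduct.map LinearMap.id (LinearMap.mul' k A) (TensorProduct.assoc k A A A
    (projR k A (A ⊗[k] A) (a ⊗ₜ[k] (b ⊗ₜ[k] c)) ⊗ₜ[k] d))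
      = projR k A (A ⊗[k] A) (a ⊗ₜ[k] (b ⊗ₜ[k] (c * d)))
  rw [projR_tmul, projR_tmul, ← TensorProduct.smul_tmul', map_smul, map_smul]
  rfl

theorem faces_12_34 : faceR k A ∘ₗ faceL₄ k A = faceL k A ∘ₗ faceR₄ k A := by
  ext a b c d
  simp [faceL, faceR, faceR₄, faceL₄]

end Faces

attribute [irreducible] face₁₂ face₂₃ faceL faceR face₁₂₃ face₂₃₄ faceL₄ faceM₄ faceR₄

end Powers

/-! ### The pentagon -/

section Pentagon

variable {k : Type*} [Field k] [CharZero k] {V : Type*} [LieRing V] [LieAlgebra k V]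
  [CompleteLie k V]

theorem bch_perturb_left {M : ℕ} {x x' y : V} (h : x - x' ∈ filt k (M + 1)) :
    bch k x y - bch k x' y - (x - x') ∈ filt k (M + 2) := by
  have := bch_perturb (x := x) (x' := x') (y := y) (y' := y) (ν := x - x') (μ := 0) (M := M)
    (by rw [sub_self]; exact Submodule.zero_mem _)
    (by rw [sub_self, sub_zero]; exact Submodule.zero_mem _) h (Submodule.zero_mem _)
  rwa [add_zero] at this

theorem bch_perturb_right {M : ℕ} {x y y' : V} (h : y - y' ∈ filt k (M + 1)) :
    bch k x y - bch k x y' - (y - y') ∈ filt k (M + 2) := by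
  have := bch_perturb (x := x) (x' := x) (y := y) (y' := y') (ν := 0) (μ := y - y') (M := M)
    (by rw [sub_self, sub_zero]; exact Submodule.zero_mem _)
    (by rw [sub_self]; exact Submodule.zero_mem _) (Submodule.zero_mem _) h
  rwa [zero_add] at this

/-- To first order, the sum around the pentagon of five approximate equalities of products is
zero. The five steps lead from one bracketing of a product to another one and back; the loop closes
since `p₁` and `t` commute. -/
theorem pentagon {M : ℕ} {p₁ p₂ p₃ q₁ q₂ r s t u v : V}
    (h₁ : bch k p₁ p₂ - bch k q₁ q₂ ∈ filt k (M + 1))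
    (h₂ : bch k q₂ p₃ - bch k r s ∈ filt k (M + 1))
    (h₃ : bch k q₁ r - bch k t u ∈ filt k (M + 1))
    (h₄ : bch k p₂ p₃ - bch k t v ∈ filt k (M + 1))
    (h₅ : bch k p₁ v - bch k u s ∈ filt k (M + 1)) (hc : ⁅p₁, t⁆ = 0) :
    (bch k q₁ r - bch k t u) - (bch k p₂ p₃ - bch k t v) + (bch k q₂ p₃ - bch k r s)
      - (bch k p₁ v - bch k u s) + (bch k p₁ p₂ - bch k q₁ q₂) ∈ filt k (M + 2) := by
  have e₁ := bch_perturb_left (y := p₃) h₁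
  have e₂ := bch_perturb_right (x := q₁) h₂
  have e₃ := bch_perturb_left (y := s) h₃
  have e₄ := bch_perturb_right (x := p₁) h₄
  have e₅ := bch_perturb_right (x := t) h₅
  have hc' : bch k p₁ (bch k t v) = bch k t (bch k p₁ v) := by
    rw [← bch_assoc, bch_comm hc, bch_assoc]
  rw [bch_assoc, bch_assoc] at e₁ e₃
  rw [hc'] at e₄
  have := Submodule.sub_mem _ (Submodule.add_mem _ e₄ e₅)
    (Submodule.add_mem _ (Submodule.add_mem _ e₁ e₂) e₃)
  convert this using 1
  abel

end Pentagon

section PullPentagon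

open PoissonEnv

variable {k : Type*} [Field k] [CharZero k] {A₂ : Type*} [Ring A₂] [Bialgebra k A₂] {A₃ : Type*}
  [Ring A₃] [Bialgebra k A₃] {A₄ : Type*} [Ring A₄] [Bialgebra k A₄] {E₂ : PoissonEnv k A₂}
  {E₃ : PoissonEnv k A₃} {E₄ : PoissonEnv k A₄}

theorem pull_congr {m m' : A₃ →ₗ[k] A₂} (hm : m = m') (h : IsPoisson E₃ E₂ m)
    (h' : IsPoisson E₃ E₂ m') (φ : E₂.V) : pull h φ = pull h' φ := by
  subst hm; rfl

theorem pull_mem_filt {m : A₃ →ₗ[k] A₂} (h : IsPoisson E₃ E₂ m) {n : ℕ} {φ : E₂.V}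
    (hφ : φ ∈ filt k n) : pull h φ ∈ filt k n :=
  mem_filt.mpr (h.toIsFilt.comp_mem (mem_filt.mp hφ))

theorem pull_pull {m : A₄ →ₗ[k] A₃} {m' : A₃ →ₗ[k] A₂} (h : IsPoisson E₄ E₃ m)
    (h' : IsPoisson E₃ E₂ m') (φ : E₂.V) : pull h (pull h' φ) = pull (h'.comp h) φ := rfl

theorem lie_pull_eq_zero {m₁ m₂ : A₃ →ₗ[k] A₂} {m : A₄ →ₗ[k] A₃} {h₁ : IsPoisson E₃ E₂ m₁}
    {h₂ : IsPoisson E₃ E₂ m₂} (h : IsPoisson E₄ E₃ m) {φ : E₂.V}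
    (h0 : ⁅pull h₁ φ, pull h₂ φ⁆ = 0) {n₁ n₂ : A₄ →ₗ[k] A₂} (e₁ : m₁ ∘ₗ m = n₁)
    (e₂ : m₂ ∘ₗ m = n₂) (g₁ : IsPoisson E₄ E₂ n₁) (g₂ : IsPoisson E₄ E₂ n₂) :
    ⁅pull g₁ φ, pull g₂ φ⁆ = 0 := by
  rw [← pull_congr e₁ (h₁.comp h), ← pull_congr e₂ (h₂.comp h), ← pull_pull h h₁, ← pull_pull h h₂,
    ← pull_lie, h0, map_zero]

/-- The five pull-backs of the leading term of the difference of the two sides of the twist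
equation satisfy the cocycle identity. -/
theorem pull_pentagon {f₁₂ f₂₃ fL fR : A₃ →ₗ[k] A₂} {g₁₂₃ g₂₃₄ gL gM gR : A₄ →ₗ[k] A₃}
    (h₁₂ : IsPoisson E₃ E₂ f₁₂) (h₂₃ : IsPoisson E₃ E₂ f₂₃) (hL : IsPoisson E₃ E₂ fL)
    (hR : IsPoisson E₃ E₂ fR) (j₁₂₃ : IsPoisson E₄ E₃ g₁₂₃) (j₂₃₄ : IsPoisson E₄ E₃ g₂₃₄)
    (jL : IsPoisson E₄ E₃ gL) (jM : IsPoisson E₄ E₃ gM) (jR : IsPoisson E₄ E₃ gR)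
    (e₁ : f₁₂ ∘ₗ g₁₂₃ = f₁₂ ∘ₗ gR) (e₂ : fL ∘ₗ g₁₂₃ = f₁₂ ∘ₗ gL) (e₃ : fL ∘ₗ gL = fL ∘ₗ gM)
    (e₄ : f₂₃ ∘ₗ g₁₂₃ = f₁₂ ∘ₗ g₂₃₄) (e₅ : fR ∘ₗ g₁₂₃ = f₁₂ ∘ₗ gM) (e₆ : f₂₃ ∘ₗ gM = fL ∘ₗ g₂₃₄)
    (e₇ : fR ∘ₗ gM = fR ∘ₗ gR) (e₈ : f₂₃ ∘ₗ g₂₃₄ = f₂₃ ∘ₗ gL) (e₉ : fR ∘ₗ g₂₃₄ = f₂₃ ∘ₗ gR)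
    (e₀ : fR ∘ₗ gL = fL ∘ₗ gR) {M : ℕ} {φ : E₂.V}
    (hc : ⁅pull (h₁₂.comp j₁₂₃) φ, pull (h₂₃.comp j₂₃₄) φ⁆ = 0) {Φ : E₃.V}
    (hΦ : Φ = bch k (pull h₁₂ φ) (pull hL φ) - bch k (pull h₂₃ φ) (pull hR φ))
    (h : Φ ∈ filt k (M + 1)) {t : A₄} (ht : t ∈ E₄.P)
    {t₁₂₃ t₂₃₄ tL tM tR : A₃} (i₁ : g₁₂₃ t = t₁₂₃) (i₂ : g₂₃₄ t = t₂₃₄) (i₃ : gL t = tL)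
    (i₄ : gM t = tM) (i₅ : gR t = tR) :
    Φ.1 (t₂₃₄ ^ (M + 2)) - Φ.1 (tL ^ (M + 2)) + Φ.1 (tM ^ (M + 2)) - Φ.1 (tR ^ (M + 2))
      + Φ.1 (t₁₂₃ ^ (M + 2)) = 0 := by
  subst i₁ i₂ i₃ i₄ i₅
  have hs : ∀ {m : A₄ →ₗ[k] A₃}, IsPoisson E₄ E₃ m →
      Φ.1 (m t ^ (M + 2)) = Φ.1 (m (t ^ (M + 2))) :=
    fun hm => (symbol_comp hm.toIsFilt (mem_filt.mp h) ht).symm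
  rw [hs j₁₂₃, hs j₂₃₄, hs jL, hs jM, hs jR]
  suffices H : pull j₂₃₄ Φ - pull jL Φ + pull jM Φ - pull jR Φ + pull j₁₂₃ Φ ∈ filt k (M + 2) from
    mem_F_succ.mp (mem_filt.mp H) _ (E₄.pow_mem_C ht (M + 2))
  have g₁ := pull_mem_filt j₁₂₃ h
  have g₂ := pull_mem_filt jM h
  have g₃ := pull_mem_filt j₂₃₄ h
  have g₄ := pull_mem_filt jL h
  have g₅ := pull_mem_filt jR h
  simp only [hΦ, map_sub, pull_bch, pull_pull] at g₁ g₂ g₃ g₄ g₅ ⊢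
  rw [← pull_congr e₅ (hR.comp j₁₂₃)] at g₂ ⊢
  rw [← pull_congr e₄ (h₂₃.comp j₁₂₃), ← pull_congr e₆ (h₂₃.comp jM)] at g₃ ⊢
  rw [← pull_congr e₂ (hL.comp j₁₂₃), pull_congr e₃ _ (hL.comp jM),
    ← pull_congr e₈ (h₂₃.comp j₂₃₄)] at g₄ ⊢
  rw [← pull_congr e₁ (h₁₂.comp j₁₂₃), ← pull_congr e₀ (hR.comp jL),
    ← pull_congr e₉ (hR.comp j₂₃₄), ← pull_congr e₇ (hR.comp jM)] at g₅ ⊢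
  exact pentagon g₁ g₂ g₃ g₄ g₅ hc

end PullPentagon

section Defect

open PoissonEnv

variable {k : Type*} [Field k] [CharZero k] {A : Type*} [Ring A] [Bialgebra k A]
  {E : PoissonEnv k A}

/-- The difference of the two sides of the twist equation. -/
noncomputable def defect (φ : E.E₂.V) : E.E₃.V :=
  bch k (pull (isPoisson_face₁₂ E) φ) (pull (isPoisson_faceL E) φ)
    - bch k (pull (isPoisson_face₂₃ E) φ) (pull (isPoisson_faceR E) φ)

/-- The symbol of a function of two variables. -/
noncomputable def sym₂ (N : ℕ) (φ : A ⊗[k] A →ₗ[k] k) (x y : E.P) : k := φ (pt₂ x y ^ N)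

/-- The symbol of a function of three variables. -/
noncomputable def sym₃ (N : ℕ) (φ : (A ⊗[k] A) ⊗[k] A →ₗ[k] k) (x y z : E.P) : k :=
  φ (pt₃ x y z ^ N)

theorem projL_assoc : projL k (A ⊗[k] A) (A ⊗[k] A) ∘ₗ
    (TensorProduct.assoc k (A ⊗[k] A) A A).toLinearMap = face₁₂ k A ∘ₗ face₁₂₃ k A := by
  ext a b c d
  simp [face₁₂, face₁₂₃, smul_smul, mul_comm]

theorem projR_assoc : projR k (A ⊗[k] A) (A ⊗[k] A) ∘ₗ
    (TensorProduct.assoc k (A ⊗[k] A) A A).toLinearMap = face₂₃ k A ∘ₗ face₂₃₄ k A := by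
  ext a b c d
  simp [face₂₃, face₂₃₄, mul_comm, TensorProduct.smul_tmul']

theorem lie_faces_12_34 (φ : E.E₂.V) :
    ⁅pull ((isPoisson_face₁₂ E).comp (isPoisson_face₁₂₃ E)) φ,
      pull ((isPoisson_face₂₃ E).comp (isPoisson_face₂₃₄ E)) φ⁆ = 0 := by
  have ha : IsPoisson E.E₄ (E.E₂.tensor E.E₂)
    (TensorProduct.assoc k (A ⊗[k] A) A A).toLinearMap := isPoisson_assoc
  exact lie_pull_eq_zero ha (lie_projL_projR φ φ) projL_assoc projR_assoc _ _

/-- The leading term of the defect is a cocycle. -/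
theorem cobd₃_defect {M : ℕ} {φ : E.E₂.V} (h : defect φ ∈ filt k (M + 1)) (x y z w : E.P) :
    cobd₃ (sym₃ (E := E) (M + 2) (defect φ).1) x y z w = 0 := by
  have hc := lie_faces_12_34 φ
  exact pull_pentagon (isPoisson_face₁₂ E) (isPoisson_face₂₃ E) (isPoisson_faceL E)
    (isPoisson_faceR E) (isPoisson_face₁₂₃ E) (isPoisson_face₂₃₄ E) (isPoisson_faceL₄ E)
    (isPoisson_faceM₄ E) (isPoisson_faceR₄ E) (faces_1_2 k A) (faces_12_3 k A) (faces_123_4 k A)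
    (faces_2_3 k A) (faces_1_23 k A) (faces_23_4 k A) (faces_1_234 k A) (faces_3_4 k A)
    (faces_2_34 k A) (faces_12_34 k A) hc rfl h (pt₄_mem x y z w) (face₁₂₃_pt x y z w)
    (face₂₃₄_pt x y z w) (faceL₄_pt x y z w) (faceM₄_pt x y z w) (faceR₄_pt x y z w)

end Defect

/-! ### Lifting of cochains to functions -/

section Lifting

open PoissonEnv

variable {k : Type*} [Field k] [CharZero k] {A : Type*} [Ring A] [Bialgebra k A]
  {E : PoissonEnv k A}

/-- A function of two variables which vanishes when one of the variables is the unit, that is an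
element of the completed tensor square of the maximal ideal. -/
def Normalized (φ : A ⊗[k] A →ₗ[k] k) : Prop :=
  ∀ u : A, φ ((1 : A) ⊗ₜ[k] u) = 0 ∧ φ (u ⊗ₜ[k] (1 : A)) = 0

theorem Normalized.add {φ ψ : A ⊗[k] A →ₗ[k] k} (hφ : Normalized φ) (hψ : Normalized ψ) :
    Normalized (φ + ψ) := fun u => by
  rw [LinearMap.add_apply, LinearMap.add_apply, (hφ u).1, (hφ u).2, (hψ u).1, (hψ u).2]
  simp

variable (k A) in
/-- The transpose of the pull-back along `(a, b) ↦ (a, 1)`. -/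
noncomputable def keepL : A ⊗[k] A →ₗ[k] A ⊗[k] A := (incl₁ k A A).toLinearMap ∘ₗ projL k A A

variable (k A) in
/-- The transpose of the pull-back along `(a, b) ↦ (1, b)`. -/
noncomputable def keepR : A ⊗[k] A →ₗ[k] A ⊗[k] A := (incl₂ k A A).toLinearMap ∘ₗ projR k A A

theorem keepL_tmul (a b : A) :
    keepL k A (a ⊗ₜ[k] b) = (Coalgebra.counit (R := k) b) • (a ⊗ₜ[k] (1 : A)) := by
  rw [keepL, LinearMap.comp_apply, projL_tmul, map_smul, AlgHom.toLinearMap_apply, incl₁_apply]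

theorem keepR_tmul (a b : A) :
    keepR k A (a ⊗ₜ[k] b) = (Coalgebra.counit (R := k) a) • ((1 : A) ⊗ₜ[k] b) := by
  rw [keepR, LinearMap.comp_apply, projR_tmul, map_smul, AlgHom.toLinearMap_apply, incl₂_apply]

theorem isPoisson_keepL : IsPoisson E.E₂ E.E₂ (keepL k A) :=
  (isMor_incl₁ (E₁ := E) (E₂ := E)).isPoisson.comp isPoisson_projL

theorem isPoisson_keepR : IsPoisson E.E₂ E.E₂ (keepR k A) :=
  (isMor_incl₂ (E₁ := E) (E₂ := E)).isPoisson.comp isPoisson_projR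

theorem keepL_pt (x y : E.P) : keepL k A (pt₂ x y) = pt₂ x (0 : E.P) := by
  rw [keepL, LinearMap.comp_apply, pt₂, pt₂, projL_incl y.2, ZeroMemClass.coe_zero, map_zero,
    add_zero]
  rfl

theorem keepR_pt (x y : E.P) : keepR k A (pt₂ x y) = pt₂ (0 : E.P) y := by
  rw [keepR, LinearMap.comp_apply, pt₂, pt₂, projR_incl x.2, ZeroMemClass.coe_zero, map_zero,
    zero_add]
  rfl

/-- A function whose symbol is normalized can be normalized without changing the symbol. -/
theorem exists_normalized {N : ℕ} {ψ : A ⊗[k] A →ₗ[k] k} (hψ : ψ ∈ E.E₂.F N)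
    (h₁ : ∀ x : E.P, sym₂ N ψ x (0 : E.P) = 0) (h₂ : ∀ x : E.P, sym₂ N ψ (0 : E.P) x = 0) :
    ∃ ψ' ∈ E.E₂.F N, Normalized ψ' ∧ ∀ x y : E.P, sym₂ N ψ' x y = sym₂ N ψ x y := by
  have hL := isPoisson_keepL (E := E)
  have hR := isPoisson_keepR (E := E)
  refine ⟨ψ - ψ ∘ₗ keepL k A - ψ ∘ₗ keepR k A + ψ ∘ₗ keepL k A ∘ₗ keepR k A,
    Submodule.add_mem _ (Submodule.sub_mem _ (Submodule.sub_mem _ hψ (hL.toIsFilt.comp_mem hψ))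
      (hR.toIsFilt.comp_mem hψ)) ((hL.comp hR).toIsFilt.comp_mem hψ), fun u => ?_, fun x y => ?_⟩
  · simp only [LinearMap.add_apply, LinearMap.sub_apply, LinearMap.comp_apply, keepL_tmul,
      keepR_tmul, map_smul, Bialgebra.counit_one, one_smul]
    constructor <;> ring
  · have e₁ := symbol_comp hL.toIsFilt hψ (pt₂_mem x y)
    have e₂ := symbol_comp hR.toIsFilt hψ (pt₂_mem x y)
    have e₃ := symbol_comp (hL.comp hR).toIsFilt hψ (pt₂_mem x y)
    rw [keepL_pt] at e₁
    rw [keepR_pt] at e₂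
    rw [LinearMap.comp_apply (keepL k A), keepR_pt, keepL_pt] at e₃
    simp only [sym₂, LinearMap.add_apply, LinearMap.sub_apply] at h₁ h₂ ⊢
    rw [e₁, e₂, e₃, h₁, h₂, h₁]
    ring

theorem pt₃_add_self (x y z : E.P) : pt₃ (x + x) (y + y) (z + z) = (2 : k) • pt₃ x y z := by
  simp only [pt₃, pt₂, Submodule.coe_add, map_add, smul_add, two_smul]

variable (E) in
/-- The maps `E.P × E.P → E.P` which are symbols of maps that respect the filtrations, so that they
can be substituted for the variables in a symbol. -/
def substitutions : Set (E.P → E.P → E.P) :=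
  {α | ∃ m : A ⊗[k] A →ₗ[k] A, IsFilt E.E₂ E m ∧ ∀ x y : E.P, m (pt₂ x y) = α x y}

variable (E) in
/-- The symbol of a function of two variables depends linearly on the function. -/
noncomputable def sym₂Hom (N : ℕ) : (A ⊗[k] A →ₗ[k] k) →ₗ[k] E.P → E.P → k where
  toFun := sym₂ N
  map_add' _ _ := rfl
  map_smul' _ _ := rfl

theorem subst_mem {N : ℕ} {Φ : (A ⊗[k] A) ⊗[k] A →ₗ[k] k} (hΦ : Φ ∈ E.E₃.F N)
    {α β γ : E.P → E.P → E.P} (hα : α ∈ substitutions E) (hβ : β ∈ substitutions E)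
    (hγ : γ ∈ substitutions E) :
    (fun x y => sym₃ N Φ (α x y) (β x y) (γ x y)) ∈ (E.E₂.F N).map (sym₂Hom E N) := by
  obtain ⟨a, ha, ea⟩ := hα
  obtain ⟨b, hb, eb⟩ := hβ
  obtain ⟨c, hc, ec⟩ := hγ
  have hab := isFilt_pairMap ha hb
  have habc : IsFilt E.E₂ E.E₃ (pairMap (pairMap a b) c) := isFilt_pairMap hab hc
  refine ⟨Φ ∘ₗ pairMap (pairMap a b) c, habc.comp_mem hΦ, ?_⟩
  funext x y
  have h := symbol_comp habc hΦ (pt₂_mem x y)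
  rw [pairMap_apply hab hc (pt₂_mem x y), pairMap_apply ha hb (pt₂_mem x y), ea, eb, ec] at h
  exact h

/-- The leading term of a function of three variables, if it is a cocycle, is the coboundary of
the leading term of a function of two variables. -/
theorem exists_lift {N : ℕ} (hN : 3 ≤ N) {Φ : (A ⊗[k] A) ⊗[k] A →ₗ[k] k} (hΦ : Φ ∈ E.E₃.F N)
    (hc : ∀ x y z w : E.P, cobd₃ (sym₃ N Φ) x y z w = 0)
    (hn : ∀ x z : E.P, sym₃ N Φ x 0 z = 0)
    (h8 : N ≠ 3 ∨ ∀ x y z : E.P, alt₃ (sym₃ N Φ) x y z = 0) :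
    ∃ ψ ∈ E.E₂.F N, Normalized ψ ∧
      ∀ x y z : E.P, cobd₂ (sym₂ N ψ) x y z = sym₃ N Φ x y z := by
  have hpow : ∀ j, j < 3 → ((2 : k) ^ N ≠ 2 ^ j) := by
    intro j hj h
    have : (2 : ℕ) ^ N = 2 ^ j := by exact_mod_cast h
    have := Nat.pow_right_injective (le_refl 2) this
    omega
  obtain ⟨g, ⟨ψ, hψ, rfl⟩, hg⟩ := exists_cobd₂_eq (T := substitutions E)
    (S := (E.E₂.F N).map (sym₂Hom E N)) (f := sym₃ N Φ) (s := 2 ^ N)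
    ⟨projL k A A, isPoisson_projL.toIsFilt, fun x y => projL_incl y.2⟩
    ⟨projR k A A, isPoisson_projR.toIsFilt, fun x y => projR_incl x.2⟩
    (by
      rintro α ⟨a, ha, ea⟩ β ⟨b, hb, eb⟩
      refine ⟨_, isFilt_mulPair ha hb, fun x y => ?_⟩
      rw [mulPair_apply ha hb (pt₂_mem x y), ea, eb]; rfl)
    (fun α hα β hβ γ hγ => subst_mem hΦ hα hβ hγ) hc
    (fun x y z => by rw [sym₃, pt₃_add_self, smul_pow, map_smul]; rfl)
    (by simpa using hpow 1 (by norm_num))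
    (by have := hpow 2 (by norm_num); norm_num at this; exact this)
    (h8.imp_left fun h3 h => by
      have : (2 : ℕ) ^ N = 2 ^ 3 := by norm_num; exact_mod_cast h
      exact h3 (Nat.pow_right_injective (le_refl 2) this))
  have h0 : sym₂ N ψ (0 : E.P) (0 : E.P) = 0 := by
    have h1 : pt₂ (0 : E.P) (0 : E.P) = 0 := by simp [pt₂]
    rw [sym₂, h1, zero_pow (by omega), map_zero]
  have hx : ∀ x z : E.P, sym₂ N ψ (0 : E.P) z = sym₂ N ψ x (0 : E.P) := by
    intro x z
    have h1 := (hg x 0 z).trans (hn x z)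
    simp only [cobd₂, add_zero, zero_add] at h1
    have h2 : sym₂ N ψ (0 : E.P) z - sym₂ N ψ x (0 : E.P) = 0 := by
      rw [← h1]
      change _ = sym₂ N ψ (0 : E.P) z - sym₂ N ψ x z + sym₂ N ψ x z - sym₂ N ψ x (0 : E.P)
      ring
    exact sub_eq_zero.mp h2
  obtain ⟨ψ', hψ', hn', hs⟩ := exists_normalized hψ (fun x => by rw [← hx x 0, h0])
    (fun x => by rw [hx 0 x, h0])
  refine ⟨ψ', hψ', hn', fun x y z => ?_⟩
  rw [← hg]
  simp only [cobd₂, hs]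
  rfl

end Lifting

/-! ### Construction of twists by successive approximation -/

section Perturb

variable {k : Type*} [Field k] [CharZero k] {V : Type*} [LieRing V] [LieAlgebra k V]
  [CompleteLie k V]

theorem bch_add_add {M : ℕ} {x y ν μ : V} (hν : ν ∈ filt k (M + 1)) (hμ : μ ∈ filt k (M + 1)) :
    bch k (x + ν) (y + μ) - bch k x y - (ν + μ) ∈ filt k (M + 2) :=
  bch_perturb (by rw [add_sub_cancel_left, sub_self]; exact Submodule.zero_mem _)
    (by rw [add_sub_cancel_left, sub_self]; exact Submodule.zero_mem _) hν hμ

end Perturb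

section PullPerturb

open PoissonEnv

variable {k : Type*} [Field k] [CharZero k] {A₂ : Type*} [Ring A₂] [Bialgebra k A₂] {A₃ : Type*}
  [Ring A₃] [Bialgebra k A₃] {A₄ : Type*} [Ring A₄] [Bialgebra k A₄] {E₂ : PoissonEnv k A₂}
  {E₃ : PoissonEnv k A₃} {E₄ : PoissonEnv k A₄} {f₁ f₂ f₃ f₄ : A₃ →ₗ[k] A₂}
  (h₁ : IsPoisson E₃ E₂ f₁) (h₂ : IsPoisson E₃ E₂ f₂) (h₃ : IsPoisson E₃ E₂ f₃)
  (h₄ : IsPoisson E₃ E₂ f₄)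

include h₁ h₂ h₃ h₄ in
theorem bch_pull_perturb {M : ℕ} {φ h : E₂.V} (hh : h ∈ filt k (M + 1)) {Φ Φ' : E₃.V}
    (hΦ : Φ = bch k (pull h₁ φ) (pull h₂ φ) - bch k (pull h₃ φ) (pull h₄ φ))
    (hΦ' : Φ' = bch k (pull h₁ (φ + h)) (pull h₂ (φ + h))
      - bch k (pull h₃ (φ + h)) (pull h₄ (φ + h))) (h0 : Φ ∈ filt k (M + 1)) :
    Φ' ∈ filt k (M + 1) ∧ ∀ {t : A₃}, t ∈ E₃.P → ∀ {t₁ t₂ t₃ t₄ : A₂},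
      f₁ t = t₁ → f₂ t = t₂ → f₃ t = t₃ → f₄ t = t₄ →
      Φ'.1 (t ^ (M + 2)) = Φ.1 (t ^ (M + 2)) + (h.1 (t₁ ^ (M + 2)) + h.1 (t₂ ^ (M + 2))
        - (h.1 (t₃ ^ (M + 2)) + h.1 (t₄ ^ (M + 2)))) := by
  have g₁ := pull_mem_filt h₁ hh
  have g₂ := pull_mem_filt h₂ hh
  have g₃ := pull_mem_filt h₃ hh
  have g₄ := pull_mem_filt h₄ hh
  have e₁ := bch_add_add (x := pull h₁ φ) (y := pull h₂ φ) g₁ g₂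
  have e₂ := bch_add_add (x := pull h₃ φ) (y := pull h₄ φ) g₃ g₄
  rw [← map_add, ← map_add] at e₁ e₂
  have e : Φ' - Φ - ((pull h₁ h + pull h₂ h) - (pull h₃ h + pull h₄ h)) ∈ filt k (M + 2) := by
    rw [hΦ, hΦ']
    have := Submodule.sub_mem _ e₁ e₂
    convert this using 1
    abel
  refine ⟨?_, fun {t} ht {t₁ t₂ t₃ t₄} i₁ i₂ i₃ i₄ => ?_⟩
  · have e' := CompleteLie.anti (k := k) (Nat.le_succ (M + 1)) e
    have := Submodule.add_mem _ (Submodule.add_mem _ e' h0)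
      (Submodule.sub_mem _ (Submodule.add_mem _ g₁ g₂) (Submodule.add_mem _ g₃ g₄))
    convert this using 1
    abel
  · subst i₁ i₂ i₃ i₄
    have hs : ∀ {m : A₃ →ₗ[k] A₂}, IsPoisson E₃ E₂ m →
        h.1 (m t ^ (M + 2)) = h.1 (m (t ^ (M + 2))) :=
      fun hm => (symbol_comp hm.toIsFilt (mem_filt.mp hh) ht).symm
    have := mem_F_succ.mp (mem_filt.mp e) _ (E₃.pow_mem_C ht (M + 2))
    rw [hs h₁, hs h₂, hs h₃, hs h₄]
    change Φ'.1 (t ^ (M + 2)) - Φ.1 (t ^ (M + 2)) - ((h.1 (f₁ (t ^ (M + 2)))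
      + h.1 (f₂ (t ^ (M + 2)))) - (h.1 (f₃ (t ^ (M + 2))) + h.1 (f₄ (t ^ (M + 2))))) = 0 at this
    linear_combination this

theorem bch_pull_comp {j : A₄ →ₗ[k] A₃} (hj : IsPoisson E₄ E₃ j) {φ : E₂.V} {a b c d : E₄.V}
    (ha : φ.1 ∘ₗ f₁ ∘ₗ j = a.1) (hb : φ.1 ∘ₗ f₂ ∘ₗ j = b.1) (hc : φ.1 ∘ₗ f₃ ∘ₗ j = c.1)
    (hd : φ.1 ∘ₗ f₄ ∘ₗ j = d.1) (h : bch k a b = bch k c d) :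
    (bch k (pull h₁ φ) (pull h₂ φ) - bch k (pull h₃ φ) (pull h₄ φ)).1 ∘ₗ j = 0 := by
  have ea : pull hj (pull h₁ φ) = a := Subtype.ext ha
  have eb : pull hj (pull h₂ φ) = b := Subtype.ext hb
  have ec : pull hj (pull h₃ φ) = c := Subtype.ext hc
  have ed : pull hj (pull h₄ φ) = d := Subtype.ext hd
  have := pull_val hj (bch k (pull h₁ φ) (pull h₂ φ) - bch k (pull h₃ φ) (pull h₄ φ))
  rw [← this, map_sub, pull_bch, pull_bch, ea, eb, ec, ed, h, sub_self]
  rfl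

theorem bch_pull_congr {M : ℕ} {φ ψ : E₂.V} (h : φ - ψ ∈ filt k (M + 1)) :
    (bch k (pull h₁ φ) (pull h₂ φ) - bch k (pull h₃ φ) (pull h₄ φ))
      - (bch k (pull h₁ ψ) (pull h₂ ψ) - bch k (pull h₃ ψ) (pull h₄ ψ)) ∈ filt k (M + 1) := by
  have hp : ∀ {m : A₃ →ₗ[k] A₂} (hm : IsPoisson E₃ E₂ m),
      pull hm φ - pull hm ψ ∈ filt k (M + 1) := fun hm => by
    rw [← map_sub]; exact pull_mem_filt hm h
  have := Submodule.sub_mem _ (bch_congr (hp h₁) (hp h₂)) (bch_congr (hp h₃) (hp h₄))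
  convert this using 1
  abel

end PullPerturb

section Construction

open PoissonEnv

variable {k : Type*} [Field k] [CharZero k] {A : Type*} [Ring A] [Bialgebra k A]
  {E : PoissonEnv k A}

theorem defect_one_left {φ : E.E₂.V} (h : Normalized φ.1) (v w : A) :
    (defect φ).1 (((1 : A) ⊗ₜ[k] v) ⊗ₜ[k] w) = 0 := by
  have hj : IsPoisson E.E₂ E.E₃ (TensorProduct.map (incl₂ k A A).toLinearMap LinearMap.id) :=
    (isMor_incl₂ (E₁ := E) (E₂ := E)).isPoisson.map IsPoisson.id
  refine LinearMap.congr_fun (bch_pull_comp _ _ _ _ hj (a := 0) (b := φ) (c := φ) (d := 0)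
    ?_ ?_ ?_ ?_ (by rw [zero_bch, bch_zero])) (v ⊗ₜ[k] w) <;>
  · ext a b
    simp [face₁₂, face₂₃, faceL, faceR, incl₂_apply, (h _).1]

theorem defect_one_middle {φ : E.E₂.V} (h : Normalized φ.1) :
    (defect φ).1 ∘ₗ TensorProduct.map (incl₁ k A A).toLinearMap LinearMap.id = 0 := by
  have hj : IsPoisson E.E₂ E.E₃ (TensorProduct.map (incl₁ k A A).toLinearMap LinearMap.id) :=
    (isMor_incl₁ (E₁ := E) (E₂ := E)).isPoisson.map IsPoisson.id
  refine bch_pull_comp _ _ _ _ hj (a := 0) (b := φ) (c := 0) (d := φ) ?_ ?_ ?_ ?_ rfl <;>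
  · ext a b
    simp [face₁₂, face₂₃, faceL, faceR, incl₁_apply, (h _).1, (h _).2]

theorem defect_one_right {φ : E.E₂.V} (h : Normalized φ.1) (v w : A) :
    (defect φ).1 ((v ⊗ₜ[k] w) ⊗ₜ[k] (1 : A)) = 0 := by
  have hj : IsPoisson E.E₂ E.E₃ (incl₁ k (A ⊗[k] A) A).toLinearMap :=
    (isMor_incl₁ (E₁ := E.E₂) (E₂ := E)).isPoisson
  refine LinearMap.congr_fun (bch_pull_comp _ _ _ _ hj (a := φ) (b := 0) (c := 0) (d := φ)
    ?_ ?_ ?_ ?_ (by rw [zero_bch, bch_zero])) (v ⊗ₜ[k] w) <;>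
  · ext a b
    simp [face₁₂, face₂₃, faceL, faceR, incl₁_apply, (h _).2]

theorem exists_defect_succ {M : ℕ} (hM : 1 ≤ M) {φ : E.E₂.V} (hφ : Normalized φ.1)
    (hd : defect φ ∈ filt k (M + 1))
    (h8 : M ≠ 1 ∨ ∀ x y z : E.P, alt₃ (sym₃ 3 (defect φ).1) x y z = 0) :
    ∃ φ' : E.E₂.V, Normalized φ'.1 ∧ φ' - φ ∈ filt k (M + 1) ∧ defect φ' ∈ filt k (M + 2) := by
  have hn : ∀ x z : E.P, sym₃ (M + 2) (defect φ).1 x 0 z = 0 := by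
    intro x z
    have hj : IsPoisson E.E₂ E.E₃ (TensorProduct.map (incl₁ k A A).toLinearMap LinearMap.id) :=
      (isMor_incl₁ (E₁ := E) (E₂ := E)).isPoisson.map IsPoisson.id
    have h1 := symbol_comp hj.toIsFilt (mem_filt.mp hd) (pt₂_mem x z)
    rw [defect_one_middle hφ] at h1
    have h2 : TensorProduct.map (incl₁ k A A).toLinearMap LinearMap.id (pt₂ x z)
        = pt₃ x 0 z := by
      rw [pt₂, map_incl_add (isMor_incl₁ (E₁ := E) (E₂ := E)).isPoisson.one rfl, pt₃, pt₂,
        ZeroMemClass.coe_zero, map_zero, add_zero]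
      rfl
    rw [h2] at h1
    exact h1.symm
  obtain ⟨h, hh, hhn, hs⟩ := exists_lift (by omega : 3 ≤ M + 2) (mem_filt.mp hd)
    (cobd₃_defect hd) hn (by
      rcases h8 with h8 | h8
      · exact Or.inl (by omega)
      · by_cases hM1 : M = 1
        · subst hM1; exact Or.inr h8
        · exact Or.inl (by omega))
  let η : E.E₂.V := ⟨h, E.E₂.F_anti (by omega) hh⟩
  have hη : η ∈ filt k (M + 1) := mem_filt.mpr hh
  obtain ⟨h1, h2⟩ := bch_pull_perturb (isPoisson_face₁₂ E) (isPoisson_faceL E) (isPoisson_face₂₃ E)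
    (isPoisson_faceR E) hη (Φ := defect φ) (Φ' := defect (φ + η)) rfl rfl hd
  refine ⟨φ + η, hφ.add hhn, by rw [add_sub_cancel_left]; exact hη, mem_filt.mpr
    (mem_F_succ_of_symbol (mem_filt.mp h1) fun t ht => ?_)⟩
  obtain ⟨x, y, z, rfl⟩ := exists_pt₃ ht
  refine (h2 ht (face₁₂_pt x y z) (faceL_pt x y z) (face₂₃_pt x y z) (faceR_pt x y z)).trans ?_
  have h3 := hs x y z
  simp only [cobd₂, sym₂, sym₃] at h3
  change (defect φ).1 (pt₃ x y z ^ (M + 2)) + (h (pt₂ x y ^ (M + 2))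
    + h (pt₂ (x + y) z ^ (M + 2)) - (h (pt₂ y z ^ (M + 2)) + h (pt₂ x (y + z) ^ (M + 2)))) = 0
  rw [← h3]
  ring

end Construction

section Limit

open PoissonEnv

variable {k : Type*} [Field k] [CharZero k]

/-- A sequence of elements of a complete Lie algebra, obtained by corrections of increasing
order, has a limit. -/
theorem exists_limit_of_step {V : Type*} [LieRing V] [LieAlgebra k V] [CompleteLie k V]
    {p : ℕ → V → Prop} {x₀ : V} (h0 : p 0 x₀)
    (step : ∀ n x, p n x → ∃ y, p (n + 1) y ∧ y - x ∈ filt k (n + 2)) :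
    ∃ l, l - x₀ ∈ filt k 2 ∧ ∀ n, ∃ x, p n x ∧ l - x ∈ filt k (n + 1) := by
  choose! F hF using step
  let s : ℕ → V := fun n => Nat.rec x₀ (fun n x => F n x) n
  have hp : ∀ n, p n (s n) := by
    intro n
    induction n with
    | zero => exact h0
    | succ n ih => exact (hF n _ ih).1
  have hs : ∀ n, s (n + 1) - s n ∈ filt k (n + 2) := fun n => (hF n _ (hp n)).2
  obtain ⟨l, hl⟩ := CompleteLie.complete (k := k) (fun n => s n) fun n =>
    CompleteLie.anti (k := k) (by omega : n ≤ n + 2) (hs n)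
  have h1 : ∀ n, l - s n ∈ filt k (n + 1) := by
    intro n
    have := Submodule.add_mem _ (hl (n + 1)) (CompleteLie.anti (k := k)
      (by omega : n + 1 ≤ n + 2) (hs n))
    rwa [sub_add_sub_cancel] at this
  refine ⟨l, ?_, fun n => ⟨s n, hp n, h1 n⟩⟩
  have h2 : l - s 1 + (s 1 - s 0) ∈ filt k 2 := Submodule.add_mem _ (h1 1) (hs 0)
  rwa [sub_add_sub_cancel] at h2

variable {A : Type*} [Ring A] [Bialgebra k A] {E : PoissonEnv k A}

theorem eq_zero_of_forall_mem_filt {B : Type*} [Ring B] [Bialgebra k B] {E : PoissonEnv k B}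
    {φ : E.V} (h : ∀ n, φ ∈ filt k (n + 1)) : φ = 0 :=
  eq_of_sub_mem_W (k := k) fun n => by rw [sub_zero]; exact h n

theorem apply_eq_of_sub_mem_filt {B : Type*} [Ring B] [Bialgebra k B] {E : PoissonEnv k B} (u : B) :
    ∃ n, ∀ φ ψ : E.V, φ - ψ ∈ filt k (n + 1) → φ.1 u = ψ.1 u := by
  obtain ⟨n, hn⟩ := E.exists_mem_C u
  refine ⟨n, fun φ ψ h => ?_⟩
  have := mem_F.mp (mem_filt.mp h) n (by omega) u hn
  exact sub_eq_zero.mp this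

theorem normalized_of_limit {l : E.E₂.V}
    (h : ∀ n, ∃ x : E.E₂.V, Normalized x.1 ∧ l - x ∈ filt k (n + 1)) : Normalized l.1 := by
  intro u
  obtain ⟨n, hn⟩ := apply_eq_of_sub_mem_filt (E := E.E₂) ((1 : A) ⊗ₜ[k] u)
  obtain ⟨m, hm⟩ := apply_eq_of_sub_mem_filt (E := E.E₂) (u ⊗ₜ[k] (1 : A))
  obtain ⟨x, hx, hlx⟩ := h n
  obtain ⟨y, hy, hly⟩ := h m
  exact ⟨(hn _ _ hlx).trans (hx u).1, (hm _ _ hly).trans (hy u).2⟩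

/-- A solution of the twist equation up to terms of order three extends to a twist, if the
antisymmetrization of the leading term of its defect vanishes. -/
theorem exists_twist_of_alt₃ {φ : E.E₂.V} (hφ : Normalized φ.1) (hd : defect φ ∈ filt k 2)
    (h8 : ∀ x y z : E.P, alt₃ (sym₃ 3 (defect φ).1) x y z = 0) :
    ∃ l : E.E₂.V, Normalized l.1 ∧ defect l = 0 ∧ l - φ ∈ filt k 2 := by
  obtain ⟨l, hl, h⟩ := exists_limit_of_step (k := k) (V := E.E₂.V) (x₀ := φ)
    (p := fun n x => Normalized x.1 ∧ defect x ∈ filt k (n + 2)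
      ∧ (n ≠ 0 ∨ ∀ x' y z : E.P, alt₃ (sym₃ 3 (defect x).1) x' y z = 0))
    ⟨hφ, hd, Or.inr h8⟩ fun n x ⟨hx, hdx, h8⟩ => by
      obtain ⟨y, hy, hyx, hdy⟩ := exists_defect_succ (by omega : 1 ≤ n + 1) hx hdx
        (h8.imp_left fun h => by omega)
      exact ⟨y, ⟨hy, hdy, Or.inl (Nat.succ_ne_zero n)⟩, hyx⟩
  refine ⟨l, normalized_of_limit fun n => ?_, eq_zero_of_forall_mem_filt fun n => ?_, hl⟩
  · obtain ⟨x, ⟨hx, _⟩, hlx⟩ := h n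
    exact ⟨x, hx, hlx⟩
  · obtain ⟨x, ⟨_, hdx, _⟩, hlx⟩ := h n
    have h1 := bch_pull_congr (isPoisson_face₁₂ E) (isPoisson_faceL E) (isPoisson_face₂₃ E)
      (isPoisson_faceR E) hlx
    have h2 : defect l - defect x ∈ filt k (n + 1) := h1
    have h3 := Submodule.add_mem _ h2 (CompleteLie.anti (k := k) (by omega : n + 1 ≤ n + 2) hdx)
    rwa [sub_add_cancel] at h3

end Limit

/-! ### The condition in degree three -/

section PullThree

open PoissonEnv

variable {k : Type*} [Field k] [CharZero k] {A₂ : Type*} [Ring A₂] [Bialgebra k A₂] {A₃ : Type*}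
  [Ring A₃] [Bialgebra k A₃] {E₂ : PoissonEnv k A₂} {E₃ : PoissonEnv k A₃}
  {f₁ f₂ f₃ f₄ : A₃ →ₗ[k] A₂} (h₁ : IsPoisson E₃ E₂ f₁) (h₂ : IsPoisson E₃ E₂ f₂)
  (h₃ : IsPoisson E₃ E₂ f₃) (h₄ : IsPoisson E₃ E₂ f₄)

theorem bch_pull_apply {φ : E₂.V} {u : A₃} (hu : u ∈ E₃.C 3) {r s : k}
    (hr : extProd (φ.1 ∘ₗ f₁) (φ.1 ∘ₗ f₂) (E₃.d u) = r)
    (hs : extProd (φ.1 ∘ₗ f₃) (φ.1 ∘ₗ f₄) (E₃.d u) = s) :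
    (bch k (pull h₁ φ) (pull h₂ φ) - bch k (pull h₃ φ) (pull h₄ φ)).1 u
      = φ.1 (f₁ u) + φ.1 (f₂ u) - (φ.1 (f₃ u) + φ.1 (f₄ u)) + (2 : k)⁻¹ * (r - s) := by
  have e₁ := bch_sub_mem_W_three k (pull h₁ φ) (pull h₂ φ)
  have e₂ := bch_sub_mem_W_three k (pull h₃ φ) (pull h₄ φ)
  have e := mem_F_succ.mp (mem_filt.mp (Submodule.sub_mem _ e₁ e₂)) _ hu
  change (bch k (pull h₁ φ) (pull h₂ φ)).1 u - (φ.1 (f₁ u) + φ.1 (f₂ u)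
      + (2 : k)⁻¹ * extProd (φ.1 ∘ₗ f₁) (φ.1 ∘ₗ f₂) (E₃.d u))
      - ((bch k (pull h₃ φ) (pull h₄ φ)).1 u - (φ.1 (f₃ u) + φ.1 (f₄ u)
      + (2 : k)⁻¹ * extProd (φ.1 ∘ₗ f₃) (φ.1 ∘ₗ f₄) (E₃.d u))) = 0 at e
  rw [hr, hs] at e
  change (bch k (pull h₁ φ) (pull h₂ φ)).1 u - (bch k (pull h₃ φ) (pull h₄ φ)).1 u = _
  linear_combination e

end PullThree

section DegreeThree

open PoissonEnv

variable {k : Type*} [Field k] [CharZero k] {A : Type*} [Ring A] [Bialgebra k A]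
  {E : PoissonEnv k A}

theorem sym₃_three {Φ : (A ⊗[k] A) ⊗[k] A →ₗ[k] k}
    (h₁ : ∀ v w : A, Φ (((1 : A) ⊗ₜ[k] v) ⊗ₜ[k] w) = 0)
    (h₂ : ∀ v w : A, Φ ((v ⊗ₜ[k] (1 : A)) ⊗ₜ[k] w) = 0)
    (h₃ : ∀ v w : A, Φ ((v ⊗ₜ[k] w) ⊗ₜ[k] (1 : A)) = 0) (x y z : E.P) :
    sym₃ 3 Φ x y z = 6 * Φ (((x : A) ⊗ₜ[k] (y : A)) ⊗ₜ[k] (z : A)) := by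
  have h₁₂ : ∀ w : A, Φ ((1 : A ⊗[k] A) ⊗ₜ[k] w) = 0 := fun w => h₁ 1 w
  have h₃' : ∀ t : A ⊗[k] A, Φ (t ⊗ₜ[k] (1 : A)) = 0 := by
    intro t
    induction t with
    | zero => simp
    | add a b ha hb => rw [TensorProduct.add_tmul, map_add, ha, hb, add_zero]
    | tmul a b => exact h₃ a b
  have h2 : ∀ w : A, Φ ((pt₂ x y ^ 2 : A ⊗[k] A) ⊗ₜ[k] w)
      = 2 * Φ (((x : A) ⊗ₜ[k] (y : A)) ⊗ₜ[k] w) := by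
    intro w
    rw [pt₂, incl_add_pow]
    simp [Finset.sum_range_succ, TensorProduct.add_tmul, h₁, h₂, two_mul]
  have h1 : ∀ w : A, Φ ((pt₂ x y) ⊗ₜ[k] w) = 0 := by
    intro w
    rw [pt₂, TensorProduct.add_tmul, map_add, incl₁_apply, incl₂_apply, h₁, h₂, add_zero]
  change Φ (pt₃ x y z ^ 3) = _
  rw [pt₃, incl_add_pow]
  have h3 : ∀ t : (A ⊗[k] A) ⊗[k] A, (3 : ℕ) • t = t + t + t := fun t => by
    rw [succ_nsmul, two_nsmul]
  simp [Finset.sum_range_succ, h₁₂, h₃', h1, h2, h3, -nsmul_eq_mul]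
  ring

theorem eq_of_mem_map₂ {V V' W : Type*} [AddCommGroup V] [Module k V] [AddCommGroup V']
    [Module k V'] [AddCommGroup W] [Module k W] {P : Submodule k V} {Q : Submodule k V'}
    {f g : V ⊗[k] V' →ₗ[k] W} (h : ∀ a ∈ P, ∀ b ∈ Q, f (a ⊗ₜ[k] b) = g (a ⊗ₜ[k] b))
    {t : V ⊗[k] V'} (ht : t ∈ Submodule.map₂ (TensorProduct.mk k V V') P Q) : f t = g t := by
  induction ht using map₂_induction with
  | tmul a b ha hb => exact h a ha b hb
  | zero => rw [map_zero, map_zero]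
  | add s t _ _ hs ht => rw [map_add, map_add, hs, ht]
  | smul r t _ ht => rw [map_smul, map_smul, ht]

theorem E₃_d_tmul (x y z : E.P) : E.E₃.d (((x : A) ⊗ₜ[k] (y : A)) ⊗ₜ[k] (z : A))
    = midSwap (midSwap (E.d x ⊗ₜ[k] ((y : A) ⊗ₜ[k] (1 : A) + (1 : A) ⊗ₜ[k] (y : A)))
        ⊗ₜ[k] ((z : A) ⊗ₜ[k] (1 : A) + (1 : A) ⊗ₜ[k] (z : A)))
      + midSwap (midSwap (((x : A) ⊗ₜ[k] (1 : A) + (1 : A) ⊗ₜ[k] (x : A)) ⊗ₜ[k] E.d y)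
        ⊗ₜ[k] ((z : A) ⊗ₜ[k] (1 : A) + (1 : A) ⊗ₜ[k] (z : A)))
      + midSwap (midSwap (((x : A) ⊗ₜ[k] (1 : A) + (1 : A) ⊗ₜ[k] (x : A))
        ⊗ₜ[k] ((y : A) ⊗ₜ[k] (1 : A) + (1 : A) ⊗ₜ[k] (y : A))) ⊗ₜ[k] E.d z) := by
  rw [tensor_d, coPoissonTensor_tmul, tensor_d, coPoissonTensor_tmul, comul_tensor,
    E.prim x x.2, E.prim y y.2, E.prim z z.2, TensorProduct.add_tmul, map_add]

/-- The function `φ(·, y)`, for a fixed value `y` of the second argument. -/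
noncomputable def sliceL (φ : A ⊗[k] A →ₗ[k] k) (y : A) : A →ₗ[k] k :=
  φ ∘ₗ (TensorProduct.mk k A A).flip y

/-- The function `φ(x, ·)`, for a fixed value `x` of the first argument. -/
noncomputable def sliceR (φ : A ⊗[k] A →ₗ[k] k) (x : A) : A →ₗ[k] k := φ ∘ₗ TensorProduct.mk k A A x

theorem extProd_face₁₂_faceL {φ : A ⊗[k] A →ₗ[k] k} (h : Normalized φ) (x y z : E.P) :
    extProd (φ ∘ₗ face₁₂ k A) (φ ∘ₗ faceL k A)
      (E.E₃.d (((x : A) ⊗ₜ[k] (y : A)) ⊗ₜ[k] (z : A)))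
      = extProd (sliceL φ y) (sliceL φ z) (E.d x) + extProd (sliceR φ x) (sliceL φ z) (E.d y) := by
  have hx := E.counit_eq_zero x.2
  have hy := E.counit_eq_zero y.2
  have hz := E.counit_eq_zero z.2
  have dx := E.d_mem x x.2
  have dy := E.d_mem y y.2
  have dz := E.d_mem z z.2
  rw [E₃_d_tmul, map_add, map_add]
  have e₁ := eq_of_mem_map₂ (f := extProd (φ ∘ₗ face₁₂ k A) (φ ∘ₗ faceL k A) ∘ₗ midSwap.toLinearMap
      ∘ₗ (TensorProduct.mk k _ _).flip ((z : A) ⊗ₜ[k] (1 : A) + (1 : A) ⊗ₜ[k] (z : A))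
      ∘ₗ midSwap.toLinearMap
      ∘ₗ (TensorProduct.mk k _ _).flip ((y : A) ⊗ₜ[k] (1 : A) + (1 : A) ⊗ₜ[k] (y : A)))
    (g := extProd (sliceL φ y) (sliceL φ z)) (fun a _ b _ => by
      simp [face₁₂, faceL, hz, (h _).2,
        sliceL]) dx
  have e₂ := eq_of_mem_map₂ (f := extProd (φ ∘ₗ face₁₂ k A) (φ ∘ₗ faceL k A) ∘ₗ midSwap.toLinearMap
      ∘ₗ (TensorProduct.mk k _ _).flip ((z : A) ⊗ₜ[k] (1 : A) + (1 : A) ⊗ₜ[k] (z : A))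
      ∘ₗ midSwap.toLinearMap
      ∘ₗ TensorProduct.mk k _ _ ((x : A) ⊗ₜ[k] (1 : A) + (1 : A) ⊗ₜ[k] (x : A)))
    (g := extProd (sliceR φ x) (sliceL φ z)) (fun a _ b _ => by
      simp [face₁₂, faceL, hz, (h _).1,
        sliceL, sliceR]) dy
  have e₃ := eq_of_mem_map₂ (f := extProd (φ ∘ₗ face₁₂ k A) (φ ∘ₗ faceL k A) ∘ₗ midSwap.toLinearMap
      ∘ₗ TensorProduct.mk k _ _ (midSwap (((x : A) ⊗ₜ[k] (1 : A) + (1 : A) ⊗ₜ[k] (x : A))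
        ⊗ₜ[k] ((y : A) ⊗ₜ[k] (1 : A) + (1 : A) ⊗ₜ[k] (y : A))))) (g := 0) (fun a ha b _ => by
      simp [TensorProduct.add_tmul, TensorProduct.tmul_add, face₁₂, E.counit_eq_zero ha]) dz
  refine (congrArg₂ _ (congrArg₂ _ e₁ e₂) e₃).trans ?_
  simp

theorem extProd_face₂₃_faceR {φ : A ⊗[k] A →ₗ[k] k} (h : Normalized φ) (x y z : E.P) :
    extProd (φ ∘ₗ face₂₃ k A) (φ ∘ₗ faceR k A)
      (E.E₃.d (((x : A) ⊗ₜ[k] (y : A)) ⊗ₜ[k] (z : A)))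
      = extProd (sliceL φ z) (sliceR φ x) (E.d y) + extProd (sliceR φ y) (sliceR φ x) (E.d z) := by
  have hx := E.counit_eq_zero x.2
  have dx := E.d_mem x x.2
  have dy := E.d_mem y y.2
  have dz := E.d_mem z z.2
  rw [E₃_d_tmul, map_add, map_add]
  have e₁ := eq_of_mem_map₂ (f := extProd (φ ∘ₗ face₂₃ k A) (φ ∘ₗ faceR k A) ∘ₗ midSwap.toLinearMap
      ∘ₗ (TensorProduct.mk k _ _).flip ((z : A) ⊗ₜ[k] (1 : A) + (1 : A) ⊗ₜ[k] (z : A))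
      ∘ₗ midSwap.toLinearMap
      ∘ₗ (TensorProduct.mk k _ _).flip ((y : A) ⊗ₜ[k] (1 : A) + (1 : A) ⊗ₜ[k] (y : A)))
    (g := 0) (fun a ha b _ => by
      simp [face₂₃, E.counit_eq_zero ha]) dx
  have e₂ := eq_of_mem_map₂ (f := extProd (φ ∘ₗ face₂₃ k A) (φ ∘ₗ faceR k A) ∘ₗ midSwap.toLinearMap
      ∘ₗ (TensorProduct.mk k _ _).flip ((z : A) ⊗ₜ[k] (1 : A) + (1 : A) ⊗ₜ[k] (z : A))
      ∘ₗ midSwap.toLinearMap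
      ∘ₗ TensorProduct.mk k _ _ ((x : A) ⊗ₜ[k] (1 : A) + (1 : A) ⊗ₜ[k] (x : A)))
    (g := extProd (sliceL φ z) (sliceR φ x)) (fun a _ b _ => by
      simp [face₂₃, faceR, hx, (h _).2,
        sliceL, sliceR]) dy
  have e₃ := eq_of_mem_map₂ (f := extProd (φ ∘ₗ face₂₃ k A) (φ ∘ₗ faceR k A) ∘ₗ midSwap.toLinearMap
      ∘ₗ TensorProduct.mk k _ _ (midSwap (((x : A) ⊗ₜ[k] (1 : A) + (1 : A) ⊗ₜ[k] (x : A))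
        ⊗ₜ[k] ((y : A) ⊗ₜ[k] (1 : A) + (1 : A) ⊗ₜ[k] (y : A)))))
    (g := extProd (sliceR φ y) (sliceR φ x)) (fun a ha b _ => by
      simp [TensorProduct.add_tmul, TensorProduct.tmul_add, face₂₃, faceR, hx, (h _).1, sliceR]) dz
  refine (congrArg₂ _ (congrArg₂ _ e₁ e₂) e₃).trans ?_
  simp

theorem defect_tmul {φ : E.E₂.V} (h : Normalized φ.1) (x y z : E.P) :
    (defect φ).1 (((x : A) ⊗ₜ[k] (y : A)) ⊗ₜ[k] (z : A))
      = φ.1 (((x : A) * (y : A)) ⊗ₜ[k] (z : A)) - φ.1 ((x : A) ⊗ₜ[k] ((y : A) * (z : A)))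
        + (2 : k)⁻¹ * (extProd (sliceL φ.1 y) (sliceL φ.1 z) (E.d x)
          + extProd (sliceR φ.1 x) (sliceL φ.1 z) (E.d y)
          - (extProd (sliceL φ.1 z) (sliceR φ.1 x) (E.d y)
            + extProd (sliceR φ.1 y) (sliceR φ.1 x) (E.d z))) := by
  have hC : ((x : A) ⊗ₜ[k] (y : A)) ⊗ₜ[k] (z : A) ∈ E.E₃.C 3 := by
    rw [C_tensor]
    refine tmul_mem_tensorFilt (i := 2) (j := 1) le_rfl ?_ (E.mem_C_one z.2)
    rw [C_tensor]
    exact tmul_mem_tensorFilt (i := 1) (j := 1) le_rfl (E.mem_C_one x.2) (E.mem_C_one y.2)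
  have hx := E.counit_eq_zero x.2
  have hz := E.counit_eq_zero z.2
  have g₁ := extProd_face₁₂_faceL h x y z
  have g₂ := extProd_face₂₃_faceR h x y z
  have f₁ : φ.1 (face₁₂ k A (((x : A) ⊗ₜ[k] (y : A)) ⊗ₜ[k] (z : A))) = 0 := by simp [face₁₂, hz]
  have f₂ : φ.1 (face₂₃ k A (((x : A) ⊗ₜ[k] (y : A)) ⊗ₜ[k] (z : A))) = 0 := by simp [face₂₃, hx]
  have f₃ : faceL k A (((x : A) ⊗ₜ[k] (y : A)) ⊗ₜ[k] (z : A))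
      = ((x : A) * (y : A)) ⊗ₜ[k] (z : A) := by
    simp [faceL]
  have f₄ : faceR k A (((x : A) ⊗ₜ[k] (y : A)) ⊗ₜ[k] (z : A))
      = (x : A) ⊗ₜ[k] ((y : A) * (z : A)) := by
    simp [faceR]
  have e := bch_pull_apply (isPoisson_face₁₂ E) (isPoisson_faceL E) (isPoisson_face₂₃ E)
    (isPoisson_faceR E) (φ := φ) hC g₁ g₂
  rw [f₁, f₂, f₃, f₄] at e
  refine e.trans ?_
  ring

/-- The antisymmetrization of the leading term of the defect vanishes if the restriction of the
function to the primitive elements is an antisymmetric solution of the classical Yang-Baxter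
equation. -/
theorem alt₃_defect {φ : E.E₂.V} (h : Normalized φ.1)
    (hskew : ∀ x y : E.P, φ.1 ((x : A) ⊗ₜ[k] (y : A)) = -φ.1 ((y : A) ⊗ₜ[k] (x : A)))
    (hcyb : ∀ x y z : E.P,
      φ.1 (((x : A) * y - y * x) ⊗ₜ[k] (z : A)) + φ.1 (((y : A) * z - z * y) ⊗ₜ[k] (x : A))
      + φ.1 (((z : A) * x - x * z) ⊗ₜ[k] (y : A))
      + 2 * (extProd (sliceL φ.1 y) (sliceL φ.1 z) (E.d x)
        + extProd (sliceL φ.1 z) (sliceL φ.1 x) (E.d y)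
        + extProd (sliceL φ.1 x) (sliceL φ.1 y) (E.d z)) = 0) (x y z : E.P) :
    alt₃ (sym₃ 3 (defect φ).1) x y z = 0 := by
  have hR : ∀ x w : E.P, sliceR φ.1 x w = -sliceL φ.1 x w := fun x w => hskew x w
  have hRL : ∀ (x : E.P) (ψ : A →ₗ[k] k) (w : E.P),
      extProd (sliceR φ.1 x) ψ (E.d w) = -extProd (sliceL φ.1 x) ψ (E.d w) := by
    intro x ψ w
    refine eq_of_mem_map₂ (g := -extProd (sliceL φ.1 x) ψ) (fun a ha b _ => ?_) (E.d_mem w w.2)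
    rw [LinearMap.neg_apply, extProd_tmul, extProd_tmul, hR x ⟨a, ha⟩, neg_mul]
  have hLR : ∀ (x : E.P) (ψ : A →ₗ[k] k) (w : E.P),
      extProd ψ (sliceR φ.1 x) (E.d w) = -extProd ψ (sliceL φ.1 x) (E.d w) := by
    intro x ψ w
    refine eq_of_mem_map₂ (g := -extProd ψ (sliceL φ.1 x)) (fun a _ b hb => ?_) (E.d_mem w w.2)
    rw [LinearMap.neg_apply, extProd_tmul, extProd_tmul, hR x ⟨b, hb⟩, mul_neg]
  have hK : ∀ (ψ χ : A →ₗ[k] k) (w : E.P), extProd ψ χ (E.d w) = -extProd χ ψ (E.d w) := by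
    intro ψ χ w
    have h1 := LinearMap.congr_fun (E.pb_skew χ ψ) w
    rwa [LinearMap.neg_apply, pb_apply, pb_apply] at h1
  have hbr : ∀ x y z : E.P, φ.1 (((x : A) * y - y * x) ⊗ₜ[k] (z : A))
      = φ.1 (((x : A) * y) ⊗ₜ[k] (z : A)) - φ.1 (((y : A) * x) ⊗ₜ[k] (z : A)) := fun x y z => by
    rw [TensorProduct.sub_tmul, map_sub]
  have hbr' : ∀ x y z : E.P, φ.1 ((z : A) ⊗ₜ[k] ((x : A) * y)) - φ.1 ((z : A) ⊗ₜ[k] ((y : A) * x))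
      = φ.1 (((y : A) * x) ⊗ₜ[k] (z : A)) - φ.1 (((x : A) * y) ⊗ₜ[k] (z : A)) := fun x y z => by
    have := hskew z ⟨_, E.lie_mem x x.2 y y.2⟩
    rw [TensorProduct.tmul_sub, map_sub, hbr] at this
    rw [this]; ring
  have hs := sym₃_three (defect_one_left h) (fun v w => LinearMap.congr_fun (defect_one_middle h)
    (v ⊗ₜ[k] w)) (defect_one_right h) (E := E)
  simp only [alt₃, hs, defect_tmul h, hRL, hLR]
  have h0 := hcyb x y z
  simp only [hbr] at h0
  have i₁ := hbr' x y z
  have i₂ := hbr' y z x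
  have i₃ := hbr' z x y
  have k₁ := hK (sliceL φ.1 z) (sliceL φ.1 y) x
  have k₂ := hK (sliceL φ.1 x) (sliceL φ.1 z) y
  have k₃ := hK (sliceL φ.1 y) (sliceL φ.1 x) z
  rw [k₁, k₂, k₃]
  linear_combination 12 * h0 - 6 * i₁ - 6 * i₂ - 6 * i₃

end DegreeThree

/-! ### The gauge action -/

section GaugeGroup

variable {k : Type*} [Field k] [CharZero k] {V : Type*} [LieRing V] [LieAlgebra k V]
  [CompleteLie k V]

theorem neg_bch_cancel (x y : V) : bch k (-x) (bch k x y) = y := by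
  rw [← bch_assoc, neg_bch, zero_bch]

theorem bch_left_comm {x y : V} (h : ⁅x, y⁆ = 0) (z : V) :
    bch k x (bch k y z) = bch k y (bch k x z) := by
  rw [← bch_assoc, bch_comm h, bch_assoc]

theorem gauge_twist {a b c ab bc abc f₁₂ fL f₂₃ fR : V}
    (h : bch k f₁₂ fL = bch k f₂₃ fR) (h₁ : ⁅f₁₂, c⁆ = 0) (h₂ : ⁅a, f₂₃⁆ = 0) (h₃ : ⁅a, bc⁆ = 0)
    (h₄ : ⁅a, b⁆ = 0) (h₅ : ⁅a, c⁆ = 0) :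
    bch k (bch k (bch k (bch k a b) f₁₂) (-ab)) (bch k (bch k (bch k ab c) fL) (-abc))
      = bch k (bch k (bch k (bch k b c) f₂₃) (-bc)) (bch k (bch k (bch k a bc) fR) (-abc)) := by
  simp only [bch_assoc, neg_bch_cancel]
  rw [bch_left_comm h₁, bch_left_comm h₃, neg_bch_cancel, ← bch_left_comm h₂, ← bch_left_comm h₅,
    ← bch_left_comm h₄, ← bch_assoc f₁₂, h, bch_assoc]

end GaugeGroup

section PullGauge

open PoissonEnv

variable {k : Type*} [Field k] [CharZero k] {A₁ : Type*} [Ring A₁] [Bialgebra k A₁] {A₂ : Type*}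
  [Ring A₂] [Bialgebra k A₂] {A₃ : Type*} [Ring A₃] [Bialgebra k A₃] {E₁ : PoissonEnv k A₁}
  {E₂ : PoissonEnv k A₂} {E₃ : PoissonEnv k A₃} {p₁ p₂ m : A₂ →ₗ[k] A₁} (h₁ : IsPoisson E₂ E₁ p₁)
  (h₂ : IsPoisson E₂ E₁ p₂) (hm : IsPoisson E₂ E₁ m)

/-- The gauge transform `lam¹ ⋆ lam² ⋆ φ ⋆ (-lam)¹²`, for any three morphisms in the place of the
two projections and of the product. -/
noncomputable def gaugeBy (lam : E₁.V) (φ : E₂.V) : E₂.V :=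
  bch k (bch k (bch k (pull h₁ lam) (pull h₂ lam)) φ) (-pull hm lam)

theorem gaugeBy_zero (φ : E₂.V) : gaugeBy h₁ h₂ hm 0 φ = φ := by
  rw [gaugeBy, map_zero, map_zero, map_zero, zero_bch, zero_bch, neg_zero, bch_zero]

theorem pull_gaugeBy {j : A₃ →ₗ[k] A₂} (hj : IsPoisson E₃ E₂ j) (lam : E₁.V) (φ : E₂.V) :
    pull hj (gaugeBy h₁ h₂ hm lam φ)
      = bch k (bch k (bch k (pull (h₁.comp hj) lam) (pull (h₂.comp hj) lam)) (pull hj φ))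
        (-pull (hm.comp hj) lam) := by
  simp only [gaugeBy, pull_bch, map_neg, pull_pull]

theorem gaugeBy_comp_eq_zero {j : A₃ →ₗ[k] A₂} (hj : IsPoisson E₃ E₂ j) {lam : E₁.V} {φ : E₂.V}
    (hφ : φ.1 ∘ₗ j = 0) {a b c : E₃.V} (ha : lam.1 ∘ₗ p₁ ∘ₗ j = a.1) (hb : lam.1 ∘ₗ p₂ ∘ₗ j = b.1)
    (hc : lam.1 ∘ₗ m ∘ₗ j = c.1) (h : bch k a b = c) :
    (gaugeBy h₁ h₂ hm lam φ).1 ∘ₗ j = 0 := by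
  have ea : pull (h₁.comp hj) lam = a := Subtype.ext ha
  have eb : pull (h₂.comp hj) lam = b := Subtype.ext hb
  have ec : pull (hm.comp hj) lam = c := Subtype.ext hc
  have e : pull hj φ = 0 := Subtype.ext hφ
  rw [← pull_val hj, pull_gaugeBy, ea, eb, ec, e, bch_zero, h, bch_neg]
  rfl

include h₁ h₂ hm in
theorem gaugeBy_congr {M : ℕ} {lam mu : E₁.V} (h : lam - mu ∈ filt k (M + 1)) (φ : E₂.V) :
    gaugeBy h₁ h₂ hm lam φ - gaugeBy h₁ h₂ hm mu φ ∈ filt k (M + 1) := by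
  have hp : ∀ {m : A₂ →ₗ[k] A₁} (hm : IsPoisson E₂ E₁ m),
      pull hm lam - pull hm mu ∈ filt k (M + 1) := fun hm => by
    rw [← map_sub]; exact pull_mem_filt hm h
  refine bch_congr (bch_congr (bch_congr (hp h₁) (hp h₂)) ?_) ?_
  · rw [sub_self]; exact Submodule.zero_mem _
  · have := Submodule.neg_mem _ (hp hm)
    rwa [neg_sub'] at this

theorem gaugeBy_perturb {M : ℕ} {lam eta : E₁.V} (h : eta ∈ filt k (M + 1)) (φ : E₂.V) :
    gaugeBy h₁ h₂ hm (lam + eta) φ - gaugeBy h₁ h₂ hm lam φ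
      - (pull h₁ eta + pull h₂ eta - pull hm eta) ∈ filt k (M + 2) := by
  have g₁ := pull_mem_filt h₁ h
  have g₂ := pull_mem_filt h₂ h
  have g₃ := pull_mem_filt hm h
  have e₁ := bch_add_add (x := pull h₁ lam) (y := pull h₂ lam) g₁ g₂
  have e₂ := bch_perturb (y := φ) (y' := φ) (μ := 0) e₁
    (by rw [sub_self, sub_self]; exact Submodule.zero_mem _) (Submodule.add_mem _ g₁ g₂)
    (Submodule.zero_mem _)
  rw [add_zero] at e₂
  have e₃ := bch_perturb (y := -pull hm lam + -pull hm eta) (y' := -pull hm lam)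
    (μ := -pull hm eta) e₂
    (by rw [add_sub_cancel_left, sub_self]; exact Submodule.zero_mem _)
    (Submodule.add_mem _ g₁ g₂) (Submodule.neg_mem _ g₃)
  rw [gaugeBy, gaugeBy, map_add, map_add, map_add, neg_add, sub_eq_add_neg (_ + _) (pull hm eta)]
  exact e₃

theorem gaugeBy_perturb_symbol {M : ℕ} {lam eta : E₁.V} (h : eta ∈ filt k (M + 1)) (φ : E₂.V)
    {ψ : E₂.V} (hψ : gaugeBy h₁ h₂ hm lam φ - ψ ∈ filt k (M + 1))
    (hs : ∀ t ∈ E₂.P, (gaugeBy h₁ h₂ hm lam φ - ψ).1 (t ^ (M + 2))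
      = -(eta.1 (p₁ t ^ (M + 2)) + eta.1 (p₂ t ^ (M + 2)) - eta.1 (m t ^ (M + 2)))) :
    gaugeBy h₁ h₂ hm (lam + eta) φ - ψ ∈ filt k (M + 2) := by
  have e := gaugeBy_perturb h₁ h₂ hm (lam := lam) h φ
  have g₁ := pull_mem_filt h₁ h
  have g₂ := pull_mem_filt h₂ h
  have g₃ := pull_mem_filt hm h
  have e' : (gaugeBy h₁ h₂ hm lam φ - ψ) + (pull h₁ eta + pull h₂ eta - pull hm eta)
      ∈ filt k (M + 2) := by
    refine mem_filt.mpr (mem_F_succ_of_symbol (mem_filt.mp (Submodule.add_mem _ hψ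
      (Submodule.sub_mem _ (Submodule.add_mem _ g₁ g₂) g₃))) fun t ht => ?_)
    have hc : ∀ {m : A₂ →ₗ[k] A₁}, IsPoisson E₂ E₁ m →
        eta.1 (m t ^ (M + 2)) = eta.1 (m (t ^ (M + 2))) :=
      fun hm => (symbol_comp hm.toIsFilt (mem_filt.mp h) ht).symm
    have h0 := hs t ht
    rw [hc h₁, hc h₂, hc hm] at h0
    change (gaugeBy h₁ h₂ hm lam φ - ψ).1 (t ^ (M + 2)) + (eta.1 (p₁ (t ^ (M + 2)))
      + eta.1 (p₂ (t ^ (M + 2))) - eta.1 (m (t ^ (M + 2)))) = 0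
    rw [h0, neg_add_cancel]
  have := Submodule.add_mem _ e e'
  convert this using 1
  abel

variable {f₁₂ f₂₃ fL fR : A₃ →ₗ[k] A₂} {q₁ q₃ : A₃ →ₗ[k] A₁} (j₁₂ : IsPoisson E₃ E₂ f₁₂)
  (j₂₃ : IsPoisson E₃ E₂ f₂₃) (jL : IsPoisson E₃ E₂ fL) (jR : IsPoisson E₃ E₂ fR)
  (l₁ : IsPoisson E₃ E₁ q₁) (l₃ : IsPoisson E₃ E₁ q₃)

theorem bch_pull_gaugeBy (e₁ : p₁ ∘ₗ f₁₂ = q₁) (e₂ : p₁ ∘ₗ fL = m ∘ₗ f₁₂) (e₃ : p₂ ∘ₗ fL = q₃)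
    (e₄ : p₁ ∘ₗ f₂₃ = p₂ ∘ₗ f₁₂) (e₅ : p₂ ∘ₗ f₂₃ = q₃) (e₆ : p₁ ∘ₗ fR = q₁)
    (e₇ : p₂ ∘ₗ fR = m ∘ₗ f₂₃) (e₈ : m ∘ₗ fR = m ∘ₗ fL) (lam : E₁.V) (φ : E₂.V)
    (hφ : bch k (pull j₁₂ φ) (pull jL φ) = bch k (pull j₂₃ φ) (pull jR φ))
    (c₁ : ∀ ψ : E₂.V, ⁅pull l₁ lam, pull j₂₃ ψ⁆ = 0) (c₃ : ⁅pull j₁₂ φ, pull l₃ lam⁆ = 0) :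
    bch k (pull j₁₂ (gaugeBy h₁ h₂ hm lam φ)) (pull jL (gaugeBy h₁ h₂ hm lam φ))
      = bch k (pull j₂₃ (gaugeBy h₁ h₂ hm lam φ)) (pull jR (gaugeBy h₁ h₂ hm lam φ)) := by
  have d₁ := c₁ (pull h₁ lam)
  have d₂ := c₁ (pull h₂ lam)
  have d₃ := c₁ (pull hm lam)
  rw [pull_pull] at d₁ d₂ d₃
  rw [pull_congr e₄ _ (h₂.comp j₁₂)] at d₁
  rw [pull_congr e₅ _ l₃] at d₂
  simp only [pull_gaugeBy]
  rw [pull_congr e₁ _ l₁, pull_congr e₂ _ (hm.comp j₁₂), pull_congr e₃ _ l₃,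
    pull_congr e₄ _ (h₂.comp j₁₂), pull_congr e₅ _ l₃, pull_congr e₆ _ l₁,
    pull_congr e₇ _ (hm.comp j₂₃), pull_congr e₈ _ (hm.comp jL)]
  exact gauge_twist hφ c₃ (c₁ φ) d₃ d₁ d₂

end PullGauge

section Gauge

open PoissonEnv

variable {k : Type*} [Field k] [CharZero k] {A : Type*} [Ring A] [Bialgebra k A]
  {E : PoissonEnv k A}

/-- The gauge action on functions of two variables. -/
noncomputable def gauge (lam : E.V) (φ : E.E₂.V) : E.E₂.V :=
  gaugeBy (isPoisson_projL (E₁ := E) (E₂ := E)) (isPoisson_projR (E₁ := E) (E₂ := E))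
    (isPoisson_mul' E) lam φ

theorem Normalized.gauge {φ : E.E₂.V} (h : Normalized φ.1) (lam : E.V) :
    Normalized (gauge lam φ).1 := by
  intro u
  constructor
  · have hj := (isMor_incl₂ (E₁ := E) (E₂ := E)).isPoisson
    refine LinearMap.congr_fun (gaugeBy_comp_eq_zero _ _ _ hj (a := 0) (b := lam) (c := lam)
      ?_ ?_ ?_ ?_ (zero_bch lam)) u
    · ext v
      exact (h v).1
    · ext v
      have h1 : lam.1 1 = 0 := (mem_F_two.mp lam.2).1
      simp [incl₂_apply, h1]
    · ext v
      simp [incl₂_apply]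
    · ext v
      simp [incl₂_apply]
  · have hj := (isMor_incl₁ (E₁ := E) (E₂ := E)).isPoisson
    refine LinearMap.congr_fun (gaugeBy_comp_eq_zero _ _ _ hj (a := lam) (b := 0) (c := lam)
      ?_ ?_ ?_ ?_ (bch_zero lam)) u
    · ext v
      exact (h v).2
    · ext v
      simp [incl₁_apply]
    · ext v
      have h1 : lam.1 1 = 0 := (mem_F_two.mp lam.2).1
      simp [incl₁_apply, h1]
    · ext v
      simp [incl₁_apply]

theorem defect_eq_zero_iff {φ : E.E₂.V} : defect φ = 0 ↔
    bch k (pull (isPoisson_face₁₂ E) φ) (pull (isPoisson_faceL E) φ)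
      = bch k (pull (isPoisson_face₂₃ E) φ) (pull (isPoisson_faceR E) φ) := sub_eq_zero

/-- The transpose of the pull-back along `(a, b, c) ↦ a`. -/
noncomputable def pr₁ (k A : Type*) [Field k] [Ring A] [Bialgebra k A] :
    (A ⊗[k] A) ⊗[k] A →ₗ[k] A :=
  projL k A (A ⊗[k] A) ∘ₗ (TensorProduct.assoc k A A A).toLinearMap

theorem isPoisson_pr₁ : IsPoisson E.E₃ E (pr₁ k A) :=
  (isPoisson_projL (E₁ := E) (E₂ := E.E₂)).comp isPoisson_assoc

/-- The transpose of the pull-back along `(a, b, c) ↦ c`. -/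
noncomputable def pr₃ (k A : Type*) [Field k] [Ring A] [Bialgebra k A] :
    (A ⊗[k] A) ⊗[k] A →ₗ[k] A := projR k (A ⊗[k] A) A

theorem isPoisson_pr₃ : IsPoisson E.E₃ E (pr₃ k A) := isPoisson_projR

theorem lie_pr₁_face₂₃ (lam : E.V) (φ : E.E₂.V) :
    ⁅pull (isPoisson_pr₁ (E := E)) lam, pull (isPoisson_face₂₃ E) φ⁆ = 0 := by
  have ha : IsPoisson E.E₃ (E.tensor E.E₂) (TensorProduct.assoc k A A A).toLinearMap :=
    isPoisson_assoc
  have h1 := congrArg (pull ha) (lie_projL_projR (E₁ := E) (E₂ := E.E₂) lam φ)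
  rw [pull_lie, map_zero] at h1
  have e : pull (isPoisson_face₂₃ E) φ
      = pull ha (pull (isPoisson_projR (E₁ := E) (E₂ := E.E₂)) φ) :=
    Subtype.ext (by rw [pull_val, pull_val, pull_val, face₂₃, LinearMap.comp_assoc])
  rw [e]
  exact h1

theorem lie_face₁₂_pr₃ (lam : E.V) (φ : E.E₂.V) :
    ⁅pull (isPoisson_face₁₂ E) φ, pull (isPoisson_pr₃ (E := E)) lam⁆ = 0 := by
  have e : pull (isPoisson_face₁₂ E) φ = pull (isPoisson_projL (E₁ := E.E₂) (E₂ := E)) φ :=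
    Subtype.ext (by rw [pull_val, pull_val, face₁₂])
  rw [e]
  exact lie_projL_projR φ lam

/-- Gauge transforms of twists are twists. -/
theorem defect_gauge {φ : E.E₂.V} (h : defect φ = 0) (lam : E.V) : defect (gauge lam φ) = 0 := by
  refine defect_eq_zero_iff.mpr (bch_pull_gaugeBy _ _ _ (isPoisson_face₁₂ E) (isPoisson_face₂₃ E)
    (isPoisson_faceL E) (isPoisson_faceR E) (isPoisson_pr₁ (E := E)) (isPoisson_pr₃ (E := E))
    ?_ ?_ ?_ ?_ ?_ ?_ ?_ ?_ lam φ (defect_eq_zero_iff.mp h) (lie_pr₁_face₂₃ lam)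
    (lie_face₁₂_pr₃ lam φ)) <;>
  · ext a b c
    simp [pr₁, pr₃, face₁₂, face₂₃, faceL, faceR, smul_smul, mul_comm, mul_assoc]

theorem pt₂_self (x : E.P) : pt₂ x x = Coalgebra.comul (R := k) (x : A) := by
  rw [E.prim x x.2]; rfl

/-- The difference of two twists is, to first order, a coboundary, so that it can be removed by a
gauge transformation. -/
theorem exists_gauge_succ {M : ℕ} (hM : 1 ≤ M) {φ ψ : E.E₂.V} (hφ : defect φ = 0)
    (hψ : defect ψ = 0) {lam : E.V} (h : gauge lam φ - ψ ∈ filt k (M + 1)) :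
    ∃ mu : E.V, gauge mu φ - ψ ∈ filt k (M + 2) ∧ mu - lam ∈ filt k (M + 1) := by
  have hpow : ∀ j, j < 3 → ((2 : k) ^ (M + 2) ≠ 2 ^ j) := by
    intro j hj h
    have : (2 : ℕ) ^ (M + 2) = 2 ^ j := by exact_mod_cast h
    have := Nat.pow_right_injective (le_refl 2) this
    omega
  set D : E.E₂.V := gauge lam φ - ψ with hD
  have hs : ∀ x y : E.P, sym₂ (M + 2) D.1 (x + x) (y + y) = 2 ^ (M + 2) * sym₂ (M + 2) D.1 x y := by
    intro x y
    have h1 : pt₂ (x + x) (y + y) = (2 : k) • pt₂ x y := by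
      simp only [pt₂, Submodule.coe_add, map_add, smul_add, two_smul]
    rw [sym₂, h1, smul_pow, map_smul]
    rfl
  have hc : ∀ x y z : E.P, cobd₂ (sym₂ (M + 2) D.1) x y z = 0 := by
    intro x y z
    obtain ⟨-, h2⟩ := bch_pull_perturb (isPoisson_face₁₂ E) (isPoisson_faceL E)
      (isPoisson_face₂₃ E) (isPoisson_faceR E) h (φ := ψ) (Φ := defect ψ)
      (Φ' := defect (ψ + D)) rfl rfl (by rw [hψ]; exact Submodule.zero_mem _)
    have h3 := h2 (pt₃_mem x y z) (face₁₂_pt x y z) (faceL_pt x y z) (face₂₃_pt x y z)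
      (faceR_pt x y z)
    rw [hψ, hD, add_sub_cancel, defect_gauge hφ] at h3
    change (0 : k) = 0 + (sym₂ (M + 2) D.1 x y + sym₂ (M + 2) D.1 (x + y) z
      - (sym₂ (M + 2) D.1 y z + sym₂ (M + 2) D.1 x (y + z))) at h3
    simp only [cobd₂]
    linear_combination h3
  have hcb := cocycle₂_eq hc hs (by simpa using hpow 1 (by norm_num))
    (by have := hpow 2 (by norm_num); norm_num at this; exact this)
  have hF := isFilt_comul (E₁ := E).comp_mem (mem_filt.mp h)
  -- the restriction of the leading term to the diagonal is the symbol of its pull-back along the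
  -- diagonal map, whose transpose is the coproduct
  let eta : E.V := -((2 : k) - 2 ^ (M + 2))⁻¹ •
    ⟨D.1 ∘ₗ Coalgebra.comul (R := k), E.F_anti (by omega) hF⟩
  have heta : eta ∈ filt k (M + 1) := mem_filt.mpr (Submodule.smul_mem _ _ hF)
  have hval : ∀ x : E.P, eta.1 ((x : A) ^ (M + 2))
      = -((2 : k) - 2 ^ (M + 2))⁻¹ * sym₂ (M + 2) D.1 x x := by
    intro x
    have h1 := symbol_comp (isFilt_comul (E₁ := E)) (mem_filt.mp h) x.2
    rw [← pt₂_self] at h1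
    exact congrArg (fun r => -((2 : k) - 2 ^ (M + 2))⁻¹ * r) h1
  refine ⟨lam + eta, gaugeBy_perturb_symbol _ _ _ heta φ h fun t ht => ?_, by
    rw [add_sub_cancel_left]; exact heta⟩
  obtain ⟨x, y, rfl⟩ := exists_pt₂ ht
  have h1 : projL k A A (pt₂ x y) = x := projL_incl y.2
  have h2 : projR k A A (pt₂ x y) = y := projR_incl x.2
  have h3 : LinearMap.mul' k A (pt₂ x y) = (x + y : E.P) := mul'_incl _ _
  rw [h1, h2, h3, hval, hval, hval]
  refine (hcb x y).trans ?_
  rw [div_eq_mul_inv]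
  ring

/-- Two twists which agree to second order are related by a gauge transformation. -/
theorem exists_gauge_eq {φ ψ : E.E₂.V} (hφ : defect φ = 0) (hψ : defect ψ = 0)
    (h : φ - ψ ∈ filt k 2) : ∃ lam : E.V, gauge lam φ = ψ := by
  obtain ⟨l, -, hl⟩ := exists_limit_of_step (k := k) (V := E.V) (x₀ := 0)
    (p := fun n lam => gauge lam φ - ψ ∈ filt k (n + 2))
    (by rw [gauge, gaugeBy_zero]; exact h)
    fun n lam h => exists_gauge_succ (by omega : 1 ≤ n + 1) hφ hψ h
  refine ⟨l, sub_eq_zero.mp (eq_zero_of_forall_mem_filt fun n => ?_)⟩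
  obtain ⟨x, hx, hlx⟩ := hl n
  have h1 : gauge l φ - gauge x φ ∈ filt k (n + 1) := gaugeBy_congr _ _ _ hlx φ
  have h2 := Submodule.add_mem _ h1 (CompleteLie.anti (k := k) (by omega : n + 1 ≤ n + 2) hx)
  rwa [sub_add_sub_cancel] at h2

end Gauge

/-! ### The square of the maximal ideal -/

section SquareIdeal

open PoissonEnv

variable {k : Type*} [Field k] [CharZero k] {A : Type*} [Ring A] [Bialgebra k A]
  {E : PoissonEnv k A}

/-- The product of functions. -/
noncomputable def funMul (φ ψ : A →ₗ[k] k) : A →ₗ[k] k :=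
  extProd φ ψ ∘ₗ Coalgebra.comul (R := k)

theorem funMul_pow {φ ψ : A →ₗ[k] k} {x : A} (hx : x ∈ E.P) (n : ℕ) : funMul φ ψ (x ^ n)
    = ∑ i ∈ Finset.range (n + 1), (n.choose i : k) * (φ (x ^ i) * ψ (x ^ (n - i))) := by
  have h : Coalgebra.comul (R := k) (x ^ n) = (incl₁ k A A x + incl₂ k A A x) ^ n := by
    rw [Bialgebra.comul_pow, E.prim x hx]; rfl
  rw [funMul, LinearMap.comp_apply, h, incl_add_pow, map_sum]
  refine Finset.sum_congr rfl fun i _ => ?_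
  rw [map_nsmul, extProd_tmul, nsmul_eq_mul]

theorem funMul_mem {φ ψ : A →ₗ[k] k} {m n : ℕ} (hφ : φ ∈ E.F m) (hψ : ψ ∈ E.F n) :
    funMul φ ψ ∈ E.F (m + n) := by
  rw [mem_F]
  intro l hl u hu
  have h1 := (isFilt_comul (E₁ := E)).mem_C l u hu
  rw [C_tensor, tensorFilt] at h1
  rw [funMul, LinearMap.comp_apply]
  generalize Coalgebra.comul (R := k) u = t at h1
  induction h1 using Submodule.span_induction with
  | mem t ht =>
    obtain ⟨i, j, a, b, hij, ha, hb, rfl⟩ := ht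
    rw [extProd_tmul]
    rcases lt_or_ge i m with h | h
    · rw [mem_F.mp hφ i h a ha, zero_mul]
    · rw [mem_F.mp hψ j (by omega) b hb, mul_zero]
  | zero => rw [map_zero]
  | add s t _ _ hs ht => rw [map_add, hs, ht, add_zero]
  | smul r t _ ht => rw [map_smul, ht, smul_zero]

theorem mem_F_one {φ : A →ₗ[k] k} (h : φ 1 = 0) : φ ∈ E.F 1 := by
  rw [mem_F_succ, C, pow_zero]
  intro u hu
  obtain ⟨r, rfl⟩ := Submodule.mem_one.mp hu
  rw [Algebra.algebraMap_eq_smul_one, map_smul, h, smul_zero]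

theorem comp_mulRight_mem {φ : A →ₗ[k] k} {n : ℕ} (h : φ ∈ E.F (n + 1)) {y : A} (hy : y ∈ E.P) :
    φ ∘ₗ LinearMap.mulRight k y ∈ E.F n :=
  mem_F.mpr fun m hm u hu => mem_F.mp h (m + 1) (by omega) _ (E.mul_mem_C hu (E.mem_C_one hy))

variable {I : Type*} [Fintype I] {e : I → A} {X : I → A →ₗ[k] k}

/-- Euler's formula: to first order, a function is the combination of the coordinates with its
partial derivatives as coefficients. -/
theorem sub_euler_mem (he : ∀ i, e i ∈ E.P) (hX : ∀ i, X i 1 = 0)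
    (hb : ∀ x ∈ E.P, ∑ i, X i x • e i = x) {n : ℕ} {φ : A →ₗ[k] k} (h : φ ∈ E.F (n + 1)) :
    φ - ∑ i, funMul (X i) (((n : k) + 1)⁻¹ • (φ ∘ₗ LinearMap.mulRight k (e i)))
      ∈ E.F (n + 1 + 1) := by
  have hd : ∀ i, φ ∘ₗ LinearMap.mulRight k (e i) ∈ E.F n := fun i => comp_mulRight_mem h (he i)
  have hval : ∀ x ∈ E.P, ∀ i, funMul (X i) (((n : k) + 1)⁻¹ • (φ ∘ₗ LinearMap.mulRight k (e i)))
      (x ^ (n + 1)) = X i x * φ (x ^ n * e i) := by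
    intro x hx i
    have hn : ((n : k) + 1) ≠ 0 := by exact_mod_cast Nat.succ_ne_zero n
    rw [funMul_pow hx, Finset.sum_eq_single 1]
    · rw [Nat.choose_one_right, Nat.add_sub_cancel, pow_one, LinearMap.smul_apply,
        LinearMap.comp_apply, LinearMap.mulRight_apply, smul_eq_mul]
      push_cast
      field_simp
    · intro j hj hj1
      rcases Nat.lt_or_gt_of_ne hj1 with h0 | h0
      · have : j = 0 := by omega
        subst this
        rw [pow_zero, hX, zero_mul, mul_zero]
      · have hj' := Finset.mem_range.mp hj
        rw [LinearMap.smul_apply, mem_F.mp (hd i) (n + 1 - j) (by omega) _ (E.pow_mem_C hx _),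
          smul_zero, mul_zero, mul_zero]
    · intro hj
      exact absurd (Finset.mem_range.mpr (by omega)) hj
  have h0 : ∀ i, funMul (X i) (((n : k) + 1)⁻¹ • (φ ∘ₗ LinearMap.mulRight k (e i)))
      ∈ E.F (n + 1) := by
    intro i
    have := funMul_mem (mem_F_one (E := E) (hX i)) (Submodule.smul_mem _ ((n : k) + 1)⁻¹ (hd i))
    rwa [add_comm 1 n] at this
  refine mem_F_succ_of_symbol (Submodule.sub_mem _ h (Submodule.sum_mem _ fun i _ => h0 i))
    fun x hx => ?_
  rw [LinearMap.sub_apply, LinearMap.sum_apply, Finset.sum_congr rfl fun i _ => hval x hx i]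
  have h1 : φ (x ^ (n + 1)) = ∑ i, X i x * φ (x ^ n * e i) := by
    have := congrArg (fun y => φ (x ^ n * y)) (hb x hx)
    simp only [Finset.mul_sum, map_sum, mul_smul_comm, map_smul, smul_eq_mul] at this
    rw [pow_succ, this]
  rw [h1, sub_self]

theorem sum_funMul_mem {M : I → A →ₗ[k] k} {n : ℕ} (hM : ∀ i, M i ∈ E.F n) :
    ∑ i, funMul (X i) (M i) ∈ E.F n :=
  Submodule.sum_mem _ fun i _ => by
    have := funMul_mem (m := 0) (mem_F.mpr fun m hm => absurd hm (Nat.not_lt_zero m)) (hM i)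
      (φ := X i)
    rwa [zero_add] at this

theorem funMul_add (φ ψ χ : A →ₗ[k] k) : funMul φ (ψ + χ) = funMul φ ψ + funMul φ χ := by
  ext u
  simp only [funMul, LinearMap.comp_apply, LinearMap.add_apply]
  generalize Coalgebra.comul (R := k) u = t
  induction t with
  | zero => simp
  | add a b ha hb => simp only [map_add, ha, hb]; ring
  | tmul a b => simp [mul_add]

/-- The functions that vanish to order two are combinations of the coordinates with coefficients
that vanish at the unit: the coefficients are the limits of the approximations given by Euler's
formula. -/
theorem exists_eq_sum_funMul (he : ∀ i, e i ∈ E.P) (hX : ∀ i, X i 1 = 0)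
    (hb : ∀ x ∈ E.P, ∑ i, X i x • e i = x) {φ : A →ₗ[k] k} (h : φ ∈ E.F 2) :
    ∃ M : I → A →ₗ[k] k, (∀ i, M i 1 = 0) ∧ φ = ∑ i, funMul (X i) (M i) := by
  have step : ∀ n (G : I → A →ₗ[k] k), φ - ∑ i, funMul (X i) (G i) ∈ E.F (n + 2) →
      ∃ G' : I → A →ₗ[k] k, φ - ∑ i, funMul (X i) (G' i) ∈ E.F (n + 1 + 2)
        ∧ ∀ i, G' i - G i ∈ E.F (n + 1) := by
    intro n G hG
    have hs := sub_euler_mem he hX hb hG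
    refine ⟨fun i => G i + (((n + 1 : ℕ) : k) + 1)⁻¹ •
      ((φ - ∑ i, funMul (X i) (G i)) ∘ₗ LinearMap.mulRight k (e i)), ?_, fun i => ?_⟩
    · simp only [funMul_add, Finset.sum_add_distrib, ← sub_sub]
      exact hs
    · rw [add_sub_cancel_left]
      exact Submodule.smul_mem _ _ (comp_mulRight_mem hG (he i))
  choose! S hS using step
  let G : ℕ → I → A →ₗ[k] k := fun n => Nat.rec (fun _ => 0) (fun n g => S n g) n
  have hG : ∀ n, φ - ∑ i, funMul (X i) (G n i) ∈ E.F (n + 2) := by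
    intro n
    induction n with
    | zero =>
      have h0 : ∑ i, funMul (X i) (G 0 i) = 0 := Finset.sum_eq_zero fun i _ => by
        have := funMul_add (X i) 0 0
        rw [add_zero] at this
        exact left_eq_add.mp this
      rw [h0, sub_zero]; exact h
    | succ n ih => exact (hS n _ ih).1
  have hl : ∀ i, ∃ l, ∀ n, l - G n i ∈ E.F (n + 1) := fun i =>
    E.exists_limit fun n => (hS n _ (hG n)).2 i
  choose M hM using hl
  refine ⟨M, fun i => ?_, ?_⟩
  · have := mem_F.mp (hM i 0) 0 (by omega) 1 (E.one_mem_C 0)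
    exact (sub_eq_zero.mp this)
  · ext u
    obtain ⟨n, hn⟩ := E.exists_mem_C u
    have h1 := sum_funMul_mem (X := X) fun i => hM i n
    have h2 : ∀ i, funMul (X i) (M i) = funMul (X i) (G n i) + funMul (X i) (M i - G n i) := by
      intro i
      rw [← funMul_add, add_sub_cancel]
    rw [Finset.sum_congr rfl fun i _ => h2 i, Finset.sum_add_distrib, LinearMap.add_apply,
      mem_F.mp h1 n (by omega) u hn, add_zero]
    have h3 := mem_F.mp (hG n) n (by omega) u hn
    exact sub_eq_zero.mp h3

end SquareIdeal

/-! ### The enveloping algebra of a Lie bialgebra -/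

section Env

open PoissonEnv

variable {k : Type*} [Field k] {L : Type*} [LieRing L] [LieAlgebra k L]

attribute [local instance] LieRing.ofAssociativeRing

theorem ιι_mem (t : L ⊗[k] L) : ιι t ∈ Submodule.map₂ (TensorProduct.mk k (U k L) (U k L))
    (UniversalEnvelopingAlgebra.ι k : L →ₗ⁅k⁆ U k L).toLinearMap.range
    (UniversalEnvelopingAlgebra.ι k : L →ₗ⁅k⁆ U k L).toLinearMap.range := by
  induction t with
  | zero => rw [map_zero]; exact Submodule.zero_mem _
  | add a b ha hb => rw [map_add]; exact Submodule.add_mem _ ha hb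
  | tmul a b => exact Submodule.apply_mem_map₂ _ ⟨a, rfl⟩ ⟨b, rfl⟩

theorem adjoin_range_ι : Algebra.adjoin k
    ((UniversalEnvelopingAlgebra.ι k : L →ₗ⁅k⁆ U k L).toLinearMap.range : Set (U k L)) = ⊤ := by
  set S := Algebra.adjoin k
    ((UniversalEnvelopingAlgebra.ι k : L →ₗ⁅k⁆ U k L).toLinearMap.range : Set (U k L)) with hS
  have hmem : ∀ x : L, UniversalEnvelopingAlgebra.ι k x ∈ S :=
    fun x => Algebra.subset_adjoin ⟨x, rfl⟩
  let g : L →ₗ⁅k⁆ S :=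
    { toFun := fun x => ⟨UniversalEnvelopingAlgebra.ι k x, hmem x⟩
      map_add' := fun x y => Subtype.ext (map_add _ x y)
      map_smul' := fun r x => Subtype.ext (map_smul _ r x)
      map_lie' := fun {x y} => Subtype.ext (LieHom.map_lie _ x y) }
  have h : S.val.comp (UniversalEnvelopingAlgebra.lift k g) = AlgHom.id k (U k L) :=
    algHom_ext_ι k L fun x => by
      rw [AlgHom.comp_apply, UniversalEnvelopingAlgebra.lift_ι_apply]; rfl
  refine eq_top_iff.mpr fun u _ => ?_
  have := DFunLike.congr_fun h u
  rw [AlgHom.comp_apply, AlgHom.id_apply] at this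
  rw [← this]
  exact (UniversalEnvelopingAlgebra.lift k g u).2

/-- The enveloping algebra of a Lie bialgebra, with its co-Poisson structure. -/
noncomputable def LieBialgebra.env (D : LieBialgebra k L) : PoissonEnv k (U k L) where
  P := (UniversalEnvelopingAlgebra.ι k : L →ₗ⁅k⁆ U k L).toLinearMap.range
  prim := by
    rintro _ ⟨x, rfl⟩
    exact comulU_ι k L x
  gen := adjoin_range_ι
  lie_mem := by
    rintro _ ⟨x, rfl⟩ _ ⟨y, rfl⟩
    exact ⟨⁅x, y⁆, LieHom.map_lie _ x y⟩
  d := D.coPoisson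
  d_mul := D.coPoisson_mul
  d_mem := by
    rintro _ ⟨x, rfl⟩
    rw [LieHom.coe_toLinearMap, D.coPoisson_ι]
    exact ιι_mem _
  antisymm := by
    rintro _ ⟨x, rfl⟩
    rw [LieHom.coe_toLinearMap, D.coPoisson_ι]
    exact comm_map_eq_neg _ (D.antisymm x)
  coJacobi := by
    rintro _ ⟨x, rfl⟩
    exact cycSum_rTensor_eq_zero
      (f := (UniversalEnvelopingAlgebra.ι k : L →ₗ⁅k⁆ U k L).toLinearMap) D.coPoisson_ι
      (D.coJacobi x)

theorem LieBialgebra.ι_mem (D : LieBialgebra k L) (x : L) :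
    UniversalEnvelopingAlgebra.ι k x ∈ D.env.P := ⟨x, rfl⟩

variable (k L) in
/-- The canonical map of a Lie algebra to its enveloping algebra, as a linear map. -/
noncomputable def ιLin : L →ₗ[k] U k L :=
  (UniversalEnvelopingAlgebra.ι k : L →ₗ⁅k⁆ U k L).toLinearMap

theorem ιLin_lie (x y : L) : ιLin k L ⁅x, y⁆ = ιLin k L x * ιLin k L y - ιLin k L y * ιLin k L x :=
  LieHom.map_lie _ x y

theorem LieBialgebra.env_d_ιLin (D : LieBialgebra k L) (x : L) :
    D.env.d (ιLin k L x) = TensorProduct.map (ιLin k L) (ιLin k L) (D.δ x) := D.coPoisson_ι x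

theorem sum_coord_smul_ι {I : Type*} [Fintype I] (b : Module.Basis I k L) {ρ : U k L →ₗ[k] L}
    (hρ : ∀ x, ρ (UniversalEnvelopingAlgebra.ι k x) = x) (x : L) :
    (UniversalEnvelopingAlgebra.ι k : L →ₗ⁅k⁆ U k L).toLinearMap x
      = ∑ i, (b.coord i ∘ₗ ρ) ((UniversalEnvelopingAlgebra.ι k : L →ₗ⁅k⁆ U k L).toLinearMap x)
        • UniversalEnvelopingAlgebra.ι k (b i) := by
  have h1 := congrArg (UniversalEnvelopingAlgebra.ι k : L →ₗ⁅k⁆ U k L).toLinearMap (b.sum_repr x)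
  rw [map_sum] at h1
  conv_lhs => rw [← h1]
  refine Finset.sum_congr rfl fun i _ => ?_
  rw [LinearMap.comp_apply, LieHom.coe_toLinearMap, hρ, map_smul]
  rfl

end Env

section IsStarTensor

variable {k : Type*} [Field k] [CharZero k] {A : Type*} [Ring A] [Bialgebra k A] {B : Type*}
  [Ring B] [Bialgebra k B] {E : PoissonEnv k A} {E' : PoissonEnv k B}

theorem isStar_tensor_iff {φ ψ : (E.tensor E').V} {χ : Fun k (A ⊗[k] B)} :
    IsStar k (Fun.poisson (coPoissonTensor E.d E'.d)) (WithConv.toConv φ.1) (WithConv.toConv ψ.1) χ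
      ↔ χ.ofConv = (bch k φ ψ).1 := by
  rw [← PoissonEnv.tensor_d]
  exact PoissonEnv.isStar_iff (E := E.tensor E') (φ := φ) (ψ := ψ) (χ := χ)

theorem isStar_tensor₃_iff {φ ψ : E.E₃.V} {χ : Fun k ((A ⊗[k] A) ⊗[k] A)} :
    IsStar k (Fun.poisson (coPoissonTensor (coPoissonTensor E.d E.d) E.d)) (WithConv.toConv φ.1)
      (WithConv.toConv ψ.1) χ ↔ χ.ofConv = (bch k φ ψ).1 := by
  rw [← PoissonEnv.tensor_d, ← PoissonEnv.tensor_d]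
  exact PoissonEnv.isStar_iff (E := E.E₃) (φ := φ) (ψ := ψ) (χ := χ)

open PoissonEnv Coalgebra

theorem exists_isStar_iff_defect_eq_zero {φ : E.E₂.V} {d : A →ₗ[k] A ⊗[k] A} (hd : E.d = d) :
    (∃ g : Fun k ((A ⊗[k] A) ⊗[k] A),
      IsStar k (Fun.poisson (coPoissonTensor (coPoissonTensor d d) d))
        (Fun.pull ((TensorProduct.rid k (A ⊗[k] A)).toLinearMap ∘ₗ
          (counit (R := k)).lTensor (A ⊗[k] A)) (WithConv.toConv φ.1))
        (Fun.pull ((LinearMap.mul' k A).rTensor A) (WithConv.toConv φ.1)) g ∧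
      IsStar k (Fun.poisson (coPoissonTensor (coPoissonTensor d d) d))
        (Fun.pull ((TensorProduct.lid k (A ⊗[k] A)).toLinearMap ∘ₗ
          (counit (R := k)).rTensor (A ⊗[k] A) ∘ₗ
          (TensorProduct.assoc k A A A).toLinearMap) (WithConv.toConv φ.1))
        (Fun.pull ((LinearMap.mul' k A).lTensor A ∘ₗ
          (TensorProduct.assoc k A A A).toLinearMap) (WithConv.toConv φ.1)) g)
      ↔ defect φ = 0 := by
  subst hd
  have h₁ : Fun.pull ((TensorProduct.rid k (A ⊗[k] A)).toLinearMap ∘ₗ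
      (counit (R := k)).lTensor (A ⊗[k] A)) (WithConv.toConv φ.1)
      = WithConv.toConv (pull (isPoisson_face₁₂ E) φ).1 := by
    rw [pull_val, face₁₂]; rfl
  have h₂ : Fun.pull ((LinearMap.mul' k A).rTensor A) (WithConv.toConv φ.1)
      = WithConv.toConv (pull (isPoisson_faceL E) φ).1 := by
    rw [pull_val, faceL]; rfl
  have h₃ : Fun.pull ((TensorProduct.lid k (A ⊗[k] A)).toLinearMap ∘ₗ
      (counit (R := k)).rTensor (A ⊗[k] A) ∘ₗ
      (TensorProduct.assoc k A A A).toLinearMap) (WithConv.toConv φ.1)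
      = WithConv.toConv (pull (isPoisson_face₂₃ E) φ).1 := by
    rw [pull_val, face₂₃]; rfl
  have h₄ : Fun.pull ((LinearMap.mul' k A).lTensor A ∘ₗ
      (TensorProduct.assoc k A A A).toLinearMap) (WithConv.toConv φ.1)
      = WithConv.toConv (pull (isPoisson_faceR E) φ).1 := by
    rw [pull_val, faceR]; rfl
  rw [defect_eq_zero_iff, h₁, h₂, h₃, h₄]
  simp only [isStar_tensor₃_iff]
  refine ⟨?_, fun h => ⟨WithConv.toConv _, rfl, congrArg Subtype.val h⟩⟩
  rintro ⟨g, hg, hg'⟩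
  exact Subtype.ext (hg.symm.trans hg')

theorem exists_isStar_iff_eq_gauge {lam : E.V} {φ : E.E₂.V} {g : Fun k (A ⊗[k] A)}
    {d : A →ₗ[k] A ⊗[k] A} (hd : E.d = d) :
    (∃ p q : Fun k (A ⊗[k] A),
      IsStar k (Fun.poisson (coPoissonTensor d d))
        (Fun.pull ((TensorProduct.rid k A).toLinearMap ∘ₗ (counit (R := k)).lTensor A)
          (WithConv.toConv lam.1))
        (Fun.pull ((TensorProduct.lid k A).toLinearMap ∘ₗ (counit (R := k)).rTensor A)
          (WithConv.toConv lam.1)) p ∧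
      IsStar k (Fun.poisson (coPoissonTensor d d)) p (WithConv.toConv φ.1) q ∧
      IsStar k (Fun.poisson (coPoissonTensor d d)) q
        (Fun.pull (LinearMap.mul' k A) (-WithConv.toConv lam.1)) g)
      ↔ g.ofConv = (gauge lam φ).1 := by
  subst hd
  have h₁ : Fun.pull ((TensorProduct.rid k A).toLinearMap ∘ₗ (counit (R := k)).lTensor A)
      (WithConv.toConv lam.1)
      = WithConv.toConv (pull (isPoisson_projL (E₁ := E) (E₂ := E)) lam).1 := rfl
  have h₂ : Fun.pull ((TensorProduct.lid k A).toLinearMap ∘ₗ (counit (R := k)).rTensor A)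
      (WithConv.toConv lam.1)
      = WithConv.toConv (pull (isPoisson_projR (E₁ := E) (E₂ := E)) lam).1 := rfl
  have h₃ : Fun.pull (LinearMap.mul' k A) (-WithConv.toConv lam.1)
      = WithConv.toConv (-pull (isPoisson_mul' E) lam).1 := rfl
  rw [h₁, h₂, h₃]
  constructor
  · rintro ⟨p, q, hp, hq, hg⟩
    obtain rfl : p = WithConv.toConv _ := congrArg WithConv.toConv (isStar_tensor_iff.mp hp)
    obtain rfl : q = WithConv.toConv _ := congrArg WithConv.toConv (isStar_tensor_iff.mp hq)
    exact isStar_tensor_iff.mp hg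
  · intro h
    exact ⟨WithConv.toConv _, WithConv.toConv _, isStar_tensor_iff.mpr rfl,
      isStar_tensor_iff.mpr rfl, isStar_tensor_iff.mpr h⟩

end IsStarTensor

section Env

open PoissonEnv

variable {k : Type*} [Field k] {L : Type*} [LieRing L] [LieAlgebra k L]

variable [CharZero k] (D : LieBialgebra k L)

theorem Normalized.mem_F_two {f : U k L ⊗[k] U k L →ₗ[k] k} (h : Normalized f) :
    f ∈ D.env.E₂.F 2 := by
  refine PoissonEnv.mem_F_two.mpr ⟨(h 1).1, fun t ht => ?_⟩
  obtain ⟨x, -, y, -, rfl⟩ := mem_tensorP.mp ht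
  rw [map_add, incl₁_apply, incl₂_apply, (h _).1, (h _).2, add_zero]

theorem isTwist_iff {φ : D.env.E₂.V} :
    D.IsTwist (WithConv.toConv φ.1) ↔ Normalized φ.1 ∧ defect φ = 0 :=
  and_congr Iff.rfl (exists_isStar_iff_defect_eq_zero (d := D.coPoisson) rfl)

theorem isGauge_iff {lam : D.env.V} {φ : D.env.E₂.V} {g : LieBialgebra.O₂ k L} :
    D.IsGauge (WithConv.toConv lam.1) (WithConv.toConv φ.1) g ↔ g.ofConv = (gauge lam φ).1 :=
  exists_isStar_iff_eq_gauge (d := D.coPoisson) rfl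

theorem convMul_ofConv (φ ψ : LieBialgebra.O₁ k L) :
    (φ * ψ).ofConv = funMul φ.ofConv ψ.ofConv := rfl

theorem mem_maxIdeal {φ : LieBialgebra.O₁ k L} :
    φ ∈ LieBialgebra.maxIdeal k L ↔ φ.ofConv 1 = 0 := Iff.rfl

theorem mem_F_two_of_mem_sq {φ : LieBialgebra.O₁ k L} (h : φ ∈ LieBialgebra.maxIdeal k L ^ 2) :
    φ.ofConv ∈ D.env.F 2 := by
  rw [pow_two] at h
  induction h using Submodule.mul_induction_on' with
  | mem_mul_mem a ha b hb =>
    rw [convMul_ofConv]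
    exact funMul_mem (m := 1) (n := 1) (mem_F_one ha) (mem_F_one hb)
  | add x _ y _ hx hy => exact Submodule.add_mem _ hx hy

/-- The square of the maximal ideal consists of the functions that vanish to order two. -/
theorem mem_sq_of_mem_F_two [FiniteDimensional k L] {φ : LieBialgebra.O₁ k L}
    (h : φ.ofConv ∈ D.env.F 2) : φ ∈ LieBialgebra.maxIdeal k L ^ 2 := by
  obtain ⟨ρ, hρ, hρ1⟩ := exists_ι_retraction (k := k) (𝔥 := L)
  let b := Module.finBasis k L
  obtain ⟨M, hM, hφ⟩ := exists_eq_sum_funMul (E := D.env)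
    (e := fun i => UniversalEnvelopingAlgebra.ι k (b i)) (X := fun i => b.coord i ∘ₗ ρ)
    (fun i => D.ι_mem _) (fun i => by rw [LinearMap.comp_apply, hρ1, map_zero]) (by
      rintro _ ⟨x, rfl⟩
      exact (sum_coord_smul_ι b hρ x).symm) h
  have h1 : φ = ∑ i, WithConv.toConv (b.coord i ∘ₗ ρ) * WithConv.toConv (M i) := by
    have h2 : φ.ofConv = (∑ i, WithConv.toConv (b.coord i ∘ₗ ρ) * WithConv.toConv (M i)
        : LieBialgebra.O₁ k L).ofConv := by
      rw [hφ, WithConv.ofConv_sum]; rfl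
    exact congrArg WithConv.toConv h2
  rw [h1, pow_two]
  refine Submodule.sum_mem _ fun i _ => Submodule.mul_mem_mul ?_ (hM i)
  rw [mem_maxIdeal]
  exact (congrArg (b.coord i) hρ1).trans (map_zero _)

end Env

/-! ### Functions of two variables with a given bilinear part -/

section BilinearPart

open PoissonEnv

variable {k : Type*} [Field k] [CharZero k] {A : Type*} [Ring A] [Bialgebra k A]
  {E : PoissonEnv k A} {φ ψ : E.E₂.V}

theorem Normalized.apply_pt₂_sq (hφ : Normalized φ.1) (x y : E.P) :
    φ.1 (pt₂ x y ^ 2) = 2 * φ.1 ((x : A) ⊗ₜ[k] (y : A)) := by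
  have h : pt₂ x y ^ 2 = ((x : A) * x) ⊗ₜ[k] (1 : A) + (x : A) ⊗ₜ[k] (y : A)
      + ((x : A) ⊗ₜ[k] (y : A) + (1 : A) ⊗ₜ[k] ((y : A) * y)) := by
    rw [pt₂, incl₁_apply, incl₂_apply, pow_two, add_mul, mul_add, mul_add]
    simp only [Algebra.TensorProduct.tmul_mul_tmul, one_mul, mul_one]
  rw [h, map_add, map_add, map_add, (hφ _).1, (hφ _).2]
  ring

theorem sub_mem_filt_two (hφ : Normalized φ.1) (hψ : Normalized ψ.1)
    (h : ∀ x y : E.P, φ.1 ((x : A) ⊗ₜ[k] (y : A)) = ψ.1 ((x : A) ⊗ₜ[k] (y : A))) :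
    φ - ψ ∈ filt k 2 := by
  refine mem_filt.mpr (mem_F_succ_of_symbol (φ - ψ).2 fun t ht => ?_)
  obtain ⟨x, y, rfl⟩ := exists_pt₂ ht
  change φ.1 (pt₂ x y ^ 2) - ψ.1 (pt₂ x y ^ 2) = 0
  rw [hφ.apply_pt₂_sq, hψ.apply_pt₂_sq, h, sub_self]

theorem apply_tmul_eq (h : φ - ψ ∈ filt k 2) {x y : A} (hx : x ∈ E.P) (hy : y ∈ E.P) :
    φ.1 (x ⊗ₜ[k] y) = ψ.1 (x ⊗ₜ[k] y) := by
  have hC : x ⊗ₜ[k] y ∈ E.E₂.C 2 := by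
    have := tmul_mem_tensorFilt (E := E) (E' := E) (n := 2) le_rfl (E.mem_C_one hx) (E.mem_C_one hy)
    rwa [← C_tensor] at this
  exact sub_eq_zero.mp (mem_F_succ.mp (mem_filt.mp h) _ hC)

/-- The leading term of the defect in degree two is the coboundary of a bilinear
form, and so vanishes. -/
theorem Normalized.defect_mem_filt_two (hφ : Normalized φ.1) : defect φ ∈ filt k 2 := by
  obtain ⟨h1, h2⟩ := bch_pull_perturb (isPoisson_face₁₂ E) (isPoisson_faceL E) (isPoisson_face₂₃ E)
    (isPoisson_faceR E) (M := 0) (φ := 0) (h := φ) (mem_filt.mpr φ.2) (Φ := 0) (Φ' := defect φ)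
    (by simp only [map_zero, bch_zero, sub_self]) (by rw [zero_add]; rfl) (Submodule.zero_mem _)
  refine mem_filt.mpr (mem_F_succ_of_symbol (mem_filt.mp h1) fun t ht => ?_)
  obtain ⟨x, y, z, rfl⟩ := exists_pt₃ ht
  refine (h2 ht (face₁₂_pt x y z) (faceL_pt x y z) (face₂₃_pt x y z) (faceR_pt x y z)).trans ?_
  rw [hφ.apply_pt₂_sq, hφ.apply_pt₂_sq, hφ.apply_pt₂_sq, hφ.apply_pt₂_sq, Submodule.coe_add,
    Submodule.coe_add, TensorProduct.add_tmul, TensorProduct.tmul_add, map_add, map_add]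
  change 0 + _ = (0 : k)
  ring

end BilinearPart

/-! ### The classical Yang-Baxter equation -/

section YangBaxter

open LieBialgebra DualLie

variable {k : Type*} [Field k] {L : Type*} [LieRing L] [LieAlgebra k L]

theorem dualDistrib_eq_contr (ξ η : Module.Dual k L) (t : L ⊗[k] L) :
    TensorProduct.dualDistrib k L L (ξ ⊗ₜ[k] η) t = η (contr ξ t) := by
  induction t with
  | zero => simp
  | add a b ha hb => simp only [map_add, ha, hb]
  | tmul a b => simp [contr]

theorem dualDistrib_swap (ξ η : Module.Dual k L) (t : L ⊗[k] L) :
    TensorProduct.dualDistrib k L L (ξ ⊗ₜ[k] η) (TensorProduct.comm k L L t)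
      = TensorProduct.dualDistrib k L L (η ⊗ₜ[k] ξ) t := by
  induction t with
  | zero => simp
  | add a b ha hb => simp only [map_add, ha, hb]
  | tmul a b => simp [mul_comm]

theorem triple_bracket13_23 (ξ η ζ : Module.Dual k L) (s t : L ⊗[k] L) :
    triple ξ η ζ (bracket13_23 k s t) = ζ ⁅contr ξ s, contr η t⁆ := by
  induction s with
  | zero => simp [bracket13_23]
  | add a b ha hb =>
    rw [map_add, add_lie, map_add, ← ha, ← hb, ← map_add, bracket13_23, TensorProduct.add_tmul,
      map_add, map_add]
    rfl
  | tmul a b =>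
    induction t with
    | zero => simp [bracket13_23]
    | add c d hc hd =>
      rw [map_add, lie_add, map_add, ← hc, ← hd, ← map_add, bracket13_23, TensorProduct.tmul_add,
        map_add, map_add]
      rfl
    | tmul c d =>
      simp [bracket13_23, triple, contr]
      ring

theorem triple_rTensor (δ : L →ₗ[k] L ⊗[k] L) (ξ η ζ : Module.Dual k L) (t : L ⊗[k] L) :
    triple ξ η ζ (δ.rTensor L t)
      = TensorProduct.dualDistrib k L L
        ((TensorProduct.dualDistrib k L L (ξ ⊗ₜ[k] η) ∘ₗ δ) ⊗ₜ[k] ζ) t := by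
  induction t with
  | zero => simp
  | add a b ha hb => simp only [map_add, ha, hb]
  | tmul a b => simp [triple]

variable [CharZero k] [FiniteDimensional k L] {D : LieBialgebra k L} {c : k} {A : Type*} [Ring A]
  [Bialgebra k A] {i : DualLie D c →ₗ[k] A} {φ : A ⊗[k] A →ₗ[k] k} {r : L ⊗[k] L}

theorem extProd_sliceL_dualCobracket (hr : TensorProduct.comm k L L r = -r)
    (hφ : ∀ ξ η, φ (i ξ ⊗ₜ[k] i η)
      = TensorProduct.dualDistrib k L L (form D c ξ ⊗ₜ[k] form D c η) r) (ξ η ζ : DualLie D c) :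
    extProd (sliceL φ (i η)) (sliceL φ (i ζ)) (TensorProduct.map i i (dualCobracket D c ξ))
      = form D c ξ ⁅contr (form D c η) r, contr (form D c ζ) r⁆ := by
  have h : ∀ χ ω, sliceL φ (i χ) (i ω) = -form D c ω (contr (form D c χ) r) := by
    intro χ ω
    have h1 := dualDistrib_swap (form D c ω) (form D c χ) r
    rw [hr, map_neg] at h1
    rw [← dualDistrib_eq_contr, ← h1, neg_neg]
    exact hφ ω χ
  rw [← pair_dualCobracket]
  generalize dualCobracket D c ξ = t
  induction t with
  | zero => simp
  | add a b ha hb => simp only [map_add, ha, hb, LinearMap.add_apply]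
  | tmul a b =>
    rw [TensorProduct.map_tmul, extProd_tmul, h, h, neg_mul_neg]
    simp [pair]

/-- An antisymmetric solution `F` of `(δ ⊗ id)(F) + [F^{1,3}, F^{2,3}] + cyclic permutations = 0`
gives, after multiplication by `c / 2`, a solution of the classical Yang-Baxter equation for the
dual Lie bialgebra: the linear term of the equation has the factor `c` of the normalization of the
duality and the quadratic term has a factor two. -/
theorem yangBaxter_dual {F : L ⊗[k] L} (hF : TensorProduct.comm k L L F = -F)
    (hF' : cycSum k (D.δ.rTensor L F + bracket13_23 k F F) = 0)
    (hφ : ∀ ξ η, φ (i ξ ⊗ₜ[k] i η)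
      = TensorProduct.dualDistrib k L L (form D c ξ ⊗ₜ[k] form D c η) ((c / 2) • F))
    (ξ η ζ : DualLie D c) :
    φ (i ⁅ξ, η⁆ ⊗ₜ[k] i ζ) + φ (i ⁅η, ζ⁆ ⊗ₜ[k] i ξ) + φ (i ⁅ζ, ξ⁆ ⊗ₜ[k] i η)
      + 2 * (extProd (sliceL φ (i η)) (sliceL φ (i ζ)) (TensorProduct.map i i (dualCobracket D c ξ))
        + extProd (sliceL φ (i ζ)) (sliceL φ (i ξ)) (TensorProduct.map i i (dualCobracket D c η))
        + extProd (sliceL φ (i ξ)) (sliceL φ (i η)) (TensorProduct.map i i (dualCobracket D c ζ)))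
      = 0 := by
  have hr : TensorProduct.comm k L L ((c / 2) • F) = -((c / 2) • F) := by
    rw [map_smul, hF, smul_neg]
  have hl : ∀ ξ η ζ : DualLie D c, φ (i ⁅ξ, η⁆ ⊗ₜ[k] i ζ)
      = c * (c / 2) * triple (form D c ξ) (form D c η) (form D c ζ) (D.δ.rTensor L F) := by
    intro ξ η ζ
    have h1 : form D c ⁅ξ, η⁆
        = c • (TensorProduct.dualDistrib k L L (form D c ξ ⊗ₜ[k] form D c η) ∘ₗ D.δ) := rfl
    rw [hφ, h1, triple_rTensor, ← TensorProduct.smul_tmul', map_smul, map_smul,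
      LinearMap.smul_apply, smul_eq_mul, smul_eq_mul, mul_assoc]
    exact mul_left_comm _ _ _
  have hq : ∀ ξ η ζ : DualLie D c,
      extProd (sliceL φ (i η)) (sliceL φ (i ζ)) (TensorProduct.map i i (dualCobracket D c ξ))
        = c / 2 * (c / 2)
          * triple (form D c η) (form D c ζ) (form D c ξ) (bracket13_23 k F F) := by
    intro ξ η ζ
    rw [extProd_sliceL_dualCobracket hr hφ, triple_bracket13_23, map_smul, map_smul, smul_lie,
      lie_smul, map_smul, map_smul, smul_eq_mul, smul_eq_mul, mul_assoc]
  have h := congrArg (triple (form D c ξ) (form D c η) (form D c ζ)) hF'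
  simp only [cycSum, LinearMap.add_apply, LinearMap.id_apply, LinearMap.comp_apply, map_add,
    triple_cyc, map_zero] at h
  rw [hl, hl, hl, hq, hq, hq]
  linear_combination (c * (c / 2)) * h

end YangBaxter

section Conjugation

variable {k : Type*} [Field k] {L : Type*} [LieRing L] [LieAlgebra k L]

theorem bracket13_23_sq (φ : L ≃ₗ⁅k⁆ L) (s t : L ⊗[k] L) :
    bracket13_23 k (sq φ s) (sq φ t)
      = TensorProduct.map (sq φ) φ.toLinearEquiv.toLinearMap (bracket13_23 k s t) := by
  induction s with
  | zero => simp [bracket13_23]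
  | add a b ha hb =>
    simp only [bracket13_23, map_add, TensorProduct.add_tmul] at ha hb ⊢
    rw [ha, hb]
  | tmul a b =>
    induction t with
    | zero => simp [bracket13_23]
    | add c d hc hd =>
      simp only [bracket13_23, map_add, TensorProduct.tmul_add] at hc hd ⊢
      rw [hc, hd]
    | tmul c d =>
      have h : φ ⁅b, d⁆ = ⁅φ b, φ d⁆ := φ.map_lie b d
      simp [bracket13_23, sq, h]

theorem LieBialgebra.cycSum_conj (D : LieBialgebra k L) (φ : L ≃ₗ⁅k⁆ L) {F : L ⊗[k] L}
    (hF : cycSum k (D.δ.rTensor L F + bracket13_23 k F F) = 0) :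
    cycSum k ((D.conj φ).δ.rTensor L (sq φ F) + bracket13_23 k (sq φ F) (sq φ F)) = 0 := by
  have h : (D.conj φ).δ.rTensor L (sq φ F)
      = TensorProduct.map (sq φ) φ.toLinearEquiv.toLinearMap (D.δ.rTensor L F) :=
    rTensor_map (d := D.δ) (f := φ.toLinearEquiv.toLinearMap) (fun a => by
      change sq φ (D.δ (φ.symm (φ a))) = sq φ (D.δ a)
      rw [LieEquiv.symm_apply_apply]) F
  rw [h, bracket13_23_sq, ← map_add]
  exact (cycSum_map φ.toLinearEquiv.toLinearMap _).trans (by rw [hF, map_zero])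

end Conjugation

/-! ### Twists of the dual formal group -/

section Twists

open PoissonEnv LieBialgebra DualLie

variable {k : Type*} [Field k] [CharZero k] {L : Type*} [LieRing L] [LieAlgebra k L]
  [FiniteDimensional k L] {D : LieBialgebra k L} {c : k}

/-- Every element of `L ⊗ L` is the image of a function in the completed tensor square of the
maximal ideal, which need not be a twist. -/
theorem exists_normalized_extension (r : L ⊗[k] L) :
    ∃ φ : U k (DualLie D c) ⊗[k] U k (DualLie D c) →ₗ[k] k, Normalized φ ∧
      ∀ ξ η : DualLie D c,
        φ (UniversalEnvelopingAlgebra.ι k ξ ⊗ₜ[k] UniversalEnvelopingAlgebra.ι k η)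
          = TensorProduct.dualDistrib k L L (form D c ξ ⊗ₜ[k] form D c η) r := by
  obtain ⟨ρ, hρ, hρ1⟩ := exists_ι_retraction (k := k) (𝔥 := DualLie D c)
  refine ⟨(pair D c).flip r ∘ₗ TensorProduct.map ρ ρ, fun u => ⟨?_, ?_⟩, fun ξ η => ?_⟩
  · rw [LinearMap.comp_apply, TensorProduct.map_tmul, hρ1, TensorProduct.zero_tmul, map_zero]
  · rw [LinearMap.comp_apply, TensorProduct.map_tmul, hρ1, TensorProduct.tmul_zero, map_zero]
  · rw [LinearMap.comp_apply, TensorProduct.map_tmul, hρ, hρ]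
    rfl

/-- An antisymmetric solution of the Yang-Baxter equation lifts to a twist: any lift solves the
twist equation up to terms of order three, and is then corrected order by order. -/
theorem exists_isTwist_hasImage {F : L ⊗[k] L} (hF : TensorProduct.comm k L L F = -F)
    (hF' : cycSum k (D.δ.rTensor L F + bracket13_23 k F F) = 0) :
    ∃ f : O₂ k (DualLie D c), (D.dual c).IsTwist f ∧ HasImage D c f ((c / 2) • F) := by
  obtain ⟨φ₀, hn, hφ₀⟩ := exists_normalized_extension (D := D) (c := c) ((c / 2) • F)
  let φ : (D.dual c).env.E₂.V := ⟨φ₀, hn.mem_F_two (D.dual c)⟩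
  have hskew : ∀ x y : (D.dual c).env.P,
      φ.1 ((x : U k (DualLie D c)) ⊗ₜ[k] (y : U k (DualLie D c)))
        = -φ.1 ((y : U k (DualLie D c)) ⊗ₜ[k] (x : U k (DualLie D c))) := by
    rintro ⟨_, ξ, rfl⟩ ⟨_, η, rfl⟩
    have h1 := dualDistrib_swap (form D c η) (form D c ξ) ((c / 2) • F)
    rw [map_smul, hF, smul_neg, map_neg] at h1
    exact (hφ₀ ξ η).trans (h1.symm.trans (congrArg Neg.neg (hφ₀ η ξ).symm))
  obtain ⟨l, hl, hd, h⟩ := exists_twist_of_alt₃ (φ := φ) hn (Normalized.defect_mem_filt_two hn)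
    (alt₃_defect hn hskew (by
      rintro ⟨_, ξ, rfl⟩ ⟨_, η, rfl⟩ ⟨_, ζ, rfl⟩
      have h1 := yangBaxter_dual (i := ιLin k (DualLie D c)) hF hF' hφ₀ ξ η ζ
      rw [ιLin_lie, ιLin_lie, ιLin_lie] at h1
      have hd : ∀ ω : DualLie D c, (D.dual c).env.d (ιLin k _ ω)
          = TensorProduct.map (ιLin k _) (ιLin k _) (dualCobracket D c ω) :=
        (D.dual c).env_d_ιLin
      rw [← hd, ← hd, ← hd] at h1
      exact h1))
  refine ⟨WithConv.toConv l.1, (isTwist_iff (D.dual c)).mpr ⟨hl, hd⟩, fun ξ η => ?_⟩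
  exact (apply_tmul_eq h ((D.dual c).ι_mem _) ((D.dual c).ι_mem _)).trans (hφ₀ _ _)

theorem exists_isGauge {f g : O₂ k (DualLie D c)} {r : L ⊗[k] L} (hf : (D.dual c).IsTwist f)
    (hfr : HasImage D c f r) (hg : (D.dual c).IsTwist g) (hgr : HasImage D c g r) :
    ∃ lam ∈ maxIdeal k (DualLie D c) ^ 2, (D.dual c).IsGauge lam f g := by
  have hn : Normalized f.ofConv := hf.1
  have hn' : Normalized g.ofConv := hg.1
  let φ : (D.dual c).env.E₂.V := ⟨f.ofConv, hn.mem_F_two (D.dual c)⟩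
  let ψ : (D.dual c).env.E₂.V := ⟨g.ofConv, hn'.mem_F_two (D.dual c)⟩
  have h : φ - ψ ∈ filt k 2 := sub_mem_filt_two hn hn' (by
    rintro ⟨_, ξ, rfl⟩ ⟨_, η, rfl⟩
    exact (hfr ξ η).trans (hgr ξ η).symm)
  obtain ⟨lam, hlam⟩ := exists_gauge_eq ((isTwist_iff (D.dual c) (φ := φ)).mp hf).2
    ((isTwist_iff (D.dual c) (φ := ψ)).mp hg).2 h
  refine ⟨WithConv.toConv lam.1, mem_sq_of_mem_F_two (D.dual c) lam.2,
    (isGauge_iff (D.dual c) (φ := φ)).mpr ?_⟩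
  rw [hlam]

theorem exists_isGauge_isTwist {f : O₂ k (DualLie D c)} (hf : (D.dual c).IsTwist f)
    {lam : O₁ k (DualLie D c)} (hlam : lam ∈ maxIdeal k (DualLie D c) ^ 2) :
    ∃ g, (D.dual c).IsGauge lam f g ∧ (D.dual c).IsTwist g := by
  have hn : Normalized f.ofConv := hf.1
  let φ : (D.dual c).env.E₂.V := ⟨f.ofConv, hn.mem_F_two (D.dual c)⟩
  let l : (D.dual c).env.V := ⟨lam.ofConv, mem_F_two_of_mem_sq (D.dual c) hlam⟩
  exact ⟨WithConv.toConv (gauge l φ).1, (isGauge_iff (D.dual c) (lam := l) (φ := φ)).mpr rfl,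
    (isTwist_iff (D.dual c)).mpr ⟨Normalized.gauge hn l,
      defect_gauge ((isTwist_iff (D.dual c) (φ := φ)).mp hf).2 l⟩⟩

end Twists

end GammaLift

theorem proposition3p3 {k : Type*} [Field k] [CharZero k] {𝔤 : Type*} [LieRing 𝔤]
    [LieAlgebra k 𝔤] [FiniteDimensional k 𝔤] {Γ : Type*} [Group Γ]
    (B : GammaLift.GroupLieBialgebra k 𝔤 Γ) (c : k) (γ γ' : Γ) :
    (∃ f : GammaLift.LieBialgebra.O₂ k (GammaLift.DualLie (B.at γ) c),
      ((B.at γ).dual c).IsTwist f ∧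
      GammaLift.HasImage (B.at γ) c f ((c / 2) • GammaLift.sq (B.θ γ) (B.f γ'))) ∧
    (∀ f g : GammaLift.LieBialgebra.O₂ k (GammaLift.DualLie (B.at γ) c),
      ((B.at γ).dual c).IsTwist f →
      GammaLift.HasImage (B.at γ) c f ((c / 2) • GammaLift.sq (B.θ γ) (B.f γ')) →
      ((B.at γ).dual c).IsTwist g →
      GammaLift.HasImage (B.at γ) c g ((c / 2) • GammaLift.sq (B.θ γ) (B.f γ')) →
      ∃ lam ∈ GammaLift.LieBialgebra.maxIdeal k (GammaLift.DualLie (B.at γ) c) ^ 2,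
        ((B.at γ).dual c).IsGauge lam f g) ∧
    (∀ f : GammaLift.LieBialgebra.O₂ k (GammaLift.DualLie (B.at γ) c),
      ((B.at γ).dual c).IsTwist f →
      ∀ lam ∈ GammaLift.LieBialgebra.maxIdeal k (GammaLift.DualLie (B.at γ) c) ^ 2,
        ∃ g : GammaLift.LieBialgebra.O₂ k (GammaLift.DualLie (B.at γ) c),
          ((B.at γ).dual c).IsGauge lam f g ∧ ((B.at γ).dual c).IsTwist g) := by
  refine ⟨GammaLift.exists_isTwist_hasImage (GammaLift.comm_map_eq_neg _ (B.f_antisymm γ'))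
    (B.toLieBialgebra.cycSum_conj (B.θ γ) (B.f_twist γ')),
    fun f g hf hfr hg hgr => GammaLift.exists_isGauge hf hfr hg hgr,
    fun f hf lam hlam => GammaLift.exists_isGauge_isTwist hf hlam⟩
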